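/- **Setting.** Let $D_x,D_c\ge 1$, $D=D_x+D_c$, $r,a,b,\sigma>0$, $n_0\ge 1$. Let $\mathcal X\subset[0,r]^{D_x}$ and $\mathcal C\subset[0,r]^{D_c}$ be compact and convex, $\mathcal X$ with non-empty interior, and $\mathcal Z=\mathcal X\times\mathcal C$. Let $p$ be a probability density on $\mathbb R^{D_c}$ which vanishes outside $\mathcal C$ and is twice differentiable on $\mathbb R^{D_c}$ with square-integrable second order partial derivatives. Let $K:\mathbb R^{D_c}\to[0,\infty)$ be bounded, measurable and symmetric with $\int K=1$, $\int uu^{\mathsf T}K(u)\,du=m_2\mathbf I$ for some $m_2>0$, and $\int\|u\|^qK(u)\,du<\infty$ for some $q>2$. Let $h_t^{(j)}>0$ be bandwidths with $h_t^{(j)}=\Theta(t^{-1/(4+D_c)})$ as $t\to\infty$, for each $j\in[D_c]$. The kernel density estimate (KDE) from $n$ points $c_1,\dots,c_n$ is $\frac1{n|\mathbf H_n|}\sum_{i\le n}K(\mathbf H_n^{-1}(c-c_i))$ with $\mathbf H_n=\mathrm{diag}(h_n^{(1)},\dots,h_n^{(D_c)})$. The objective $f$ is, on $\mathcal Z$,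 a sample path of a Gaussian process $\mathcal{GP}(0,k)$ with $k\le 1$ on $\mathcal Z\times\mathcal Z$, almost surely differentiable on $\mathcal Z$, such that for every $i\in[D]$ and $L>0$ $$\mathbb P\Big(\sup_{z\in\mathcal Z}\Big|\frac{\partial f}{\partial z_i}(z)\Big|>L\Big)\le a\,e^{-(L/b)^2}.$$ **Algorithm SBO-KDE.** At iteration $t$ a decision $x_t\in\mathcal X$ is made, then a context $c_t$ and the value $y_t=f(x_t,c_t)+\epsilon_t$ are observed, where the $\epsilon_t\sim\mathcal N(0,\sigma^2)$ are i.i.d. The first $n_0$ points $(x_t,c_t)\in\mathcal Z$ are an arbitrary (deterministic or random) initial design. For $t>n_0$ the contexts $c_t$ are i.i.d. with density $p$. The function $f$, the initial design, the later contexts and the noise are independent. For $t>n_0$, $x_t$ is a measurable function of the data $\mathcal D_{t-1}=\{(x_i,c_i,y_i)\}_{i<t}$ with $$x_t\in\arg\max_{x\in\mathcal X}\int_{\mathcal C}\hat p_t(c)\big(\mu_t(x,c)+\sqrt{\beta_t}\,\sigma_t(x,c)\big)\,dc,$$ where $\hat p_t$ is the KDE from $c_1,\dots,c_{t-1}$,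 $\mu_t$ and $\sigma_t$ are the Gaussian process posterior mean and standard deviation given $\mathcal D_{t-1}$, and $\beta_t=2\log(t^2/\sqrt{2\pi})+2D_x\log(t^2D_xabr\sqrt\pi/2)$ (with $\sqrt{s}$ read as $0$ if $s<0$). Let $x^*\in\arg\max_{x\in\mathcal X}\mathbb E_{c\sim p}[f(x,c)]$ and let $$\mathrm{BCR}(T)=\mathbb E\Big[\sum_{t=1}^T\big(\mathbb E_{c\sim p}[f(x^*,c)]-\mathbb E_{c\sim p}[f(x_t,c)]\big)\Big]$$ be the Bayesian cumulative regret, and $\gamma_T=\sup_{z_1,\dots,z_T\in\mathcal Z}I\big((f(z_i)+e_i)_{i\le T};(f(z_i))_{i\le T}\big)$ the maximal mutual information between noisy and true values, where the $e_i\sim\mathcal N(0,\sigma^2)$ are i.i.d. and independent of $f$. **Theorem.** There are constants $C_1,C_2>0$, depending only on $D_x,D_c,n_0,r,a,b,\sigma,K,(h_t),\mathcal C,p$, such that the regret sum has a finite expectation and for all $T\ge1$ $$\mathrm{BCR}(T)\le\frac{\pi^2}{3}+\sqrt{\beta_T\gamma_TC_2}\Big(\sqrt{T^{D_c/(4+D_c)}}+\sqrt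 T\Big)+2C_1T^{\frac{2+D_c}{4+D_c}}.$$ The right-hand side is $o(T)$ as $T\to\infty$; in particular $\mathrm{BCR}(T)/T\to0$. -/

import Mathlib

open MeasureTheory ProbabilityTheory Filter Topology Asymptotics
open scoped ENNReal NNReal Matrix

noncomputable section

namespace SBOKDE

/-- Points `z = (x, c)` of the joint decision-context space `ℝ^Dx × ℝ^Dc`. -/
abbrev Pt (Dx Dc : ℕ) : Type := (Fin Dx → ℝ) × (Fin Dc → ℝ)

variable {Dx Dc : ℕ} {Ω : Type*} [MeasurableSpace Ω]

/-! ### Kernel density estimation -/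

/-- Kernels for density estimation on `ℝ^d`: bounded symmetric probability densities with second
moment matrix `m₂ I`, and a finite absolute moment of some order above two. -/
structure IsKDEKernel {d : ℕ} (K : (Fin d → ℝ) → ℝ) : Prop where
  measurable : Measurable K
  nonneg : ∀ u, 0 ≤ K u
  bounded : ∃ B : ℝ, ∀ u, K u ≤ B
  symm : ∀ u, K (-u) = K u
  integrable : Integrable K
  integral_eq_one : ∫ u, K u = 1
  second_moment : ∃ m₂ : ℝ, 0 < m₂ ∧
    ∀ i j : Fin d, ∫ u, u i * u j * K u = if i = j then m₂ else 0
  moment : ∃ q : ℝ, 2 < q ∧ Integrable (fun u => ‖u‖ ^ q * K u)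

/-- The kernel density estimate at `c` from the `n` samples `s`, with the diagonal bandwidth matrix
`diag (h 1, …, h d)`. -/
def kde {d n : ℕ} (K : (Fin d → ℝ) → ℝ) (h : Fin d → ℝ) (s : Fin n → Fin d → ℝ)
    (c : Fin d → ℝ) : ℝ :=
  (∑ i, K (fun j => (c j - s i j) / h j)) / (n * ∏ j, h j)

/-- `p` is a probability density on `ℝ^d` carried by `C`, twice differentiable on `ℝ^d`, with
square integrable second order partial derivatives. -/
structure IsContextDensity {d : ℕ} (C : Set (Fin d → ℝ)) (p : (Fin d → ℝ) → ℝ) : Prop where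
  nonneg : ∀ c, 0 ≤ p c
  eq_zero : ∀ c, c ∉ C → p c = 0
  integral_eq_one : ∫ c, p c = 1
  differentiable : Differentiable ℝ p
  differentiable_fderiv : Differentiable ℝ (fderiv ℝ p)
  sq_integrable : ∀ i j : Fin d, Integrable (fun c =>
    (fderiv ℝ (fderiv ℝ p) c (Pi.single i 1) (Pi.single j 1)) ^ 2)

/-- The law on `ℝ^d` with density `p`. -/
def densityLaw {d : ℕ} (p : (Fin d → ℝ) → ℝ) : Measure (Fin d → ℝ) :=
  volume.withDensity (fun c => ENNReal.ofReal (p c))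

/-! ### The Gaussian process prior and its posterior -/

/-- On `Z`, the random function `f` is a sample path of the Gaussian process `GP(0, k)`. -/
structure IsCenteredGP (P : Measure Ω) (Z : Set (Pt Dx Dc)) (k : Pt Dx Dc → Pt Dx Dc → ℝ)
    (f : Ω → Pt Dx Dc → ℝ) : Prop where
  measurable : ∀ z ∈ Z, Measurable (fun ω => f ω z)
  gaussian : IsGaussianProcess (fun (z : Z) (ω : Ω) => f ω z) P
  mean : ∀ z ∈ Z, ∫ ω, f ω z ∂P = 0
  cov : ∀ z ∈ Z, ∀ z' ∈ Z, cov[fun ω => f ω z, fun ω => f ω z'; P] = k z z'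

/-- The coordinate unit vectors of `ℝ^Dx × ℝ^Dc`. -/
def unitVec : Fin Dx ⊕ Fin Dc → Pt Dx Dc
  | Sum.inl i => (Pi.single i 1, 0)
  | Sum.inr j => (0, Pi.single j 1)

/-- The partial derivatives on `Z` of the sample path exist, and the supremum over `Z` of the
absolute value of each of them exceeds `L` with probability at most `a exp (-(L / b)²)`. -/
structure HasLipschitzTail (P : Measure Ω) (Z : Set (Pt Dx Dc)) (a b : ℝ)
    (f : Ω → Pt Dx Dc → ℝ) : Prop where
  differentiableOn : ∀ᵐ ω ∂P, DifferentiableOn ℝ (f ω) Z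
  tail : ∀ i : Fin Dx ⊕ Fin Dc, ∀ L : ℝ, 0 < L →
    P {ω | ∃ z ∈ Z, L < |fderivWithin ℝ (f ω) Z z (unitVec i)|} ≤
      ENNReal.ofReal (a * Real.exp (-(L / b) ^ 2))

/-- The vector `[k (z i, w)]_i`. -/
def kernelVec {n : ℕ} (k : Pt Dx Dc → Pt Dx Dc → ℝ) (z : Fin n → Pt Dx Dc) (w : Pt Dx Dc) :
    Fin n → ℝ := fun i => k (z i) w

/-- The matrix `[k (z i, z j)]_{ij}`. -/
def kernelMat {n : ℕ} (k : Pt Dx Dc → Pt Dx Dc → ℝ) (z : Fin n → Pt Dx Dc) :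
    Matrix (Fin n) (Fin n) ℝ := Matrix.of fun i j => k (z i) (z j)

/-- Posterior mean at `w` given the noisy values `y` at the points `z`. -/
def postMean {n : ℕ} (k : Pt Dx Dc → Pt Dx Dc → ℝ) (σ : ℝ) (z : Fin n → Pt Dx Dc)
    (y : Fin n → ℝ) (w : Pt Dx Dc) : ℝ :=
  kernelVec k z w ⬝ᵥ ((kernelMat k z + σ ^ 2 • (1 : Matrix (Fin n) (Fin n) ℝ))⁻¹ *ᵥ y)

/-- Posterior covariance given noisy values at the points `z`. -/
def postCov {n : ℕ} (k : Pt Dx Dc → Pt Dx Dc → ℝ) (σ : ℝ) (z : Fin n → Pt Dx Dc)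
    (w w' : Pt Dx Dc) : ℝ :=
  k w w' - kernelVec k z w ⬝ᵥ
    ((kernelMat k z + σ ^ 2 • (1 : Matrix (Fin n) (Fin n) ℝ))⁻¹ *ᵥ kernelVec k z w')

/-- Posterior standard deviation. -/
def postStd {n : ℕ} (k : Pt Dx Dc → Pt Dx Dc → ℝ) (σ : ℝ) (z : Fin n → Pt Dx Dc)
    (w : Pt Dx Dc) : ℝ := √(postCov k σ z w w)

/-- The upper confidence bound with exploration parameter `β`. -/
def ucb {n : ℕ} (k : Pt Dx Dc → Pt Dx Dc → ℝ) (σ β : ℝ) (z : Fin n → Pt Dx Dc)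
    (y : Fin n → ℝ) (w : Pt Dx Dc) : ℝ :=
  postMean k σ z y w + √β * postStd k σ z w

/-- `β_t = 2 log (t² / √(2π)) + 2 Dx log (t² Dx a b r √π / 2)`. -/
def beta (Dx : ℕ) (a b r : ℝ) (t : ℕ) : ℝ :=
  2 * Real.log ((t : ℝ) ^ 2 / √(2 * Real.pi)) +
    2 * Dx * Real.log ((t : ℝ) ^ 2 * Dx * a * b * r * √Real.pi / 2)

/-! ### Information gain -/

/-- Mutual information of the two components of a pair with law `ν`. -/
def mutualInfo {α β : Type*} [MeasurableSpace α] [MeasurableSpace β] (ν : Measure (α × β)) :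
    ℝ≥0∞ :=
  InformationTheory.klDiv ν (ν.fst.prod ν.snd)

/-- The joint law of `(y_D, f_D)`, where `f_D = (f (z 1), …, f (z n))` and `y_D = f_D + e` with
independent noise `e ∼ N(0, σ² I)`. -/
def obsLaw (P : Measure Ω) (f : Ω → Pt Dx Dc → ℝ) (σ : ℝ) {n : ℕ} (z : Fin n → Pt Dx Dc) :
    Measure ((Fin n → ℝ) × (Fin n → ℝ)) :=
  ((P.map (fun ω i => f ω (z i))).prod
    (Measure.pi (fun _ : Fin n => gaussianReal 0 (σ ^ 2).toNNReal))).map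
      (fun q => (q.1 + q.2, q.1))

/-- The maximal information gain `γ_T`: the largest mutual information between noisy and true
observations at `T` points of `Z`. -/
def maxInfoGain (P : Measure Ω) (Z : Set (Pt Dx Dc)) (f : Ω → Pt Dx Dc → ℝ) (σ : ℝ) (T : ℕ) : ℝ :=
  (⨆ z : Fin T → Z, mutualInfo (obsLaw P f σ (fun i => (z i : Pt Dx Dc)))).toReal

/-! ### The algorithm

Rounds are numbered from `0`: the round with index `n` is iteration `t = n + 1`; it sees the `n`
earlier data `(x i, c i, y i)`, `i < n`. -/

/-- The acquisition function at iteration `n + 1`: the integral over `C` of the upper confidence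
bound against the kernel density estimate from the `n` observed contexts. -/
def acquisition {n : ℕ} (C : Set (Fin Dc → ℝ)) (K : (Fin Dc → ℝ) → ℝ) (h : Fin Dc → ℝ)
    (k : Pt Dx Dc → Pt Dx Dc → ℝ) (σ β : ℝ) (z : Fin n → Pt Dx Dc) (y : Fin n → ℝ)
    (x : Fin Dx → ℝ) : ℝ :=
  ∫ c in C, kde K h (fun i => (z i).2) c * ucb k σ β z y (x, c)

/-- The data set available after `n` rounds. -/
def history (x : ℕ → Ω → Fin Dx → ℝ) (c : ℕ → Ω → Fin Dc → ℝ) (y : ℕ → Ω → ℝ) (n : ℕ) (ω : Ω) :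
    Fin n → Pt Dx Dc × ℝ :=
  fun i => ((x i ω, c i ω), y i ω)

/-- `x`, `c`, `y` are the decisions, contexts and noisy values produced by the algorithm SBO-KDE
on the random function `f`, with `n₀` initial points and noises `ε`. The initial design
`(x i, c i)`, `i < n₀`, may be deterministic or random; afterwards each decision is a function of the
past data which maximizes the acquisition function, and the contexts are drawn from `p`. -/
structure IsRun (P : Measure Ω) (X : Set (Fin Dx → ℝ)) (C : Set (Fin Dc → ℝ))
    (K : (Fin Dc → ℝ) → ℝ) (h : ℕ → Fin Dc → ℝ) (p : (Fin Dc → ℝ) → ℝ)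
    (k : Pt Dx Dc → Pt Dx Dc → ℝ) (a b r σ : ℝ) (n₀ : ℕ) (f : Ω → Pt Dx Dc → ℝ)
    (x : ℕ → Ω → Fin Dx → ℝ) (c : ℕ → Ω → Fin Dc → ℝ) (y ε : ℕ → Ω → ℝ) : Prop where
  decision_mem : ∀ n ω, x n ω ∈ X
  init_measurable : ∀ n, n < n₀ → Measurable (x n)
  init_context_mem : ∀ n, n < n₀ → ∀ ω, c n ω ∈ C
  context_measurable : ∀ n, Measurable (c n)
  context_law : ∀ n, n₀ ≤ n → P.map (c n) = densityLaw p
  context_indep : iIndepFun (fun n => c (n₀ + n)) P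
  noise_measurable : ∀ n, Measurable (ε n)
  noise_law : ∀ n, P.map (ε n) = gaussianReal 0 (σ ^ 2).toNNReal
  noise_indep : iIndepFun ε P
  /-- The objective, the initial design, the later contexts and the noises are independent. -/
  indep : iIndep ![
    MeasurableSpace.comap (fun ω (z : ↥(X ×ˢ C)) => f ω z) inferInstance,
    MeasurableSpace.comap (fun ω (i : Fin n₀) => (x i ω, c i ω)) inferInstance,
    MeasurableSpace.comap (fun ω n => c (n₀ + n) ω) inferInstance,
    MeasurableSpace.comap (fun ω n => ε n ω) inferInstance] P
  observation : ∀ n ω, y n ω = f ω (x n ω, c n ω) + ε n ω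
  decision_measurable : ∀ n, n₀ ≤ n →
    Measurable[MeasurableSpace.comap (history x c y n) inferInstance] (x n)
  decision_argmax : ∀ n, n₀ ≤ n → ∀ᵐ ω ∂P,
    IsMaxOn (acquisition C K (h n) k σ (beta Dx a b r (n + 1))
      (fun i => (history x c y n ω i).1) (fun i => (history x c y n ω i).2)) X (x n ω)

/-! ### Regret -/

/-- The expected reward `E_{c ∼ p} [g (x, c)]`. -/
def meanReward (C : Set (Fin Dc → ℝ)) (p : (Fin Dc → ℝ) → ℝ) (g : Pt Dx Dc → ℝ)
    (x : Fin Dx → ℝ) : ℝ := ∫ c in C, p c * g (x, c)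

/-- The cumulative regret over the iterations `1, …, T`. -/
def cumRegret (C : Set (Fin Dc → ℝ)) (p : (Fin Dc → ℝ) → ℝ) (f : Ω → Pt Dx Dc → ℝ)
    (xstar : Ω → Fin Dx → ℝ) (x : ℕ → Ω → Fin Dx → ℝ) (T : ℕ) (ω : Ω) : ℝ :=
  ∑ n ∈ Finset.range T, (meanReward C p (f ω) (xstar ω) - meanReward C p (f ω) (x n ω))

/-- The Bayesian cumulative regret. -/
def bcr (P : Measure Ω) (C : Set (Fin Dc → ℝ)) (p : (Fin Dc → ℝ) → ℝ) (f : Ω → Pt Dx Dc → ℝ)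
    (xstar : Ω → Fin Dx → ℝ) (x : ℕ → Ω → Fin Dx → ℝ) (T : ℕ) : ℝ :=
  ∫ ω, cumRegret C p f xstar x T ω ∂P

/-- `π²/3 + √(β γ C₂) (√(T^{Dc/(4+Dc)}) + √T) + 2 C₁ T^{(2+Dc)/(4+Dc)}`. -/
def regretBound (Dc : ℕ) (C₁ C₂ β γ : ℝ) (T : ℕ) : ℝ :=
  Real.pi ^ 2 / 3 +
    √(β * γ * C₂) * (√((T : ℝ) ^ ((Dc : ℝ) / (4 + Dc))) + √(T : ℝ)) +
    2 * C₁ * (T : ℝ) ^ ((2 + Dc : ℝ) / (4 + Dc))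

end SBOKDE

end

/-! Fix an iteration `t` after the initial design. Let `q` be the density estimate, `μ` and `τ` the
posterior mean and standard deviation, and `x'` a point near the optimum in a finite net of `X` of
mesh `r / t²`. The regret of the round splits into five pieces: (1) passing from the optimum to `x'`
costs at most the Lipschitz constant of `f` times `r / t²`; (2) replacing `p` by `q` in the mean of
`f(x', ·) - f(x_t, ·)` costs at most `2 sup |f|` times the `L¹` error of `q`; (3) the excess of
`f(x', ·)` over its upper confidence bound, averaged against `q`; (4) the deviation `μ - f` at
`x_t`, averaged against `q`; (5) `√β_t` times the `q`-average of `τ(x_t, ·)`. Maximality of `x_t`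
links (3) to (4) and (5); see `ofReal_regret_add_le`.

Bayes' rule (`IsAdaptive.lintegral_posterior`) says that, given the data and all contexts, the value
of `f` at a data-dependent point has law `N(μ, τ²)`. Hence (4) has mean zero, and (3), summed over
the net, is of the order of the cardinality of the net times `exp(-β_t / 2)`, that is, of order
`t⁻²`; `beta` has the form that achieves this. The objective is independent of the contexts, so the
expectation of (2) is a product, and a bias-variance estimate makes it of order `b_t²`, where `b_t`
is the bandwidth scale `t^(-1/(4+Dc))`.

For (5), the context `c_t` is independent of the past, so the expected `p`-average of `τ(x_t, ·)` is
the expected standard deviation at the point actually visited. Replacing `q` by `p` at the price of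
the `L¹` error would cost `√β_t b_t²`, a logarithmic factor too much. Instead `exists_kde_mul_rate`
compares multiplicatively: the `q`-average is at most 6 times the `p`-average plus `O(b_t^(2+ε))`,
and `b_t^ε` absorbs `√β_t`. This works because the posterior standard deviation at most doubles over
distances small relative to its own size, which follows from mean-square Lipschitz continuity of the
field.

Summing, the Cauchy-Schwarz inequality and the chain rule for mutual information
(`mutualInfo_obsLaw`, `sum_seqVar_le_maxInfoGain`) bound the visited standard deviations by `√(T ·
2(σ² + 1) γ_T)`, whence `C₂ = 6² · 2(σ² + 1)`. All other pieces sum to a multiple of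
`T^((2+Dc)/(4+Dc))`. For sublinearity, `exists_maxInfoGain_le` shows that `γ_T` is at most a power
of `T` below one: on a grid, averaging the observations in a cell gives a small posterior variance,
except at the few rounds where a cell has been visited rarely.

The rigorous setting replaces `f` by a random element of the space of continuous paths on `X × C`,
whose Lipschitz constant has a second moment bounded in terms of `a`, `b` and the dimension alone.
-/

noncomputable section

namespace SBOKDE

/-! ### Linear algebra of the posterior: optimal linear prediction in a feature space. -/

section Posterior

open scoped RealInnerProductSpace

variable {Dx Dc n : ℕ} {H : Type*} [NormedAddCommGroup H] [InnerProductSpace ℝ H]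
  {k : Pt Dx Dc → Pt Dx Dc → ℝ} {Φ : Pt Dx Dc → H} {σ : ℝ}

/-- The regularized Gram matrix. -/
def gramMat (k : Pt Dx Dc → Pt Dx Dc → ℝ) (σ : ℝ) (z : Fin n → Pt Dx Dc) :
    Matrix (Fin n) (Fin n) ℝ := kernelMat k z + σ ^ 2 • (1 : Matrix (Fin n) (Fin n) ℝ)

/-- The weights of the posterior mean as a linear function of the observations. -/
def postWeights (k : Pt Dx Dc → Pt Dx Dc → ℝ) (σ : ℝ) (z : Fin n → Pt Dx Dc) (w : Pt Dx Dc) :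
    Fin n → ℝ := (gramMat k σ z)⁻¹ *ᵥ kernelVec k z w

/-- Mean square error of the linear predictor of the value at `w` with weights `α`. -/
def predErr (Φ : Pt Dx Dc → H) (σ : ℝ) (z : Fin n → Pt Dx Dc) (w : Pt Dx Dc) (α : Fin n → ℝ) : ℝ :=
  ‖Φ w - ∑ i, α i • Φ (z i)‖ ^ 2 + σ ^ 2 * ∑ i, α i ^ 2

/-- The ridge term `σ² ∑ αᵢ²` makes the matrix invertible, and the form measures the loss caused by
non-optimal weights in `predErr_eq`. -/
lemma dotProduct_gramMat_mulVec (hk : ∀ z w, k z w = ⟪Φ z, Φ w⟫) (z : Fin n → Pt Dx Dc)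
    (α : Fin n → ℝ) :
    α ⬝ᵥ (gramMat k σ z *ᵥ α) = ‖∑ i, α i • Φ (z i)‖ ^ 2 + σ ^ 2 * ∑ i, α i ^ 2 := by
  have h1 : α ⬝ᵥ (kernelMat k z *ᵥ α) = ‖∑ i, α i • Φ (z i)‖ ^ 2 := by
    rw [← real_inner_self_eq_norm_sq, sum_inner]
    simp only [dotProduct, Matrix.mulVec, kernelMat, Matrix.of_apply, hk, inner_sum,
      real_inner_smul_left, real_inner_smul_right, Finset.mul_sum]
    exact Finset.sum_congr rfl fun i _ => Finset.sum_congr rfl fun j _ => by ring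
  rw [gramMat, Matrix.add_mulVec, dotProduct_add, h1, Matrix.smul_mulVec, Matrix.one_mulVec,
    dotProduct_smul, smul_eq_mul]
  simp [dotProduct, sq]

lemma gramMat_transpose (hk : ∀ z w, k z w = ⟪Φ z, Φ w⟫) (z : Fin n → Pt Dx Dc) :
    (gramMat k σ z)ᵀ = gramMat k σ z := by
  ext i j
  simp only [gramMat, kernelMat, Matrix.transpose_apply, Matrix.add_apply, Matrix.of_apply, hk,
    real_inner_comm, Matrix.smul_apply, Matrix.one_apply, eq_comm]

lemma isUnit_det_gramMat (hk : ∀ z w, k z w = ⟪Φ z, Φ w⟫) (hσ : 0 < σ) (z : Fin n → Pt Dx Dc) :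
    IsUnit (gramMat k σ z).det := by
  rw [← Matrix.isUnit_iff_isUnit_det, ← Matrix.mulVec_injective_iff_isUnit]
  refine (injective_iff_map_eq_zero (gramMat k σ z).mulVecLin).2 fun α hα => ?_
  have h := dotProduct_gramMat_mulVec (σ := σ) hk z α
  rw [Matrix.mulVecLin_apply] at hα
  rw [hα, dotProduct_zero] at h
  have h2 : ∑ i, α i ^ 2 = 0 := by
    have h3 : 0 ≤ ∑ i, α i ^ 2 := Finset.sum_nonneg fun i _ => sq_nonneg _
    have h4 : 0 ≤ ‖∑ i, α i • Φ (z i)‖ ^ 2 := sq_nonneg _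
    have h5 : 0 < σ ^ 2 := by positivity
    nlinarith
  ext i
  have := (Finset.sum_eq_zero_iff_of_nonneg fun i _ => sq_nonneg (α i)).1 h2 i (Finset.mem_univ i)
  simpa using this

lemma gramMat_mulVec_postWeights (hk : ∀ z w, k z w = ⟪Φ z, Φ w⟫) (hσ : 0 < σ)
    (z : Fin n → Pt Dx Dc) (w : Pt Dx Dc) :
    gramMat k σ z *ᵥ postWeights k σ z w = kernelVec k z w := by
  rw [postWeights, Matrix.mulVec_mulVec, Matrix.mul_nonsing_inv _ (isUnit_det_gramMat hk hσ z),
    Matrix.one_mulVec]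

lemma postMean_eq_dotProduct (hk : ∀ z w, k z w = ⟪Φ z, Φ w⟫) (z : Fin n → Pt Dx Dc)
    (y : Fin n → ℝ) (w : Pt Dx Dc) : postMean k σ z y w = postWeights k σ z w ⬝ᵥ y := by
  change kernelVec k z w ⬝ᵥ ((gramMat k σ z)⁻¹ *ᵥ y) = _
  rw [postWeights, Matrix.dotProduct_mulVec, ← Matrix.mulVec_transpose,
    Matrix.transpose_nonsing_inv, gramMat_transpose hk]

/-- Completion of the square around the solution of the normal equations. The posterior variance is
thus the minimum of the prediction error over all linear predictors, and any convenient choice of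
weights bounds it from above. -/
lemma predErr_eq (hk : ∀ z w, k z w = ⟪Φ z, Φ w⟫) (hσ : 0 < σ)
    (z : Fin n → Pt Dx Dc) (w : Pt Dx Dc) (α : Fin n → ℝ) :
    predErr Φ σ z w α = postCov k σ z w w +
      (α - postWeights k σ z w) ⬝ᵥ (gramMat k σ z *ᵥ (α - postWeights k σ z w)) := by
  have h1 : predErr Φ σ z w α =
      k w w - 2 * (α ⬝ᵥ kernelVec k z w) + α ⬝ᵥ (gramMat k σ z *ᵥ α) := by
    rw [predErr, dotProduct_gramMat_mulVec hk, norm_sub_sq_real, inner_sum]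
    simp only [dotProduct, kernelVec, hk, real_inner_smul_right, real_inner_self_eq_norm_sq]
    simp only [real_inner_comm]
    ring
  have h2 : postCov k σ z w w = k w w - kernelVec k z w ⬝ᵥ postWeights k σ z w := rfl
  have h3 := gramMat_mulVec_postWeights hk hσ z w
  have h4 : postWeights k σ z w ⬝ᵥ (gramMat k σ z *ᵥ α) = α ⬝ᵥ kernelVec k z w := by
    rw [Matrix.dotProduct_mulVec, ← Matrix.mulVec_transpose, gramMat_transpose hk, h3,
      dotProduct_comm]
  rw [h1, h2, Matrix.mulVec_sub, dotProduct_sub, sub_dotProduct, sub_dotProduct, h3, h4,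
    dotProduct_comm (kernelVec k z w)]
  ring

lemma postCov_self_eq_predErr (hk : ∀ z w, k z w = ⟪Φ z, Φ w⟫) (hσ : 0 < σ)
    (z : Fin n → Pt Dx Dc) (w : Pt Dx Dc) :
    postCov k σ z w w = predErr Φ σ z w (postWeights k σ z w) := by
  simp [predErr_eq hk hσ]

lemma postCov_self_le_predErr (hk : ∀ z w, k z w = ⟪Φ z, Φ w⟫) (hσ : 0 < σ)
    (z : Fin n → Pt Dx Dc) (w : Pt Dx Dc) (α : Fin n → ℝ) :
    postCov k σ z w w ≤ predErr Φ σ z w α := by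
  rw [predErr_eq hk hσ, dotProduct_gramMat_mulVec hk, le_add_iff_nonneg_right]
  positivity

lemma postCov_self_nonneg (hk : ∀ z w, k z w = ⟪Φ z, Φ w⟫) (hσ : 0 < σ)
    (z : Fin n → Pt Dx Dc) (w : Pt Dx Dc) : 0 ≤ postCov k σ z w w := by
  rw [postCov_self_eq_predErr hk hσ, predErr]
  positivity

lemma postCov_self_le (hk : ∀ z w, k z w = ⟪Φ z, Φ w⟫) (hσ : 0 < σ)
    (z : Fin n → Pt Dx Dc) (w : Pt Dx Dc) : postCov k σ z w w ≤ ‖Φ w‖ ^ 2 := by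
  simpa [predErr] using postCov_self_le_predErr hk hσ z w 0

/-- The optimal weights for `w'` are used to predict the value at `w`; only the target moves, and
`(s + t)² ≤ 2s² + 2t²`. -/
lemma postCov_self_le_two_mul_add (hk : ∀ z w, k z w = ⟪Φ z, Φ w⟫) (hσ : 0 < σ)
    (z : Fin n → Pt Dx Dc) (w w' : Pt Dx Dc) :
    postCov k σ z w w ≤ 2 * postCov k σ z w' w' + 2 * ‖Φ w - Φ w'‖ ^ 2 := by
  refine (postCov_self_le_predErr hk hσ z w (postWeights k σ z w')).trans ?_
  rw [postCov_self_eq_predErr hk hσ z w', predErr, predErr]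
  set v := ∑ i, postWeights k σ z w' i • Φ (z i)
  have h1 : ‖Φ w - v‖ ≤ ‖Φ w' - v‖ + ‖Φ w - Φ w'‖ := by
    have := norm_add_le (Φ w' - v) (Φ w - Φ w')
    rwa [show Φ w' - v + (Φ w - Φ w') = Φ w - v by abel] at this
  have h2 : ‖Φ w - v‖ ^ 2 ≤ (‖Φ w' - v‖ + ‖Φ w - Φ w'‖) ^ 2 := by gcongr
  have h3 : 0 ≤ σ ^ 2 * ∑ i, postWeights k σ z w' i ^ 2 := by positivity
  nlinarith [sq_nonneg (‖Φ w' - v‖ - ‖Φ w - Φ w'‖)]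

/-- Averaging the observations at `m` nearby points bounds the posterior variance. -/
lemma postCov_self_le_of_card (hk : ∀ z w, k z w = ⟪Φ z, Φ w⟫) (hσ : 0 < σ)
    (z : Fin n → Pt Dx Dc) (w : Pt Dx Dc) (s : Finset (Fin n)) (hs : s.Nonempty) {δ : ℝ}
    (hδ : ∀ i ∈ s, ‖Φ w - Φ (z i)‖ ≤ δ) :
    postCov k σ z w w ≤ δ ^ 2 + σ ^ 2 / s.card := by
  classical
  have hm : (0 : ℝ) < s.card := by exact_mod_cast hs.card_pos
  refine (postCov_self_le_predErr hk hσ z w fun i => if i ∈ s then (s.card : ℝ)⁻¹ else 0).trans ?_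
  rw [predErr]
  have h1 : Φ w - ∑ i, (if i ∈ s then (s.card : ℝ)⁻¹ else 0) • Φ (z i) =
      (s.card : ℝ)⁻¹ • ∑ i ∈ s, (Φ w - Φ (z i)) := by
    simp only [ite_smul, zero_smul, Finset.sum_ite_mem, Finset.univ_inter, Finset.sum_sub_distrib,
      Finset.sum_const, smul_sub, Finset.smul_sum]
    rw [← Nat.cast_smul_eq_nsmul ℝ, smul_smul, inv_mul_cancel₀ hm.ne', one_smul]
  have h2 : ‖(s.card : ℝ)⁻¹ • ∑ i ∈ s, (Φ w - Φ (z i))‖ ≤ δ := by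
    rw [norm_smul, norm_inv, Real.norm_of_nonneg hm.le, inv_mul_le_iff₀ hm]
    refine (norm_sum_le_of_le s hδ).trans ?_
    simp
  have h3 : ∑ i, (if i ∈ s then (s.card : ℝ)⁻¹ else 0) ^ 2 = (s.card : ℝ)⁻¹ := by
    simp only [ite_pow, ne_eq, OfNat.ofNat_ne_zero, not_false_eq_true, zero_pow, Finset.sum_ite_mem,
      Finset.univ_inter, Finset.sum_const, nsmul_eq_mul]
    field_simp
  rw [h1, h3, ← div_eq_mul_inv]
  gcongr

/-- A sequential design on a space covered by `N` cells of small diameter has a small total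
posterior variance. -/
lemma sum_postCov_le (hk : ∀ z w, k z w = ⟪Φ z, Φ w⟫) (hσ : 0 < σ) {Z : Set (Pt Dx Dc)}
    (hΦ : ∀ w ∈ Z, ‖Φ w‖ ≤ 1) {ι : Type*} [Fintype ι] (cell : Pt Dx Dc → ι) {δ : ℝ}
    (hcell : ∀ w ∈ Z, ∀ w' ∈ Z, cell w = cell w' → ‖Φ w - Φ w'‖ ≤ δ)
    (z : ℕ → Pt Dx Dc) (hz : ∀ i, z i ∈ Z) (m : ℕ) (hm : 0 < m) (T : ℕ) :
    ∑ t ∈ Finset.range T, postCov k σ (fun i : Fin t => z i) (z t) (z t) ≤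
      T * (δ ^ 2 + σ ^ 2 / m) + Fintype.card ι * m := by
  classical
  -- The number of earlier design points in the cell of `z t`.
  set cnt : ℕ → ℕ := fun t => (Finset.univ.filter fun i : Fin t => cell (z t) = cell (z i)).card
    with hcnt
  have hmono : ∀ s t, s < t → cell (z s) = cell (z t) → cnt s < cnt t := by
    intro s t hst hc
    have hsub : (Finset.univ.filter fun i : Fin s => cell (z s) = cell (z i)).map
        (Fin.castLEEmb hst.le) ⊂ Finset.univ.filter fun i : Fin t => cell (z t) = cell (z i) := by
      rw [Finset.ssubset_iff_of_subset]
      · refine ⟨⟨s, hst⟩, by simp [hc], ?_⟩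
        simp only [Finset.mem_map, Finset.mem_filter, Finset.mem_univ, true_and, not_exists, not_and]
        intro i _ h
        have := congrArg Fin.val h
        simp at this
        omega
      · intro i hi
        simp only [Finset.mem_map, Finset.mem_filter, Finset.mem_univ, true_and] at hi ⊢
        obtain ⟨j, hj, rfl⟩ := hi
        simpa [← hc] using hj
    have := Finset.card_lt_card hsub
    rwa [Finset.card_map] at this
  -- Successive visits to a cell have strictly increasing counts, so a round is determined by its
  -- cell and its count. At most `m` rounds per cell have a count below `m`; these are charged the
  -- trivial variance bound 1.
  have hcard : ((Finset.range T).filter fun t => cnt t < m).card ≤ Fintype.card ι * m := by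
    have : ((Finset.range T).filter fun t => cnt t < m).card ≤
        ((Finset.univ : Finset ι) ×ˢ Finset.range m).card := by
      refine Finset.card_le_card_of_injOn (fun t => (cell (z t), cnt t)) ?_ ?_
      · intro t ht
        simp at ht ⊢
        exact ht.2
      · intro s _ t _ hst
        simp only [Prod.mk.injEq] at hst
        rcases lt_trichotomy s t with h | h | h
        · exact absurd hst.2 (hmono s t h hst.1).ne
        · exact h
        · exact absurd hst.2 (hmono t s h hst.1.symm).ne'
    simpa using this
  have hterm : ∀ t ∈ Finset.range T, postCov k σ (fun i : Fin t => z i) (z t) (z t) ≤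
      (δ ^ 2 + σ ^ 2 / m) + if cnt t < m then 1 else 0 := by
    intro t _
    split_ifs with h
    · have h1 := postCov_self_le hk hσ (fun i : Fin t => z i) (z t)
      have h2 : ‖Φ (z t)‖ ^ 2 ≤ 1 := pow_le_one₀ (norm_nonneg _) (hΦ _ (hz t))
      have h3 : 0 ≤ δ ^ 2 + σ ^ 2 / m := by positivity
      linarith
    · rw [not_lt] at h
      rw [add_zero]
      refine (postCov_self_le_of_card hk hσ (fun i : Fin t => z i) (z t)
        (Finset.univ.filter fun i : Fin t => cell (z t) = cell (z i))
        (Finset.card_pos.1 (hm.trans_le h)) (δ := δ) ?_).trans ?_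
      · intro i hi
        exact hcell _ (hz t) _ (hz i) (by simpa using hi)
      · have : (m : ℝ) ≤ cnt t := by exact_mod_cast h
        have hm' : (0 : ℝ) < m := by exact_mod_cast hm
        gcongr
  refine (Finset.sum_le_sum hterm).trans ?_
  rw [Finset.sum_add_distrib, Finset.sum_const, Finset.card_range, nsmul_eq_mul, Finset.sum_boole]
  gcongr
  exact_mod_cast hcard

end Posterior

end SBOKDE

end

noncomputable section

namespace SBOKDE

/-! ### Densities of the Gaussian observation noise. -/

section NoiseDensity

lemma lintegral_pi_fin_succ {α : Type*} [MeasurableSpace α] (μ : Measure α) [SigmaFinite μ] {n : ℕ}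
    {f : (Fin (n + 1) → α) → ℝ≥0∞} (hf : Measurable f) :
    ∫⁻ y, f y ∂Measure.pi (fun _ : Fin (n + 1) => μ) =
      ∫⁻ η, ∫⁻ t, f (Fin.snoc (α := fun _ => α) η t) ∂μ ∂Measure.pi (fun _ : Fin n => μ) := by
  have hmp := (measurePreserving_piFinSuccAbove (fun _ : Fin (n + 1) => μ) (Fin.last n)).symm
  rw [← hmp.lintegral_comp hf, lintegral_prod_symm' (fun a => f ((MeasurableEquiv.piFinSuccAbove
    (fun _ => α) (Fin.last n)).symm a)) (hf.comp hmp.measurable)]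
  refine lintegral_congr fun η => lintegral_congr fun t => ?_
  congr 1
  change Fin.insertNth (α := fun _ => α) (Fin.last n) t η = _
  rw [Fin.insertNth_last]
  rfl

lemma measurable_fin_snoc {α : Type*} [MeasurableSpace α] {n : ℕ} :
    Measurable fun q : (Fin n → α) × α => (Fin.snoc (α := fun _ => α) q.1 q.2 : Fin (n + 1) → α) := by
  refine measurable_pi_iff.2 fun i => ?_
  refine Fin.lastCases ?_ (fun j => ?_) i
  · simpa using measurable_snd
  · simpa [Function.comp_def] using (measurable_pi_apply j).comp measurable_fst

lemma measurable_fin_snoc_right {α : Type*} [MeasurableSpace α] {n : ℕ} (η : Fin n → α) :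
    Measurable fun t : α => (Fin.snoc (α := fun _ => α) η t : Fin (n + 1) → α) :=
  measurable_fin_snoc.comp (measurable_prodMk_left (x := η))

/-- The variance of the observation noise. -/
abbrev noiseVar (σ : ℝ) : ℝ≥0 := (σ ^ 2).toNNReal

lemma noiseVar_ne_zero {σ : ℝ} (hσ : 0 < σ) : noiseVar σ ≠ 0 := by
  simpa [noiseVar] using hσ.ne'

lemma coe_noiseVar (σ : ℝ) : (noiseVar σ : ℝ) = σ ^ 2 := Real.coe_toNNReal _ (sq_nonneg _)

lemma lintegral_gaussianReal_const_add {v : ℝ≥0} (hv : v ≠ 0) (m : ℝ) {h : ℝ → ℝ≥0∞}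
    (hh : Measurable h) :
    ∫⁻ e, h (m + e) ∂gaussianReal 0 v = ∫⁻ t, h t * gaussianPDF m v t := by
  rw [← lintegral_map (f := h) (g := fun e => m + e) hh (by fun_prop), gaussianReal_map_const_add,
    zero_add, gaussianReal_of_var_ne_zero _ hv,
    lintegral_withDensity_eq_lintegral_mul _ (measurable_gaussianPDF _ _) hh]
  simp [mul_comm]

/-- The likelihood of the observations `y` if the true values are `m`. -/
def lik (σ : ℝ) {n : ℕ} (m y : Fin n → ℝ) : ℝ≥0∞ := ∏ i, gaussianPDF (m i) (noiseVar σ) (y i)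

lemma measurable_lik (σ : ℝ) {n : ℕ} {α : Type*} [MeasurableSpace α] {m y : α → Fin n → ℝ}
    (hm : Measurable m) (hy : Measurable y) : Measurable fun a => lik σ (m a) (y a) := by
  refine Finset.measurable_prod _ fun i _ => ?_
  have : Measurable fun a => (m a i, noiseVar σ, y a i) :=
    ((measurable_pi_apply i).comp hm).prodMk
      (measurable_const.prodMk ((measurable_pi_apply i).comp hy))
  exact measurable_uncurry_gaussianPDF.comp this

lemma lik_snoc (σ : ℝ) {n : ℕ} (m y : Fin n → ℝ) (m' y' : ℝ) :
    lik σ (Fin.snoc (α := fun _ => ℝ) m m') (Fin.snoc (α := fun _ => ℝ) y y') =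
      lik σ m y * gaussianPDF m' (noiseVar σ) y' := by
  simp [lik, Fin.prod_univ_castSucc]

lemma lik_eq_ofReal (σ : ℝ) {n : ℕ} (m y : Fin n → ℝ) :
    lik σ m y = ENNReal.ofReal (∏ i, gaussianPDFReal (m i) (noiseVar σ) (y i)) := by
  rw [ENNReal.ofReal_prod_of_nonneg fun i _ => gaussianPDFReal_nonneg _ _ _]
  rfl

lemma lik_pos {σ : ℝ} (hσ : 0 < σ) {n : ℕ} (m y : Fin n → ℝ) : 0 < lik σ m y := by
  rw [lik_eq_ofReal, ENNReal.ofReal_pos]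
  exact Finset.prod_pos fun i _ => gaussianPDFReal_pos _ _ _ (noiseVar_ne_zero hσ)

lemma lik_ne_top (σ : ℝ) {n : ℕ} (m y : Fin n → ℝ) : lik σ m y ≠ ∞ := by
  rw [lik_eq_ofReal]
  exact ENNReal.ofReal_ne_top

/-- The maximal value of the noise density. -/
def pdfMax (σ : ℝ) : ℝ := (√(2 * Real.pi * noiseVar σ))⁻¹

lemma gaussianPDFReal_le_pdfMax (σ m y : ℝ) : gaussianPDFReal m (noiseVar σ) y ≤ pdfMax σ := by
  rw [gaussianPDFReal, pdfMax]
  refine mul_le_of_le_one_right (by positivity) (Real.exp_le_one_iff.2 ?_)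
  exact div_nonpos_of_nonpos_of_nonneg (neg_nonpos.2 (sq_nonneg _)) (by positivity)

lemma lik_le (σ : ℝ) {n : ℕ} (m y : Fin n → ℝ) : lik σ m y ≤ ENNReal.ofReal (pdfMax σ ^ n) := by
  rw [lik_eq_ofReal]
  refine ENNReal.ofReal_le_ofReal ?_
  refine (Finset.prod_le_prod (fun i _ => gaussianPDFReal_nonneg _ _ _)
    fun i _ => gaussianPDFReal_le_pdfMax σ (m i) (y i)).trans ?_
  simp

/-- Trades the integral over the noise for an integral over the observed values against the
likelihood. The one-dimensional translation identity is applied to the last coordinate, the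
induction hypothesis to the others. -/
lemma lintegral_noise_add {σ : ℝ} (hσ : 0 < σ) {n : ℕ} (m : Fin n → ℝ)
    {h : (Fin n → ℝ) → ℝ≥0∞} (hh : Measurable h) :
    ∫⁻ e, h (fun i => m i + e i) ∂Measure.pi (fun _ : Fin n => gaussianReal 0 (noiseVar σ)) =
      ∫⁻ y, h y * lik σ m y := by
  induction n with
  | zero =>
    rw [volume_pi, Measure.pi_of_empty, Measure.pi_of_empty, lintegral_dirac, lintegral_dirac]
    simp only [lik, Finset.univ_eq_empty, Finset.prod_empty, mul_one]
    congr 1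
    exact Subsingleton.elim _ _
  | succ n ih =>
    have hadd : Measurable fun e : Fin (n + 1) → ℝ => fun i => m i + e i :=
      measurable_pi_iff.2 fun i => (measurable_pi_apply i).const_add _
    rw [lintegral_pi_fin_succ (f := fun e => h fun i => m i + e i) _ (hh.comp hadd), volume_pi,
      lintegral_pi_fin_succ (f := fun y => h y * lik σ m y) _
      (hh.mul (measurable_lik σ measurable_const measurable_id))]
    have h1 : ∀ η : Fin n → ℝ, ∫⁻ t, h (fun i => m i + Fin.snoc (α := fun _ => ℝ) η t i)
        ∂gaussianReal 0 (noiseVar σ) = ∫⁻ t, h (Fin.snoc (α := fun _ => ℝ)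
          (fun i : Fin n => m i.castSucc + η i) t) *
          gaussianPDF (m (Fin.last n)) (noiseVar σ) t := by
      intro η
      have hm' : Measurable fun t => h (Fin.snoc (α := fun _ => ℝ)
          (fun i : Fin n => m i.castSucc + η i) t) :=
        hh.comp (measurable_fin_snoc_right _)
      rw [← lintegral_gaussianReal_const_add (noiseVar_ne_zero hσ) _ hm']
      refine lintegral_congr fun t => ?_
      congr 1
      ext i
      refine Fin.lastCases ?_ (fun j => ?_) i <;> simp
    have hmeas : Measurable fun q : (Fin n → ℝ) × ℝ => h (Fin.snoc (α := fun _ => ℝ) q.1 q.2) *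
          gaussianPDF (m (Fin.last n)) (noiseVar σ) q.2 :=
      (hh.comp measurable_fin_snoc).mul ((measurable_gaussianPDF _ _).comp measurable_snd)
    rw [lintegral_congr h1, ih (fun i => m i.castSucc)
      (h := fun η => ∫⁻ t, h (Fin.snoc (α := fun _ => ℝ) η t) *
          gaussianPDF (m (Fin.last n)) (noiseVar σ) t) hmeas.lintegral_prod_right', volume_pi]
    refine lintegral_congr fun η => ?_
    have hm' : Measurable fun t => h (Fin.snoc (α := fun _ => ℝ) η t) *
        gaussianPDF (m (Fin.last n)) (noiseVar σ) t :=
      hmeas.comp (measurable_const.prodMk measurable_id)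
    rw [← lintegral_mul_const _ hm']
    refine lintegral_congr fun t => ?_
    have : m = Fin.snoc (α := fun _ => ℝ) (fun i : Fin n => m i.castSucc) (m (Fin.last n)) := by
      ext i
      refine Fin.lastCases ?_ (fun j => ?_) i <;> simp
    conv_rhs => rw [this, lik_snoc]
    ring

end NoiseDensity

end SBOKDE

end

noncomputable section

namespace SBOKDE

/-! ### Gaussian random fields and the law of the prediction residual. -/

section GaussField

open scoped RealInnerProductSpace

variable {Dx Dc : ℕ} {𝓕 : Type*} [MeasurableSpace 𝓕]

/-- A jointly measurable centered Gaussian random field. -/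
structure IsGaussField (ρ : Measure 𝓕) (G : 𝓕 → Pt Dx Dc → ℝ) : Prop where
  measurable : Measurable (Function.uncurry G)
  gaussian : IsGaussianProcess (fun z φ => G φ z) ρ
  mean : ∀ z, ∫ φ, G φ z ∂ρ = 0

/-- The covariance kernel of a centered random field. -/
def covKer (ρ : Measure 𝓕) (G : 𝓕 → Pt Dx Dc → ℝ) (z w : Pt Dx Dc) : ℝ := ∫ φ, G φ z * G φ w ∂ρ

variable {ρ : Measure 𝓕} {G : 𝓕 → Pt Dx Dc → ℝ}

namespace IsGaussField

lemma isProbabilityMeasure (hG : IsGaussField ρ G) : IsProbabilityMeasure ρ :=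
  hG.gaussian.isProbabilityMeasure

lemma measurable_apply (hG : IsGaussField ρ G) (z : Pt Dx Dc) : Measurable fun φ => G φ z :=
  hG.measurable.comp (measurable_id.prodMk measurable_const)

lemma measurable_of_apply (hG : IsGaussField ρ G) (φ : 𝓕) : Measurable (G φ) :=
  hG.measurable.comp (measurable_const.prodMk measurable_id)

lemma memLp (hG : IsGaussField ρ G) (z : Pt Dx Dc) : MemLp (fun φ => G φ z) 2 ρ :=
  (hG.gaussian.hasGaussianLaw_eval z).memLp_two

lemma measurable_covKer (hG : IsGaussField ρ G) : Measurable (Function.uncurry (covKer ρ G)) := by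
  have := hG.isProbabilityMeasure
  have h : Measurable fun q : (Pt Dx Dc × Pt Dx Dc) × 𝓕 => G q.2 q.1.1 * G q.2 q.1.2 := by
    have h1 : Measurable fun q : (Pt Dx Dc × Pt Dx Dc) × 𝓕 => G q.2 q.1.1 :=
      hG.measurable.comp (measurable_snd.prodMk measurable_fst.fst)
    have h2 : Measurable fun q : (Pt Dx Dc × Pt Dx Dc) × 𝓕 => G q.2 q.1.2 :=
      hG.measurable.comp (measurable_snd.prodMk measurable_fst.snd)
    exact h1.mul h2
  exact (h.stronglyMeasurable.integral_prod_right (ν := ρ)).measurable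

lemma covariance_eq (hG : IsGaussField ρ G) (z w : Pt Dx Dc) :
    cov[fun φ => G φ z, fun φ => G φ w; ρ] = covKer ρ G z w := by
  have := hG.isProbabilityMeasure
  rw [covariance_eq_sub (hG.memLp z) (hG.memLp w), hG.mean, zero_mul, sub_zero]
  rfl

/-- The values of the field as vectors of `L²`. -/
def feature (hG : IsGaussField ρ G) (z : Pt Dx Dc) : Lp ℝ 2 ρ := (hG.memLp z).toLp

lemma covKer_eq_inner (hG : IsGaussField ρ G) (z w : Pt Dx Dc) :
    covKer ρ G z w = ⟪hG.feature z, hG.feature w⟫ := by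
  rw [L2.inner_def, covKer]
  refine integral_congr_ae ?_
  filter_upwards [(hG.memLp z).coeFn_toLp, (hG.memLp w).coeFn_toLp] with φ h1 h2
  rw [feature, feature, h1, h2]
  simp [mul_comm]

lemma norm_feature_sub_sq (hG : IsGaussField ρ G) (z w : Pt Dx Dc) :
    ‖hG.feature z - hG.feature w‖ ^ 2 = ∫ φ, (G φ z - G φ w) ^ 2 ∂ρ := by
  rw [feature, feature, ← MemLp.toLp_sub, ← real_inner_self_eq_norm_sq, L2.inner_def]
  refine integral_congr_ae ?_
  filter_upwards [((hG.memLp z).sub (hG.memLp w)).coeFn_toLp] with φ h1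
  rw [h1]
  simp [sq]

lemma norm_feature_sq (hG : IsGaussField ρ G) (z : Pt Dx Dc) :
    ‖hG.feature z‖ ^ 2 = covKer ρ G z z := by
  rw [← real_inner_self_eq_norm_sq, hG.covKer_eq_inner]

/-- The points `u i` may repeat, whereas a Gaussian process is defined through finite sets of
indices; the family is a linear image of the values on the set of its points. -/
lemma hasGaussianLaw_family (hG : IsGaussField ρ G) {ι : Type*} [Fintype ι] (u : ι → Pt Dx Dc) :
    HasGaussianLaw (fun φ i => G φ (u i)) ρ := by
  classical
  let L : ((Finset.univ.image u) → ℝ) →L[ℝ] ι → ℝ := LinearMap.toContinuousLinearMap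
    { toFun := fun x i => x ⟨u i, by simp⟩
      map_add' := fun x y => by ext; simp
      map_smul' := fun c x => by ext; simp }
  exact (hG.gaussian.hasGaussianLaw (Finset.univ.image u)).map L

end IsGaussField

/-- The law of `n` independent observation noises. -/
abbrev noiseLaw (σ : ℝ) (n : ℕ) : Measure (Fin n → ℝ) :=
  Measure.pi fun _ : Fin n => gaussianReal 0 (noiseVar σ)

lemma hasGaussianLaw_noise (σ : ℝ) (n : ℕ) :
    HasGaussianLaw (fun e : Fin n → ℝ => e) (noiseLaw σ n) := by
  refine iIndepFun.hasGaussianLaw (X := fun (i : Fin n) (e : Fin n → ℝ) => e i) (fun i => ⟨?_⟩) ?_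
  · rw [(measurePreserving_eval (fun _ : Fin n => gaussianReal 0 (noiseVar σ)) i).map_eq]
    infer_instance
  · exact iIndepFun_pi (X := fun _ t => t) fun i => aemeasurable_id

lemma memLp_noise (σ : ℝ) {n : ℕ} (i : Fin n) : MemLp (fun e : Fin n → ℝ => e i) 2 (noiseLaw σ n) :=
  ((hasGaussianLaw_noise σ n).eval i).memLp_two

lemma integral_noise (σ : ℝ) {n : ℕ} (i : Fin n) : ∫ e, e i ∂noiseLaw σ n = 0 := by
  have h := measurePreserving_eval (fun _ : Fin n => gaussianReal 0 (noiseVar σ)) i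
  have h2 := integral_map (μ := noiseLaw σ n) (φ := fun e => e i) (f := fun t : ℝ => t)
    (measurable_pi_apply i).aemeasurable aestronglyMeasurable_id
  rw [← h2]
  change ∫ t, t ∂(Measure.map (Function.eval i) (noiseLaw σ n)) = 0
  rw [h.map_eq, integral_id_gaussianReal]

lemma covariance_noise (σ : ℝ) {n : ℕ} (i j : Fin n) :
    cov[fun e => e i, fun e => e j; noiseLaw σ n] = if i = j then σ ^ 2 else 0 := by
  split_ifs with hij
  · subst hij
    rw [covariance_self (measurable_pi_apply i).aemeasurable]
    have h := measurePreserving_eval (fun _ : Fin n => gaussianReal 0 (noiseVar σ)) i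
    rw [← variance_id_map (measurable_pi_apply i).aemeasurable]
    change Var[id; Measure.map (Function.eval i) (noiseLaw σ n)] = _
    rw [h.map_eq, variance_id_gaussianReal, coe_noiseVar]
  · have h : iIndepFun (fun (i : Fin n) (e : Fin n → ℝ) => e i) (noiseLaw σ n) :=
      iIndepFun_pi (X := fun _ t => t) fun i => aemeasurable_id
    exact (h.indepFun hij).covariance_eq_zero (memLp_noise σ i) (memLp_noise σ j)

namespace IsGaussField

variable {σ : ℝ} {n : ℕ}

lemma cov_val_val (hG : IsGaussField ρ G) (w w' : Pt Dx Dc) :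
    cov[fun q => G q.1 w, fun q => G q.1 w'; ρ.prod (noiseLaw σ n)] = covKer ρ G w w' := by
  rw [← hG.covariance_eq, ← covariance_map_fun (μ := ρ.prod (noiseLaw σ n)) (Z := Prod.fst)
    (X := fun φ => G φ w) (Y := fun φ => G φ w')
    (hG.measurable_apply _).aestronglyMeasurable (hG.measurable_apply _).aestronglyMeasurable
    measurable_fst.aemeasurable, Measure.map_fst_prod]
  simp

lemma cov_obs_obs (hG : IsGaussField ρ G) (z : Fin n → Pt Dx Dc) (i j : Fin n) :
    cov[fun q => G q.1 (z i) + q.2 i, fun q => G q.1 (z j) + q.2 j; ρ.prod (noiseLaw σ n)] =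
      gramMat (covKer ρ G) σ z i j := by
  have := hG.isProbabilityMeasure
  have hf : ∀ w, MemLp (fun q : 𝓕 × (Fin n → ℝ) => G q.1 w) 2 (ρ.prod (noiseLaw σ n)) :=
    fun w => (hG.memLp w).comp_fst _
  have he : ∀ i, MemLp (fun q : 𝓕 × (Fin n → ℝ) => q.2 i) 2 (ρ.prod (noiseLaw σ n)) :=
    fun i => (memLp_noise σ i).comp_snd _
  have h1 := hG.cov_val_val (σ := σ) (n := n) (z i) (z j)
  have h2 : cov[fun q => q.2 i, fun q => q.2 j; ρ.prod (noiseLaw σ n)] =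
      if i = j then σ ^ 2 else 0 := by
    rw [← covariance_noise, ← covariance_map_fun (μ := ρ.prod (noiseLaw σ n)) (Z := Prod.snd)
      (X := fun e => e i) (Y := fun e => e j)
      (measurable_pi_apply _).aestronglyMeasurable (measurable_pi_apply _).aestronglyMeasurable
      measurable_snd.aemeasurable, Measure.map_snd_prod]
    simp
  have h3 : ∀ i j, cov[fun q => G q.1 (z i), fun q => q.2 j; ρ.prod (noiseLaw σ n)] = 0 :=
    fun i j => covariance_fst_snd_prod (hG.memLp _) (memLp_noise σ j)
  have e1 := covariance_add_left (hf (z i)) (he i) ((hf (z j)).add (he j))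
  have e2 := covariance_add_right (hf (z i)) (hf (z j)) (he j)
  have e3 := covariance_add_right (he i) (hf (z j)) (he j)
  have h4 := h3 j i
  rw [covariance_comm] at h4
  rw [h1, h3] at e2
  rw [h2, h4] at e3
  rw [e2, e3] at e1
  refine e1.trans ?_
  simp [gramMat, kernelMat, Matrix.one_apply]

lemma cov_obs_val (hG : IsGaussField ρ G) (z : Fin n → Pt Dx Dc) (w : Pt Dx Dc) (i : Fin n) :
    cov[fun q => G q.1 (z i) + q.2 i, fun q => G q.1 w; ρ.prod (noiseLaw σ n)] =
      kernelVec (covKer ρ G) z w i := by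
  have := hG.isProbabilityMeasure
  have hf : ∀ w, MemLp (fun q : 𝓕 × (Fin n → ℝ) => G q.1 w) 2 (ρ.prod (noiseLaw σ n)) :=
    fun w => (hG.memLp w).comp_fst _
  have he : ∀ i, MemLp (fun q : 𝓕 × (Fin n → ℝ) => q.2 i) 2 (ρ.prod (noiseLaw σ n)) :=
    fun i => (memLp_noise σ i).comp_snd _
  have h1 := hG.cov_val_val (σ := σ) (n := n) (z i) w
  have h4 : cov[fun q => G q.1 w, fun q => q.2 i; ρ.prod (noiseLaw σ n)] = 0 :=
    covariance_fst_snd_prod (hG.memLp _) (memLp_noise σ i)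
  rw [covariance_comm] at h4
  have e1 := covariance_add_left (hf (z i)) (he i) (hf w)
  rw [h1, h4, add_zero] at e1
  exact e1

/-- The prediction residual has the law `N(0, v)` with the posterior variance `v`, and it is
independent of the observations. -/
lemma residual_law (hG : IsGaussField ρ G) (hσ : 0 < σ) (z : Fin n → Pt Dx Dc) (w : Pt Dx Dc) :
    (ρ.prod (noiseLaw σ n)).map (fun q => (G q.1 w -
        ∑ i, postWeights (covKer ρ G) σ z w i * (G q.1 (z i) + q.2 i),
        fun i => G q.1 (z i) + q.2 i)) =
      (gaussianReal 0 (postCov (covKer ρ G) σ z w w).toNNReal).prod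
        ((ρ.prod (noiseLaw σ n)).map fun q i => G q.1 (z i) + q.2 i) := by
  have := hG.isProbabilityMeasure
  set κ := covKer ρ G
  set α := postWeights κ σ z w
  set Q := ρ.prod (noiseLaw σ n) with hQ
  set Y : Fin n → 𝓕 × (Fin n → ℝ) → ℝ := fun i q => G q.1 (z i) + q.2 i with hY
  set A : 𝓕 × (Fin n → ℝ) → ℝ := fun q => G q.1 w - ∑ i, α i * Y i q with hA
  have hf : ∀ w, MemLp (fun q : 𝓕 × (Fin n → ℝ) => G q.1 w) 2 Q :=
    fun w => (hG.memLp w).comp_fst _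
  have he : ∀ i, MemLp (fun q : 𝓕 × (Fin n → ℝ) => q.2 i) 2 Q :=
    fun i => (memLp_noise σ i).comp_snd _
  have hYL : ∀ i, MemLp (Y i) 2 Q := fun i => (hf _).add (he i)
  have hαY : ∀ i, MemLp (fun q => α i * Y i q) 2 Q := fun i => (hYL i).const_mul _
  have hSL : MemLp (fun q => ∑ i, α i * Y i q) 2 Q := memLp_finsetSum _ fun i _ => hαY i
  have hAL : MemLp A 2 Q := (hf w).sub hSL
  have hcov_left : ∀ {W : 𝓕 × (Fin n → ℝ) → ℝ}, MemLp W 2 Q →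
      cov[A, W; Q] = cov[fun q => G q.1 w, W; Q] - ∑ i, α i * cov[Y i, W; Q] := by
    intro W hW
    rw [hA, covariance_fun_sub_left (hf w) hSL hW, covariance_fun_sum_left hαY hW]
    simp only [covariance_const_mul_left]
  have hS := gramMat_mulVec_postWeights hG.covKer_eq_inner hσ z w
  -- This is the normal equation for the posterior weights.
  have hAY : ∀ j, cov[A, Y j; Q] = 0 := by
    intro j
    rw [hcov_left (hYL j), covariance_comm, hY, hG.cov_obs_val]
    simp only [hQ, hG.cov_obs_obs]
    have := congrFun hS j
    rw [← this, Matrix.mulVec, dotProduct, sub_eq_zero]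
    refine Finset.sum_congr rfl fun i _ => ?_
    have ht := congrFun (congrFun (gramMat_transpose (σ := σ) hG.covKer_eq_inner z) i) j
    rw [Matrix.transpose_apply] at ht
    rw [ht, mul_comm]
  have hvar : Var[A; Q] = postCov κ σ z w w := by
    rw [← covariance_self hAL.aemeasurable]
    have h1 : cov[A, A; Q] = cov[A, fun q => G q.1 w; Q] - ∑ i, α i * cov[A, Y i; Q] := by
      conv_lhs => enter [2]; rw [hA]
      rw [covariance_fun_sub_right hAL (hf w) hSL, covariance_fun_sum_right hαY hAL]
      simp only [covariance_const_mul_right]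
    rw [h1, hcov_left (hf w)]
    simp only [hAY, mul_zero, Finset.sum_const_zero, sub_zero]
    simp only [hY, hQ, hG.cov_obs_val, hG.cov_val_val]
    change _ = κ w w - kernelVec κ z w ⬝ᵥ α
    rw [dotProduct_comm]
    rfl
  have hmean : ∫ q, A q ∂Q = 0 := by
    have i1 : ∀ w, ∫ q, G q.1 w ∂Q = 0 := fun w => by
      rw [hQ, integral_fun_fst (fun φ => G φ w), hG.mean, smul_zero]
    have i2 : ∀ i, ∫ q : 𝓕 × (Fin n → ℝ), q.2 i ∂Q = 0 := fun i => by
      rw [hQ, integral_fun_snd (fun e : Fin n → ℝ => e i), integral_noise, smul_zero]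
    rw [hA, integral_sub ((hf w).integrable one_le_two) (hSL.integrable one_le_two), i1,
      integral_finsetSum _ fun i _ => (hαY i).integrable one_le_two]
    simp only [integral_const_mul, hY]
    simp only [integral_add ((hf _).integrable one_le_two) ((he _).integrable one_le_two), i1, i2]
    simp
  -- Zero covariance yields independence only for jointly Gaussian variables. The index `none`
  -- carries the query point, which is allowed to coincide with a design point.
  have hjoint : HasGaussianLaw (fun q : 𝓕 × (Fin n → ℝ) =>
      ((fun i : Option (Fin n) => G q.1 (i.elim w z)), q.2)) Q := by
    refine IndepFun.hasGaussianLaw (X := fun q : 𝓕 × (Fin n → ℝ) =>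
      (fun i : Option (Fin n) => G q.1 (i.elim w z))) (Y := fun q => q.2) ⟨?_⟩ ⟨?_⟩ ?_
    · have hm : Measurable fun φ => (fun i : Option (Fin n) => G φ (i.elim w z)) :=
        measurable_pi_iff.2 fun i => hG.measurable_apply _
      have := Measure.map_map (μ := Q) hm measurable_fst
      rw [Function.comp_def] at this
      rw [← this, hQ, Measure.map_fst_prod]
      simpa using (hG.hasGaussianLaw_family fun i : Option (Fin n) => i.elim w z).isGaussian_map
    · rw [hQ, Measure.map_snd_prod]
      simpa using (hasGaussianLaw_noise σ n).isGaussian_map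
    · exact indepFun_prod (X := fun φ => (fun i : Option (Fin n) => G φ (i.elim w z)))
        (Y := fun e : Fin n → ℝ => e) (measurable_pi_iff.2 fun i => hG.measurable_apply _)
        measurable_id
  have hAYlaw : HasGaussianLaw (fun q => (A q, fun i => Y i q)) Q := by
    let L : ((Option (Fin n) → ℝ) × (Fin n → ℝ)) →L[ℝ] ℝ × (Fin n → ℝ) :=
      LinearMap.toContinuousLinearMap
      { toFun := fun u => (u.1 none - ∑ i, α i * (u.1 (some i) + u.2 i),
          fun i => u.1 (some i) + u.2 i)
        map_add' := fun u v => by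
          ext i
          · simp only [Prod.fst_add, Prod.snd_add, Pi.add_apply, mul_add, Finset.sum_add_distrib]
            ring
          · simp only [Prod.fst_add, Prod.snd_add, Pi.add_apply]
            ring
        map_smul' := fun c u => by
          ext i
          · simp only [Prod.smul_fst, Prod.smul_snd, Pi.smul_apply, smul_eq_mul, RingHom.id_apply,
              mul_sub, Finset.mul_sum]
            congr 1
            exact Finset.sum_congr rfl fun i _ => by ring
          · simp only [Prod.smul_fst, Prod.smul_snd, Pi.smul_apply, smul_eq_mul, RingHom.id_apply]
            ring }
    exact hjoint.map L
  have hind : IndepFun A (fun q i => Y i q) Q := by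
    have h1 : HasGaussianLaw (fun q => ((fun _ : Unit => A q), fun i => Y i q)) Q := by
      let L : (ℝ × (Fin n → ℝ)) →L[ℝ] (Unit → ℝ) × (Fin n → ℝ) :=
        LinearMap.toContinuousLinearMap
        { toFun := fun u => (fun _ => u.1, u.2)
          map_add' := fun u v => rfl
          map_smul' := fun c u => rfl }
      exact hAYlaw.map L
    have h2 := HasGaussianLaw.indepFun_of_covariance_eval (X := fun _ : Unit => A) (Y := Y) h1
      fun _ j => hAY j
    exact h2.comp (measurable_pi_apply ()) measurable_id
  have hAlaw : Q.map A = gaussianReal 0 (postCov κ σ z w w).toNNReal := by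
    rw [hAYlaw.fst.map_eq_gaussianReal, hmean, hvar]
  rw [← hAlaw]
  exact (indepFun_iff_map_prod_eq_prod_map_map hAYlaw.fst.aemeasurable hAYlaw.snd.aemeasurable).1
    hind

end IsGaussField

end GaussField

end SBOKDE

end

noncomputable section

namespace SBOKDE

/-! ### Bayes' rule at a fixed design. -/

section Conjugacy

variable {Dx Dc : ℕ} {𝓕 : Type*} [MeasurableSpace 𝓕] {ρ : Measure 𝓕} {G : 𝓕 → Pt Dx Dc → ℝ}
  {σ : ℝ} {n : ℕ}

/-- Dominated convergence. It serves to upgrade identities between densities from almost every point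
to every point. -/
lemma continuous_lintegral_of_le {α β : Type*} [MeasurableSpace α] [TopologicalSpace β]
    [FirstCountableTopology β] {μ : Measure α} [IsFiniteMeasure μ] {f : β → α → ℝ≥0∞} {C : ℝ≥0∞}
    (hC : C ≠ ∞) (hf : ∀ b, Measurable (f b)) (hle : ∀ b a, f b a ≤ C)
    (hcont : ∀ a, Continuous fun b => f b a) : Continuous fun b => ∫⁻ a, f b a ∂μ := by
  refine continuous_iff_continuousAt.2 fun b => ?_
  refine tendsto_lintegral_filter_of_dominated_convergence (fun _ => C)
    (Eventually.of_forall hf) (Eventually.of_forall fun b => ae_of_all _ (hle b)) ?_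
    (ae_of_all _ fun a => (hcont a).tendsto b)
  rw [lintegral_const]
  exact ENNReal.mul_ne_top hC (measure_ne_top _ _)

/-- The density of the observations at the points `z`. -/
def evidence (ρ : Measure 𝓕) (G : 𝓕 → Pt Dx Dc → ℝ) (σ : ℝ) (z : Fin n → Pt Dx Dc)
    (y : Fin n → ℝ) : ℝ≥0∞ := ∫⁻ φ, lik σ (fun i => G φ (z i)) y ∂ρ

lemma continuous_lik (m : Fin n → ℝ) : Continuous fun y => lik σ m y := by
  simp only [lik_eq_ofReal]
  refine ENNReal.continuous_ofReal.comp (continuous_finsetProd _ fun i _ => ?_)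
  unfold gaussianPDFReal
  fun_prop

lemma evidence_ne_top [IsProbabilityMeasure ρ] (z : Fin n → Pt Dx Dc) (y : Fin n → ℝ) :
    evidence ρ G σ z y ≠ ∞ := by
  refine ((lintegral_mono fun φ => lik_le σ (fun i => G φ (z i)) y).trans_lt ?_).ne
  simp

lemma measurable_field_family (hG : IsGaussField ρ G) (z : Fin n → Pt Dx Dc) :
    Measurable fun φ => fun i => G φ (z i) :=
  measurable_pi_iff.2 fun i => hG.measurable_apply (z i)

lemma evidence_pos [IsProbabilityMeasure ρ] (hG : IsGaussField ρ G) (hσ : 0 < σ)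
    (z : Fin n → Pt Dx Dc) (y : Fin n → ℝ) : 0 < evidence ρ G σ z y := by
  rw [evidence, lintegral_pos_iff_support
    (measurable_lik σ (measurable_field_family hG z) measurable_const)]
  have : (Function.support fun φ => lik σ (fun i => G φ (z i)) y) = Set.univ := by
    ext φ
    simpa using (lik_pos hσ _ _).ne'
  rw [this, measure_univ]
  exact one_pos

/-- Both sides compute the expectation of `χ(Y) ψ(f(w))`, where `Y` are the noisy observations. On
the left the noise is integrated out into the likelihood; on the right `f(w)` is the posterior mean
plus a residual that is independent of `Y` with law `N(0, v)`. Varying `χ` identifies the two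
factors for almost every `y`. -/
lemma lintegral_conjugacy (hG : IsGaussField ρ G) (hσ : 0 < σ) (z : Fin n → Pt Dx Dc)
    (w : Pt Dx Dc) {ψ : ℝ → ℝ≥0∞} (hψ : Measurable ψ) {χ : (Fin n → ℝ) → ℝ≥0∞}
    (hχ : Measurable χ) :
    ∫⁻ y, χ y * ∫⁻ φ, ψ (G φ w) * lik σ (fun i => G φ (z i)) y ∂ρ =
      ∫⁻ y, χ y * (evidence ρ G σ z y * ∫⁻ s, ψ (postMean (covKer ρ G) σ z y w + s)
        ∂gaussianReal 0 (postCov (covKer ρ G) σ z w w).toNNReal) := by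
  have := hG.isProbabilityMeasure
  set κ := covKer ρ G
  set α := postWeights κ σ z w
  set γ := gaussianReal 0 (postCov κ σ z w w).toNNReal
  have hz := measurable_field_family hG z
  have hdot : Measurable fun y : Fin n → ℝ => α ⬝ᵥ y := by
    simp only [dotProduct]
    fun_prop
  have hlik : Measurable fun q : 𝓕 × (Fin n → ℝ) => lik σ (fun i => G q.1 (z i)) q.2 :=
    measurable_lik σ (hz.comp measurable_fst) measurable_snd
  have hadd : ∀ φ, Measurable fun e : Fin n → ℝ => fun i => G φ (z i) + e i :=
    fun φ => measurable_pi_iff.2 fun i => (measurable_pi_apply i).const_add _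
  have hY : Measurable fun q : 𝓕 × (Fin n → ℝ) => fun i => G q.1 (z i) + q.2 i :=
    measurable_pi_iff.2 fun i => ((hG.measurable_apply (z i)).comp measurable_fst).add
      ((measurable_pi_apply i).comp measurable_snd)
  have hA : Measurable fun q : 𝓕 × (Fin n → ℝ) => G q.1 w - ∑ i, α i * (G q.1 (z i) + q.2 i) :=
    ((hG.measurable_apply w).comp measurable_fst).sub
      (Finset.measurable_sum _ fun i _ => ((measurable_pi_apply i).comp hY).const_mul _)
  have hmid : ∀ (F : ℝ × (Fin n → ℝ) → ℝ≥0∞), Measurable F →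
      ∫⁻ q, F (G q.1 w - ∑ i, α i * (G q.1 (z i) + q.2 i), fun i => G q.1 (z i) + q.2 i)
        ∂ρ.prod (noiseLaw σ n) = ∫⁻ s, (∫⁻ y, F (s, y) * evidence ρ G σ z y) ∂γ := by
    intro F hF
    rw [← lintegral_map (f := F) hF (hA.prodMk hY), hG.residual_law hσ z w,
      lintegral_prod _ hF.aemeasurable]
    refine lintegral_congr fun s => ?_
    have hFs : Measurable fun y => F (s, y) := hF.comp (measurable_const.prodMk measurable_id)
    rw [lintegral_map hFs hY, lintegral_prod (fun q : 𝓕 × (Fin n → ℝ) => F (s, fun i => G q.1 (z i) + q.2 i))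
      (hFs.comp hY).aemeasurable]
    have : ∀ φ, ∫⁻ e, F (s, fun i => G φ (z i) + e i) ∂noiseLaw σ n =
        ∫⁻ y, F (s, y) * lik σ (fun i => G φ (z i)) y := fun φ => lintegral_noise_add hσ _ hFs
    rw [lintegral_congr this, lintegral_lintegral_swap]
    · refine lintegral_congr fun y => ?_
      rw [lintegral_const_mul _ (measurable_lik σ hz measurable_const), evidence]
    · exact ((hFs.comp measurable_snd).mul hlik).aemeasurable
  have hχψ : Measurable fun q : 𝓕 × (Fin n → ℝ) => χ q.2 * (ψ (G q.1 w) * lik σ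
      (fun i => G q.1 (z i)) q.2) := (hχ.comp measurable_snd).mul
    ((hψ.comp ((hG.measurable_apply w).comp measurable_fst)).mul hlik)
  have hF : Measurable fun u : ℝ × (Fin n → ℝ) => χ u.2 * ψ (α ⬝ᵥ u.2 + u.1) :=
    (hχ.comp measurable_snd).mul (hψ.comp ((hdot.comp measurable_snd).add measurable_fst))
  calc ∫⁻ y, χ y * ∫⁻ φ, ψ (G φ w) * lik σ (fun i => G φ (z i)) y ∂ρ
      = ∫⁻ φ, (∫⁻ y, χ y * (ψ (G φ w) * lik σ (fun i => G φ (z i)) y)) ∂ρ := by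
        rw [lintegral_lintegral_swap hχψ.aemeasurable]
        refine lintegral_congr fun y => ?_
        rw [lintegral_const_mul]
        exact (hψ.comp (hG.measurable_apply w)).mul (measurable_lik σ hz measurable_const)
    _ = ∫⁻ φ, ∫⁻ e, χ (fun i => G φ (z i) + e i) * ψ (G φ w) ∂noiseLaw σ n ∂ρ := by
        refine lintegral_congr fun φ => ?_
        rw [lintegral_noise_add hσ (fun i => G φ (z i)) (h := fun y => χ y * ψ (G φ w))
          (hχ.mul_const _)]
        simp only [mul_assoc]
    _ = ∫⁻ q, χ (fun i => G q.1 (z i) + q.2 i) * ψ (G q.1 w) ∂ρ.prod (noiseLaw σ n) := by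
        rw [lintegral_prod]
        exact ((hχ.comp hY).mul
          (hψ.comp ((hG.measurable_apply w).comp measurable_fst))).aemeasurable
    _ = ∫⁻ s, (∫⁻ y, χ y * ψ (α ⬝ᵥ y + s) * evidence ρ G σ z y) ∂γ := by
        rw [← hmid _ hF]
        refine lintegral_congr fun q => ?_
        simp [dotProduct]
    _ = _ := by
        rw [lintegral_lintegral_swap]
        · refine lintegral_congr fun y => ?_
          rw [← lintegral_const_mul, ← lintegral_const_mul]
          · refine lintegral_congr fun s => ?_
            rw [postMean_eq_dotProduct hG.covKer_eq_inner]
            ring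
          · exact (hψ.comp (measurable_id.const_add _)).const_mul _
          · exact hψ.comp (measurable_id.const_add _)
        · have he : Measurable (evidence ρ G σ z) := hlik.lintegral_prod_left'
          exact (hF.mul (he.comp measurable_snd)).aemeasurable

/-- Bayes' rule for Gaussian observations at fixed points. -/
lemma posterior_fixed_design (hG : IsGaussField ρ G) (hσ : 0 < σ) (z : Fin n → Pt Dx Dc)
    (w : Pt Dx Dc) (y : Fin n → ℝ) {ψ : ℝ → ℝ≥0∞} (hψ : Measurable ψ) :
    ∫⁻ φ, ψ (G φ w) * lik σ (fun i => G φ (z i)) y ∂ρ =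
      evidence ρ G σ z y * ∫⁻ s, ψ (postMean (covKer ρ G) σ z y w + s)
        ∂gaussianReal 0 (postCov (covKer ρ G) σ z w w).toNNReal := by
  have := hG.isProbabilityMeasure
  set κ := covKer ρ G with hκ
  set γ := gaussianReal 0 (postCov κ σ z w w).toNNReal with hγ
  have hz := measurable_field_family hG z
  have hliky : ∀ y, Measurable fun φ => lik σ (fun i => G φ (z i)) y :=
    fun y => measurable_lik σ hz measurable_const
  have hlik : Measurable fun q : 𝓕 × (Fin n → ℝ) => lik σ (fun i => G q.1 (z i)) q.2 :=
    measurable_lik σ (hz.comp measurable_fst) measurable_snd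
  have hpm : Continuous fun y => postMean κ σ z y w := by
    simp only [hκ, postMean_eq_dotProduct hG.covKer_eq_inner, dotProduct]
    fun_prop
  have hev : Continuous (evidence ρ G σ z) :=
    continuous_lintegral_of_le (C := ENNReal.ofReal (pdfMax σ ^ n)) ENNReal.ofReal_ne_top
      hliky (fun y φ => lik_le σ _ _) fun φ => continuous_lik _
  -- For bounded continuous test functions both sides are continuous in `y`, so the exceptional null
  -- set is empty. Every `y` matters, because in an adaptive design the points are themselves
  -- functions of `y`.
  have hbc : ∀ (f : BoundedContinuousFunction ℝ ℝ≥0) (y : Fin n → ℝ),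
      ∫⁻ φ, f (G φ w) * lik σ (fun i => G φ (z i)) y ∂ρ =
        evidence ρ G σ z y * ∫⁻ s, f (postMean κ σ z y w + s) ∂γ := by
    intro f
    set C : ℝ≥0 := nndist f 0
    have hfC : ∀ t, (f t : ℝ≥0∞) ≤ C := fun t =>
      ENNReal.coe_le_coe.2 (BoundedContinuousFunction.NNReal.upper_bound f t)
    have hfm : Measurable fun t => (f t : ℝ≥0∞) := f.continuous.measurable.coe_nnreal_ennreal
    have c1 : Continuous fun y => ∫⁻ φ, f (G φ w) * lik σ (fun i => G φ (z i)) y ∂ρ := by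
      refine continuous_lintegral_of_le (C := C * ENNReal.ofReal (pdfMax σ ^ n))
        (ENNReal.mul_ne_top ENNReal.coe_ne_top ENNReal.ofReal_ne_top)
        (fun y => (hfm.comp (hG.measurable_apply w)).mul (hliky y))
        (fun y φ => mul_le_mul' (hfC _) (lik_le σ _ _)) fun φ => ?_
      exact ENNReal.continuous_const_mul ENNReal.coe_ne_top |>.comp (continuous_lik _)
    have c2 : Continuous fun y => ∫⁻ s, f (postMean κ σ z y w + s) ∂γ := by
      refine continuous_lintegral_of_le (C := C) ENNReal.coe_ne_top
        (fun y => hfm.comp (measurable_id.const_add _)) (fun y s => hfC _) fun s => ?_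
      exact ENNReal.continuous_coe.comp (f.continuous.comp (hpm.add continuous_const))
    have c2top : ∀ y, ∫⁻ s, f (postMean κ σ z y w + s) ∂γ ≠ ∞ := fun y => by
      refine ((lintegral_mono fun s => hfC _).trans_lt ?_).ne
      simp
    have c3 : Continuous fun y => evidence ρ G σ z y * ∫⁻ s, f (postMean κ σ z y w + s) ∂γ := by
      refine continuous_iff_continuousAt.2 fun y => ?_
      exact ENNReal.Tendsto.mul (hev.tendsto y) (Or.inr (c2top y)) (c2.tendsto y)
        (Or.inr (evidence_ne_top z y))
    have hae : (fun y => ∫⁻ φ, f (G φ w) * lik σ (fun i => G φ (z i)) y ∂ρ) =ᵐ[volume]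
        fun y => evidence ρ G σ z y * ∫⁻ s, f (postMean κ σ z y w + s) ∂γ := by
      refine ae_eq_of_forall_setLIntegral_eq_of_sigmaFinite c1.measurable c3.measurable ?_
      intro s hs _
      have h := lintegral_conjugacy hG hσ z w hfm (χ := s.indicator 1) (measurable_one.indicator hs)
      rw [← lintegral_indicator hs, ← lintegral_indicator hs]
      refine Eq.trans (lintegral_congr fun y => ?_) (h.trans (lintegral_congr fun y => ?_))
      all_goals by_cases hy : y ∈ s <;> simp [hy, hκ, hγ]
    intro y
    exact congrFun ((Continuous.ae_eq_iff_eq volume c1 c3).1 hae) y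
  have hmadd : Measurable fun s => postMean κ σ z y w + s := by fun_prop
  -- Bounded continuous functions determine finite measures, which extends the identity to every
  -- measurable `ψ`.
  have hmeq : (ρ.withDensity fun φ => lik σ (fun i => G φ (z i)) y).map (fun φ => G φ w) =
      evidence ρ G σ z y • γ.map (fun s => postMean κ σ z y w + s) := by
    have : IsFiniteMeasure (ρ.withDensity fun φ => lik σ (fun i => G φ (z i)) y) :=
      isFiniteMeasure_withDensity (evidence_ne_top z y)
    refine ext_of_forall_lintegral_eq_of_IsFiniteMeasure fun f => ?_
    have hfm : Measurable fun t => (f t : ℝ≥0∞) := f.continuous.measurable.coe_nnreal_ennreal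
    rw [lintegral_map hfm (hG.measurable_apply w), lintegral_smul_measure,
      lintegral_map hfm hmadd, lintegral_withDensity_eq_lintegral_mul _
      (hliky y) (show Measurable fun φ => (f (G φ w) : ℝ≥0∞) from hfm.comp (hG.measurable_apply w)),
      smul_eq_mul, ← hbc f y]
    refine lintegral_congr fun φ => ?_
    simp [mul_comm]
  have h : ∫⁻ t, ψ t ∂(ρ.withDensity fun φ => lik σ (fun i => G φ (z i)) y).map (fun φ => G φ w) =
      ∫⁻ t, ψ t ∂(evidence ρ G σ z y • γ.map (fun s => postMean κ σ z y w + s)) := by rw [hmeq]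
  rw [lintegral_map hψ (hG.measurable_apply w), lintegral_smul_measure,
      lintegral_map hψ hmadd, lintegral_withDensity_eq_lintegral_mul _
      (hliky y) (show Measurable fun φ => ψ (G φ w) from hψ.comp (hG.measurable_apply w)), smul_eq_mul] at h
  rw [← h]
  refine lintegral_congr fun φ => ?_
  simp [mul_comm]

end Conjugacy

end SBOKDE

end

noncomputable section

namespace SBOKDE

/-! ### Measurability of the posterior moments in the data. -/

section Measurability

variable {Dx Dc n : ℕ} {α : Type*} [MeasurableSpace α]

lemma measurable_matrix_det {A : α → Matrix (Fin n) (Fin n) ℝ}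
    (hA : ∀ i j, Measurable fun a => A a i j) : Measurable fun a => (A a).det := by
  simp only [Matrix.det_apply]
  exact Finset.measurable_sum _ fun τ _ =>
    (Finset.measurable_prod _ fun i _ => hA _ _).const_smul _

lemma measurable_matrix_inv {A : α → Matrix (Fin n) (Fin n) ℝ}
    (hA : ∀ i j, Measurable fun a => A a i j) (i j : Fin n) : Measurable fun a => (A a)⁻¹ i j := by
  simp only [Matrix.inv_def, Matrix.smul_apply, Ring.inverse_eq_inv', Matrix.adjugate_apply]
  refine (measurable_matrix_det hA).inv.smul (measurable_matrix_det fun k l => ?_)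
  simp only [Matrix.updateRow_apply]
  split_ifs
  · exact measurable_const
  · exact hA _ _

variable {k : Pt Dx Dc → Pt Dx Dc → ℝ} {σ : ℝ} {z : α → Fin n → Pt Dx Dc} {w : α → Pt Dx Dc}
  {y : α → Fin n → ℝ}

lemma measurable_kernelVec (hk : Measurable (Function.uncurry k)) (hz : ∀ i, Measurable fun a => z a i)
    (hw : Measurable w) (i : Fin n) : Measurable fun a => kernelVec k (z a) (w a) i :=
  hk.comp ((hz i).prodMk hw)

lemma measurable_gramMat_inv (hk : Measurable (Function.uncurry k))
    (hz : ∀ i, Measurable fun a => z a i) (i j : Fin n) :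
    Measurable fun a => (gramMat k σ (z a))⁻¹ i j := by
  refine measurable_matrix_inv (fun i j => ?_) i j
  simp only [gramMat, kernelMat, Matrix.add_apply, Matrix.of_apply]
  exact (hk.comp ((hz i).prodMk (hz j))).add_const _

lemma measurable_postMean (hk : Measurable (Function.uncurry k))
    (hz : ∀ i, Measurable fun a => z a i) (hy : Measurable y) (hw : Measurable w) :
    Measurable fun a => postMean k σ (z a) (y a) (w a) := by
  change Measurable fun a => kernelVec k (z a) (w a) ⬝ᵥ ((gramMat k σ (z a))⁻¹ *ᵥ (y a))
  simp only [dotProduct, Matrix.mulVec]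
  exact Finset.measurable_sum _ fun i _ => (measurable_kernelVec hk hz hw i).mul
    (Finset.measurable_sum _ fun j _ => (measurable_gramMat_inv hk hz i j).mul
      ((measurable_pi_apply j).comp hy))

lemma measurable_postCov (hk : Measurable (Function.uncurry k))
    (hz : ∀ i, Measurable fun a => z a i) (hw : Measurable w) :
    Measurable fun a => postCov k σ (z a) (w a) (w a) := by
  change Measurable fun a => k (w a) (w a) -
    kernelVec k (z a) (w a) ⬝ᵥ ((gramMat k σ (z a))⁻¹ *ᵥ kernelVec k (z a) (w a))
  simp only [dotProduct, Matrix.mulVec]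
  exact (hk.comp (hw.prodMk hw)).sub (Finset.measurable_sum _ fun i _ =>
    (measurable_kernelVec hk hz hw i).mul (Finset.measurable_sum _ fun j _ =>
      (measurable_gramMat_inv hk hz i j).mul (measurable_kernelVec hk hz hw j)))

lemma measurable_postStd (hk : Measurable (Function.uncurry k))
    (hz : ∀ i, Measurable fun a => z a i) (hw : Measurable w) :
    Measurable fun a => postStd k σ (z a) (w a) := (measurable_postCov hk hz hw).sqrt

end Measurability

/-! ### Bayes' rule for adaptively chosen points. -/

section Adaptive

variable {Dx Dc : ℕ} {Ω 𝓕 𝓤 : Type*} [MeasurableSpace Ω] [MeasurableSpace 𝓕] [MeasurableSpace 𝓤]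
  {P : Measure Ω} {G : 𝓕 → Pt Dx Dc → ℝ} {σ : ℝ}

lemma lintegral_comp_indepFun {α β : Type*} [MeasurableSpace α] [MeasurableSpace β]
    [IsProbabilityMeasure P] {A : Ω → α} {B : Ω → β} (hA : Measurable A) (hB : Measurable B)
    (h : IndepFun A B P) {f : α × β → ℝ≥0∞} (hf : Measurable f) :
    ∫⁻ ω, f (A ω, B ω) ∂P = ∫⁻ ω, ∫⁻ b, f (A ω, b) ∂(P.map B) ∂P := by
  have := Measure.isProbabilityMeasure_map (μ := P) hB.aemeasurable
  rw [← lintegral_map (f := f) hf (hA.prodMk hB),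
    (indepFun_iff_map_prod_eq_prod_map_map hA.aemeasurable hB.aemeasurable).1 h,
    lintegral_prod _ hf.aemeasurable, lintegral_map (f := fun a => ∫⁻ b, f (a, b) ∂P.map B)
    hf.lintegral_prod_right' hA]

/-- The design points determined by the external randomness `d.1` and the observations `d.2`. -/
def designPts {𝓤 : Type*} (ζ : ∀ n, 𝓤 × (Fin n → ℝ) → Pt Dx Dc) {n : ℕ} (d : 𝓤 × (Fin n → ℝ)) :
    Fin n → Pt Dx Dc :=
  fun i => ζ i (d.1, fun j : Fin i => d.2 (j.castLE i.2.le))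

/-- The first `n` observations. -/
def obs {Ω : Type*} (y : ℕ → Ω → ℝ) (n : ℕ) (ω : Ω) : Fin n → ℝ := fun i => y i ω

/-- Noisy observations `y` of the field `G (F ω)` at sequentially chosen points: the `n`-th point
is a function of the external randomness `U` and of the earlier observations. -/
structure IsAdaptive (P : Measure Ω) (G : 𝓕 → Pt Dx Dc → ℝ) (σ : ℝ) (F : Ω → 𝓕) (U : Ω → 𝓤)
    (ε y : ℕ → Ω → ℝ) (ζ : ∀ n, 𝓤 × (Fin n → ℝ) → Pt Dx Dc) : Prop where
  measurable_F : Measurable F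
  measurable_U : Measurable U
  measurable_noise : ∀ n, Measurable (ε n)
  measurable_design : ∀ n, Measurable (ζ n)
  field : IsGaussField (P.map F) G
  indep_F_U : IndepFun F U P
  noise_law : ∀ n, P.map (ε n) = gaussianReal 0 (noiseVar σ)
  indep_noise : ∀ n, IndepFun (fun ω => (F ω, U ω, fun i : Fin n => ε i ω)) (ε n) P
  observation : ∀ n ω, y n ω = G (F ω) (ζ n (U ω, obs y n ω)) + ε n ω

variable {F : Ω → 𝓕} {U : Ω → 𝓤} {ε y : ℕ → Ω → ℝ} {ζ : ∀ n, 𝓤 × (Fin n → ℝ) → Pt Dx Dc}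

lemma measurable_designPts (hζ : ∀ n, Measurable (ζ n)) {n : ℕ} (i : Fin n) :
    Measurable fun d : 𝓤 × (Fin n → ℝ) => designPts ζ d i :=
  (hζ i).comp (measurable_fst.prodMk
    (measurable_pi_iff.2 fun _ => (measurable_pi_apply _).comp measurable_snd))

lemma obs_succ {Ω : Type*} {y : ℕ → Ω → ℝ} (n : ℕ) (ω : Ω) :
    obs y (n + 1) ω = Fin.snoc (α := fun _ => ℝ) (obs y n ω) (y n ω) := by
  ext i
  refine Fin.lastCases ?_ (fun j => ?_) i <;> simp [obs]

lemma designPts_snoc {𝓤 : Type*} {ζ : ∀ n, 𝓤 × (Fin n → ℝ) → Pt Dx Dc} {n : ℕ} (u : 𝓤)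
    (η : Fin n → ℝ) (t : ℝ) :
    designPts ζ (u, (Fin.snoc (α := fun _ => ℝ) η t : Fin (n + 1) → ℝ)) =
      Fin.snoc (α := fun _ => Pt Dx Dc) (designPts ζ (u, η)) (ζ n (u, η)) := by
  ext1 i
  refine Fin.lastCases ?_ (fun j => ?_) i
  · simp only [designPts, Fin.snoc_last, Fin.val_last]
    congr 2
    ext j
    exact Fin.snoc_castSucc (α := fun _ => ℝ) t η j
  · simp only [designPts, Fin.snoc_castSucc, Fin.val_castSucc]
    congr 2
    ext l
    exact Fin.snoc_castSucc (α := fun _ => ℝ) t η (l.castLE j.2.le)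

namespace IsAdaptive

/-- Unrolls the recursion: the first `n` observations involve only the first `n` noises, and are
therefore independent of `ε n`. -/
lemma exists_obs_eq (h : IsAdaptive P G σ F U ε y ζ) (n : ℕ) :
    ∃ Θ : 𝓕 × 𝓤 × (Fin n → ℝ) → Fin n → ℝ, Measurable Θ ∧
      ∀ ω, obs y n ω = Θ (F ω, U ω, fun i => ε i ω) := by
  induction n with
  | zero => exact ⟨fun _ => Fin.elim0, measurable_const, fun ω => Subsingleton.elim _ _⟩
  | succ n ih =>
    obtain ⟨Θ, hΘ, hobs⟩ := ih
    let π : 𝓕 × 𝓤 × (Fin (n + 1) → ℝ) → 𝓕 × 𝓤 × (Fin n → ℝ) :=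
      fun q => (q.1, q.2.1, fun i => q.2.2 i.castSucc)
    have hπ : Measurable π := measurable_fst.prodMk (measurable_snd.fst.prodMk
      (measurable_pi_iff.2 fun i => (measurable_pi_apply _).comp measurable_snd.snd))
    refine ⟨fun q => Fin.snoc (α := fun _ => ℝ) (Θ (π q))
      (G q.1 (ζ n (q.2.1, Θ (π q))) + q.2.2 (Fin.last n)), ?_, fun ω => ?_⟩
    · refine measurable_fin_snoc.comp ((hΘ.comp hπ).prodMk (Measurable.add ?_ ?_))
      · exact h.field.measurable.comp (measurable_fst.prodMk ((h.measurable_design n).comp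
          (measurable_snd.fst.prodMk (hΘ.comp hπ))))
      · exact (measurable_pi_apply _).comp measurable_snd.snd
    · rw [obs_succ, h.observation, hobs]
      rfl

lemma measurable_obs (h : IsAdaptive P G σ F U ε y ζ) (n : ℕ) : Measurable (obs y n) := by
  obtain ⟨Θ, hΘ, hobs⟩ := h.exists_obs_eq n
  rw [funext hobs]
  exact hΘ.comp (h.measurable_F.prodMk (h.measurable_U.prodMk
    (measurable_pi_iff.2 fun i => h.measurable_noise i)))

lemma indepFun_obs_noise (h : IsAdaptive P G σ F U ε y ζ) (n : ℕ) :
    IndepFun (fun ω => (F ω, U ω, obs y n ω)) (ε n) P := by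
  obtain ⟨Θ, hΘ, hobs⟩ := h.exists_obs_eq n
  have := (h.indep_noise n).comp (φ := fun q => (q.1, q.2.1, Θ q))
    (measurable_fst.prodMk (measurable_snd.fst.prodMk hΘ)) measurable_id
  convert! this using 1
  ext1 ω
  simp [hobs]

/-- The likelihood of the observations, given the field and the external randomness. -/
lemma lintegral_eq (h : IsAdaptive P G σ F U ε y ζ) [IsProbabilityMeasure P] (hσ : 0 < σ) (n : ℕ)
    {H : 𝓕 × 𝓤 × (Fin n → ℝ) → ℝ≥0∞} (hH : Measurable H) :
    ∫⁻ ω, H (F ω, U ω, obs y n ω) ∂P =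
      ∫⁻ φ, ∫⁻ u, (∫⁻ η, H (φ, u, η) * lik σ (fun i => G φ (designPts ζ (u, η) i)) η)
        ∂(P.map U) ∂(P.map F) := by
  have hpF := Measure.isProbabilityMeasure_map (μ := P) h.measurable_F.aemeasurable
  have hpU := Measure.isProbabilityMeasure_map (μ := P) h.measurable_U.aemeasurable
  induction n with
  | zero =>
    have hHU : Measurable fun q : 𝓕 × 𝓤 => H (q.1, q.2, Fin.elim0) :=
      hH.comp (measurable_fst.prodMk (measurable_snd.prodMk measurable_const))
    have h0 : ∀ φ u, ∫⁻ η : Fin 0 → ℝ, H (φ, u, η) *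
        lik σ (fun i => G φ (designPts ζ (u, η) i)) η = H (φ, u, Fin.elim0) := by
      intro φ u
      rw [volume_pi, Measure.pi_of_empty _ (Fin.elim0 : Fin 0 → ℝ), lintegral_dirac]
      simp [lik]
    simp only [h0]
    rw [lintegral_map (f := fun φ => ∫⁻ u, H (φ, u, Fin.elim0) ∂P.map U)
      hHU.lintegral_prod_right' h.measurable_F]
    refine Eq.trans (lintegral_congr fun ω => ?_)
      (lintegral_comp_indepFun h.measurable_F h.measurable_U h.indep_F_U hHU)
    congr 3
    exact Subsingleton.elim _ _
  | succ n ih =>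
    have hW : Measurable fun ω => (F ω, U ω, obs y n ω) :=
      h.measurable_F.prodMk (h.measurable_U.prodMk (h.measurable_obs n))
    let m : 𝓕 × 𝓤 × (Fin n → ℝ) → ℝ := fun q => G q.1 (ζ n q.2)
    have hm : Measurable m :=
      h.field.measurable.comp (measurable_fst.prodMk ((h.measurable_design n).comp measurable_snd))
    let S : (𝓕 × 𝓤 × (Fin n → ℝ)) × ℝ → 𝓕 × 𝓤 × (Fin (n + 1) → ℝ) :=
      fun q => (q.1.1, q.1.2.1, Fin.snoc (α := fun _ => ℝ) q.1.2.2 q.2)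
    have hS : Measurable S := measurable_fst.fst.prodMk (measurable_fst.snd.fst.prodMk
      (measurable_fin_snoc.comp (measurable_fst.snd.snd.prodMk measurable_snd)))
    have hpdf : Measurable fun q : (𝓕 × 𝓤 × (Fin n → ℝ)) × ℝ =>
        gaussianPDF (m q.1) (noiseVar σ) q.2 :=
      measurable_uncurry_gaussianPDF.comp ((hm.comp measurable_fst).prodMk
        (measurable_const.prodMk measurable_snd))
    have hJ : Measurable fun q : (𝓕 × 𝓤 × (Fin n → ℝ)) × ℝ =>
        H (S q) * gaussianPDF (m q.1) (noiseVar σ) q.2 := (hH.comp hS).mul hpdf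
    -- The new observation is the field at a point fixed by the past, plus a noise independent of
    -- the past; its conditional density is Gaussian around that value of the field.
    have h1 : ∫⁻ ω, H (F ω, U ω, obs y (n + 1) ω) ∂P =
        ∫⁻ ω, (∫⁻ t, H (S ((F ω, U ω, obs y n ω), t)) *
          gaussianPDF (m (F ω, U ω, obs y n ω)) (noiseVar σ) t) ∂P := by
      have h2 : ∀ ω, H (F ω, U ω, obs y (n + 1) ω) =
          (fun q : (𝓕 × 𝓤 × (Fin n → ℝ)) × ℝ => H (S (q.1, m q.1 + q.2)))
            ((F ω, U ω, obs y n ω), ε n ω) := by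
        intro ω
        rw [obs_succ, h.observation]
      have hK : Measurable fun q : (𝓕 × 𝓤 × (Fin n → ℝ)) × ℝ => H (S (q.1, m q.1 + q.2)) :=
        hH.comp (hS.comp (measurable_fst.prodMk ((hm.comp measurable_fst).add measurable_snd)))
      rw [lintegral_congr h2, lintegral_comp_indepFun hW (h.measurable_noise n)
        (h.indepFun_obs_noise n) hK, h.noise_law]
      refine lintegral_congr fun ω => ?_
      exact lintegral_gaussianReal_const_add (noiseVar_ne_zero hσ) (m (F ω, U ω, obs y n ω))
        (h := fun t => H (S ((F ω, U ω, obs y n ω), t)))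
        (hH.comp (hS.comp (measurable_const.prodMk measurable_id)))
    rw [h1, ih hJ.lintegral_prod_right']
    refine lintegral_congr fun φ => lintegral_congr fun u => ?_
    have hmeas : Measurable fun η : Fin (n + 1) → ℝ => H (φ, u, η) *
        lik σ (fun i => G φ (designPts ζ (u, η) i)) η := by
      refine (hH.comp (measurable_const.prodMk (measurable_const.prodMk measurable_id))).mul
        (measurable_lik σ (measurable_pi_iff.2 fun i => ?_) measurable_id)
      exact (h.field.measurable_of_apply φ).comp ((measurable_designPts h.measurable_design i).comp
        (measurable_const.prodMk measurable_id))
    rw [volume_pi, volume_pi, lintegral_pi_fin_succ _ hmeas]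
    refine lintegral_congr fun η => ?_
    have hJη : Measurable fun t => H (S ((φ, u, η), t)) *
        gaussianPDF (m (φ, u, η)) (noiseVar σ) t :=
      hJ.comp (measurable_const.prodMk measurable_id)
    rw [← lintegral_mul_const _ hJη]
    refine lintegral_congr fun t => ?_
    have h3 : (fun i => G φ (designPts ζ (u, (Fin.snoc (α := fun _ => ℝ) η t : Fin (n + 1) → ℝ)) i))
        = Fin.snoc (α := fun _ => ℝ) (fun i => G φ (designPts ζ (u, η) i)) (m (φ, u, η)) := by
      rw [designPts_snoc]
      ext i
      refine Fin.lastCases ?_ (fun j => ?_) i <;> simp [m]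
    rw [h3, lik_snoc]
    change H (φ, u, _) * _ * _ = H (φ, u, _) * _
    ring

lemma gaussianReal_zero_eq_map {v : ℝ} :
    gaussianReal 0 v.toNNReal = (gaussianReal 0 1).map fun s => √v * s := by
  rw [gaussianReal_map_const_mul, mul_zero, mul_one]
  congr 1
  ext
  by_cases hv : 0 ≤ v
  · simp [hv]
  · rw [not_le] at hv
    simp [Real.sqrt_eq_zero_of_nonpos hv.le, hv.le]

/-- Bayes' rule for adaptively chosen points. -/
lemma lintegral_posterior (h : IsAdaptive P G σ F U ε y ζ) [IsProbabilityMeasure P] (hσ : 0 < σ)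
    {n : ℕ} {w : 𝓤 × (Fin n → ℝ) → Pt Dx Dc} (hw : Measurable w)
    {Φ : (𝓤 × (Fin n → ℝ)) × ℝ → ℝ≥0∞} (hΦ : Measurable Φ) :
    ∫⁻ ω, Φ ((U ω, obs y n ω), G (F ω) (w (U ω, obs y n ω))) ∂P =
      ∫⁻ ω, ∫⁻ s, Φ ((U ω, obs y n ω),
        postMean (covKer (P.map F) G) σ (designPts ζ (U ω, obs y n ω)) (obs y n ω)
          (w (U ω, obs y n ω)) +
        postStd (covKer (P.map F) G) σ (designPts ζ (U ω, obs y n ω)) (w (U ω, obs y n ω)) * s)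
        ∂gaussianReal 0 1 ∂P := by
  have hpF := Measure.isProbabilityMeasure_map (μ := P) h.measurable_F.aemeasurable
  have hpU := Measure.isProbabilityMeasure_map (μ := P) h.measurable_U.aemeasurable
  set κ := covKer (P.map F) G
  have hκ : Measurable (Function.uncurry κ) := h.field.measurable_covKer
  have hζ := h.measurable_design
  have hpm : Measurable fun d : 𝓤 × (Fin n → ℝ) => postMean κ σ (designPts ζ d) d.2 (w d) :=
    measurable_postMean hκ (measurable_designPts hζ) measurable_snd hw
  have hps : Measurable fun d : 𝓤 × (Fin n → ℝ) => postStd κ σ (designPts ζ d) (w d) :=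
    measurable_postStd hκ (measurable_designPts hζ) hw
  have hΦ2 : Measurable fun q : (𝓤 × (Fin n → ℝ)) × ℝ => Φ (q.1,
      postMean κ σ (designPts ζ q.1) q.1.2 (w q.1) + postStd κ σ (designPts ζ q.1) (w q.1) * q.2) :=
    hΦ.comp (measurable_fst.prodMk ((hpm.comp measurable_fst).add
      ((hps.comp measurable_fst).mul measurable_snd)))
  have hR : Measurable fun d : 𝓤 × (Fin n → ℝ) => ∫⁻ s, Φ (d,
      postMean κ σ (designPts ζ d) d.2 (w d) + postStd κ σ (designPts ζ d) (w d) * s)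
      ∂gaussianReal 0 1 := hΦ2.lintegral_prod_right'
  have hL : Measurable fun q : 𝓕 × 𝓤 × (Fin n → ℝ) => Φ (q.2, G q.1 (w q.2)) :=
    hΦ.comp (measurable_snd.prodMk
      (h.field.measurable.comp (measurable_fst.prodMk (hw.comp measurable_snd))))
  have hlik : Measurable fun q : 𝓕 × 𝓤 × (Fin n → ℝ) =>
      lik σ (fun i => G q.1 (designPts ζ q.2 i)) q.2.2 :=
    measurable_lik σ (measurable_pi_iff.2 fun i => h.field.measurable.comp (measurable_fst.prodMk
      ((measurable_designPts hζ i).comp measurable_snd))) measurable_snd.snd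
  -- The field is integrated innermost. For fixed `u` and `η` the design points are constants, and
  -- the rule for a fixed design applies under the two outer integrals.
  have hswap : ∀ H : 𝓕 × 𝓤 × (Fin n → ℝ) → ℝ≥0∞, Measurable H →
      ∫⁻ ω, H (F ω, U ω, obs y n ω) ∂P =
        ∫⁻ u, (∫⁻ η, (∫⁻ φ, H (φ, u, η) * lik σ (fun i => G φ (designPts ζ (u, η) i)) η
          ∂(P.map F))) ∂(P.map U) := by
    intro H hH
    have hHl : Measurable fun q : 𝓕 × 𝓤 × (Fin n → ℝ) =>
        H q * lik σ (fun i => G q.1 (designPts ζ q.2 i)) q.2.2 := hH.mul hlik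
    rw [h.lintegral_eq hσ n hH, lintegral_lintegral_swap]
    · refine lintegral_congr fun u => ?_
      have h4 : Measurable fun q : 𝓕 × (Fin n → ℝ) => H (q.1, u, q.2) *
          lik σ (fun i => G q.1 (designPts ζ (u, q.2) i)) q.2 :=
        hHl.comp (measurable_fst.prodMk (measurable_const.prodMk measurable_snd))
      exact lintegral_lintegral_swap h4.aemeasurable
    · have h3 : Measurable fun q : (𝓕 × 𝓤) × (Fin n → ℝ) => H (q.1.1, q.1.2, q.2) *
          lik σ (fun i => G q.1.1 (designPts ζ (q.1.2, q.2) i)) q.2 :=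
        hHl.comp (measurable_fst.fst.prodMk (measurable_fst.snd.prodMk measurable_snd))
      exact h3.lintegral_prod_right'.aemeasurable
  have hR' : Measurable fun q : 𝓕 × 𝓤 × (Fin n → ℝ) => ∫⁻ s, Φ (q.2,
      postMean κ σ (designPts ζ q.2) q.2.2 (w q.2) + postStd κ σ (designPts ζ q.2) (w q.2) * s)
      ∂gaussianReal 0 1 := hR.comp measurable_snd
  refine (hswap _ hL).trans (Eq.trans ?_ (hswap _ hR').symm)
  simp only
  refine lintegral_congr fun u => lintegral_congr fun η => ?_
  have hψ : Measurable fun t => Φ ((u, η), t) := hΦ.comp (measurable_const.prodMk measurable_id)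
  have hlu : Measurable fun φ => lik σ (fun i => G φ (designPts ζ (u, η) i)) η :=
    measurable_lik σ (measurable_field_family h.field (designPts ζ (u, η))) measurable_const
  refine (posterior_fixed_design h.field hσ (designPts ζ (u, η)) (w (u, η)) η hψ).trans ?_
  have hψ2 : Measurable fun s => Φ ((u, η), postMean κ σ (designPts ζ (u, η)) η (w (u, η)) + s) :=
    hψ.comp (measurable_id.const_add _)
  have hmul : Measurable fun s : ℝ => √(postCov κ σ (designPts ζ (u, η)) (w (u, η)) (w (u, η))) * s :=
    measurable_id.const_mul _
  rw [lintegral_const_mul _ hlu, mul_comm, gaussianReal_zero_eq_map, lintegral_map hψ2 hmul]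
  simp only [postStd, evidence]

end IsAdaptive

end Adaptive

end SBOKDE

end

noncomputable section

namespace SBOKDE

/-! ### Differential entropy of Gaussian laws. -/

section Entropy

lemma measurable_gaussianPDF_mean (v : ℝ≥0) (t : ℝ) : Measurable fun m => gaussianPDF m v t :=
  measurable_uncurry_gaussianPDF.comp
    (measurable_id.prodMk (measurable_const.prodMk measurable_const))

lemma continuous_gaussianPDF (m : ℝ) (v : ℝ≥0) : Continuous fun t => gaussianPDF m v t := by
  refine ENNReal.continuous_ofReal.comp ?_
  unfold gaussianPDFReal
  fun_prop

/-- The convolution of two Gaussian laws, at the level of densities; it provides the predictive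
density of a new observation. Testing against indicators gives the identity almost everywhere,
continuity in `t` everywhere. -/
lemma lintegral_gaussianPDF_add_mean {σ : ℝ} (hσ : 0 < σ) (m : ℝ) (v : ℝ≥0) (t : ℝ) :
    ∫⁻ s, gaussianPDF (m + s) (noiseVar σ) t ∂gaussianReal 0 v =
      gaussianPDF m (v + noiseVar σ) t := by
  have hn := noiseVar_ne_zero hσ
  have hadd : v + noiseVar σ ≠ 0 := by simp [hn]
  have hJ : Measurable fun q : ℝ × ℝ => gaussianPDF (m + q.2) (noiseVar σ) q.1 :=
    measurable_uncurry_gaussianPDF.comp ((measurable_snd.const_add _).prodMk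
      (measurable_const.prodMk measurable_fst))
  have c1 : Continuous fun t => ∫⁻ s, gaussianPDF (m + s) (noiseVar σ) t ∂gaussianReal 0 v := by
    refine continuous_lintegral_of_le (C := ENNReal.ofReal (pdfMax σ)) ENNReal.ofReal_ne_top
      (fun t => (measurable_gaussianPDF_mean (noiseVar σ) t).comp (measurable_id.const_add m))
      (fun t s => ENNReal.ofReal_le_ofReal (gaussianPDFReal_le_pdfMax σ _ _))
      fun s => continuous_gaussianPDF _ _
  have hkey : ∀ h : ℝ → ℝ≥0∞, Measurable h →
      ∫⁻ t, h t * ∫⁻ s, gaussianPDF (m + s) (noiseVar σ) t ∂gaussianReal 0 v =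
        ∫⁻ t, h t * gaussianPDF m (v + noiseVar σ) t := by
    intro h hh
    have h1 : ∀ s, ∫⁻ t, h t * gaussianPDF (m + s) (noiseVar σ) t =
        ∫⁻ e, h (m + (s + e)) ∂gaussianReal 0 (noiseVar σ) := fun s => by
      rw [← lintegral_gaussianReal_const_add hn (m + s) hh]
      simp only [add_assoc]
    have h2 : Measurable fun x => h (m + x) := hh.comp (measurable_id.const_add _)
    have h3 : Measurable fun q : ℝ × ℝ => q.1 + q.2 := measurable_fst.add measurable_snd
    calc ∫⁻ t, h t * ∫⁻ s, gaussianPDF (m + s) (noiseVar σ) t ∂gaussianReal 0 v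
        = ∫⁻ t, ∫⁻ s, h t * gaussianPDF (m + s) (noiseVar σ) t ∂gaussianReal 0 v := by
          refine lintegral_congr fun t => ?_
          rw [lintegral_const_mul]
          exact (measurable_gaussianPDF_mean (noiseVar σ) t).comp (measurable_id.const_add m)
      _ = ∫⁻ s, (∫⁻ t, h t * gaussianPDF (m + s) (noiseVar σ) t) ∂gaussianReal 0 v := by
          have : Measurable fun q : ℝ × ℝ => h q.1 * gaussianPDF (m + q.2) (noiseVar σ) q.1 :=
            (hh.comp measurable_fst).mul hJ
          exact lintegral_lintegral_swap this.aemeasurable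
      _ = ∫⁻ s, (∫⁻ e, h (m + (s + e)) ∂gaussianReal 0 (noiseVar σ)) ∂gaussianReal 0 v :=
          lintegral_congr h1
      _ = ∫⁻ x, h (m + x) ∂gaussianReal 0 (v + noiseVar σ) := by
          rw [← add_zero (0 : ℝ), ← gaussianReal_conv_gaussianReal, Measure.conv,
            lintegral_map h2 h3,
            lintegral_prod (fun q : ℝ × ℝ => h (m + (q.1 + q.2))) (h2.comp h3).aemeasurable]
          simp
      _ = _ := lintegral_gaussianReal_const_add hadd m hh
  have hae : (fun t => ∫⁻ s, gaussianPDF (m + s) (noiseVar σ) t ∂gaussianReal 0 v) =ᵐ[volume]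
      fun t => gaussianPDF m (v + noiseVar σ) t := by
    refine ae_eq_of_forall_setLIntegral_eq_of_sigmaFinite c1.measurable
      (measurable_gaussianPDF _ _) fun s hs _ => ?_
    have h := hkey (s.indicator 1) (measurable_one.indicator hs)
    rw [← lintegral_indicator hs, ← lintegral_indicator hs]
    refine Eq.trans (lintegral_congr fun y => ?_) (h.trans (lintegral_congr fun y => ?_))
    all_goals by_cases hy : y ∈ s <;> simp [hy]
  exact congrFun ((Continuous.ae_eq_iff_eq volume c1 (continuous_gaussianPDF _ _)).1 hae) t

/-- Minus the differential entropy of the centered normal law of variance `V`. -/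
def negEntropy (V : ℝ≥0) : ℝ := Real.log (√(2 * Real.pi * V))⁻¹ - 1 / 2

lemma log_gaussianPDFReal {V : ℝ≥0} (hV : V ≠ 0) (m s : ℝ) :
    Real.log (gaussianPDFReal m V s) = Real.log (√(2 * Real.pi * V))⁻¹ - (s - m) ^ 2 / (2 * V) := by
  have hV' : (0 : ℝ) < V := lt_of_le_of_ne V.2 (fun h => hV (NNReal.coe_eq_zero.1 h.symm))
  rw [gaussianPDFReal, Real.log_mul (by positivity) (Real.exp_pos _).ne', Real.log_exp]
  ring

lemma integrable_sq_gaussianReal (V : ℝ≥0) : Integrable (fun s => s ^ 2) (gaussianReal 0 V) :=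
  (memLp_id_gaussianReal' (μ := 0) (v := V) 2 (by simp)).integrable_sq

lemma integral_sq_gaussianReal (V : ℝ≥0) : ∫ s, s ^ 2 ∂gaussianReal 0 V = V := by
  have h := variance_eq_integral (μ := gaussianReal 0 V) (X := fun s => s) measurable_id.aemeasurable
  rw [variance_fun_id_gaussianReal, integral_id_gaussianReal] at h
  simpa using h.symm

lemma integrable_log_gaussianPDFReal {V : ℝ≥0} (hV : V ≠ 0) :
    Integrable (fun s => Real.log (gaussianPDFReal 0 V s)) (gaussianReal 0 V) := by
  simp only [log_gaussianPDFReal hV, sub_zero]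
  exact (integrable_const _).sub ((integrable_sq_gaussianReal V).div_const _)

lemma integral_log_gaussianPDFReal {V : ℝ≥0} (hV : V ≠ 0) :
    ∫ s, Real.log (gaussianPDFReal 0 V s) ∂gaussianReal 0 V = negEntropy V := by
  have hV' : (V : ℝ) ≠ 0 := fun h => hV (NNReal.coe_eq_zero.1 h)
  simp only [log_gaussianPDFReal hV, sub_zero]
  rw [integral_sub (integrable_const _) ((integrable_sq_gaussianReal V).div_const _),
    integral_div, integral_sq_gaussianReal, integral_const, negEntropy]
  simp only [probReal_univ, one_smul, sub_right_inj]
  field_simp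

lemma negEntropy_sub {V V' : ℝ≥0} (hV : V ≠ 0) (hV' : V' ≠ 0) :
    negEntropy V - negEntropy V' = Real.log (V' / V) / 2 := by
  have h1 : (0 : ℝ) < V := lt_of_le_of_ne V.2 (fun h => hV (NNReal.coe_eq_zero.1 h.symm))
  have h2 : (0 : ℝ) < V' := lt_of_le_of_ne V'.2 (fun h => hV' (NNReal.coe_eq_zero.1 h.symm))
  rw [negEntropy, negEntropy, Real.log_inv, Real.log_inv, Real.log_sqrt (by positivity),
    Real.log_sqrt (by positivity), Real.log_mul (by positivity) h1.ne',
    Real.log_mul (by positivity) h2.ne', Real.log_div h2.ne' h1.ne']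
  ring

end Entropy

/-! ### Mutual information as a sum of conditional gains. -/

section InfoGain

variable {Dx Dc : ℕ} {𝓕 : Type*} [MeasurableSpace 𝓕] {ρ : Measure 𝓕} {G : 𝓕 → Pt Dx Dc → ℝ}
  {σ : ℝ}

/-- The posterior variance at the `t`-th point of the design `z`, given the earlier ones. -/
def seqVar (k : Pt Dx Dc → Pt Dx Dc → ℝ) (σ : ℝ) (z : ℕ → Pt Dx Dc) (t : ℕ) : ℝ :=
  postCov k σ (fun i : Fin t => z i) (z t) (z t)

/-- The information gained by the first `n` observations of the design `z`. -/
def infoGain (k : Pt Dx Dc → Pt Dx Dc → ℝ) (σ : ℝ) (z : ℕ → Pt Dx Dc) (n : ℕ) : ℝ :=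
  ∑ t ∈ Finset.range n, Real.log (1 + seqVar k σ z t / σ ^ 2) / 2

/-- Chain rule for densities: given the earlier observations, the next one has the predictive law
with the posterior mean and with variance equal to posterior variance plus noise variance. -/
lemma evidence_snoc (hG : IsGaussField ρ G) (hσ : 0 < σ) (z : ℕ → Pt Dx Dc) (n : ℕ)
    (η : Fin n → ℝ) (t : ℝ) :
    evidence ρ G σ (fun i : Fin (n + 1) => z i) (Fin.snoc (α := fun _ => ℝ) η t) =
      evidence ρ G σ (fun i : Fin n => z i) η *
        gaussianPDF (postMean (covKer ρ G) σ (fun i : Fin n => z i) η (z n))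
          ((seqVar (covKer ρ G) σ z n).toNNReal + noiseVar σ) t := by
  rw [seqVar, ← lintegral_gaussianPDF_add_mean hσ, ← posterior_fixed_design hG hσ _ _ _
    (measurable_gaussianPDF_mean _ _), evidence]
  refine lintegral_congr fun φ => ?_
  rw [mul_comm, ← lik_snoc]
  congr 1
  ext i
  refine Fin.lastCases ?_ (fun j => ?_) i <;> simp

lemma measurable_evidence (hG : IsGaussField ρ G) {n : ℕ} (z : Fin n → Pt Dx Dc) :
    Measurable (evidence ρ G σ z) := by
  have := hG.isProbabilityMeasure
  have hlik : Measurable fun q : 𝓕 × (Fin n → ℝ) => lik σ (fun i => G q.1 (z i)) q.2 :=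
    measurable_lik σ ((measurable_field_family hG z).comp measurable_fst) measurable_snd
  exact hlik.lintegral_prod_left'

/-- The law of the first `n` observations. -/
def obsMarginal (ρ : Measure 𝓕) (G : 𝓕 → Pt Dx Dc → ℝ) (σ : ℝ) {n : ℕ} (z : Fin n → Pt Dx Dc) :
    Measure (Fin n → ℝ) := volume.withDensity (evidence ρ G σ z)

lemma measurable_snoc_add {n : ℕ} {μ : (Fin n → ℝ) → ℝ} (hμ : Measurable μ) :
    Measurable fun q : (Fin n → ℝ) × ℝ =>
      (Fin.snoc (α := fun _ => ℝ) q.1 (μ q.1 + q.2) : Fin (n + 1) → ℝ) :=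
  measurable_fin_snoc.comp (measurable_fst.prodMk ((hμ.comp measurable_fst).add measurable_snd))

lemma measurable_postMean_obs (hG : IsGaussField ρ G) {n : ℕ} (z : Fin n → Pt Dx Dc)
    (w : Pt Dx Dc) : Measurable fun η => postMean (covKer ρ G) σ z η w :=
  measurable_postMean (z := fun _ => z) hG.measurable_covKer (fun _ => measurable_const)
    measurable_id measurable_const

/-- The innovation is independent of the past and its variance does not depend on the observed
values. This is what makes the entropy of the observations a sum of Gaussian entropies. -/
lemma obsMarginal_succ (hG : IsGaussField ρ G) (hσ : 0 < σ) (z : ℕ → Pt Dx Dc) (n : ℕ) :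
    obsMarginal ρ G σ (fun i : Fin (n + 1) => z i) =
      ((obsMarginal ρ G σ (fun i : Fin n => z i)).prod
        (gaussianReal 0 ((seqVar (covKer ρ G) σ z n).toNNReal + noiseVar σ))).map fun q =>
          Fin.snoc (α := fun _ => ℝ) q.1
            (postMean (covKer ρ G) σ (fun i : Fin n => z i) q.1 (z n) + q.2) := by
  have hV : (seqVar (covKer ρ G) σ z n).toNNReal + noiseVar σ ≠ 0 := by
    simp [noiseVar_ne_zero hσ]
  set V := (seqVar (covKer ρ G) σ z n).toNNReal + noiseVar σ
  have hμ := measurable_postMean_obs (σ := σ) hG (fun i : Fin n => z i) (z n)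
  refine Measure.ext_of_lintegral _ fun f hf => ?_
  have hs := measurable_snoc_add hμ
  have hfs : Measurable fun q : (Fin n → ℝ) × ℝ => f (Fin.snoc (α := fun _ => ℝ) q.1
      (postMean (covKer ρ G) σ (fun i : Fin n => z i) q.1 (z n) + q.2)) := hf.comp hs
  rw [lintegral_map hf hs, lintegral_prod _ hfs.aemeasurable, obsMarginal, obsMarginal,
    lintegral_withDensity_eq_lintegral_mul _ (measurable_evidence hG _) hf,
    lintegral_withDensity_eq_lintegral_mul _ (measurable_evidence hG _)
      hfs.lintegral_prod_right', volume_pi,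
    lintegral_pi_fin_succ _ ((measurable_evidence hG _).mul hf), volume_pi]
  refine lintegral_congr fun η => ?_
  have hfη : Measurable fun t : ℝ => f (Fin.snoc (α := fun _ => ℝ) η t) :=
    hf.comp (measurable_fin_snoc_right η)
  simp only [Pi.mul_apply]
  rw [lintegral_gaussianReal_const_add hV _ hfη, ← lintegral_const_mul]
  · refine lintegral_congr fun t => ?_
    rw [evidence_snoc hG hσ]
    ring
  · exact hfη.mul (measurable_gaussianPDF _ _)

lemma isProbabilityMeasure_obsMarginal (hG : IsGaussField ρ G) (hσ : 0 < σ) (z : ℕ → Pt Dx Dc)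
    (n : ℕ) : IsProbabilityMeasure (obsMarginal ρ G σ (fun i : Fin n => z i)) := by
  have := hG.isProbabilityMeasure
  induction n with
  | zero =>
    constructor
    rw [obsMarginal, withDensity_apply _ MeasurableSet.univ, Measure.restrict_univ, volume_pi,
      Measure.pi_of_empty _ (Fin.elim0 : Fin 0 → ℝ), lintegral_dirac]
    simp [evidence, lik]
  | succ n ih =>
    rw [obsMarginal_succ hG hσ]
    exact Measure.isProbabilityMeasure_map (measurable_snoc_add
      (measurable_postMean_obs hG _ _)).aemeasurable

lemma toReal_evidence_snoc_pos (hG : IsGaussField ρ G) (hσ : 0 < σ) {n : ℕ} (z : Fin n → Pt Dx Dc)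
    (η : Fin n → ℝ) : 0 < (evidence ρ G σ z η).toReal := by
  have := hG.isProbabilityMeasure
  exact ENNReal.toReal_pos (evidence_pos hG hσ z η).ne' (evidence_ne_top z η)

/-- Chain rule for entropy, by induction: the log evidence is that of the past plus the log density
of the innovation. Integrability is carried along, so that the divergence can be computed as a
difference of integrals. -/
lemma integrable_log_evidence (hG : IsGaussField ρ G) (hσ : 0 < σ) (z : ℕ → Pt Dx Dc) (n : ℕ) :
    Integrable (fun η => Real.log (evidence ρ G σ (fun i : Fin n => z i) η).toReal)
        (obsMarginal ρ G σ (fun i : Fin n => z i)) ∧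
      ∫ η, Real.log (evidence ρ G σ (fun i : Fin n => z i) η).toReal
        ∂obsMarginal ρ G σ (fun i : Fin n => z i) =
      ∑ t ∈ Finset.range n, negEntropy ((seqVar (covKer ρ G) σ z t).toNNReal + noiseVar σ) := by
  have := hG.isProbabilityMeasure
  induction n with
  | zero =>
    have : ∀ η : Fin 0 → ℝ, Real.log (evidence ρ G σ (fun i : Fin 0 => z i) η).toReal = 0 := by
      intro η
      simp [evidence, lik]
    simp [this]
  | succ n ih =>
    have hV : (seqVar (covKer ρ G) σ z n).toNNReal + noiseVar σ ≠ 0 := by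
      simp [noiseVar_ne_zero hσ]
    have hs := measurable_snoc_add
      (measurable_postMean_obs (σ := σ) hG (fun i : Fin n => z i) (z n))
    have hp := isProbabilityMeasure_obsMarginal hG hσ z n
    rw [obsMarginal_succ hG hσ]
    set V := (seqVar (covKer ρ G) σ z n).toNNReal + noiseVar σ
    set M := obsMarginal ρ G σ (fun i : Fin n => z i)
    have hmeas : Measurable fun η => Real.log
        (evidence ρ G σ (fun i : Fin (n + 1) => z i) η).toReal :=
      (measurable_evidence hG _).ennreal_toReal.log
    have heq : (fun q : (Fin n → ℝ) × ℝ => Real.log (evidence ρ G σ (fun i : Fin (n + 1) => z i)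
        (Fin.snoc (α := fun _ => ℝ) q.1
          (postMean (covKer ρ G) σ (fun i : Fin n => z i) q.1 (z n) + q.2))).toReal) =
        fun q => Real.log (evidence ρ G σ (fun i : Fin n => z i) q.1).toReal +
          Real.log (gaussianPDFReal 0 V q.2) := by
      ext q
      rw [evidence_snoc hG hσ, ENNReal.toReal_mul, toReal_gaussianPDF,
        Real.log_mul (toReal_evidence_snoc_pos hG hσ _ _).ne' (gaussianPDFReal_pos _ _ _ hV).ne',
        log_gaussianPDFReal hV, log_gaussianPDFReal hV]
      simp
    have i1 : Integrable (fun q : (Fin n → ℝ) × ℝ => Real.log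
        (evidence ρ G σ (fun i : Fin n => z i) q.1).toReal) (M.prod (gaussianReal 0 V)) :=
      ih.1.comp_fst _
    have i2 : Integrable (fun q : (Fin n → ℝ) × ℝ => Real.log (gaussianPDFReal 0 V q.2))
        (M.prod (gaussianReal 0 V)) := (integrable_log_gaussianPDFReal hV).comp_snd _
    constructor
    · rw [integrable_map_measure hmeas.aestronglyMeasurable hs.aemeasurable, Function.comp_def, heq]
      exact i1.add i2
    · rw [integral_map hs.aemeasurable hmeas.aestronglyMeasurable, heq, integral_add i1 i2,
        integral_fun_fst (fun η => Real.log (evidence ρ G σ (fun i : Fin n => z i) η).toReal),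
        integral_fun_snd (fun s => Real.log (gaussianPDFReal 0 V s)), ih.2,
        integral_log_gaussianPDFReal hV, Finset.sum_range_succ]
      simp [V]

/-- The mutual information of noisy and true values is the information gain. -/
theorem mutualInfo_obsLaw (hG : IsGaussField ρ G) (hσ : 0 < σ) (z : ℕ → Pt Dx Dc) (n : ℕ) :
    mutualInfo (obsLaw ρ G σ fun i : Fin n => z i) =
      ENNReal.ofReal (infoGain (covKer ρ G) σ z n) := by
  have := hG.isProbabilityMeasure
  set zn : Fin n → Pt Dx Dc := fun i => z i with hzn
  have hpM : IsProbabilityMeasure (obsMarginal ρ G σ zn) := isProbabilityMeasure_obsMarginal hG hσ z n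
  set M := obsMarginal ρ G σ zn with hM
  have hval : Measurable fun φ => fun i => G φ (zn i) := measurable_field_family hG zn
  set θ := ρ.map (fun φ i => G φ (zn i)) with hθ
  have hpθ : IsProbabilityMeasure θ := Measure.isProbabilityMeasure_map hval.aemeasurable
  have hT : Measurable fun q : (Fin n → ℝ) × (Fin n → ℝ) => (q.1 + q.2, q.1) :=
    (measurable_fst.add measurable_snd).prodMk measurable_fst
  have hobs : obsLaw ρ G σ zn = (θ.prod (noiseLaw σ n)).map (fun q => (q.1 + q.2, q.1)) := rfl
  have hlikc : ∀ y : Fin n → ℝ, Measurable fun m => lik σ m y := fun y =>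
    measurable_lik σ measurable_id measurable_const
  have hev : ∀ y, evidence ρ G σ zn y = ∫⁻ m, lik σ m y ∂θ := fun y => by
    rw [evidence, hθ, lintegral_map (hlikc y) hval]
  have hlint : ∀ F : (Fin n → ℝ) × (Fin n → ℝ) → ℝ≥0∞, Measurable F →
      ∫⁻ q, F q ∂obsLaw ρ G σ zn = ∫⁻ y, (∫⁻ m, F (y, m) * lik σ m y ∂θ) := by
    intro F hF
    have hF2 : Measurable fun q : (Fin n → ℝ) × (Fin n → ℝ) => F (q.2, q.1) * lik σ q.1 q.2 :=
      (hF.comp measurable_swap).mul (measurable_lik σ measurable_fst measurable_snd)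
    rw [hobs, lintegral_map hF hT, lintegral_prod (fun q : (Fin n → ℝ) × (Fin n → ℝ) =>
      F (q.1 + q.2, q.1)) (hF.comp hT).aemeasurable]
    have : ∀ m, ∫⁻ e, F (m + e, m) ∂noiseLaw σ n = ∫⁻ y, F (y, m) * lik σ m y := fun m =>
      lintegral_noise_add hσ m (h := fun y => F (y, m)) (hF.comp measurable_prodMk_right)
    simp only
    rw [lintegral_congr this]
    exact lintegral_lintegral_swap hF2.aemeasurable
  have hpO : IsProbabilityMeasure (obsLaw ρ G σ zn) := by
    rw [hobs]
    exact Measure.isProbabilityMeasure_map hT.aemeasurable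
  have hfst : (obsLaw ρ G σ zn).fst = M := by
    refine Measure.ext_of_lintegral _ fun f hf => ?_
    rw [Measure.fst, lintegral_map hf measurable_fst,
      hlint (fun q => f q.1) (hf.comp measurable_fst), hM, obsMarginal,
      lintegral_withDensity_eq_lintegral_mul _ (measurable_evidence hG _) hf]
    refine lintegral_congr fun y => ?_
    simp only
    rw [lintegral_const_mul _ (hlikc y), Pi.mul_apply, hev, mul_comm]
  have hsnd : (obsLaw ρ G σ zn).snd = θ := by
    rw [hobs, Measure.snd, Measure.map_map measurable_snd hT]
    change Measure.map Prod.fst (θ.prod (noiseLaw σ n)) = θ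
    rw [Measure.map_fst_prod]
    simp
  -- By Bayes' rule, likelihood over evidence is the density of the joint law with respect to the
  -- product of its marginals.
  set r : (Fin n → ℝ) × (Fin n → ℝ) → ℝ≥0∞ := fun q => lik σ q.2 q.1 / evidence ρ G σ zn q.1
    with hr
  have hrm : Measurable r := (measurable_lik σ measurable_snd measurable_fst).div
    ((measurable_evidence hG zn).comp measurable_fst)
  have hdens : obsLaw ρ G σ zn = (M.prod θ).withDensity r := by
    refine Measure.ext_of_lintegral _ fun f hf => ?_
    rw [hlint f hf, lintegral_withDensity_eq_lintegral_mul _ hrm hf,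
      lintegral_prod _ (hrm.mul hf).aemeasurable, hM, obsMarginal,
      lintegral_withDensity_eq_lintegral_mul _ (measurable_evidence hG _)
        (hrm.mul hf).lintegral_prod_right']
    refine lintegral_congr fun y => ?_
    have hy : Measurable fun m => (r * f) (y, m) := (hrm.mul hf).comp measurable_prodMk_left
    rw [Pi.mul_apply, ← lintegral_const_mul _ hy]
    refine lintegral_congr fun m => ?_
    rw [Pi.mul_apply, hr, ← mul_assoc, ENNReal.mul_div_cancel (evidence_pos hG hσ zn y).ne'
      (evidence_ne_top zn y), mul_comm]
  have hac : obsLaw ρ G σ zn ≪ M.prod θ := by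
    rw [hdens]
    exact withDensity_absolutelyContinuous _ _
  have hllr : llr (obsLaw ρ G σ zn) (M.prod θ) =ᵐ[obsLaw ρ G σ zn] fun q =>
      Real.log (lik σ q.2 q.1).toReal - Real.log (evidence ρ G σ zn q.1).toReal := by
    have h1 : (obsLaw ρ G σ zn).rnDeriv (M.prod θ) =ᵐ[M.prod θ] r := by
      conv_lhs => rw [hdens]
      exact Measure.rnDeriv_withDensity _ hrm
    filter_upwards [hac.ae_le h1] with q hq
    rw [llr, hq, hr, ENNReal.toReal_div, Real.log_div]
    · exact (ENNReal.toReal_pos (lik_pos hσ _ _).ne' (lik_ne_top _ _ _)).ne'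
    · exact (toReal_evidence_snoc_pos hG hσ _ _).ne'
  -- At an observation `m + e` of true values `m` the likelihood depends on the noise `e` alone, so
  -- its expected logarithm is `n` times the negative entropy of the noise.
  have hlog : ∀ q : (Fin n → ℝ) × (Fin n → ℝ), Real.log (lik σ q.1 (q.1 + q.2)).toReal =
      ∑ i, Real.log (gaussianPDFReal 0 (noiseVar σ) (q.2 i)) := by
    intro q
    rw [lik, ENNReal.toReal_prod, Real.log_prod]
    · refine Finset.sum_congr rfl fun i _ => ?_
      rw [toReal_gaussianPDF, log_gaussianPDFReal (noiseVar_ne_zero hσ),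
        log_gaussianPDFReal (noiseVar_ne_zero hσ)]
      simp
    · intro i _
      rw [toReal_gaussianPDF]
      exact (gaussianPDFReal_pos _ _ _ (noiseVar_ne_zero hσ)).ne'
  have hi0 : ∀ i, Integrable (fun e : Fin n → ℝ => Real.log (gaussianPDFReal 0 (noiseVar σ) (e i)))
      (noiseLaw σ n) := fun i =>
    (measurePreserving_eval (fun _ : Fin n => gaussianReal 0 (noiseVar σ)) i).integrable_comp_of_integrable
      (integrable_log_gaussianPDFReal (noiseVar_ne_zero hσ))
  have hi0' : ∀ i, ∫ e : Fin n → ℝ, Real.log (gaussianPDFReal 0 (noiseVar σ) (e i)) ∂noiseLaw σ n =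
      negEntropy (noiseVar σ) := fun i => by
    have hmp := measurePreserving_eval (fun _ : Fin n => gaussianReal 0 (noiseVar σ)) i
    rw [← integral_log_gaussianPDFReal (noiseVar_ne_zero hσ), ← hmp.map_eq, integral_map
      (measurable_pi_apply i).aemeasurable]
    exact (measurable_gaussianPDFReal _ _).log.aestronglyMeasurable
  have hlikm : Measurable fun q : (Fin n → ℝ) × (Fin n → ℝ) => Real.log (lik σ q.2 q.1).toReal :=
    (measurable_lik σ measurable_snd measurable_fst).ennreal_toReal.log
  have hi1 : Integrable (fun q : (Fin n → ℝ) × (Fin n → ℝ) => Real.log (lik σ q.2 q.1).toReal)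
      (obsLaw ρ G σ zn) := by
    rw [hobs, integrable_map_measure hlikm.aestronglyMeasurable hT.aemeasurable, Function.comp_def]
    simp only [hlog]
    exact integrable_finsetSum _ fun i _ => (hi0 i).comp_snd _
  have hi2 : Integrable (fun q : (Fin n → ℝ) × (Fin n → ℝ) =>
      Real.log (evidence ρ G σ zn q.1).toReal) (obsLaw ρ G σ zn) := by
    have := (integrable_log_evidence hG hσ z n).1
    rw [← hzn, ← hM, ← hfst, Measure.fst, integrable_map_measure _ measurable_fst.aemeasurable] at this
    · exact this
    · exact (measurable_evidence hG _).ennreal_toReal.log.aestronglyMeasurable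
  have hint1 : ∫ q, Real.log (lik σ q.2 q.1).toReal ∂obsLaw ρ G σ zn = n * negEntropy (noiseVar σ) := by
    rw [hobs, integral_map hT.aemeasurable hlikm.aestronglyMeasurable]
    simp only [hlog]
    rw [integral_finsetSum _ fun i _ => (hi0 i).comp_snd _]
    have : ∀ i, ∫ q : (Fin n → ℝ) × (Fin n → ℝ), Real.log (gaussianPDFReal 0 (noiseVar σ) (q.2 i))
        ∂θ.prod (noiseLaw σ n) = negEntropy (noiseVar σ) := fun i => by
      rw [integral_fun_snd (fun e : Fin n → ℝ => Real.log (gaussianPDFReal 0 (noiseVar σ) (e i))),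
        hi0']
      simp
    simp [this]
  have hint2 : ∫ q, Real.log (evidence ρ G σ zn q.1).toReal ∂obsLaw ρ G σ zn =
      ∑ t ∈ Finset.range n, negEntropy ((seqVar (covKer ρ G) σ z t).toNNReal + noiseVar σ) := by
    rw [← (integrable_log_evidence hG hσ z n).2, ← hzn, ← hM, ← hfst, Measure.fst,
      integral_map measurable_fst.aemeasurable
      (measurable_evidence hG _).ennreal_toReal.log.aestronglyMeasurable]
  rw [mutualInfo, hfst, hsnd, InformationTheory.klDiv_of_ac_of_integrable hac
    ((integrable_congr hllr).2 (hi1.sub hi2)), integral_congr_ae hllr, integral_sub hi1 hi2, hint1,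
    hint2]
  congr 1
  simp only [probReal_univ, add_sub_cancel_right]
  rw [infoGain, ← nsmul_eq_mul, ← Finset.card_range n, ← Finset.sum_const, Finset.card_range,
    ← Finset.sum_sub_distrib]
  refine Finset.sum_congr rfl fun t _ => ?_
  have hv : 0 ≤ seqVar (covKer ρ G) σ z t := postCov_self_nonneg hG.covKer_eq_inner hσ _ _
  rw [negEntropy_sub (noiseVar_ne_zero hσ) (by simp [noiseVar_ne_zero hσ]), NNReal.coe_add,
    Real.coe_toNNReal _ hv, coe_noiseVar]
  congr 2
  field_simp
  ring

end InfoGain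

end SBOKDE

end

noncomputable section

namespace SBOKDE

/-! ### Differences of a twice differentiable function in `L¹`. -/

section Translation

variable {d : ℕ}

/-- The fundamental theorem of calculus along the segment needs an integrable derivative, not a
continuous one; if the derivative is not integrable, the right-hand side is infinite. -/
lemma enorm_sub_le_lintegral_fderiv {F : (Fin d → ℝ) → ℝ} (hF : Differentiable ℝ F)
    (x v : Fin d → ℝ) :
    ‖F (x + v) - F x‖ₑ ≤ ∫⁻ t in Set.Ioc (0 : ℝ) 1, ‖fderiv ℝ F (x + t • v) v‖ₑ := by
  by_cases hfin : ∫⁻ t in Set.Ioc (0 : ℝ) 1, ‖fderiv ℝ F (x + t • v) v‖ₑ = ∞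
  · rw [hfin]
    exact le_top
  have hd : ∀ t : ℝ, HasDerivAt (fun t : ℝ => F (x + t • v)) (fderiv ℝ F (x + t • v) v) t := by
    intro t
    have h1 : HasDerivAt (fun t : ℝ => x + t • v) v t := by
      simpa using ((hasDerivAt_id t).smul_const v).const_add x
    exact (hF _).hasFDerivAt.comp_hasDerivAt t h1
  have hmeas : Measurable fun t : ℝ => fderiv ℝ F (x + t • v) v :=
    (measurable_fderiv_apply_const ℝ F v).comp
      (measurable_const.add (measurable_id.smul_const v))
  have hint : IntervalIntegrable (fun t : ℝ => fderiv ℝ F (x + t • v) v) volume 0 1 := by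
    rw [intervalIntegrable_iff_integrableOn_Ioc_of_le zero_le_one]
    exact ⟨hmeas.aestronglyMeasurable, lt_of_le_of_ne le_top hfin⟩
  have h := intervalIntegral.integral_eq_sub_of_hasDerivAt (fun t _ => hd t) hint
  simp only [one_smul, zero_smul, add_zero] at h
  rw [← h, intervalIntegral.integral_of_le zero_le_one]
  exact enorm_integral_le_lintegral_enorm _

lemma lintegral_enorm_translate_sub_le {F : (Fin d → ℝ) → ℝ} (hF : Differentiable ℝ F)
    (v : Fin d → ℝ) :
    ∫⁻ x, ‖F (x + v) - F x‖ₑ ≤ ∫⁻ x, ‖fderiv ℝ F x v‖ₑ := by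
  have hm : Measurable fun x => ‖fderiv ℝ F x v‖ₑ := (measurable_fderiv_apply_const ℝ F v).enorm
  have hm2 : Measurable fun q : (Fin d → ℝ) × ℝ => ‖fderiv ℝ F (q.1 + q.2 • v) v‖ₑ :=
    hm.comp (measurable_fst.add (measurable_snd.smul_const v))
  calc ∫⁻ x, ‖F (x + v) - F x‖ₑ
      ≤ ∫⁻ x, ∫⁻ t in Set.Ioc (0 : ℝ) 1, ‖fderiv ℝ F (x + t • v) v‖ₑ :=
        lintegral_mono fun x => enorm_sub_le_lintegral_fderiv hF x v
    _ = ∫⁻ t in Set.Ioc (0 : ℝ) 1, ∫⁻ x, ‖fderiv ℝ F (x + t • v) v‖ₑ :=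
        lintegral_lintegral_swap hm2.aemeasurable
    _ = ∫⁻ t in Set.Ioc (0 : ℝ) 1, ∫⁻ x, ‖fderiv ℝ F x v‖ₑ :=
        lintegral_congr fun t => lintegral_add_right_eq_self (fun x => ‖fderiv ℝ F x v‖ₑ) (t • v)
    _ = _ := by simp

/-- The sum of the `L¹` norms of the second order partial derivatives. -/
def hessianMass (p : (Fin d → ℝ) → ℝ) : ℝ≥0∞ :=
  ∑ i, ∑ j, ∫⁻ c, ‖fderiv ℝ (fderiv ℝ p) c (Pi.single i 1) (Pi.single j 1)‖ₑ

lemma sum_smul_single (v : Fin d → ℝ) : v = ∑ i, v i • Pi.single i (1 : ℝ) := by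
  ext j
  simp [Finset.sum_apply, Pi.single_apply]

lemma measurable_hessian_apply {p : (Fin d → ℝ) → ℝ} (v w : Fin d → ℝ) :
    Measurable fun c => fderiv ℝ (fderiv ℝ p) c v w :=
  (ContinuousLinearMap.apply ℝ ℝ w).continuous.measurable.comp
    (measurable_fderiv_apply_const ℝ (fderiv ℝ p) v)

lemma lintegral_hessian_le (p : (Fin d → ℝ) → ℝ) (v : Fin d → ℝ) :
    ∫⁻ c, ‖fderiv ℝ (fderiv ℝ p) c v v‖ₑ ≤ ‖v‖ₑ ^ 2 * hessianMass p := by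
  have hpt : ∀ c, ‖fderiv ℝ (fderiv ℝ p) c v v‖ₑ ≤ ∑ i, ∑ j,
      ‖v‖ₑ ^ 2 * ‖fderiv ℝ (fderiv ℝ p) c (Pi.single i 1) (Pi.single j 1)‖ₑ := by
    intro c
    have h1 : fderiv ℝ (fderiv ℝ p) c v v = ∑ i, ∑ j, (v i * v j) *
        fderiv ℝ (fderiv ℝ p) c (Pi.single i 1) (Pi.single j 1) := by
      conv_lhs => rw [sum_smul_single v]
      simp only [map_sum, map_smul, sum_apply, smul_apply,
        smul_eq_mul, Finset.mul_sum]
      rw [Finset.sum_comm]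
      refine Finset.sum_congr rfl fun i _ => Finset.sum_congr rfl fun j _ => by ring
    have hv : ∀ i, ‖v i‖ₑ ≤ ‖v‖ₑ := fun i => by
      rw [← ofReal_norm, ← ofReal_norm]
      exact ENNReal.ofReal_le_ofReal (norm_le_pi_norm v i)
    rw [h1]
    refine (enorm_sum_le _ _).trans (Finset.sum_le_sum fun i _ => (enorm_sum_le _ _).trans
      (Finset.sum_le_sum fun j _ => ?_))
    rw [enorm_mul, enorm_mul, sq]
    gcongr
    · exact hv i
    · exact hv j
  have hm : ∀ i j : Fin d, Measurable fun c =>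
      ‖fderiv ℝ (fderiv ℝ p) c (Pi.single i 1) (Pi.single j 1)‖ₑ := fun i j =>
    (measurable_hessian_apply _ _).enorm
  refine (lintegral_mono hpt).trans (le_of_eq ?_)
  rw [lintegral_finsetSum _ fun i _ => Finset.measurable_fun_sum _ fun j _ => (hm i j).const_mul _,
    hessianMass, Finset.mul_sum]
  refine Finset.sum_congr rfl fun i _ => ?_
  rw [lintegral_finsetSum _ fun j _ => (hm i j).const_mul _, Finset.mul_sum]
  exact Finset.sum_congr rfl fun j _ => lintegral_const_mul _ (hm i j)

/-- A second difference is a first difference of a first difference, so the `L¹` translation bound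
is applied twice; translation invariance of Lebesgue measure removes the shifts. -/
lemma lintegral_second_difference_le {p : (Fin d → ℝ) → ℝ} (hp : Differentiable ℝ p)
    (hp' : Differentiable ℝ (fderiv ℝ p)) (v : Fin d → ℝ) :
    ∫⁻ c, ‖p (c - v) + p (c + v) - 2 * p c‖ₑ ≤ ‖v‖ₑ ^ 2 * hessianMass p := by
  have hsub : Differentiable ℝ fun c => p (c - v) := hp.comp (differentiable_id.sub_const v)
  have hF1 : Differentiable ℝ fun c => p c - p (c - v) := hp.sub hsub
  have hF2 : Differentiable ℝ fun c => fderiv ℝ p c v :=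
    hp'.clm_apply (differentiable_const v)
  have hd1 : ∀ c, fderiv ℝ (fun c => p c - p (c - v)) c v = fderiv ℝ p c v - fderiv ℝ p (c - v) v := by
    intro c
    have h1 : fderiv ℝ (fun c => p (c - v)) c = fderiv ℝ p (c - v) := fderiv_comp_sub v
    rw [fderiv_fun_sub (hp c) (hsub c), h1]
    rfl
  have hd2 : ∀ c, fderiv ℝ (fun c => fderiv ℝ p c v) c v = fderiv ℝ (fderiv ℝ p) c v v := by
    intro c
    rw [fderiv_clm_apply (hp' c) (differentiableAt_const v)]
    simp
  calc ∫⁻ c, ‖p (c - v) + p (c + v) - 2 * p c‖ₑ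
      = ∫⁻ c, ‖(p (c + v) - p (c + v - v)) - (p c - p (c - v))‖ₑ := by
        refine lintegral_congr fun c => ?_
        rw [add_sub_cancel_right]
        congr 1
        ring
    _ ≤ ∫⁻ c, ‖fderiv ℝ (fun c => p c - p (c - v)) c v‖ₑ := lintegral_enorm_translate_sub_le hF1 v
    _ = ∫⁻ c, ‖fderiv ℝ p (c - v + v) v - fderiv ℝ p (c - v) v‖ₑ :=
        lintegral_congr fun c => by rw [hd1, sub_add_cancel]
    _ = ∫⁻ c, ‖fderiv ℝ p (c + v) v - fderiv ℝ p c v‖ₑ :=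
        lintegral_sub_right_eq_self (fun c => ‖fderiv ℝ p (c + v) v - fderiv ℝ p c v‖ₑ) v
    _ ≤ ∫⁻ c, ‖fderiv ℝ (fun c => fderiv ℝ p c v) c v‖ₑ := lintegral_enorm_translate_sub_le hF2 v
    _ = ∫⁻ c, ‖fderiv ℝ (fderiv ℝ p) c v v‖ₑ := lintegral_congr fun c => by rw [hd2]
    _ ≤ _ := lintegral_hessian_le p v

end Translation

/-! ### The context density. -/

namespace IsContextDensity

variable {d : ℕ} {C : Set (Fin d → ℝ)} {p : (Fin d → ℝ) → ℝ}

lemma continuous (hp : IsContextDensity C p) : Continuous p := hp.differentiable.continuous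

lemma integrable (hp : IsContextDensity C p) : Integrable p :=
  Integrable.of_integral_ne_zero (by rw [hp.integral_eq_one]; exact one_ne_zero)

lemma lintegral_eq_one (hp : IsContextDensity C p) : ∫⁻ c, ENNReal.ofReal (p c) = 1 := by
  rw [← ofReal_integral_eq_lintegral_ofReal hp.integrable (Eventually.of_forall hp.nonneg),
    hp.integral_eq_one, ENNReal.ofReal_one]

/-- Near each point off the closed set `C` the density vanishes, and so do its derivatives. On `C`,
which has finite volume, `t ≤ 1 + t²` reduces the `L¹` norm to the assumed square integrability. -/
lemma hessianMass_ne_top (hp : IsContextDensity C p) (hC : IsCompact C) : hessianMass p ≠ ∞ := by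
  refine ENNReal.sum_ne_top.2 fun i _ => ENNReal.sum_ne_top.2 fun j _ => ?_
  have hzero : ∀ c, c ∉ C → fderiv ℝ (fderiv ℝ p) c = 0 := by
    intro c hc
    have hnear : ∀ᶠ x in 𝓝 c, x ∉ C := hC.isClosed.isOpen_compl.eventually_mem hc
    have h1 : fderiv ℝ p =ᶠ[𝓝 c] fun _ => 0 := by
      filter_upwards [hnear.eventually_nhds] with x hx
      have : p =ᶠ[𝓝 x] fun _ => 0 := hx.mono fun y hy => hp.eq_zero y hy
      rw [this.fderiv_eq]
      simp
    rw [h1.fderiv_eq]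
    simp
  have hb : ∀ c, ‖fderiv ℝ (fderiv ℝ p) c (Pi.single i 1) (Pi.single j 1)‖ₑ ≤
      C.indicator 1 c +
        ‖(fderiv ℝ (fderiv ℝ p) c (Pi.single i 1) (Pi.single j 1)) ^ 2‖ₑ := by
    intro c
    by_cases hc : c ∈ C
    · rw [Set.indicator_of_mem hc, Pi.one_apply, enorm_pow]
      set x := ‖fderiv ℝ (fderiv ℝ p) c (Pi.single i 1) (Pi.single j 1)‖ₑ
      rcases le_total x 1 with h | h
      · exact h.trans le_self_add
      · refine le_trans ?_ le_add_self
        calc x = x * 1 := (mul_one _).symm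
          _ ≤ x * x := by gcongr
          _ = x ^ 2 := (sq x).symm
    · simp [hzero c hc]
  refine ne_top_of_le_ne_top ?_ (lintegral_mono hb)
  rw [lintegral_add_left (measurable_one.indicator hC.measurableSet),
    lintegral_indicator_one hC.measurableSet]
  exact ENNReal.add_ne_top.2 ⟨hC.measure_lt_top.ne, (hp.sq_integrable i j).2.ne⟩

lemma setLIntegral_eq (hp : IsContextDensity C p) (hC : MeasurableSet C) (V : (Fin d → ℝ) → ℝ≥0∞) :
    ∫⁻ c in C, ENNReal.ofReal (p c) * V c = ∫⁻ c, ENNReal.ofReal (p c) * V c := by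
  rw [← lintegral_indicator hC]
  refine lintegral_congr fun c => ?_
  by_cases hc : c ∈ C
  · simp [hc]
  · simp [hc, hp.eq_zero c hc]

end IsContextDensity

/-! ### Rescaled kernels and the bias of the density estimate. -/

section Kernel

variable {d : ℕ} {K : (Fin d → ℝ) → ℝ} {h : Fin d → ℝ}

/-- The kernel `K` rescaled by the bandwidths `h`. -/
def scaledKernel (K : (Fin d → ℝ) → ℝ) (h : Fin d → ℝ) (v : Fin d → ℝ) : ℝ :=
  K (fun j => v j / h j) / ∏ j, h j

lemma kde_eq {n : ℕ} (K : (Fin d → ℝ) → ℝ) (h : Fin d → ℝ) (s : Fin n → Fin d → ℝ)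
    (c : Fin d → ℝ) : kde K h s c = (∑ i, scaledKernel K h (c - s i)) / n := by
  simp only [kde, scaledKernel, Pi.sub_apply, Finset.sum_div, div_div, mul_comm]

lemma measurable_scaledKernel (hK : IsKDEKernel K) : Measurable (scaledKernel K h) :=
  (hK.measurable.comp (measurable_pi_lambda _ fun j => (measurable_pi_apply j).div_const _)).div_const
    _

lemma scaledKernel_nonneg (hK : IsKDEKernel K) (hh : ∀ j, 0 < h j) (v : Fin d → ℝ) :
    0 ≤ scaledKernel K h v :=
  div_nonneg (hK.nonneg _) (Finset.prod_nonneg fun j _ => (hh j).le)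

lemma scaledKernel_neg (hK : IsKDEKernel K) (v : Fin d → ℝ) :
    scaledKernel K h (-v) = scaledKernel K h v := by
  rw [scaledKernel, scaledKernel, ← hK.symm]
  congr 2
  ext j
  simp [neg_div]

lemma scaledKernel_le {B : ℝ} (hB : ∀ u, K u ≤ B) (hh : ∀ j, 0 < h j) (v : Fin d → ℝ) :
    scaledKernel K h v ≤ B / ∏ j, h j :=
  div_le_div_of_nonneg_right (hB _) (Finset.prod_nonneg fun j _ => (hh j).le)

/-- The change of variables `v = diag(h) u`, whose determinant cancels the normalization of the
rescaled kernel. -/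
lemma lintegral_mul_scaledKernel (hK : IsKDEKernel K) (hh : ∀ j, 0 < h j)
    {f : (Fin d → ℝ) → ℝ≥0∞} (hf : Measurable f) :
    ∫⁻ v, f v * ENNReal.ofReal (scaledKernel K h v) =
      ∫⁻ u, f (fun j => h j * u j) * ENNReal.ofReal (K u) := by
  have hprod : 0 < ∏ j, h j := Finset.prod_pos fun j _ => hh j
  have hdet : (Matrix.diagonal h).det ≠ 0 := by
    rw [Matrix.det_diagonal]
    exact hprod.ne'
  have hg : Measurable fun v => f v * ENNReal.ofReal (scaledKernel K h v) :=
    hf.mul (measurable_scaledKernel hK).ennreal_ofReal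
  have hl : Measurable (Matrix.toLin' (Matrix.diagonal h)) :=
    (LinearMap.continuous_on_pi _).measurable
  conv_lhs => rw [← Real.smul_map_diagonal_volume_pi hdet]
  rw [lintegral_smul_measure, lintegral_map hg hl, Matrix.det_diagonal, abs_of_pos hprod,
    smul_eq_mul]
  refine (lintegral_const_mul _ (hg.comp hl)).symm.trans ?_
  refine lintegral_congr fun u => ?_
  rw [Function.comp_apply]
  have h1 : Matrix.toLin' (Matrix.diagonal h) u = fun j => h j * u j := by
    ext j
    simp [Matrix.toLin'_apply, Matrix.mulVec_diagonal]
  have h2 : (fun j => h j * u j / h j) = u := by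
    ext j
    rw [mul_div_cancel_left₀ _ (hh j).ne']
  rw [h1, scaledKernel, h2, mul_left_comm, ← ENNReal.ofReal_mul hprod.le,
    mul_div_cancel₀ _ hprod.ne']

lemma IsKDEKernel.lintegral_eq_one (hK : IsKDEKernel K) : ∫⁻ u, ENNReal.ofReal (K u) = 1 := by
  rw [← ofReal_integral_eq_lintegral_ofReal hK.integrable (Eventually.of_forall hK.nonneg),
    hK.integral_eq_one, ENNReal.ofReal_one]

lemma lintegral_scaledKernel (hK : IsKDEKernel K) (hh : ∀ j, 0 < h j) :
    ∫⁻ v, ENNReal.ofReal (scaledKernel K h v) = 1 := by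
  have := lintegral_mul_scaledKernel hK hh (f := fun _ => 1) measurable_const
  simpa [hK.lintegral_eq_one] using this

lemma integrable_scaledKernel (hK : IsKDEKernel K) (hh : ∀ j, 0 < h j) :
    Integrable (scaledKernel K h) := by
  refine ⟨(measurable_scaledKernel hK).aestronglyMeasurable, ?_⟩
  rw [hasFiniteIntegral_iff_ofReal (Eventually.of_forall (scaledKernel_nonneg hK hh)),
    lintegral_scaledKernel hK hh]
  exact ENNReal.one_lt_top

lemma integral_scaledKernel (hK : IsKDEKernel K) (hh : ∀ j, 0 < h j) :
    ∫ v, scaledKernel K h v = 1 := by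
  rw [integral_eq_lintegral_of_nonneg_ae (Eventually.of_forall (scaledKernel_nonneg hK hh))
    (measurable_scaledKernel hK).aestronglyMeasurable, lintegral_scaledKernel hK hh]
  simp

lemma norm_scale_le {H : ℝ} (hh : ∀ j, 0 < h j) (hH : ∀ j, h j ≤ H) (hH0 : 0 ≤ H) (u : Fin d → ℝ) :
    ‖fun j => h j * u j‖ ≤ H * ‖u‖ := by
  refine (pi_norm_le_iff_of_nonneg (by positivity)).2 fun j => ?_
  rw [norm_mul, Real.norm_of_nonneg (hh j).le]
  exact mul_le_mul (hH j) (norm_le_pi_norm u j) (norm_nonneg _) hH0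

/-- The absolute moment of order `q` of the kernel. -/
def absMoment (K : (Fin d → ℝ) → ℝ) (q : ℝ) : ℝ≥0∞ :=
  ∫⁻ u, ENNReal.ofReal (‖u‖ ^ q) * ENNReal.ofReal (K u)

lemma lintegral_rpow_mul_scaledKernel_le (hK : IsKDEKernel K) (hh : ∀ j, 0 < h j) {H : ℝ}
    (hH : ∀ j, h j ≤ H) (hH0 : 0 ≤ H) {q : ℝ} (hq : 0 ≤ q) :
    ∫⁻ v, ENNReal.ofReal (‖v‖ ^ q) * ENNReal.ofReal (scaledKernel K h v) ≤
      ENNReal.ofReal (H ^ q) * absMoment K q := by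
  have hm : Measurable fun u : Fin d → ℝ => ENNReal.ofReal (‖u‖ ^ q) :=
    (measurable_norm.pow_const q).ennreal_ofReal
  rw [lintegral_mul_scaledKernel hK hh hm, absMoment]
  refine le_of_le_of_eq ?_ (lintegral_const_mul _ (hm.mul hK.measurable.ennreal_ofReal))
  refine lintegral_mono fun u => ?_
  rw [← mul_assoc]
  refine mul_le_mul' ?_ le_rfl
  rw [← ENNReal.ofReal_mul (by positivity)]
  refine ENNReal.ofReal_le_ofReal ?_
  rw [← Real.mul_rpow hH0 (norm_nonneg _)]
  exact Real.rpow_le_rpow (norm_nonneg _) (norm_scale_le hh hH hH0 u) hq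

lemma absMoment_ne_top (hK : IsKDEKernel K) {q : ℝ} (hi : Integrable (fun u => ‖u‖ ^ q * K u)) :
    absMoment K q ≠ ∞ := by
  have := hi.2
  rw [hasFiniteIntegral_iff_ofReal (Eventually.of_forall fun u =>
    mul_nonneg (Real.rpow_nonneg (norm_nonneg _) _) (hK.nonneg u))] at this
  rw [absMoment]
  refine ne_of_lt (lt_of_eq_of_lt (lintegral_congr fun u => ?_) this)
  rw [ENNReal.ofReal_mul (Real.rpow_nonneg (norm_nonneg _) _)]

lemma absMoment_two_ne_top (hK : IsKDEKernel K) : absMoment K 2 ≠ ∞ := by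
  obtain ⟨q, hq, hi⟩ := hK.moment
  have h1 := absMoment_ne_top hK hi
  have hle : absMoment K 2 ≤ 1 + absMoment K q := by
    rw [← hK.lintegral_eq_one, absMoment, absMoment,
      ← lintegral_add_left hK.measurable.ennreal_ofReal]
    refine lintegral_mono fun u => ?_
    have : ENNReal.ofReal (‖u‖ ^ (2 : ℝ)) ≤ 1 + ENNReal.ofReal (‖u‖ ^ q) := by
      rw [← ENNReal.ofReal_one, ← ENNReal.ofReal_add zero_le_one (by positivity)]
      refine ENNReal.ofReal_le_ofReal ?_
      rcases le_total ‖u‖ 1 with h | h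
      · have := Real.rpow_le_one (norm_nonneg u) h (by norm_num : (0 : ℝ) ≤ 2)
        have := Real.rpow_nonneg (norm_nonneg u) q
        linarith
      · have := Real.rpow_le_rpow_of_exponent_le h hq.le
        linarith
    calc ENNReal.ofReal (‖u‖ ^ (2 : ℝ)) * ENNReal.ofReal (K u)
        ≤ (1 + ENNReal.ofReal (‖u‖ ^ q)) * ENNReal.ofReal (K u) := by gcongr
      _ = _ := by rw [add_mul, one_mul]
  exact ne_top_of_le_ne_top (ENNReal.add_ne_top.2 ⟨ENNReal.one_ne_top, h1⟩) hle

/-- The density `p` smoothed by the rescaled kernel. -/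
def smoothed (K : (Fin d → ℝ) → ℝ) (h : Fin d → ℝ) (p : (Fin d → ℝ) → ℝ) (c : Fin d → ℝ) : ℝ :=
  ∫ v, scaledKernel K h v * p (c - v)

variable {C : Set (Fin d → ℝ)} {p : (Fin d → ℝ) → ℝ}

lemma smoothed_nonneg (hK : IsKDEKernel K) (hh : ∀ j, 0 < h j) (hp : IsContextDensity C p)
    (c : Fin d → ℝ) : 0 ≤ smoothed K h p c :=
  integral_nonneg fun v => mul_nonneg (scaledKernel_nonneg hK hh v) (hp.nonneg _)

lemma integrable_scaledKernel_mul (hK : IsKDEKernel K) (hh : ∀ j, 0 < h j)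
    (hp : IsContextDensity C p) {φ : (Fin d → ℝ) → Fin d → ℝ}
    (hφ : MeasurePreserving φ) :
    Integrable fun v => scaledKernel K h v * p (φ v) := by
  obtain ⟨B, hB⟩ := hK.bounded
  refine (hφ.integrable_comp_of_integrable hp.integrable).bdd_mul
    (measurable_scaledKernel hK).aestronglyMeasurable (c := B / ∏ j, h j)
    (Eventually.of_forall fun v => ?_)
  rw [Real.norm_of_nonneg (scaledKernel_nonneg hK hh v)]
  exact scaledKernel_le hB hh v

lemma smoothed_eq_integral (c : Fin d → ℝ) :
    smoothed K h p c = ∫ c', scaledKernel K h (c - c') * p c' := by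
  rw [smoothed, ← integral_sub_left_eq_self _ volume c]
  simp

lemma ofReal_smoothed (hK : IsKDEKernel K) (hh : ∀ j, 0 < h j)
    (hp : IsContextDensity C p) (c : Fin d → ℝ) :
    ENNReal.ofReal (smoothed K h p c) =
      ∫⁻ c', ENNReal.ofReal (scaledKernel K h (c - c')) * ENNReal.ofReal (p c') := by
  have h1 := integrable_scaledKernel_mul hK hh hp (φ := fun v => c - v)
    (Measure.measurePreserving_sub_left volume c)
  have h2 : Integrable fun c' => scaledKernel K h (c - c') * p c' := by
    have := (Measure.measurePreserving_sub_left volume c).integrable_comp_of_integrable h1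
    simpa [Function.comp_def] using this
  rw [smoothed_eq_integral, ofReal_integral_eq_lintegral_ofReal h2 (Eventually.of_forall fun c' =>
    mul_nonneg (scaledKernel_nonneg hK hh _) (hp.nonneg _))]
  refine lintegral_congr fun c' => ?_
  rw [ENNReal.ofReal_mul (scaledKernel_nonneg hK hh _)]

lemma measurable_smoothed (hK : IsKDEKernel K) (hp : IsContextDensity C p) :
    Measurable (smoothed K h p) := by
  have : Measurable fun q : (Fin d → ℝ) × (Fin d → ℝ) => scaledKernel K h q.2 * p (q.1 - q.2) :=
    ((measurable_scaledKernel hK).comp measurable_snd).mul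
      (hp.continuous.measurable.comp (measurable_fst.sub measurable_snd))
  exact this.stronglyMeasurable.integral_prod_right.measurable

/-- Symmetry of the kernel cancels the first order term: averaging the shifts by `v` and `-v`
expresses twice the bias as a kernel average of second differences, whose `L¹` norm is `O(‖v‖²)`.
The second absolute moment of the kernel then provides the factor `H²`. -/
lemma lintegral_smoothed_sub_le (hK : IsKDEKernel K) (hh : ∀ j, 0 < h j) (hp : IsContextDensity C p)
    {H : ℝ} (hH : ∀ j, h j ≤ H) (hH0 : 0 ≤ H) :
    ∫⁻ c, ‖smoothed K h p c - p c‖ₑ ≤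
      ENNReal.ofReal (H ^ 2) * (absMoment K 2 * hessianMass p) := by
  have hsymm : ∀ c, smoothed K h p c = ∫ v, scaledKernel K h v * p (c + v) := by
    intro c
    rw [smoothed, ← integral_neg_eq_self]
    simp only [scaledKernel_neg hK, sub_neg_eq_add]
  have hpt : ∀ c, ‖smoothed K h p c - p c‖ₑ ≤ ∫⁻ v, ENNReal.ofReal (scaledKernel K h v) *
      ‖p (c - v) + p (c + v) - 2 * p c‖ₑ := by
    intro c
    have i1 := integrable_scaledKernel_mul hK hh hp (φ := fun v => c - v)
      (Measure.measurePreserving_sub_left volume c)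
    have i2 := integrable_scaledKernel_mul hK hh hp (φ := fun v => c + v)
      (measurePreserving_add_left volume c)
    have i3 : Integrable fun v => scaledKernel K h v * (2 * p c) :=
      (integrable_scaledKernel hK hh).mul_const _
    have h2 : 2 * (smoothed K h p c - p c) =
        ∫ v, scaledKernel K h v * (p (c - v) + p (c + v) - 2 * p c) := by
      calc 2 * (smoothed K h p c - p c) = (∫ v, scaledKernel K h v * p (c - v)) +
            (∫ v, scaledKernel K h v * p (c + v)) - ∫ v, scaledKernel K h v * (2 * p c) := by
            rw [integral_mul_const, integral_scaledKernel hK hh, ← hsymm c]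
            change _ = smoothed K h p c + _ - _
            ring
        _ = _ := by
            rw [← integral_add i1 i2]
            refine (integral_sub (i1.add i2) i3).symm.trans ?_
            refine integral_congr_ae (Eventually.of_forall fun v => ?_)
            simp only [Pi.add_apply]
            ring
    calc ‖smoothed K h p c - p c‖ₑ ≤ ‖2 * (smoothed K h p c - p c)‖ₑ := by
          rw [enorm_mul]
          refine le_mul_of_one_le_left zero_le ?_
          rw [← ofReal_norm]
          norm_num
      _ ≤ _ := by
          rw [h2]
          refine (enorm_integral_le_lintegral_enorm _).trans (le_of_eq (lintegral_congr fun v => ?_))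
          rw [enorm_mul, Real.enorm_of_nonneg (scaledKernel_nonneg hK hh v)]
  have hpm := hp.continuous.measurable
  have hmeas : Measurable fun q : (Fin d → ℝ) × (Fin d → ℝ) =>
      ENNReal.ofReal (scaledKernel K h q.2) * ‖p (q.1 - q.2) + p (q.1 + q.2) - 2 * p q.1‖ₑ :=
    ((measurable_scaledKernel hK).comp measurable_snd).ennreal_ofReal.mul
      (((hpm.comp (measurable_fst.sub measurable_snd)).add
        (hpm.comp (measurable_fst.add measurable_snd))).sub
          ((hpm.comp measurable_fst).const_mul 2)).enorm
  have hdiff : ∀ v : Fin d → ℝ, Measurable fun c => ‖p (c - v) + p (c + v) - 2 * p c‖ₑ := fun v =>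
    (((hpm.comp (measurable_id.sub_const v)).add (hpm.comp (measurable_id.add_const v))).sub
      (hpm.const_mul 2)).enorm
  calc ∫⁻ c, ‖smoothed K h p c - p c‖ₑ
      ≤ ∫⁻ c, ∫⁻ v, ENNReal.ofReal (scaledKernel K h v) *
        ‖p (c - v) + p (c + v) - 2 * p c‖ₑ := lintegral_mono hpt
    _ = ∫⁻ v, ∫⁻ c, ENNReal.ofReal (scaledKernel K h v) *
        ‖p (c - v) + p (c + v) - 2 * p c‖ₑ := lintegral_lintegral_swap hmeas.aemeasurable
    _ = ∫⁻ v, ENNReal.ofReal (scaledKernel K h v) *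
        ∫⁻ c, ‖p (c - v) + p (c + v) - 2 * p c‖ₑ :=
        lintegral_congr fun v => lintegral_const_mul _ (hdiff v)
    _ ≤ ∫⁻ v, hessianMass p *
          (ENNReal.ofReal (‖v‖ ^ (2 : ℝ)) * ENNReal.ofReal (scaledKernel K h v)) := by
        refine lintegral_mono fun v => ?_
        have := lintegral_second_difference_le hp.differentiable hp.differentiable_fderiv v
        calc _ ≤ ENNReal.ofReal (scaledKernel K h v) * (‖v‖ₑ ^ 2 * hessianMass p) := by gcongr
          _ = _ := by
            rw [Real.rpow_two, ENNReal.ofReal_pow (norm_nonneg _), ofReal_norm]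
            ring
    _ = hessianMass p * ∫⁻ v,
          (ENNReal.ofReal (‖v‖ ^ (2 : ℝ)) * ENNReal.ofReal (scaledKernel K h v)) :=
        lintegral_const_mul _ ((measurable_norm.pow_const _).ennreal_ofReal.mul
          (measurable_scaledKernel hK).ennreal_ofReal)
    _ ≤ hessianMass p * (ENNReal.ofReal (H ^ (2 : ℝ)) * absMoment K 2) := by
        gcongr
        exact lintegral_rpow_mul_scaledKernel_le hK hh hH hH0 (by norm_num)
    _ = _ := by
        rw [Real.rpow_two]
        ring

end Kernel

end SBOKDE

end

noncomputable section

namespace SBOKDE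

/-! ### Smoothing weighted by a slowly varying function. -/

section WeightedSmoothing

variable {d : ℕ} {K : (Fin d → ℝ) → ℝ} {h : Fin d → ℝ} {C : Set (Fin d → ℝ)} {p : (Fin d → ℝ) → ℝ}

lemma lintegral_lintegral_scaledKernel_mul (hK : IsKDEKernel K)
    {W : (Fin d → ℝ) → ℝ≥0∞} (hW : Measurable W) {J : (Fin d → ℝ) → ℝ≥0∞} (hJ : Measurable J) :
    ∫⁻ c, ∫⁻ c', ENNReal.ofReal (scaledKernel K h (c - c')) * (W c' * J (c - c')) =
      (∫⁻ c', W c') * ∫⁻ v, J v * ENNReal.ofReal (scaledKernel K h v) := by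
  have hk := (measurable_scaledKernel (h := h) hK).ennreal_ofReal
  have hm : Measurable fun q : (Fin d → ℝ) × (Fin d → ℝ) =>
      ENNReal.ofReal (scaledKernel K h (q.1 - q.2)) * (W q.2 * J (q.1 - q.2)) :=
    (hk.comp (measurable_fst.sub measurable_snd)).mul
      ((hW.comp measurable_snd).mul (hJ.comp (measurable_fst.sub measurable_snd)))
  rw [lintegral_lintegral_swap hm.aemeasurable, ← lintegral_mul_const _ hW]
  refine lintegral_congr fun c' => ?_
  have h1 : ∀ c, ENNReal.ofReal (scaledKernel K h (c - c')) * (W c' * J (c - c')) =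
      W c' * (J (c - c') * ENNReal.ofReal (scaledKernel K h (c - c'))) := fun c => by ring
  have hm' : Measurable fun c => J (c - c') * ENNReal.ofReal (scaledKernel K h (c - c')) :=
    (hJ.comp (measurable_id.sub_const c')).mul (hk.comp (measurable_id.sub_const c'))
  rw [lintegral_congr h1, lintegral_const_mul _ hm']
  congr 1
  exact lintegral_sub_right_eq_self (fun v => J v * ENNReal.ofReal (scaledKernel K h v)) c'

/-- Where `V ≤ s`, the smoothed density exceeds `p` by at most the bias, which is weighted by `s`
only. Where `V > s`, the convolution is expanded: for `‖c - c'‖ ≤ s / L` the value `V c` is at most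
`2 V c'`, so the contribution is at most `2 ∫ p V`, and larger distances fall into the kernel tail
because `V ≤ 1`. The two cases together account for the constant 3. -/
lemma setLIntegral_smoothed_mul_le (hK : IsKDEKernel K) (hh : ∀ j, 0 < h j)
    (hp : IsContextDensity C p) (hC : MeasurableSet C) {V : (Fin d → ℝ) → ℝ} (hV : Measurable V)
    (hV1 : ∀ c ∈ C, V c ≤ 1) {L s : ℝ} (hL : 0 < L)
    (hVL : ∀ c ∈ C, ∀ c' ∈ C, L * ‖c - c'‖ ≤ V c → V c ≤ 2 * V c') :
    ∫⁻ c in C, ENNReal.ofReal (smoothed K h p c) * ENNReal.ofReal (V c) ≤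
      3 * (∫⁻ c in C, ENNReal.ofReal (p c) * ENNReal.ofReal (V c)) +
        ENNReal.ofReal s * (∫⁻ c, ‖smoothed K h p c - p c‖ₑ) +
        ∫⁻ v, {v : Fin d → ℝ | s / L < ‖v‖}.indicator 1 v * ENNReal.ofReal (scaledKernel K h v) := by
  set J : (Fin d → ℝ) → ℝ≥0∞ := {v : Fin d → ℝ | s / L < ‖v‖}.indicator 1 with hJdef
  have hJ : Measurable J :=
    measurable_one.indicator (measurableSet_lt measurable_const measurable_norm)
  have hpm := hp.continuous.measurable.ennreal_ofReal
  have hVm := hV.ennreal_ofReal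
  have hk := (measurable_scaledKernel (h := h) hK).ennreal_ofReal
  have hsm := measurable_smoothed (h := h) hK hp
  have m1 : Measurable fun q : (Fin d → ℝ) × (Fin d → ℝ) =>
      ENNReal.ofReal (scaledKernel K h (q.1 - q.2)) *
        (2 * (ENNReal.ofReal (p q.2) * ENNReal.ofReal (V q.2)) * 1) :=
    (hk.comp (measurable_fst.sub measurable_snd)).mul
      ((((hpm.mul hVm).comp measurable_snd).const_mul 2).mul measurable_const)
  have m2 : Measurable fun q : (Fin d → ℝ) × (Fin d → ℝ) =>
      ENNReal.ofReal (scaledKernel K h (q.1 - q.2)) * (ENNReal.ofReal (p q.2) * J (q.1 - q.2)) :=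
    (hk.comp (measurable_fst.sub measurable_snd)).mul
      ((hpm.comp measurable_snd).mul (hJ.comp (measurable_fst.sub measurable_snd)))
  have hpt : ∀ c ∈ C, ENNReal.ofReal (smoothed K h p c) * ENNReal.ofReal (V c) ≤
      (ENNReal.ofReal (p c) * ENNReal.ofReal (V c) +
        ENNReal.ofReal s * ‖smoothed K h p c - p c‖ₑ) +
      ((∫⁻ c', ENNReal.ofReal (scaledKernel K h (c - c')) *
        (2 * (ENNReal.ofReal (p c') * ENNReal.ofReal (V c')) * 1)) +
        ∫⁻ c', ENNReal.ofReal (scaledKernel K h (c - c')) *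
          (ENNReal.ofReal (p c') * J (c - c'))) := by
    intro c hc
    rcases le_or_gt (V c) s with hs | hs
    · refine le_trans ?_ le_self_add
      have h1 : ENNReal.ofReal (smoothed K h p c) ≤
          ENNReal.ofReal (p c) + ‖smoothed K h p c - p c‖ₑ := by
        rw [← ofReal_norm, ← ENNReal.ofReal_add (hp.nonneg c) (norm_nonneg _)]
        refine ENNReal.ofReal_le_ofReal ?_
        have := Real.le_norm_self (smoothed K h p c - p c)
        linarith
      calc _ ≤ (ENNReal.ofReal (p c) + ‖smoothed K h p c - p c‖ₑ) * ENNReal.ofReal (V c) := by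
            gcongr
        _ = ENNReal.ofReal (p c) * ENNReal.ofReal (V c) +
            ENNReal.ofReal (V c) * ‖smoothed K h p c - p c‖ₑ := by ring
        _ ≤ _ := by gcongr
    · refine le_trans ?_ le_add_self
      have m1c : Measurable fun c' => ENNReal.ofReal (scaledKernel K h (c - c')) *
          (2 * (ENNReal.ofReal (p c') * ENNReal.ofReal (V c')) * 1) :=
        (hk.comp (measurable_id.const_sub c)).mul (((hpm.mul hVm).const_mul 2).mul measurable_const)
      have m0 : Measurable fun c' => ENNReal.ofReal (scaledKernel K h (c - c')) *
          ENNReal.ofReal (p c') := (hk.comp (measurable_id.const_sub c)).mul hpm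
      rw [ofReal_smoothed hK hh hp, ← lintegral_add_left m1c, ← lintegral_mul_const _ m0]
      refine lintegral_mono fun c' => ?_
      simp only
      by_cases hc' : c' ∈ C
      · rw [← mul_add, mul_assoc]
        gcongr
        rw [mul_one, mul_left_comm, ← mul_add]
        gcongr
        by_cases hn : s / L < ‖c - c'‖
        · have : J (c - c') = 1 := by
            rw [hJdef]
            exact Set.indicator_of_mem (by exact hn) _
          rw [this]
          refine le_trans ?_ le_add_self
          rw [← ENNReal.ofReal_one]
          exact ENNReal.ofReal_le_ofReal (hV1 c hc)
        · rw [not_lt, le_div_iff₀ hL, mul_comm] at hn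
          refine le_trans ?_ le_self_add
          have := hVL c hc c' hc' (hn.trans hs.le)
          rw [← ENNReal.ofReal_ofNat, ← ENNReal.ofReal_mul (by norm_num)]
          exact ENNReal.ofReal_le_ofReal this
      · simp [hp.eq_zero c' hc']
  have hA : Measurable fun c => ENNReal.ofReal (p c) * ENNReal.ofReal (V c) := hpm.mul hVm
  have hB' : Measurable fun c => ‖smoothed K h p c - p c‖ₑ := (hsm.sub hp.continuous.measurable).enorm
  have hB : Measurable fun c => ENNReal.ofReal s * ‖smoothed K h p c - p c‖ₑ := hB'.const_mul _
  refine (setLIntegral_mono' hC hpt).trans ?_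
  have hAB : Measurable fun c => ENNReal.ofReal (p c) * ENNReal.ofReal (V c) +
      ENNReal.ofReal s * ‖smoothed K h p c - p c‖ₑ := hA.add hB
  rw [lintegral_add_left hAB, lintegral_add_left hA, lintegral_add_left m1.lintegral_prod_right']
  have e1 : ∫⁻ c in C, ENNReal.ofReal s * ‖smoothed K h p c - p c‖ₑ ≤
      ENNReal.ofReal s * ∫⁻ c, ‖smoothed K h p c - p c‖ₑ := by
    rw [← lintegral_const_mul _ hB']
    exact setLIntegral_le_lintegral _ _
  have e2 : ∫⁻ c in C, ∫⁻ c', ENNReal.ofReal (scaledKernel K h (c - c')) *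
        (2 * (ENNReal.ofReal (p c') * ENNReal.ofReal (V c')) * 1) ≤
      2 * ∫⁻ c in C, ENNReal.ofReal (p c) * ENNReal.ofReal (V c) := by
    refine (setLIntegral_le_lintegral _ _).trans ?_
    rw [lintegral_lintegral_scaledKernel_mul hK (hA.const_mul 2) (J := fun _ => 1)
      measurable_const, lintegral_const_mul _ hA, hp.setLIntegral_eq hC fun c => ENNReal.ofReal (V c)]
    simp only [one_mul]
    rw [lintegral_scaledKernel hK hh, mul_one]
  have e3 : ∫⁻ c in C, ∫⁻ c', ENNReal.ofReal (scaledKernel K h (c - c')) *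
      (ENNReal.ofReal (p c') * J (c - c')) ≤ ∫⁻ v, J v * ENNReal.ofReal (scaledKernel K h v) := by
    refine (setLIntegral_le_lintegral _ _).trans ?_
    rw [lintegral_lintegral_scaledKernel_mul hK hpm hJ, hp.lintegral_eq_one, one_mul]
  calc _ ≤ _ := add_le_add (add_le_add_right e1 _) (add_le_add e2 e3)
    _ = _ := by ring

/-- Markov's inequality for the moment of order `q`. -/
lemma lintegral_tail_le (hK : IsKDEKernel K) (hh : ∀ j, 0 < h j) {H : ℝ}
    (hH : ∀ j, h j ≤ H) (hH0 : 0 ≤ H) {q : ℝ} (hq : 0 ≤ q) {ρ : ℝ} (hρ : 0 < ρ) :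
    ∫⁻ v, {v : Fin d → ℝ | ρ < ‖v‖}.indicator 1 v * ENNReal.ofReal (scaledKernel K h v) ≤
      ENNReal.ofReal ((H / ρ) ^ q) * absMoment K q := by
  have hpt : ∀ v : Fin d → ℝ, {v : Fin d → ℝ | ρ < ‖v‖}.indicator (1 : (Fin d → ℝ) → ℝ≥0∞) v *
      ENNReal.ofReal (scaledKernel K h v) ≤ ENNReal.ofReal (ρ⁻¹ ^ q) *
        (ENNReal.ofReal (‖v‖ ^ q) * ENNReal.ofReal (scaledKernel K h v)) := by
    intro v
    rw [← mul_assoc]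
    gcongr
    by_cases hv : ρ < ‖v‖
    · rw [Set.indicator_of_mem (by exact hv), Pi.one_apply, ← ENNReal.ofReal_one,
        ← ENNReal.ofReal_mul (by positivity), ← Real.mul_rpow (by positivity) (norm_nonneg _)]
      refine ENNReal.ofReal_le_ofReal (Real.one_le_rpow ?_ hq)
      rw [inv_mul_eq_div, one_le_div hρ]
      exact hv.le
    · rw [Set.indicator_of_notMem (by exact hv)]
      exact zero_le
  refine (lintegral_mono hpt).trans ?_
  have hm : Measurable fun v : Fin d → ℝ =>
      ENNReal.ofReal (‖v‖ ^ q) * ENNReal.ofReal (scaledKernel K h v) :=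
    (measurable_norm.pow_const _).ennreal_ofReal.mul (measurable_scaledKernel hK).ennreal_ofReal
  rw [lintegral_const_mul _ hm, div_eq_mul_inv, mul_comm H,
    Real.mul_rpow (by positivity) hH0, ENNReal.ofReal_mul (by positivity), mul_assoc]
  gcongr
  exact lintegral_rpow_mul_scaledKernel_le hK hh hH hH0 hq

end WeightedSmoothing

/-- After `n₀` arbitrary initial terms, `c` is an i.i.d. sequence with density `p`. -/
structure IsSampling {d : ℕ} {Ω : Type*} [MeasurableSpace Ω] (P : Measure Ω) (n₀ : ℕ)
    (p : (Fin d → ℝ) → ℝ) (c : ℕ → Ω → Fin d → ℝ) : Prop where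
  measurable : ∀ n, Measurable (c n)
  law : ∀ n, n₀ ≤ n → P.map (c n) = densityLaw p
  indep : iIndepFun (fun n => c (n₀ + n)) P

/-! ### Stochastic error of the kernel density estimate. -/

namespace IsSampling

variable {d n₀ : ℕ} {Ω : Type*} [MeasurableSpace Ω] {P : Measure Ω}
  {K : (Fin d → ℝ) → ℝ} {h : Fin d → ℝ} {C : Set (Fin d → ℝ)} {p : (Fin d → ℝ) → ℝ}
  {c : ℕ → Ω → Fin d → ℝ}

lemma lintegral_comp (hc : IsSampling P n₀ p c) (hp : IsContextDensity C p) {n : ℕ} (hn : n₀ ≤ n)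
    {f : (Fin d → ℝ) → ℝ≥0∞} (hf : Measurable f) :
    ∫⁻ ω, f (c n ω) ∂P = ∫⁻ x, f x * ENNReal.ofReal (p x) := by
  rw [← lintegral_map hf (hc.measurable n), hc.law n hn, densityLaw,
    lintegral_withDensity_eq_lintegral_mul _ hp.continuous.measurable.ennreal_ofReal hf]
  exact lintegral_congr fun x => mul_comm _ _

/-- The contribution of the `N` first random samples to the kernel density estimate from `n`
samples. -/
def sampledPart (K : (Fin d → ℝ) → ℝ) (h : Fin d → ℝ) (n₀ : ℕ) (c : ℕ → Ω → Fin d → ℝ) (n : ℕ)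
    (ω : Ω) (x : Fin d → ℝ) : ℝ :=
  (∑ i ∈ Finset.range (n - n₀), scaledKernel K h (x - c (n₀ + i) ω)) / n

/-- The contribution of the initial samples to the kernel density estimate from `n` samples. -/
def initialPart (K : (Fin d → ℝ) → ℝ) (h : Fin d → ℝ) (n₀ : ℕ) (c : ℕ → Ω → Fin d → ℝ) (n : ℕ)
    (ω : Ω) (x : Fin d → ℝ) : ℝ :=
  (∑ i ∈ Finset.range n₀, scaledKernel K h (x - c i ω)) / n

lemma kde_eq_add (K : (Fin d → ℝ) → ℝ) (h : Fin d → ℝ) (c : ℕ → Ω → Fin d → ℝ) {n : ℕ}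
    (hn : n₀ ≤ n) (ω : Ω) (x : Fin d → ℝ) :
    kde K h (fun i : Fin n => c i ω) x =
      initialPart K h n₀ c n ω x + sampledPart K h n₀ c n ω x := by
  rw [kde_eq, initialPart, sampledPart, ← add_div,
    Fin.sum_univ_eq_sum_range (fun i => scaledKernel K h (x - c i ω)) n]
  congr 1
  conv_lhs => rw [← Nat.add_sub_of_le hn]
  rw [Finset.sum_range_add]

lemma measurable_kernel_sum (hK : IsKDEKernel K) (hc : ∀ n, Measurable (c n)) (s : Finset ℕ) (m : ℕ)
    (n : ℕ) : Measurable fun q : Ω × (Fin d → ℝ) =>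
      (∑ i ∈ s, scaledKernel K h (q.2 - c (m + i) q.1)) / (n : ℝ) :=
  (Finset.measurable_fun_sum _ fun _ _ => (measurable_scaledKernel hK).comp
    (measurable_snd.sub ((hc _).comp measurable_fst))).div_const _

lemma measurable_sampledPart (hK : IsKDEKernel K) (hc : ∀ n, Measurable (c n)) (n : ℕ) :
    Measurable fun q : Ω × (Fin d → ℝ) => sampledPart K h n₀ c n q.1 q.2 :=
  measurable_kernel_sum hK hc _ _ _

lemma measurable_initialPart (hK : IsKDEKernel K) (hc : ∀ n, Measurable (c n)) (n : ℕ) :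
    Measurable fun q : Ω × (Fin d → ℝ) => initialPart K h n₀ c n q.1 q.2 := by
  have := measurable_kernel_sum (h := h) hK hc (Finset.range n₀) 0 n
  simpa only [zero_add, initialPart] using this

lemma lintegral_initialPart (hK : IsKDEKernel K) (hh : ∀ j, 0 < h j) (n : ℕ) (ω : Ω) :
    ∫⁻ x, ENNReal.ofReal (initialPart K h n₀ c n ω x) = ENNReal.ofReal (n₀ / n) := by
  have h1 : ∀ x, ENNReal.ofReal (initialPart K h n₀ c n ω x) =
      ∑ i ∈ Finset.range n₀, ENNReal.ofReal (n : ℝ)⁻¹ * ENNReal.ofReal (scaledKernel K h (x - c i ω)) := by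
    intro x
    rw [initialPart, div_eq_inv_mul, ENNReal.ofReal_mul (by positivity),
      ENNReal.ofReal_sum_of_nonneg fun i _ => scaledKernel_nonneg hK hh _, Finset.mul_sum]
  have hk := (measurable_scaledKernel (h := h) hK).ennreal_ofReal
  have hm : ∀ i, Measurable fun x => ENNReal.ofReal (scaledKernel K h (x - c i ω)) := fun i =>
    hk.comp (measurable_id.sub_const _)
  rw [lintegral_congr h1, lintegral_finsetSum _ fun i _ => (hm i).const_mul _]
  have h2 : ∀ i, ∫⁻ x, ENNReal.ofReal (n : ℝ)⁻¹ * ENNReal.ofReal (scaledKernel K h (x - c i ω)) =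
      ENNReal.ofReal (n : ℝ)⁻¹ := fun i => by
    rw [lintegral_const_mul _ (hm i),
      lintegral_sub_right_eq_self (fun x => ENNReal.ofReal (scaledKernel K h x)),
      lintegral_scaledKernel hK hh, mul_one]
  rw [Finset.sum_congr rfl fun i _ => h2 i, Finset.sum_const, Finset.card_range, nsmul_eq_mul,
    div_eq_mul_inv, ENNReal.ofReal_mul (by positivity), ENNReal.ofReal_natCast]

/-- The summands are independent with values in `[0, B]`, so the variance of each is at most `B`
times its mean. The factor `smoothed K h p x` is kept: it has integral one over the whole space, and
in `lintegral_kde_mul_le` a weight cancels it. -/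
lemma lintegral_sampledPart_sub_sq_le [IsProbabilityMeasure P] (hc : IsSampling P n₀ p c)
    (hp : IsContextDensity C p)
    (hK : IsKDEKernel K) (hh : ∀ j, 0 < h j) {B : ℝ} (hB : ∀ v, scaledKernel K h v ≤ B) {n : ℕ}
    (hn : 0 < n) (x : Fin d → ℝ) :
    ∫⁻ ω, ENNReal.ofReal ((sampledPart K h n₀ c n ω x -
        ((n - n₀ : ℕ) : ℝ) / n * smoothed K h p x) ^ 2) ∂P ≤
      ENNReal.ofReal (B / n * smoothed K h p x) := by
  set X : ℕ → Ω → ℝ := fun i ω => scaledKernel K h (x - c (n₀ + i) ω) with hX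
  set g := smoothed K h p x with hg
  have hg0 : 0 ≤ g := smoothed_nonneg hK hh hp x
  have hB0 : 0 ≤ B := (scaledKernel_nonneg hK hh 0).trans (hB 0)
  have hkx : Measurable fun y => scaledKernel K h (x - y) :=
    (measurable_scaledKernel hK).comp (measurable_id.const_sub x)
  have hXm : ∀ i, Measurable (X i) := fun i => hkx.comp (hc.measurable _)
  have hX0 : ∀ i ω, 0 ≤ X i ω := fun i ω => scaledKernel_nonneg hK hh _
  have hXB : ∀ i ω, X i ω ≤ B := fun i ω => hB _
  have hXL : ∀ i, MemLp (X i) 2 P := fun i =>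
    MemLp.of_bound (hXm i).aestronglyMeasurable B (Eventually.of_forall fun ω => by
      rw [Real.norm_of_nonneg (hX0 i ω)]
      exact hXB i ω)
  have hEX : ∀ i, ∫ ω, X i ω ∂P = g := by
    intro i
    rw [integral_eq_lintegral_of_nonneg_ae (Eventually.of_forall (hX0 i))
      (hXm i).aestronglyMeasurable,
      hc.lintegral_comp hp (Nat.le_add_right n₀ i) (f := fun y => ENNReal.ofReal (scaledKernel K h (x - y)))
        hkx.ennreal_ofReal, ← ofReal_smoothed hK hh hp, ENNReal.toReal_ofReal hg0]
  have hVX : ∀ i, Var[X i; P] ≤ B * g := by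
    intro i
    refine (variance_le_expectation_sq (hXm i).aestronglyMeasurable).trans ?_
    rw [← hEX i, ← integral_const_mul]
    refine integral_mono (hXL i).integrable_sq (((hXL i).integrable one_le_two).const_mul _) fun ω => ?_
    simp only [Pi.pow_apply]
    rw [sq]
    exact mul_le_mul_of_nonneg_right (hXB i ω) (hX0 i ω)
  set S : Ω → ℝ := fun ω => ∑ i ∈ Finset.range (n - n₀), X i ω with hS
  have hSL : MemLp S 2 P := memLp_finsetSum _ fun i _ => hXL i
  have hES : ∫ ω, S ω ∂P = ((n - n₀ : ℕ) : ℝ) * g := by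
    simp only [hS]
    rw [integral_finsetSum _ fun i _ => (hXL i).integrable one_le_two]
    simp [hEX]
  have hVS : Var[S; P] ≤ ((n - n₀ : ℕ) : ℝ) * (B * g) := by
    have hS' : S = ∑ i ∈ Finset.range (n - n₀), X i := by
      ext ω
      simp [hS]
    rw [hS', IndepFun.variance_sum (fun i _ => hXL i) fun i _ j _ hij =>
      (hc.indep.indepFun hij).comp (φ := fun y => scaledKernel K h (x - y))
        (ψ := fun y => scaledKernel K h (x - y)) hkx hkx]
    refine (Finset.sum_le_sum fun i _ => hVX i).trans (le_of_eq ?_)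
    simp
  have hn' : (0 : ℝ) < n := by exact_mod_cast hn
  have hpt : ∀ ω, ENNReal.ofReal ((sampledPart K h n₀ c n ω x - ((n - n₀ : ℕ) : ℝ) / n * g) ^ 2) =
      ENNReal.ofReal ((n : ℝ)⁻¹ ^ 2) * ENNReal.ofReal ((S ω - ∫ ω, S ω ∂P) ^ 2) := by
    intro ω
    rw [← ENNReal.ofReal_mul (by positivity), hES, ← mul_pow, hS, sampledPart]
    congr 2
    simp only [hX]
    field_simp
  have hSm : Measurable S := Finset.measurable_fun_sum _ fun i _ => hXm i
  rw [lintegral_congr hpt, lintegral_const_mul _ ((hSm.sub_const _).pow_const 2).ennreal_ofReal,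
    ← evariance_eq_lintegral_ofReal, ← hSL.ofReal_variance_eq, ← ENNReal.ofReal_mul (by positivity)]
  refine ENNReal.ofReal_le_ofReal ?_
  have hN : ((n - n₀ : ℕ) : ℝ) ≤ n := by exact_mod_cast Nat.sub_le _ _
  calc (n : ℝ)⁻¹ ^ 2 * Var[S; P] ≤ (n : ℝ)⁻¹ ^ 2 * (n * (B * g)) := by
        gcongr
        exact hVS.trans (by gcongr)
    _ = B / n * g := by field_simp

lemma lintegral_smoothed (hp : IsContextDensity C p)
    (hK : IsKDEKernel K) (hh : ∀ j, 0 < h j) :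
    ∫⁻ x, ENNReal.ofReal (smoothed K h p x) = 1 := by
  have := lintegral_lintegral_scaledKernel_mul (h := h) hK (W := fun x => ENNReal.ofReal (p x))
    hp.continuous.measurable.ennreal_ofReal (J := fun _ => 1) measurable_const
  simp only [one_mul, mul_one, lintegral_scaledKernel hK hh, hp.lintegral_eq_one] at this
  rw [← this]
  exact lintegral_congr fun x => ofReal_smoothed hK hh hp x

/-- The error is the sum of the initial samples, the fluctuation of the random samples, the bias,
and the mass `n₀ / n` missing from the random part. The fluctuation `t` is bounded by `|t| ≤ lam +
t² / lam` and integrated over `C`, which passes from variance to `L¹` with `lam` left free. -/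
lemma lintegral_abs_kde_sub_le [IsProbabilityMeasure P] (hc : IsSampling P n₀ p c)
    (hp : IsContextDensity C p) (hK : IsKDEKernel K) (hh : ∀ j, 0 < h j) {B : ℝ}
    (hB : ∀ v, scaledKernel K h v ≤ B) {n : ℕ} (hn : 0 < n) (hn₀ : n₀ ≤ n) {lam : ℝ} (hlam : 0 < lam) :
    ∫⁻ ω, (∫⁻ x in C, ENNReal.ofReal |kde K h (fun i : Fin n => c i ω) x - p x|) ∂P ≤
      ENNReal.ofReal (2 * (n₀ / n)) + (∫⁻ x, ‖smoothed K h p x - p x‖ₑ) +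
        ENNReal.ofReal lam * volume C + ENNReal.ofReal (B / n / lam) := by
  have hn' : (0 : ℝ) < n := by exact_mod_cast hn
  have hB0 : 0 ≤ B := (scaledKernel_nonneg hK hh 0).trans (hB 0)
  set g := smoothed K h p with hg
  set N : ℝ := ((n - n₀ : ℕ) : ℝ) / n with hN
  have hN1 : N = 1 - n₀ / n := by
    rw [hN, Nat.cast_sub hn₀, sub_div, div_self hn'.ne']
  have hgm : Measurable g := measurable_smoothed hK hp
  have hpt : ∀ ω x, ENNReal.ofReal |kde K h (fun i : Fin n => c i ω) x - p x| ≤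
      ENNReal.ofReal (initialPart K h n₀ c n ω x) + (ENNReal.ofReal (n₀ / n) * ENNReal.ofReal (g x) +
        (‖g x - p x‖ₑ + (ENNReal.ofReal lam +
        ENNReal.ofReal lam⁻¹ * ENNReal.ofReal ((sampledPart K h n₀ c n ω x - N * g x) ^ 2)))) := by
    intro ω x
    have hi : 0 ≤ initialPart K h n₀ c n ω x :=
      div_nonneg (Finset.sum_nonneg fun i _ => scaledKernel_nonneg hK hh _) hn'.le
    have hgx : 0 ≤ g x := smoothed_nonneg hK hh hp x
    rw [kde_eq_add K h c hn₀, ← ofReal_norm, Real.norm_eq_abs, ← ENNReal.ofReal_mul (by positivity),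
      ← ENNReal.ofReal_mul (by positivity), ← ENNReal.ofReal_add (by positivity) (by positivity),
      ← ENNReal.ofReal_add (by positivity) (by positivity),
      ← ENNReal.ofReal_add (by positivity) (by positivity),
      ← ENNReal.ofReal_add (by positivity) (by positivity)]
    refine ENNReal.ofReal_le_ofReal ?_
    set a := sampledPart K h n₀ c n ω x
    set e := initialPart K h n₀ c n ω x
    have h1 : |a - N * g x| ≤ lam + lam⁻¹ * (a - N * g x) ^ 2 := by
      rw [← sq_abs]
      set t := |a - N * g x|
      have : lam⁻¹ * t ^ 2 - t + lam = lam⁻¹ * ((t - lam / 2) ^ 2 + 3 / 4 * lam ^ 2) := by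
        field_simp
        ring
      have : 0 ≤ lam⁻¹ * ((t - lam / 2) ^ 2 + 3 / 4 * lam ^ 2) := by positivity
      linarith
    have h2 : e + a - p x = e + (a - N * g x) + (g x - p x) - n₀ / n * g x := by
      rw [hN1]
      ring
    have h3 : 0 ≤ n₀ / n * g x := by positivity
    rw [h2]
    calc |e + (a - N * g x) + (g x - p x) - n₀ / n * g x|
        ≤ |e + (a - N * g x) + (g x - p x)| + |n₀ / n * g x| := abs_sub _ _
      _ ≤ |e| + |a - N * g x| + |g x - p x| + |n₀ / n * g x| := by
          gcongr
          exact abs_add_three _ _ _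
      _ ≤ _ := by
          rw [abs_of_nonneg hi, abs_of_nonneg h3]
          linarith
  have hsq : Measurable fun q : Ω × (Fin d → ℝ) =>
      ENNReal.ofReal ((sampledPart K h n₀ c n q.1 q.2 - N * g q.2) ^ 2) :=
    (((measurable_sampledPart hK hc.measurable n).sub
      ((hgm.comp measurable_snd).const_mul N)).pow_const 2).ennreal_ofReal
  have hpart : ∀ ω, ∫⁻ x in C, ENNReal.ofReal |kde K h (fun i : Fin n => c i ω) x - p x| ≤
      ENNReal.ofReal (n₀ / n) + (ENNReal.ofReal (n₀ / n) + ((∫⁻ x, ‖g x - p x‖ₑ) +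
        (ENNReal.ofReal lam * volume C + ENNReal.ofReal lam⁻¹ * ∫⁻ x,
          ENNReal.ofReal ((sampledPart K h n₀ c n ω x - N * g x) ^ 2)))) := by
    intro ω
    have m1 : Measurable fun x => ENNReal.ofReal (initialPart K h n₀ c n ω x) :=
      (Measurable.of_uncurry_left (f := initialPart K h n₀ c n)
        (measurable_initialPart hK hc.measurable n)).ennreal_ofReal
    have m2 : Measurable fun x => ENNReal.ofReal (n₀ / n) * ENNReal.ofReal (g x) :=
      hgm.ennreal_ofReal.const_mul _
    have m3 : Measurable fun x => ‖g x - p x‖ₑ := (hgm.sub hp.continuous.measurable).enorm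
    have m4 : Measurable fun x => ENNReal.ofReal ((sampledPart K h n₀ c n ω x - N * g x) ^ 2) :=
      Measurable.of_uncurry_left (f := fun ω x =>
        ENNReal.ofReal ((sampledPart K h n₀ c n ω x - N * g x) ^ 2)) hsq
    refine (lintegral_mono fun x => hpt ω x).trans ?_
    rw [lintegral_add_left m1, lintegral_add_left m2, lintegral_add_left m3,
      lintegral_add_left measurable_const, lintegral_const_mul _ m4, lintegral_const_mul _
        hgm.ennreal_ofReal, setLIntegral_const]
    gcongr
    · exact (setLIntegral_le_lintegral _ _).trans (lintegral_initialPart hK hh n ω).le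
    · calc _ ≤ ENNReal.ofReal (n₀ / n) * 1 := by
            gcongr
            exact (setLIntegral_le_lintegral _ _).trans (lintegral_smoothed hp hK hh).le
        _ = _ := mul_one _
    · exact Measure.restrict_le_self
    · exact Measure.restrict_le_self
  have hvar : ∫⁻ ω, (∫⁻ x, ENNReal.ofReal ((sampledPart K h n₀ c n ω x - N * g x) ^ 2)) ∂P ≤
      ENNReal.ofReal (B / n) := by
    rw [lintegral_lintegral_swap hsq.aemeasurable]
    refine (lintegral_mono fun x => hc.lintegral_sampledPart_sub_sq_le hp hK hh hB hn x).trans ?_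
    have : ∀ x, ENNReal.ofReal (B / n * smoothed K h p x) =
        ENNReal.ofReal (B / n) * ENNReal.ofReal (g x) := fun x =>
      ENNReal.ofReal_mul (by positivity)
    rw [lintegral_congr this, lintegral_const_mul _ hgm.ennreal_ofReal,
      lintegral_smoothed hp hK hh, mul_one]
  refine (lintegral_mono hpart).trans ?_
  simp only [lintegral_add_left measurable_const]
  rw [lintegral_const_mul _ hsq.lintegral_prod_right']
  simp only [lintegral_const, measure_univ, mul_one]
  calc _ ≤ ENNReal.ofReal (n₀ / n) + (ENNReal.ofReal (n₀ / n) + ((∫⁻ x, ‖g x - p x‖ₑ) +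
        (ENNReal.ofReal lam * volume C + ENNReal.ofReal lam⁻¹ * ENNReal.ofReal (B / n)))) := by
        gcongr
    _ = _ := by
        rw [two_mul, ENNReal.ofReal_add (by positivity) (by positivity), ← ENNReal.ofReal_mul
          (by positivity), div_eq_mul_inv (B / n) lam, mul_comm lam⁻¹]
        ring

/-- Let `a` be the sampled part and `g` the smoothed density. Either `a ≤ 2(g + η)`, or the
fluctuation is at least `a - (g + η) ≥ g + η`, and then its square divided by `g + η` controls the
excess. The weight `1 / (g + η)` absorbs the factor `g` of the variance and leaves `B / n` per unit
volume, whereas the plain `L¹` error is of order `√(B / n)`. The function `V` may depend on the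
samples, since only pointwise bounds on it are used. The constant 6 is this 2 times the 3 of
`setLIntegral_smoothed_mul_le`. -/
lemma lintegral_kde_mul_le [IsProbabilityMeasure P] (hc : IsSampling P n₀ p c)
    (hp : IsContextDensity C p)
    (hC : MeasurableSet C)
    (hK : IsKDEKernel K) (hh : ∀ j, 0 < h j) {B : ℝ} (hB : ∀ v, scaledKernel K h v ≤ B) {n : ℕ}
    (hn : 0 < n) (hn₀ : n₀ ≤ n) {η : ℝ} (hη : 0 < η) {V : Ω → (Fin d → ℝ) → ℝ}
    (hV : Measurable (Function.uncurry V)) (hV1 : ∀ᵐ ω ∂P, ∀ x ∈ C, V ω x ≤ 1) {L s : ℝ} (hL : 0 < L)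
    (hVL : ∀ᵐ ω ∂P, ∀ x ∈ C, ∀ x' ∈ C, L * ‖x - x'‖ ≤ V ω x → V ω x ≤ 2 * V ω x') :
    ∫⁻ ω, (∫⁻ x in C, ENNReal.ofReal (kde K h (fun i : Fin n => c i ω) x) *
        ENNReal.ofReal (V ω x)) ∂P ≤
      6 * (∫⁻ ω, (∫⁻ x in C, ENNReal.ofReal (p x) * ENNReal.ofReal (V ω x)) ∂P) +
        ENNReal.ofReal (n₀ / n) + 2 * (ENNReal.ofReal s * (∫⁻ x, ‖smoothed K h p x - p x‖ₑ) +
        ∫⁻ v, {v : Fin d → ℝ | s / L < ‖v‖}.indicator 1 v * ENNReal.ofReal (scaledKernel K h v)) +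
        ENNReal.ofReal (2 * η + B / n) * volume C := by
  have hn' : (0 : ℝ) < n := by exact_mod_cast hn
  have hB0 : 0 ≤ B := (scaledKernel_nonneg hK hh 0).trans (hB 0)
  set g := smoothed K h p with hg
  set N : ℝ := ((n - n₀ : ℕ) : ℝ) / n with hN
  have hN1 : N ≤ 1 := by
    rw [hN, div_le_one hn']
    exact_mod_cast Nat.sub_le _ _
  have hgm : Measurable g := measurable_smoothed hK hp
  have hg0 : ∀ x, 0 ≤ g x := smoothed_nonneg hK hh hp
  set T := ENNReal.ofReal s * (∫⁻ x, ‖g x - p x‖ₑ) +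
    ∫⁻ v, {v : Fin d → ℝ | s / L < ‖v‖}.indicator 1 v * ENNReal.ofReal (scaledKernel K h v) with hT
  have hsq : Measurable fun q : Ω × (Fin d → ℝ) =>
      ENNReal.ofReal ((g q.2 + η)⁻¹) *
        ENNReal.ofReal ((sampledPart K h n₀ c n q.1 q.2 - N * g q.2) ^ 2) :=
    ((hgm.comp measurable_snd).add_const η).inv.ennreal_ofReal.mul
    (((measurable_sampledPart hK hc.measurable n).sub
      ((hgm.comp measurable_snd).const_mul N)).pow_const 2).ennreal_ofReal
  have hpt : ∀ ω, (∀ x ∈ C, V ω x ≤ 1) → ∀ x ∈ C,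
      ENNReal.ofReal (kde K h (fun i : Fin n => c i ω) x) * ENNReal.ofReal (V ω x) ≤
      ENNReal.ofReal (initialPart K h n₀ c n ω x) +
        (2 * (ENNReal.ofReal (g x) * ENNReal.ofReal (V ω x)) + (ENNReal.ofReal (2 * η) +
        ENNReal.ofReal ((g x + η)⁻¹) *
          ENNReal.ofReal ((sampledPart K h n₀ c n ω x - N * g x) ^ 2))) := by
    intro ω hω x hx
    have hi : 0 ≤ initialPart K h n₀ c n ω x :=
      div_nonneg (Finset.sum_nonneg fun i _ => scaledKernel_nonneg hK hh _) hn'.le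
    have hgx := hg0 x
    set a := sampledPart K h n₀ c n ω x
    set e := initialPart K h n₀ c n ω x
    have hb : 0 < g x + η := by positivity
    have ha : a ≤ 2 * (g x + η) + (g x + η)⁻¹ * (a - N * g x) ^ 2 := by
      rcases le_total a (2 * (g x + η)) with h | h
      · have : 0 ≤ (g x + η)⁻¹ * (a - N * g x) ^ 2 := by positivity
        linarith
      · have h1 : N * g x ≤ g x := mul_le_of_le_one_left hgx hN1
        have h2 : a - (g x + η) ≤ a - N * g x := by linarith
        have h3 : (g x + η) * (a - (g x + η)) ≤ (a - N * g x) ^ 2 := by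
          nlinarith
        have h4 : a - (g x + η) ≤ (g x + η)⁻¹ * (a - N * g x) ^ 2 := by
          rw [inv_mul_eq_div, le_div_iff₀ hb]
          linarith
        linarith
    have hV1 : ENNReal.ofReal (V ω x) ≤ 1 := by
      rw [← ENNReal.ofReal_one]
      exact ENNReal.ofReal_le_ofReal (hω x hx)
    rw [kde_eq_add K h c hn₀]
    calc ENNReal.ofReal (e + a) * ENNReal.ofReal (V ω x)
        ≤ (ENNReal.ofReal e + (2 * ENNReal.ofReal (g x) + (ENNReal.ofReal (2 * η) +
            ENNReal.ofReal ((g x + η)⁻¹) * ENNReal.ofReal ((a - N * g x) ^ 2)))) *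
            ENNReal.ofReal (V ω x) := by
          gcongr
          rw [← ENNReal.ofReal_ofNat, ← ENNReal.ofReal_mul (by norm_num),
            ← ENNReal.ofReal_mul (by positivity), ← ENNReal.ofReal_add (by positivity) (by positivity),
            ← ENNReal.ofReal_add (by positivity) (by positivity),
            ← ENNReal.ofReal_add (by positivity) (by positivity)]
          refine ENNReal.ofReal_le_ofReal ?_
          linarith
      _ = ENNReal.ofReal e * ENNReal.ofReal (V ω x) +
            (2 * (ENNReal.ofReal (g x) * ENNReal.ofReal (V ω x)) + (ENNReal.ofReal (2 * η) +
            ENNReal.ofReal ((g x + η)⁻¹) * ENNReal.ofReal ((a - N * g x) ^ 2)) *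
            ENNReal.ofReal (V ω x)) := by ring
      _ ≤ _ := by
          gcongr
          · exact mul_le_of_le_one_right zero_le hV1
          · exact mul_le_of_le_one_right zero_le hV1
  have hVω : ∀ ω, Measurable (V ω) := fun ω => hV.comp measurable_prodMk_left
  have hpart : ∀ᵐ ω ∂P, ∫⁻ x in C, ENNReal.ofReal (kde K h (fun i : Fin n => c i ω) x) *
        ENNReal.ofReal (V ω x) ≤
      ENNReal.ofReal (n₀ / n) + (2 * T + (ENNReal.ofReal (2 * η) * volume C +
        (6 * (∫⁻ x in C, ENNReal.ofReal (p x) * ENNReal.ofReal (V ω x)) +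
        ∫⁻ x in C, ENNReal.ofReal ((g x + η)⁻¹) *
          ENNReal.ofReal ((sampledPart K h n₀ c n ω x - N * g x) ^ 2)))) := by
    filter_upwards [hV1, hVL] with ω hω hωL
    have m1 : Measurable fun x => ENNReal.ofReal (initialPart K h n₀ c n ω x) :=
      (Measurable.of_uncurry_left (f := initialPart K h n₀ c n)
        (measurable_initialPart hK hc.measurable n)).ennreal_ofReal
    have m2 : Measurable fun x => ENNReal.ofReal (g x) * ENNReal.ofReal (V ω x) :=
      hgm.ennreal_ofReal.mul (hVω ω).ennreal_ofReal
    refine (setLIntegral_mono' hC (hpt ω hω)).trans ?_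
    rw [lintegral_add_left m1, lintegral_add_left (m2.const_mul 2), lintegral_add_left measurable_const,
      lintegral_const_mul _ m2, setLIntegral_const]
    have h1 := (setLIntegral_le_lintegral C _).trans (lintegral_initialPart (n₀ := n₀) (c := c) hK hh n ω).le
    have h2 := setLIntegral_smoothed_mul_le (s := s) hK hh hp hC (hVω ω) hω hL hωL
    rw [add_assoc, ← hg, ← hT] at h2
    calc _ ≤ ENNReal.ofReal (n₀ / n) + (2 * (3 * (∫⁻ x in C, ENNReal.ofReal (p x) *
          ENNReal.ofReal (V ω x)) + T) + (ENNReal.ofReal (2 * η) * volume C +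
          ∫⁻ x in C, ENNReal.ofReal ((g x + η)⁻¹) *
          ENNReal.ofReal ((sampledPart K h n₀ c n ω x - N * g x) ^ 2))) := by gcongr
      _ = _ := by ring
  have hvar : ∫⁻ ω, (∫⁻ x in C, ENNReal.ofReal ((g x + η)⁻¹) *
          ENNReal.ofReal ((sampledPart K h n₀ c n ω x - N * g x) ^ 2)) ∂P ≤
      ENNReal.ofReal (B / n) * volume C := by
    rw [lintegral_lintegral_swap hsq.aemeasurable, ← setLIntegral_const]
    refine lintegral_mono fun x => ?_
    have hm : Measurable fun ω => ENNReal.ofReal ((sampledPart K h n₀ c n ω x - N * g x) ^ 2) :=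
      (((Measurable.of_uncurry_right (f := sampledPart K h n₀ c n)
        (measurable_sampledPart hK hc.measurable n)).sub_const _).pow_const 2).ennreal_ofReal
    rw [lintegral_const_mul _ hm]
    have hgx := hg0 x
    calc _ ≤ ENNReal.ofReal ((g x + η)⁻¹) * ENNReal.ofReal (B / n * g x) := by
          gcongr
          exact hc.lintegral_sampledPart_sub_sq_le hp hK hh hB hn x
      _ ≤ ENNReal.ofReal (B / n) := by
          rw [← ENNReal.ofReal_mul (by positivity)]
          refine ENNReal.ofReal_le_ofReal ?_
          rw [inv_mul_eq_div, div_le_iff₀ (by positivity)]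
          exact mul_le_mul_of_nonneg_left (by linarith) (by positivity)
  have hpVm : Measurable fun ω => ∫⁻ x in C, ENNReal.ofReal (p x) * ENNReal.ofReal (V ω x) := by
    have : Measurable fun q : Ω × (Fin d → ℝ) => ENNReal.ofReal (p q.2) * ENNReal.ofReal (V q.1 q.2) :=
      (hp.continuous.measurable.comp measurable_snd).ennreal_ofReal.mul hV.ennreal_ofReal
    exact this.lintegral_prod_right'
  refine (lintegral_mono_ae hpart).trans ?_
  simp only [lintegral_add_left measurable_const]
  rw [lintegral_add_left (hpVm.const_mul 6), lintegral_const_mul _ hpVm]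
  simp only [lintegral_const, measure_univ, mul_one]
  calc _ ≤ ENNReal.ofReal (n₀ / n) + (2 * T + (ENNReal.ofReal (2 * η) * volume C +
        (6 * (∫⁻ ω, (∫⁻ x in C, ENNReal.ofReal (p x) * ENNReal.ofReal (V ω x)) ∂P) +
        ENNReal.ofReal (B / n) * volume C))) := by gcongr
    _ = _ := by
        rw [ENNReal.ofReal_add (by positivity) (by positivity)]
        ring

end IsSampling

end SBOKDE

end

noncomputable section

namespace SBOKDE

/-! ### Rates in terms of the bandwidth scale. -/

section Rates

/-- The bandwidth scale `n ^ (-1 / (4 + d))`. -/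
def bandScale (d n : ℕ) : ℝ := (n : ℝ) ^ (-(1 : ℝ) / (4 + d))

variable {d : ℕ}

lemma bandScale_pos {n : ℕ} (hn : 1 ≤ n) : 0 < bandScale d n :=
  Real.rpow_pos_of_pos (by exact_mod_cast hn) _

lemma bandScale_le_one {n : ℕ} (hn : 1 ≤ n) : bandScale d n ≤ 1 := by
  refine Real.rpow_le_one_of_one_le_of_nonpos (by exact_mod_cast hn) ?_
  exact div_nonpos_of_nonpos_of_nonneg (by norm_num) (by positivity)

lemma bandScale_rpow {n : ℕ} (α : ℝ) : bandScale d n ^ α = (n : ℝ) ^ (-α / (4 + d)) := by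
  rw [bandScale, ← Real.rpow_mul (by positivity)]
  congr 1
  ring

lemma bandScale_pow_eq_inv {n : ℕ} : bandScale d n ^ (4 + d) = (n : ℝ)⁻¹ := by
  rw [← Real.rpow_natCast, bandScale_rpow, ← Real.rpow_neg_one]
  congr 1
  push_cast
  field_simp

/-- `Θ` bounds for a positive sequence hold from the first term on. -/
lemma exists_bandwidth_bounds {h : ℕ → Fin d → ℝ} (hpos : ∀ t, 1 ≤ t → ∀ j, 0 < h t j)
    (hh : ∀ j, (fun t : ℕ => h t j) =Θ[atTop] (fun t : ℕ => (t : ℝ) ^ (-(1 : ℝ) / (4 + d)))) :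
    ∃ c₁ c₂ : ℝ, 0 < c₁ ∧ 0 < c₂ ∧ ∀ n, 1 ≤ n → ∀ j,
      c₁ * bandScale d n ≤ h n j ∧ h n j ≤ c₂ * bandScale d n := by
  have hrat : ∀ {u v : ℕ → ℝ}, (∀ n, 1 ≤ n → 0 < u n) → (∀ n, 1 ≤ n → 0 < v n) →
      u =O[atTop] v → ∃ c : ℝ, ∀ n, 1 ≤ n → u n ≤ c * v n := by
    intro u v hu hv huv
    obtain ⟨c, hc⟩ := huv.bound
    obtain ⟨N, hN⟩ := eventually_atTop.1 hc
    -- The finitely many terms before the asymptotic bound sets in are covered by the sum of their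
    -- ratios.
    refine ⟨c + ∑ i ∈ Finset.range N, |u i / v i|, fun n hn => ?_⟩
    have hs : 0 ≤ ∑ i ∈ Finset.range N, |u i / v i| := Finset.sum_nonneg fun i _ => abs_nonneg _
    rcases le_or_gt N n with h | h
    · have := hN n h
      rw [Real.norm_of_nonneg (hu n hn).le, Real.norm_of_nonneg (hv n hn).le] at this
      have := mul_nonneg hs (hv n hn).le
      linarith
    · have hc0 : 0 ≤ c := by
        have h1 := hN (max N 1) (le_max_left _ _)
        rw [Real.norm_of_nonneg (hu _ (le_max_right _ _)).le,
          Real.norm_of_nonneg (hv _ (le_max_right _ _)).le] at h1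
        have h2 := hu _ (le_max_right N 1)
        have h3 := hv _ (le_max_right N 1)
        by_contra hneg
        have := mul_neg_of_neg_of_pos (not_le.1 hneg) h3
        linarith
      have h1 : |u n / v n| ≤ ∑ i ∈ Finset.range N, |u i / v i| :=
        Finset.single_le_sum (f := fun i => |u i / v i|) (fun i _ => abs_nonneg _)
          (Finset.mem_range.2 h)
      have h2 : u n = u n / v n * v n := by rw [div_mul_cancel₀ _ (hv n hn).ne']
      rw [h2]
      refine mul_le_mul_of_nonneg_right ?_ (hv n hn).le
      have := le_abs_self (u n / v n)
      linarith
  have hb : ∀ n, 1 ≤ n → 0 < bandScale d n := fun n hn => bandScale_pos hn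
  choose c₂ hc₂ using fun j => hrat (fun n hn => hpos n hn j) hb (hh j).1
  choose c₁ hc₁ using fun j => hrat hb (fun n hn => hpos n hn j) (hh j).2
  have habs : ∀ c : Fin d → ℝ, ∀ j, c j ≤ 1 + ∑ i, |c i| := fun c j => by
    have := Finset.single_le_sum (f := fun i => |c i|) (fun i _ => abs_nonneg _) (Finset.mem_univ j)
    have := le_abs_self (c j)
    linarith
  have hpos' : ∀ c : Fin d → ℝ, 0 < 1 + ∑ i, |c i| := fun c => by
    have : 0 ≤ ∑ i, |c i| := Finset.sum_nonneg fun i _ => abs_nonneg _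
    linarith
  refine ⟨(1 + ∑ i, |c₁ i|)⁻¹, 1 + ∑ i, |c₂ i|, inv_pos.2 (hpos' _), hpos' _, fun n hn j => ⟨?_, ?_⟩⟩
  · rw [inv_mul_le_iff₀ (hpos' _)]
    exact (hc₁ j n hn).trans (mul_le_mul_of_nonneg_right (habs _ _) (hpos n hn j).le)
  · exact (hc₂ j n hn).trans (mul_le_mul_of_nonneg_right (habs _ _) (hb n hn).le)

variable {K : (Fin d → ℝ) → ℝ} {h : ℕ → Fin d → ℝ} {C : Set (Fin d → ℝ)} {p : (Fin d → ℝ) → ℝ}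

lemma exists_lintegral_smoothed_sub_le (hK : IsKDEKernel K) (hp : IsContextDensity C p)
    (hC : IsCompact C) {c₂ : ℝ} (hc₂ : 0 < c₂) (hpos : ∀ t, 1 ≤ t → ∀ j, 0 < h t j)
    (hh : ∀ n, 1 ≤ n → ∀ j, h n j ≤ c₂ * bandScale d n) :
    ∃ A : ℝ, 0 ≤ A ∧ ∀ n, 1 ≤ n →
      ∫⁻ x, ‖smoothed K (h n) p x - p x‖ₑ ≤ ENNReal.ofReal (A * bandScale d n ^ 2) := by
  have hfin : absMoment K 2 * hessianMass p ≠ ∞ :=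
    ENNReal.mul_ne_top (absMoment_two_ne_top hK) (hp.hessianMass_ne_top hC)
  refine ⟨c₂ ^ 2 * (absMoment K 2 * hessianMass p).toReal, by positivity, fun n hn => ?_⟩
  have hb := bandScale_pos (d := d) hn
  refine (lintegral_smoothed_sub_le hK (hpos n hn) hp (hh n hn) (by positivity)).trans (le_of_eq ?_)
  rw [← ENNReal.ofReal_toReal hfin, ← ENNReal.ofReal_mul (by positivity)]
  simp only [ENNReal.toReal_ofReal ENNReal.toReal_nonneg]
  congr 1
  ring

/-- With `b` the bandwidth scale, the supremum of the rescaled kernel is of order `b^(-d)`, which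
equals `n b⁴` because `b^(4+d) = 1 / n`. In this form the variance factor of the estimate is `b⁴`.
-/
lemma exists_scaledKernel_le (hK : IsKDEKernel K) {c₁ : ℝ} (hc₁ : 0 < c₁)
    (hh : ∀ n, 1 ≤ n → ∀ j, c₁ * bandScale d n ≤ h n j) :
    ∃ B : ℝ, 0 ≤ B ∧ ∀ n, 1 ≤ n → ∀ v, scaledKernel K (h n) v ≤ n * (B * bandScale d n ^ 4) := by
  obtain ⟨B, hB⟩ := hK.bounded
  have hB0 : 0 ≤ B := (hK.nonneg 0).trans (hB 0)
  refine ⟨B / c₁ ^ d, by positivity, fun n hn v => ?_⟩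
  have hb := bandScale_pos (d := d) hn
  have hn' : (0 : ℝ) < n := by exact_mod_cast hn
  have hprod : (c₁ * bandScale d n) ^ d ≤ ∏ j, h n j := by
    calc (c₁ * bandScale d n) ^ d = ∏ _j : Fin d, c₁ * bandScale d n := by simp
      _ ≤ _ := Finset.prod_le_prod (fun j _ => by positivity) fun j _ => hh n hn j
  have h1 : n * (B / c₁ ^ d * bandScale d n ^ 4) = B / (c₁ * bandScale d n) ^ d := by
    have := bandScale_pow_eq_inv (d := d) (n := n)
    rw [pow_add] at this
    rw [mul_pow]
    field_simp
    rw [mul_assoc, mul_assoc, this]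
    field_simp
  rw [h1, scaledKernel]
  exact div_le_div₀ hB0 (hB _) (by positivity) hprod

/-- The expected `L¹` error of the kernel density estimate is `O (n ^ (-2 / (4 + d)))`. -/
lemma exists_kde_error_rate (n₀ : ℕ) (hK : IsKDEKernel K) (hp : IsContextDensity C p)
    (hC : IsCompact C) (hpos : ∀ t, 1 ≤ t → ∀ j, 0 < h t j)
    (hh : ∀ j, (fun t : ℕ => h t j) =Θ[atTop] (fun t : ℕ => (t : ℝ) ^ (-(1 : ℝ) / (4 + d)))) :
    ∃ A : ℝ, 0 ≤ A ∧ ∀ {Ω : Type*} [MeasurableSpace Ω] {P : Measure Ω} [IsProbabilityMeasure P]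
      {c : ℕ → Ω → Fin d → ℝ}, IsSampling P n₀ p c → ∀ n, 1 ≤ n → n₀ ≤ n →
      ∫⁻ ω, (∫⁻ x in C, ENNReal.ofReal |kde K (h n) (fun i : Fin n => c i ω) x - p x|) ∂P ≤
        ENNReal.ofReal (A * bandScale d n ^ 2) := by
  obtain ⟨c₁, c₂, hc₁, hc₂, hb⟩ := exists_bandwidth_bounds hpos hh
  obtain ⟨A, hA, hbias⟩ := exists_lintegral_smoothed_sub_le hK hp hC hc₂ hpos
    (fun n hn j => (hb n hn j).2)
  obtain ⟨B, hB, hker⟩ := exists_scaledKernel_le (h := h) hK hc₁ (fun n hn j => (hb n hn j).1)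
  refine ⟨2 * n₀ + A + (volume C).toReal + B, by positivity, ?_⟩
  intro Ω _ P _ c hc n hn hn₀
  have hx := bandScale_pos (d := d) hn
  have hx1 := bandScale_le_one (d := d) hn
  have hn' : (0 : ℝ) < n := by exact_mod_cast hn
  -- The choice `lam = b²` balances the two fluctuation terms, of orders `lam` and `b⁴ / lam`.
  refine (hc.lintegral_abs_kde_sub_le hp hK (hpos n hn) (hker n hn) hn hn₀
    (lam := bandScale d n ^ 2) (by positivity)).trans ?_
  have hinv : (n : ℝ)⁻¹ ≤ bandScale d n ^ 2 := by
    rw [← bandScale_pow_eq_inv (d := d)]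
    exact pow_le_pow_of_le_one hx.le hx1 (by omega)
  calc _ ≤ ENNReal.ofReal (2 * n₀ * bandScale d n ^ 2) + ENNReal.ofReal (A * bandScale d n ^ 2) +
        ENNReal.ofReal ((volume C).toReal * bandScale d n ^ 2) +
        ENNReal.ofReal (B * bandScale d n ^ 2) := by
        refine add_le_add (add_le_add (add_le_add ?_ (hbias n hn)) (le_of_eq ?_)) ?_
        · rw [div_eq_mul_inv, ← mul_assoc]
          gcongr
        · rw [mul_comm, ENNReal.ofReal_mul ENNReal.toReal_nonneg,
            ENNReal.ofReal_toReal hC.measure_lt_top.ne]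
        · refine le_of_eq ?_
          field_simp
    _ = _ := by
        rw [← ENNReal.ofReal_add (by positivity) (by positivity),
          ← ENNReal.ofReal_add (by positivity) (by positivity),
          ← ENNReal.ofReal_add (by positivity) (by positivity)]
        congr 1
        ring

/-- Averages against the kernel density estimate of functions which vary little at the scale of
their own size are bounded by averages against the density, up to a remainder of smaller order
than the `L¹` error. -/
lemma exists_kde_mul_rate (n₀ : ℕ) (hK : IsKDEKernel K) (hp : IsContextDensity C p)
    (hC : IsCompact C) (hpos : ∀ t, 1 ≤ t → ∀ j, 0 < h t j)
    (hh : ∀ j, (fun t : ℕ => h t j) =Θ[atTop] (fun t : ℕ => (t : ℝ) ^ (-(1 : ℝ) / (4 + d))))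
    {L : ℝ} (hL : 0 < L) :
    ∃ A ε : ℝ, 0 ≤ A ∧ 0 < ε ∧ ∀ {Ω : Type*} [MeasurableSpace Ω] {P : Measure Ω}
      [IsProbabilityMeasure P] {c : ℕ → Ω → Fin d → ℝ}, IsSampling P n₀ p c → ∀ n, 1 ≤ n → n₀ ≤ n →
      ∀ V : Ω → (Fin d → ℝ) → ℝ, Measurable (Function.uncurry V) →
      (∀ᵐ ω ∂P, ∀ x ∈ C, V ω x ≤ 1) →
      (∀ᵐ ω ∂P, ∀ x ∈ C, ∀ x' ∈ C, L * ‖x - x'‖ ≤ V ω x → V ω x ≤ 2 * V ω x') →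
      ∫⁻ ω, (∫⁻ x in C, ENNReal.ofReal (kde K (h n) (fun i : Fin n => c i ω) x) *
          ENNReal.ofReal (V ω x)) ∂P ≤
        6 * (∫⁻ ω, (∫⁻ x in C, ENNReal.ofReal (p x) * ENNReal.ofReal (V ω x)) ∂P) +
          ENNReal.ofReal (A * bandScale d n ^ (2 + ε)) := by
  obtain ⟨c₁, c₂, hc₁, hc₂, hb⟩ := exists_bandwidth_bounds hpos hh
  obtain ⟨A, hA, hbias⟩ := exists_lintegral_smoothed_sub_le hK hp hC hc₂ hpos
    (fun n hn j => (hb n hn j).2)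
  obtain ⟨B, hB, hker⟩ := exists_scaledKernel_le (h := h) hK hc₁ (fun n hn j => (hb n hn j).1)
  obtain ⟨q, hq, hi⟩ := hK.moment
  have hM := absMoment_ne_top hK hi
  -- The solution of `(1 - ε) q = 2 + ε`. With the threshold `s = b^ε` the kernel tail beyond `s /
  -- L` is of order `(b^(1-ε))^q`, and the bias term of order `b^ε b²`; both equal `b^(2+ε)`. A
  -- moment of order above two makes `ε` positive.
  set ε : ℝ := (q - 2) / (q + 1) with hεdef
  have hq1 : 0 < q + 1 := by linarith
  have hε : 0 < ε := div_pos (by linarith) hq1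
  have hε1 : ε ≤ 1 := by
    rw [hεdef, div_le_one hq1]
    linarith
  have hεq : (1 - ε) * q = 2 + ε := by
    rw [hεdef]
    field_simp
    ring
  set D : ℝ := (c₂ * L) ^ q * (absMoment K q).toReal with hD
  refine ⟨n₀ + 2 * A + 2 * D + (2 + B) * (volume C).toReal, ε, by positivity, hε, ?_⟩
  intro Ω _ P _ c hc n hn hn₀ V hV hV1 hVL
  have hx := bandScale_pos (d := d) hn
  have hx1 := bandScale_le_one (d := d) hn
  have hn' : (0 : ℝ) < n := by exact_mod_cast hn
  set x := bandScale d n with hxdef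
  refine (hc.lintegral_kde_mul_le hp hC.measurableSet hK (hpos n hn) (hker n hn) hn hn₀
    (η := x ^ 4) (s := x ^ ε) (by positivity) hV hV1 hL hVL).trans ?_
  have h4 : x ^ 4 ≤ x ^ (2 + ε) := by
    rw [← Real.rpow_natCast]
    exact Real.rpow_le_rpow_of_exponent_ge hx hx1 (by norm_num; linarith)
  have hinv : (n : ℝ)⁻¹ ≤ x ^ (2 + ε) := by
    rw [← bandScale_pow_eq_inv (d := d)]
    exact (pow_le_pow_of_le_one hx.le hx1 (by omega)).trans h4
  have htail : ∫⁻ v, {v : Fin d → ℝ | x ^ ε / L < ‖v‖}.indicator 1 v *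
      ENNReal.ofReal (scaledKernel K (h n) v) ≤ ENNReal.ofReal (D * x ^ (2 + ε)) := by
    refine (lintegral_tail_le hK (hpos n hn) (fun j => (hb n hn j).2) (by positivity)
      (q := q) (by linarith) (by positivity)).trans (le_of_eq ?_)
    have h1 : (c₂ * x / (x ^ ε / L)) ^ q = (c₂ * L) ^ q * x ^ (2 + ε) := by
      have h2 : c₂ * x / (x ^ ε / L) = (c₂ * L) * x ^ (1 - ε) := by
        rw [Real.rpow_sub hx, Real.rpow_one]
        field_simp
      rw [h2, Real.mul_rpow (by positivity) (by positivity), ← Real.rpow_mul hx.le, hεq]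
    rw [← hxdef, h1, hD, ← ENNReal.ofReal_toReal hM, ← ENNReal.ofReal_mul (by positivity)]
    simp only [ENNReal.toReal_ofReal ENNReal.toReal_nonneg]
    congr 1
    ring
  have hbias' : ENNReal.ofReal (x ^ ε) * ∫⁻ y, ‖smoothed K (h n) p y - p y‖ₑ ≤
      ENNReal.ofReal (A * x ^ (2 + ε)) := by
    calc _ ≤ ENNReal.ofReal (x ^ ε) * ENNReal.ofReal (A * x ^ 2) := by
          gcongr
          exact hbias n hn
      _ = _ := by
          rw [← ENNReal.ofReal_mul (by positivity), Real.rpow_add hx, Real.rpow_two]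
          congr 1
          ring
  rw [add_assoc, add_assoc]
  refine add_le_add le_rfl ?_
  calc _ ≤ ENNReal.ofReal (n₀ * x ^ (2 + ε)) + (ENNReal.ofReal 2 *
        (ENNReal.ofReal (A * x ^ (2 + ε)) + ENNReal.ofReal (D * x ^ (2 + ε))) +
        ENNReal.ofReal ((2 + B) * x ^ (2 + ε)) * ENNReal.ofReal (volume C).toReal) := by
        refine add_le_add ?_ (add_le_add ?_ ?_)
        · rw [div_eq_mul_inv]
          gcongr
        · rw [ENNReal.ofReal_ofNat]
          gcongr
        · rw [ENNReal.ofReal_toReal hC.measure_lt_top.ne]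
          gcongr
          have : n * (B * x ^ 4) / n = B * x ^ 4 := by field_simp
          rw [this, ← add_mul]
          gcongr
    _ = _ := by
        rw [← ENNReal.ofReal_mul (by positivity),
          ← ENNReal.ofReal_add (by positivity) (by positivity),
          ← ENNReal.ofReal_mul (by positivity),
          ← ENNReal.ofReal_add (by positivity) (by positivity),
          ← ENNReal.ofReal_add (by positivity) (by positivity)]
        congr 1
        ring

/-- Induction on `T`: Bernoulli's inequality gives `(1 - 1/(T+1))^(1-α) ≤ 1 - (1-α)/(T+1)`, which is
the required increment. -/
lemma sum_rpow_neg_le {α : ℝ} (h0 : 0 ≤ α) (h1 : α < 1) (T : ℕ) :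
    ∑ n ∈ Finset.range T, ((n : ℝ) + 1) ^ (-α) ≤ (T : ℝ) ^ (1 - α) / (1 - α) := by
  have hα : 0 < 1 - α := by linarith
  induction T with
  | zero =>
    rw [Finset.sum_range_zero, Nat.cast_zero, Real.zero_rpow hα.ne', zero_div]
  | succ T ih =>
    rw [Finset.sum_range_succ]
    have hT : (0 : ℝ) < (T : ℝ) + 1 := by positivity
    have hb : (T : ℝ) ^ (1 - α) ≤ ((T : ℝ) + 1) ^ (1 - α) * (1 - (1 - α) / ((T : ℝ) + 1)) := by
      have h2 : (T : ℝ) = ((T : ℝ) + 1) * (1 + -(1 / ((T : ℝ) + 1))) := by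
        field_simp
        ring
      have h3 : -1 ≤ -(1 / ((T : ℝ) + 1)) := by
        rw [neg_le_neg_iff, div_le_one hT]
        linarith [(Nat.cast_nonneg T : (0 : ℝ) ≤ T)]
      have h4 := rpow_one_add_le_one_add_mul_self h3 hα.le (by linarith)
      conv_lhs => rw [h2]
      rw [Real.mul_rpow hT.le (by linarith)]
      refine mul_le_mul_of_nonneg_left (h4.trans (le_of_eq ?_)) (by positivity)
      ring
    have h5 : ((T : ℝ) + 1) ^ (1 - α) = ((T : ℝ) + 1) ^ (-α) * ((T : ℝ) + 1) := by
      rw [sub_eq_neg_add, Real.rpow_add hT, Real.rpow_one]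
    have h6 : (T : ℝ) ^ (1 - α) / (1 - α) ≤
        ((T : ℝ) + 1) ^ (1 - α) / (1 - α) - ((T : ℝ) + 1) ^ (-α) := by
      rw [div_le_iff₀ hα, sub_mul, div_mul_cancel₀ _ hα.ne']
      refine hb.trans (le_of_eq ?_)
      rw [h5]
      field_simp
    push_cast
    linarith

/-- Here `1 - α = (2 + d)/(4 + d)`, so the constant `1/(1 - α)` is at most 2; this is the factor 2
in front of `C₁` in `regretBound`. -/
lemma sum_bandScale_sq_le (d T : ℕ) :
    ∑ n ∈ Finset.Ico 1 T, bandScale d n ^ 2 ≤ 2 * (T : ℝ) ^ ((2 + d : ℝ) / (4 + d)) := by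
  have h4 : (0 : ℝ) < 4 + d := by positivity
  have h1 : ∑ n ∈ Finset.Ico 1 T, bandScale d n ^ 2 ≤
      ∑ n ∈ Finset.range T, ((n : ℝ) + 1) ^ (-((2 : ℝ) / (4 + d))) := by
    rw [Finset.sum_Ico_eq_sum_range]
    refine (Finset.sum_le_sum_of_subset_of_nonneg (Finset.range_mono (Nat.sub_le T 1))
      fun n _ _ => by positivity).trans (Finset.sum_le_sum fun n _ => ?_)
    rw [← Real.rpow_two, bandScale_rpow]
    push_cast
    rw [add_comm, neg_div]
  refine h1.trans ((sum_rpow_neg_le (by positivity) ?_ T).trans ?_)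
  · rw [div_lt_one h4]
    have : (0 : ℝ) ≤ d := Nat.cast_nonneg d
    linarith
  · have h5 : 1 - (2 : ℝ) / (4 + d) = (2 + d) / (4 + d) := by
      field_simp
      ring
    rw [h5, div_eq_mul_inv, mul_comm]
    gcongr
    rw [inv_div, div_le_iff₀ (by positivity)]
    have : (0 : ℝ) ≤ d := Nat.cast_nonneg d
    linarith

end Rates

end SBOKDE

end

noncomputable section

namespace SBOKDE

/-! ### Posterior variances and the maximal information gain. -/

section GainBounds

variable {Dx Dc : ℕ} {𝓕 : Type*} [MeasurableSpace 𝓕] {ρ : Measure 𝓕} {G : 𝓕 → Pt Dx Dc → ℝ}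
  {σ : ℝ} {Z : Set (Pt Dx Dc)}

lemma seqVar_nonneg (hG : IsGaussField ρ G) (hσ : 0 < σ) (z : ℕ → Pt Dx Dc) (t : ℕ) :
    0 ≤ seqVar (covKer ρ G) σ z t := postCov_self_nonneg hG.covKer_eq_inner hσ _ _

lemma seqVar_le (hG : IsGaussField ρ G) (hσ : 0 < σ) (z : ℕ → Pt Dx Dc) (t : ℕ) :
    seqVar (covKer ρ G) σ z t ≤ covKer ρ G (z t) (z t) := by
  rw [← hG.norm_feature_sq]
  exact postCov_self_le hG.covKer_eq_inner hσ _ _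

lemma infoGain_le_sum_seqVar (hG : IsGaussField ρ G) (hσ : 0 < σ) (z : ℕ → Pt Dx Dc) (T : ℕ) :
    infoGain (covKer ρ G) σ z T ≤ (∑ t ∈ Finset.range T, seqVar (covKer ρ G) σ z t) / (2 * σ ^ 2) := by
  rw [infoGain, Finset.sum_div]
  refine Finset.sum_le_sum fun t _ => ?_
  have hv := seqVar_nonneg hG hσ z t
  have h1 : 0 ≤ seqVar (covKer ρ G) σ z t / σ ^ 2 := by positivity
  have h2 := Real.log_le_sub_one_of_pos (x := 1 + seqVar (covKer ρ G) σ z t / σ ^ 2) (by linarith)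
  rw [mul_comm, ← div_div]
  linarith

/-- With `x = v / σ²` one has `log(1 + x) ≥ x / (1 + x) = v / (σ² + v) ≥ v / (σ² + 1)`. The last
step uses `v ≤ 1`, that is, the normalization of the kernel. -/
lemma sum_seqVar_le_infoGain (hG : IsGaussField ρ G) (hσ : 0 < σ)
    (hk : ∀ w ∈ Z, covKer ρ G w w ≤ 1) {z : ℕ → Pt Dx Dc} (hz : ∀ i, z i ∈ Z) (T : ℕ) :
    ∑ t ∈ Finset.range T, seqVar (covKer ρ G) σ z t ≤
      2 * (σ ^ 2 + 1) * infoGain (covKer ρ G) σ z T := by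
  rw [infoGain, Finset.mul_sum]
  refine Finset.sum_le_sum fun t _ => ?_
  have hv := seqVar_nonneg hG hσ z t
  have hv1 := (seqVar_le hG hσ z t).trans (hk _ (hz t))
  set v := seqVar (covKer ρ G) σ z t
  have hpos : 0 < 1 + v / σ ^ 2 := by positivity
  have h1 := Real.one_sub_inv_le_log_of_pos hpos
  have h2 : 1 - (1 + v / σ ^ 2)⁻¹ = v / (σ ^ 2 + v) := by
    field_simp
    ring
  have h3 : v / (σ ^ 2 + 1) ≤ v / (σ ^ 2 + v) := by gcongr
  have h4 : v / (σ ^ 2 + 1) ≤ Real.log (1 + v / σ ^ 2) := by linarith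
  rw [div_le_iff₀ (by positivity)] at h4
  linarith

lemma iSup_mutualInfo_le (hG : IsGaussField ρ G) (hσ : 0 < σ) (T : ℕ) {S : ℝ}
    (hS : ∀ z : ℕ → Pt Dx Dc, (∀ i, z i ∈ Z) →
      ∑ t ∈ Finset.range T, seqVar (covKer ρ G) σ z t ≤ S) :
    ⨆ z : Fin T → Z, mutualInfo (obsLaw ρ G σ fun i => (z i : Pt Dx Dc)) ≤
      ENNReal.ofReal (S / (2 * σ ^ 2)) := by
  refine iSup_le fun z => ?_
  -- The chain rule is stated for infinite designs, so a finite design is continued by a constant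
  -- point of `Z`. If `Z` is empty, the only design is the empty one with `T = 0`, and any sequence
  -- will do.
  rcases isEmpty_or_nonempty Z with hZ | ⟨⟨z₀⟩⟩
  · rcases Nat.eq_zero_or_pos T with rfl | hT
    · have h0 := mutualInfo_obsLaw (σ := σ) hG hσ (fun _ => 0) 0
      have h1 : (fun i : Fin 0 => ((z i : Z) : Pt Dx Dc)) = fun _ => 0 := Subsingleton.elim _ _
      rw [h1, h0]
      simp [infoGain]
    · exact hZ.elim (z ⟨0, hT⟩)
  · set z' : ℕ → Pt Dx Dc := fun i => if h : i < T then z ⟨i, h⟩ else z₀ with hz'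
    have h1 : (fun i : Fin T => ((z i : Z) : Pt Dx Dc)) = fun i : Fin T => z' i := by
      ext1 i
      simp [hz']
    have hmem : ∀ i, z' i ∈ Z := by
      intro i
      simp only [hz']
      split_ifs
      · exact (z _).2
      · exact z₀.2
    rw [h1, mutualInfo_obsLaw hG hσ z' T]
    refine ENNReal.ofReal_le_ofReal ((infoGain_le_sum_seqVar hG hσ z' T).trans ?_)
    gcongr
    exact hS z' hmem

lemma maxInfoGain_le (hG : IsGaussField ρ G) (hσ : 0 < σ) (T : ℕ) {S : ℝ} (hS0 : 0 ≤ S)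
    (hS : ∀ z : ℕ → Pt Dx Dc, (∀ i, z i ∈ Z) →
      ∑ t ∈ Finset.range T, seqVar (covKer ρ G) σ z t ≤ S) :
    maxInfoGain ρ Z G σ T ≤ S / (2 * σ ^ 2) :=
  ENNReal.toReal_le_of_le_ofReal (by positivity) (iSup_mutualInfo_le hG hσ T hS)

/-- Finiteness of the supremum has to be established first: `maxInfoGain` is a `toReal`, which would
be zero at infinity. -/
lemma infoGain_le_maxInfoGain (hG : IsGaussField ρ G) (hσ : 0 < σ)
    (hk : ∀ w ∈ Z, covKer ρ G w w ≤ 1) {z : ℕ → Pt Dx Dc} (hz : ∀ i, z i ∈ Z) (T : ℕ) :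
    infoGain (covKer ρ G) σ z T ≤ maxInfoGain ρ Z G σ T := by
  have hfin : ⨆ z : Fin T → Z, mutualInfo (obsLaw ρ G σ fun i => (z i : Pt Dx Dc)) ≠ ∞ := by
    refine ne_top_of_le_ne_top ENNReal.ofReal_ne_top (iSup_mutualInfo_le hG hσ T (S := T) ?_)
    intro z hz
    refine (Finset.sum_le_sum fun t _ => (seqVar_le hG hσ z t).trans (hk _ (hz t))).trans ?_
    simp
  have h1 := le_iSup (fun z : Fin T → Z => mutualInfo (obsLaw ρ G σ fun i => (z i : Pt Dx Dc)))
    fun i => ⟨z i, hz i⟩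
  simp only at h1
  rw [mutualInfo_obsLaw hG hσ z T] at h1
  exact (ENNReal.ofReal_le_iff_le_toReal hfin).1 h1

/-- The total posterior variance of a design is at most `2 (σ² + 1)` times the maximal information
gain. -/
lemma sum_seqVar_le_maxInfoGain (hG : IsGaussField ρ G) (hσ : 0 < σ)
    (hk : ∀ w ∈ Z, covKer ρ G w w ≤ 1) {z : ℕ → Pt Dx Dc} (hz : ∀ i, z i ∈ Z) (T : ℕ) :
    ∑ t ∈ Finset.range T, seqVar (covKer ρ G) σ z t ≤
      2 * (σ ^ 2 + 1) * maxInfoGain ρ Z G σ T :=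
  (sum_seqVar_le_infoGain hG hσ hk hz T).trans
    (mul_le_mul_of_nonneg_left (infoGain_le_maxInfoGain hG hσ hk hz T) (by positivity))

/-- The cube of side `r / m` containing a point of `[0, r]^D`. -/
def gridCell (r : ℝ) (m : ℕ) (z : Pt Dx Dc) (i : Fin Dx ⊕ Fin Dc) : Fin (m + 1) :=
  ⟨min ⌊Sum.elim z.1 z.2 i * m / r⌋₊ m, by omega⟩

/-- Equal floors mean that the rescaled coordinates differ by at most one. Inside the cube the
truncation at `m` is inactive; the extra index `m` is attained only on the face where the coordinate
equals `r`. -/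
lemma norm_sub_le_of_gridCell_eq {r : ℝ} (hr : 0 < r) {m : ℕ} (hm : 0 < m) {z w : Pt Dx Dc}
    (hz : ∀ i, Sum.elim z.1 z.2 i ∈ Set.Icc 0 r) (hw : ∀ i, Sum.elim w.1 w.2 i ∈ Set.Icc 0 r)
    (h : gridCell r m z = gridCell r m w) : ‖z - w‖ ≤ r / m := by
  have hm' : (0 : ℝ) < m := by exact_mod_cast hm
  have hfl : ∀ a ∈ Set.Icc 0 r, ⌊a * m / r⌋₊ ≤ m := by
    intro a ha
    refine Nat.floor_le_of_le ?_
    rw [div_le_iff₀ hr, mul_comm]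
    exact mul_le_mul_of_nonneg_left ha.2 hm'.le
  have hc : ∀ i, |Sum.elim z.1 z.2 i - Sum.elim w.1 w.2 i| ≤ r / m := by
    intro i
    have h1 := congrArg Fin.val (congrFun h i)
    simp only [gridCell, min_eq_left (hfl _ (hz i)), min_eq_left (hfl _ (hw i))] at h1
    set a := Sum.elim z.1 z.2 i
    set b := Sum.elim w.1 w.2 i
    have ha : 0 ≤ a * m / r := div_nonneg (mul_nonneg (hz i).1 hm'.le) hr.le
    have hb : 0 ≤ b * m / r := div_nonneg (mul_nonneg (hw i).1 hm'.le) hr.le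
    have h2 := Nat.floor_le ha
    have h3 := Nat.lt_floor_add_one (a * m / r)
    have h4 := Nat.floor_le hb
    have h5 := Nat.lt_floor_add_one (b * m / r)
    rw [h1] at h2 h3
    have h6 : |a * m / r - b * m / r| ≤ 1 := by
      rw [abs_le]
      constructor <;> linarith
    have h7 : a - b = (a * m / r - b * m / r) * (r / m) := by field_simp
    rw [h7, abs_mul, abs_of_pos (div_pos hr hm')]
    exact mul_le_of_le_one_left (by positivity) h6
  have hrm : 0 ≤ r / m := by positivity
  rw [Prod.norm_def]
  refine max_le ((pi_norm_le_iff_of_nonneg hrm).2 fun i => ?_)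
    ((pi_norm_le_iff_of_nonneg hrm).2 fun i => ?_)
  · exact hc (Sum.inl i)
  · exact hc (Sum.inr i)

/-- The maximal information gain of a field with Lipschitz features grows at a power less than
one of `T`. -/
lemma exists_maxInfoGain_le (hG : IsGaussField ρ G) (hσ : 0 < σ)
    (hk : ∀ w ∈ Z, covKer ρ G w w ≤ 1) {r : ℝ} (hr : 0 < r)
    (hZ : ∀ z ∈ Z, ∀ i, Sum.elim z.1 z.2 i ∈ Set.Icc 0 r) {Λ : ℝ} (hΛ : 0 ≤ Λ)
    (hLip : ∀ z ∈ Z, ∀ w ∈ Z, ‖hG.feature z - hG.feature w‖ ≤ Λ * ‖z - w‖) :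
    ∃ A θ : ℝ, 0 ≤ A ∧ 0 < θ ∧ ∀ T : ℕ, 1 ≤ T →
      maxInfoGain ρ Z G σ T ≤ A * (T : ℝ) ^ (1 - θ) := by
  set D := Fintype.card (Fin Dx ⊕ Fin Dc) with hD
  refine ⟨(Λ ^ 2 * r ^ 2 + σ ^ 2 + 2 ^ D * 2 ^ (D + 1)) / (2 * σ ^ 2), 1 / (D + 2), by positivity,
    by positivity, fun T hT => ?_⟩
  have hT1 : (1 : ℝ) ≤ T := by exact_mod_cast hT
  have hT' : (0 : ℝ) < T := by linarith
  -- The integer `m = ⌈τ⌉` serves both as grid parameter and as visit threshold. The averaging part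
  -- is then of order `T / m` and the part of the rarely visited cells of order `m^(D+1)`; since
  -- `τ^(D+2) = T`, both are of order `T / τ = T^(1-θ)`.
  set τ : ℝ := (T : ℝ) ^ ((1 : ℝ) / (D + 2)) with hτ
  have hτ1 : 1 ≤ τ := Real.one_le_rpow hT1 (by positivity)
  have hτT : (T : ℝ) ^ (1 - (1 : ℝ) / (D + 2)) = T / τ := by
    rw [Real.rpow_sub hT', Real.rpow_one]
  have hτD : τ ^ (D + 1) = T / τ := by
    rw [eq_div_iff (by positivity), ← pow_succ, hτ, ← Real.rpow_natCast, ← Real.rpow_mul hT'.le]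
    have : (1 : ℝ) / (D + 2) * ((D + 1 + 1 : ℕ) : ℝ) = 1 := by
      push_cast
      field_simp
      ring
    rw [this, Real.rpow_one]
  set m := ⌈τ⌉₊ with hm
  have hm0 : 0 < m := Nat.ceil_pos.2 (by linarith)
  have hm1 : τ ≤ m := Nat.le_ceil τ
  have hm2 : (m : ℝ) ≤ 2 * τ := by
    have := Nat.ceil_lt_add_one (by linarith : 0 ≤ τ)
    linarith
  have hm3 : (1 : ℝ) ≤ m := by exact_mod_cast hm0
  have hbound : ∀ z : ℕ → Pt Dx Dc, (∀ i, z i ∈ Z) →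
      ∑ t ∈ Finset.range T, seqVar (covKer ρ G) σ z t ≤
        (Λ ^ 2 * r ^ 2 + σ ^ 2 + 2 ^ D * 2 ^ (D + 1)) * (T / τ) := by
    intro z hz
    have hfeat : ∀ w ∈ Z, ‖hG.feature w‖ ≤ 1 := by
      intro w hw
      have h1 := hk w hw
      rw [← hG.norm_feature_sq] at h1
      exact (sq_le_one_iff₀ (norm_nonneg _)).1 h1
    refine (sum_postCov_le hG.covKer_eq_inner hσ hfeat (gridCell r m) (δ := Λ * (r / m)) ?_ z hz m
      hm0 T).trans ?_
    · intro w hw w' hw' hww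
      exact (hLip w hw w' hw').trans (mul_le_mul_of_nonneg_left
        (norm_sub_le_of_gridCell_eq hr hm0 (hZ w hw) (hZ w' hw') hww) hΛ)
    · have e1 : T * ((Λ * (r / m)) ^ 2 + σ ^ 2 / m) ≤ (Λ ^ 2 * r ^ 2 + σ ^ 2) * (T / τ) := by
        have h1 : (Λ * (r / m)) ^ 2 ≤ Λ ^ 2 * r ^ 2 / m := by
          rw [mul_pow, div_pow, mul_div_assoc]
          gcongr
          nlinarith
        have h2 : T * ((Λ * (r / m)) ^ 2 + σ ^ 2 / m) ≤ (Λ ^ 2 * r ^ 2 + σ ^ 2) * (T / m) := by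
          calc _ ≤ T * (Λ ^ 2 * r ^ 2 / m + σ ^ 2 / m) := by gcongr
            _ = _ := by ring
        refine h2.trans ?_
        gcongr
      have e2 : ((Fintype.card (Fin Dx ⊕ Fin Dc → Fin (m + 1)) : ℕ) : ℝ) * m ≤
          2 ^ D * 2 ^ (D + 1) * (T / τ) := by
        rw [Fintype.card_fun, Fintype.card_fin, ← hD, ← hτD]
        push_cast
        calc ((m : ℝ) + 1) ^ D * m ≤ (2 * m) ^ D * m := by
              gcongr
              linarith
          _ = 2 ^ D * (m : ℝ) ^ (D + 1) := by rw [mul_pow, pow_succ]; ring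
          _ ≤ 2 ^ D * (2 * τ) ^ (D + 1) := by gcongr
          _ = _ := by rw [mul_pow]; ring
      calc _ ≤ (Λ ^ 2 * r ^ 2 + σ ^ 2) * (T / τ) + 2 ^ D * 2 ^ (D + 1) * (T / τ) :=
            add_le_add e1 e2
        _ = _ := by ring
  refine (maxInfoGain_le hG hσ T (by positivity) hbound).trans (le_of_eq ?_)
  rw [hτT]
  ring

lemma maxInfoGain_congr {Ω : Type*} [MeasurableSpace Ω] {P : Measure Ω}
    {F : Ω → 𝓕} (hF : Measurable F) {f : Ω → Pt Dx Dc → ℝ} (hG : IsGaussField (P.map F) G)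
    (hf : ∀ z ∈ Z, (fun ω => f ω z) =ᵐ[P] fun ω => G (F ω) z) (T : ℕ) :
    maxInfoGain P Z f σ T = maxInfoGain (P.map F) Z G σ T := by
  rw [maxInfoGain, maxInfoGain]
  congr 1
  refine iSup_congr fun z => ?_
  rw [obsLaw, obsLaw]
  congr 3
  rw [Measure.map_map (measurable_field_family hG _) hF]
  refine Measure.map_congr ?_
  filter_upwards [ae_all_iff.2 fun i => hf (z i) (z i).2] with ω hω
  ext i
  exact hω i

end GainBounds

end SBOKDE

end

noncomputable section

namespace SBOKDE

/-! ### The space of continuous paths. -/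

section PathSpace

variable {Dx Dc : ℕ} {Z : Set (Pt Dx Dc)}

/-- The continuous functions on `Z`, with the σ-algebra generated by the evaluations. -/
abbrev PathSpace (Z : Set (Pt Dx Dc)) : Type := {φ : Z → ℝ // Continuous φ}

open Classical in
/-- The value of a path, extended by zero outside of `Z`. -/
def evalPath (φ : PathSpace Z) (z : Pt Dx Dc) : ℝ := if h : z ∈ Z then φ.1 ⟨z, h⟩ else 0

lemma evalPath_of_mem (φ : PathSpace Z) {z : Pt Dx Dc} (h : z ∈ Z) : evalPath φ z = φ.1 ⟨z, h⟩ :=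
  dif_pos h

lemma evalPath_of_notMem (φ : PathSpace Z) {z : Pt Dx Dc} (h : z ∉ Z) : evalPath φ z = 0 :=
  dif_neg h

/-- On `Z`, evaluation is measurable in the path and continuous in the point, hence jointly
measurable. This is what allows exchanging integrals over contexts and over the objective. -/
lemma measurable_evalPath (hZ : MeasurableSet Z) :
    Measurable (Function.uncurry (evalPath : PathSpace Z → Pt Dx Dc → ℝ)) := by
  classical
  have h1 : Measurable (Function.uncurry fun (z : Z) (φ : PathSpace Z) => φ.1 z) :=
    measurable_uncurry_of_continuous_of_measurable (fun φ => φ.2)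
      fun z => (measurable_pi_apply z).comp measurable_subtype_coe
  set s : Set (PathSpace Z × Pt Dx Dc) := {q | q.2 ∈ Z} with hs
  have hsm : MeasurableSet s := measurable_snd hZ
  have h2 : Measurable fun q : s => q.1.1.1 ⟨q.1.2, q.2⟩ :=
    h1.comp (f := fun q : s => ((⟨q.1.2, q.2⟩ : Z), q.1.1))
      ((measurable_subtype_coe.snd.subtype_mk).prodMk measurable_subtype_coe.fst)
  have h3 := Measurable.dite h2 (g := fun _ => (0 : ℝ)) measurable_const hsm
  convert! h3 using 1

/-- The least Lipschitz constant of a path. -/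
def pathLip (φ : PathSpace Z) : ℝ≥0∞ :=
  ⨆ (z : Z) (w : Z), edist (φ.1 z) (φ.1 w) / edist z w

lemma edist_le_pathLip (φ : PathSpace Z) (z w : Z) :
    edist (φ.1 z) (φ.1 w) ≤ pathLip φ * edist z w := by
  rcases eq_or_ne z w with rfl | hzw
  · simp
  · have h1 : edist (φ.1 z) (φ.1 w) / edist z w ≤ pathLip φ :=
      le_iSup₂ (f := fun z w => edist (φ.1 z) (φ.1 w) / edist z w) z w
    exact (ENNReal.div_le_iff (edist_pos.2 hzw).ne' (edist_ne_top _ _)).1 h1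

lemma pathLip_le (φ : PathSpace Z) {L : ℝ≥0∞} (h : ∀ z w : Z, edist (φ.1 z) (φ.1 w) ≤ L * edist z w) :
    pathLip φ ≤ L :=
  iSup₂_le fun z w => ENNReal.div_le_of_le_mul (h z w)

/-- The Lipschitz inequality with a finite constant is a closed condition on pairs of points, so it
extends from a dense set. A countable dense set then makes `pathLip` measurable. -/
lemma pathLip_eq_iSup_dense (φ : PathSpace Z) {D : Set Z} (hD : Dense D) :
    pathLip φ = ⨆ (z : D) (w : D), edist (φ.1 z) (φ.1 w) / edist (z : Z) (w : Z) := by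
  refine le_antisymm ?_ ?_
  · set L := ⨆ (z : D) (w : D), edist (φ.1 z) (φ.1 w) / edist (z : Z) (w : Z) with hL
    by_cases hLt : L = ∞
    · rw [hLt]
      exact le_top
    · refine pathLip_le φ fun z w => ?_
      have hcl : IsClosed {q : Z × Z | edist (φ.1 q.1) (φ.1 q.2) ≤ L * edist q.1 q.2} :=
        isClosed_le ((φ.2.comp continuous_fst).edist (φ.2.comp continuous_snd))
          (ENNReal.continuous_const_mul hLt |>.comp (continuous_fst.edist continuous_snd))
      have hsub : D ×ˢ D ⊆ {q : Z × Z | edist (φ.1 q.1) (φ.1 q.2) ≤ L * edist q.1 q.2} := by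
        rintro ⟨z, w⟩ ⟨hz, hw⟩
        rcases eq_or_ne z w with rfl | hzw
        · simp
        · have h1 : edist (φ.1 z) (φ.1 w) / edist z w ≤ L :=
            le_iSup₂ (f := fun (z : D) (w : D) => edist (φ.1 z) (φ.1 w) / edist (z : Z) (w : Z))
              ⟨z, hz⟩ ⟨w, hw⟩
          exact (ENNReal.div_le_iff (edist_pos.2 hzw).ne' (edist_ne_top _ _)).1 h1
      have := hcl.closure_subset_iff.2 hsub
      rw [(hD.prod hD).closure_eq] at this
      have hzw : (z, w) ∈ {q : Z × Z | edist (φ.1 q.1) (φ.1 q.2) ≤ L * edist q.1 q.2} :=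
        this (Set.mem_univ _)
      exact hzw
  · exact iSup₂_le fun z w =>
      le_iSup₂_of_le (f := fun z w => edist (φ.1 z) (φ.1 w) / edist z w) z.1 w.1 le_rfl

lemma measurable_pathLip : Measurable (pathLip : PathSpace Z → ℝ≥0∞) := by
  obtain ⟨D, hDc, hD⟩ := TopologicalSpace.exists_countable_dense Z
  have := hDc.to_subtype
  rw [funext fun φ : PathSpace Z => pathLip_eq_iSup_dense φ hD]
  refine Measurable.iSup fun z => Measurable.iSup fun w => Measurable.div_const ?_ _
  have hm : ∀ z : Z, Measurable fun φ : PathSpace Z => φ.1 z := fun z =>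
    (measurable_pi_apply z).comp measurable_subtype_coe
  exact (hm z).edist (hm w)

lemma abs_evalPath_sub_le (φ : PathSpace Z) (h : pathLip φ ≠ ∞) {z w : Pt Dx Dc} (hz : z ∈ Z)
    (hw : w ∈ Z) : |evalPath φ z - evalPath φ w| ≤ (pathLip φ).toReal * ‖z - w‖ := by
  have h1 := edist_le_pathLip φ ⟨z, hz⟩ ⟨w, hw⟩
  rw [evalPath_of_mem φ hz, evalPath_of_mem φ hw, ← Real.dist_eq, dist_edist, ← dist_eq_norm,
    dist_edist, ← ENNReal.toReal_mul]
  exact ENNReal.toReal_mono (ENNReal.mul_ne_top h (edist_ne_top _ _)) h1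

end PathSpace

/-! ### Moments of the Lipschitz constant. -/

section Lipschitz

variable {Dx Dc : ℕ} {Z : Set (Pt Dx Dc)} {Ω : Type*} [MeasurableSpace Ω] {P : Measure Ω}

lemma norm_le_of_unitVec (ℓ : Pt Dx Dc →L[ℝ] ℝ) {t : ℝ} (ht : 0 ≤ t)
    (h : ∀ i, |ℓ (unitVec i)| ≤ t) : ‖ℓ‖ ≤ Fintype.card (Fin Dx ⊕ Fin Dc) * t := by
  refine ℓ.opNorm_le_bound (by positivity) fun v => ?_
  have hv : v = ∑ i : Fin Dx ⊕ Fin Dc, Sum.elim v.1 v.2 i • (unitVec i : Pt Dx Dc) := by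
    rw [Fintype.sum_sum_type]
    refine Prod.ext ?_ ?_
    · ext j
      simp [unitVec, Prod.fst_sum, Finset.sum_apply, Pi.single_apply]
    · ext j
      simp [unitVec, Prod.snd_sum, Finset.sum_apply, Pi.single_apply]
  have hc : ∀ i, |Sum.elim v.1 v.2 i| ≤ ‖v‖ := by
    rintro (i | i)
    · exact (norm_le_pi_norm v.1 i).trans (norm_fst_le v)
    · exact (norm_le_pi_norm v.2 i).trans (norm_snd_le v)
  conv_lhs => rw [hv]
  rw [map_sum]
  refine (norm_sum_le _ _).trans ?_
  calc ∑ i, ‖ℓ (Sum.elim v.1 v.2 i • (unitVec i : Pt Dx Dc))‖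
      ≤ ∑ _i : Fin Dx ⊕ Fin Dc, ‖v‖ * t := by
        refine Finset.sum_le_sum fun i _ => ?_
        rw [map_smul, smul_eq_mul, norm_mul, Real.norm_eq_abs, Real.norm_eq_abs]
        exact mul_le_mul (hc i) (h i) (abs_nonneg _) (norm_nonneg _)
    _ = _ := by
        rw [Finset.sum_const, Finset.card_univ, nsmul_eq_mul]
        ring

/-- On a convex domain the mean value inequality bounds the Lipschitz constant by the norm of the
derivative, which for the sup norm is at most the number of coordinates times the largest partial
derivative. A union bound over the coordinates finishes; the events need not be measurable. -/
lemma meas_lt_pathLip_le {a b : ℝ} {f : Ω → Pt Dx Dc → ℝ} (hZ : Convex ℝ Z)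
    (hf : HasLipschitzTail P Z a b f) {F : Ω → PathSpace Z}
    (hF : ∀ᵐ ω ∂P, ∀ z : Z, (F ω).1 z = f ω z) {t : ℝ} (ht : 0 < t) :
    P {ω | ENNReal.ofReal (Fintype.card (Fin Dx ⊕ Fin Dc) * t) < pathLip (F ω)} ≤
      Fintype.card (Fin Dx ⊕ Fin Dc) * ENNReal.ofReal (a * Real.exp (-(t / b) ^ 2)) := by
  have hsub : {ω | ENNReal.ofReal (Fintype.card (Fin Dx ⊕ Fin Dc) * t) < pathLip (F ω)} ≤ᵐ[P]
      (⋃ i ∈ (Finset.univ : Finset (Fin Dx ⊕ Fin Dc)),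
        {ω | ∃ z ∈ Z, t < |fderivWithin ℝ (f ω) Z z (unitVec i)|} : Set Ω) := by
    filter_upwards [hF, hf.differentiableOn] with ω hω hd hlt
    change ω ∈ ⋃ i ∈ (Finset.univ : Finset (Fin Dx ⊕ Fin Dc)),
        {ω | ∃ z ∈ Z, t < |fderivWithin ℝ (f ω) Z z (unitVec i)|}
    by_contra hno
    simp only [Finset.mem_univ, Set.iUnion_true, Set.mem_iUnion, Set.mem_ofPred_eq, not_exists, not_and,
      not_lt] at hno
    refine absurd hlt (not_lt.2 (pathLip_le _ fun z w => ?_))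
    rw [hω, hω, edist_dist, edist_dist, ← ENNReal.ofReal_mul (by positivity)]
    refine ENNReal.ofReal_le_ofReal ?_
    rw [Real.dist_eq, Subtype.dist_eq, dist_eq_norm, ← Real.norm_eq_abs]
    exact hZ.norm_image_sub_le_of_norm_fderivWithin_le hd
      (fun z hz => norm_le_of_unitVec _ ht.le fun i => hno i z hz) w.2 z.2
  refine (measure_mono_ae hsub).trans ((measure_biUnion_finset_le _ _).trans ?_)
  refine (Finset.sum_le_sum fun i _ => hf.tail i t ht).trans (le_of_eq ?_)
  simp

lemma summable_tail_moment (D : ℕ) (a : ℝ) {q : ℝ} (hq0 : 0 ≤ q) (hq : q < 1) :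
    Summable fun j : ℕ => (D * (j + 1) : ℝ) ^ 2 * ((1 + D * a) * q ^ j) := by
  have hn : ‖q‖ < 1 := by rwa [Real.norm_of_nonneg hq0]
  have h2 := summable_pow_mul_geometric_of_norm_lt_one 2 hn
  have h1 := summable_pow_mul_geometric_of_norm_lt_one 1 hn
  have h0 := summable_pow_mul_geometric_of_norm_lt_one 0 hn
  have := ((h2.add (h1.mul_left 2)).add h0).mul_left ((D : ℝ) ^ 2 * (1 + D * a))
  refine this.congr fun j => ?_
  ring

/-- A second moment bound, uniform over all random variables with a given Gaussian tail. -/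
lemma exists_second_moment_bound (D : ℕ) (hD : 0 < D) {a b : ℝ} (ha : 0 < a) (hb : 0 < b) :
    ∃ A : ℝ, 0 < A ∧ ∀ {Ω : Type*} [MeasurableSpace Ω] {P : Measure Ω} [IsProbabilityMeasure P]
      {M : Ω → ℝ≥0∞}, Measurable M →
      (∀ t : ℝ, 0 < t → P {ω | ENNReal.ofReal (D * t) < M ω} ≤
        D * ENNReal.ofReal (a * Real.exp (-(t / b) ^ 2))) →
      ∫⁻ ω, M ω ^ 2 ∂P ≤ ENNReal.ofReal A := by
  set q : ℝ := Real.exp (-(1 / b ^ 2)) with hqdef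
  have hq0 : 0 ≤ q := (Real.exp_pos _).le
  have hq1 : q < 1 := by
    rw [hqdef, Real.exp_lt_one_iff]
    have : 0 < 1 / b ^ 2 := by positivity
    linarith
  have hsum := summable_tail_moment D a hq0 hq1
  have hnn : ∀ j : ℕ, 0 ≤ (D * (j + 1) : ℝ) ^ 2 * ((1 + D * a) * q ^ j) := fun j => by positivity
  refine ⟨(∑' j : ℕ, (D * (j + 1) : ℝ) ^ 2 * ((1 + D * a) * q ^ j)) + 1, ?_, ?_⟩
  · have : 0 ≤ ∑' j : ℕ, (D * (j + 1) : ℝ) ^ 2 * ((1 + D * a) * q ^ j) := tsum_nonneg hnn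
    linarith
  intro Ω _ P _ M hM htail
  have hD' : (0 : ℝ) < D := by exact_mod_cast hD
  have hms : ∀ j : ℕ, MeasurableSet {ω | ENNReal.ofReal (D * j) < M ω} := fun j =>
    measurableSet_lt measurable_const hM
  -- If `D j < M ≤ D (j + 1)`, the term of index `j` alone dominates `M²`. If `M` is infinite, every
  -- term is at least one and the sum diverges.
  have hpt : ∀ ω, M ω ^ 2 ≤ ∑' j : ℕ, {ω | ENNReal.ofReal (D * j) < M ω}.indicator
      (fun _ => ENNReal.ofReal ((D * (j + 1) : ℝ) ^ 2)) ω := by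
    intro ω
    rcases eq_or_ne (M ω) 0 with h0 | h0
    · simp [h0]
    rcases eq_or_ne (M ω) ∞ with ht | ht
    · refine le_of_le_of_eq le_top (Eq.symm ?_)
      rw [← top_le_iff, ← ENNReal.tsum_const_eq_top_of_ne_zero (α := ℕ) one_ne_zero]
      refine ENNReal.tsum_le_tsum fun j => ?_
      have hmem : ω ∈ {ω | ENNReal.ofReal (D * j) < M ω} := by
        change ENNReal.ofReal (D * j) < M ω
        rw [ht]
        exact ENNReal.ofReal_lt_top
      rw [Set.indicator_of_mem hmem, ← ENNReal.ofReal_one]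
      refine ENNReal.ofReal_le_ofReal (one_le_pow₀ ?_)
      have hD1 : (1 : ℝ) ≤ D := by exact_mod_cast hD
      nlinarith [(Nat.cast_nonneg j : (0 : ℝ) ≤ j)]
    · set m := (M ω).toReal with hm
      have hm0 : 0 < m := ENNReal.toReal_pos h0 ht
      have hMm : M ω = ENNReal.ofReal m := (ENNReal.ofReal_toReal ht).symm
      have hc : 0 < ⌈m / D⌉₊ := Nat.ceil_pos.2 (by positivity)
      obtain ⟨j, hj⟩ : ∃ j, ⌈m / D⌉₊ = j + 1 := ⟨⌈m / D⌉₊ - 1, by omega⟩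
      have h1 : (j : ℝ) < m / D := Nat.lt_ceil.1 (by omega)
      have h2 : m / D ≤ (j : ℝ) + 1 := by
        have := Nat.le_ceil (m / D)
        rw [hj] at this
        exact_mod_cast this
      rw [lt_div_iff₀ hD'] at h1
      rw [div_le_iff₀ hD'] at h2
      refine le_trans ?_ (ENNReal.le_tsum j)
      rw [Set.indicator_of_mem, hMm, ← ENNReal.ofReal_pow hm0.le]
      · refine ENNReal.ofReal_le_ofReal (pow_le_pow_left₀ hm0.le ?_ 2)
        linarith
      · change ENNReal.ofReal (D * j) < M ω
        rw [hMm]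
        exact (ENNReal.ofReal_lt_ofReal_iff hm0).2 (by linarith)
  -- For `j ≥ 1`, `j² ≥ j` turns the Gaussian tail into the geometric sequence `q ^ j`. The summand
  -- 1 in `1 + D a` covers `j = 0`, where the tail hypothesis is not available.
  have hprob : ∀ j : ℕ, P {ω | ENNReal.ofReal (D * j) < M ω} ≤
      ENNReal.ofReal ((1 + D * a) * q ^ j) := by
    intro j
    rcases Nat.eq_zero_or_pos j with rfl | hj
    · refine prob_le_one.trans ?_
      rw [pow_zero, mul_one, ← ENNReal.ofReal_one]
      refine ENNReal.ofReal_le_ofReal ?_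
      have : 0 ≤ D * a := by positivity
      linarith
    · have hj1 : (1 : ℝ) ≤ j := by exact_mod_cast hj
      refine (htail j (by linarith)).trans ?_
      rw [← ENNReal.ofReal_natCast D, ← ENNReal.ofReal_mul hD'.le]
      refine ENNReal.ofReal_le_ofReal ?_
      have h1 : Real.exp (-((j : ℝ) / b) ^ 2) ≤ q ^ j := by
        rw [hqdef, ← Real.exp_nat_mul, Real.exp_le_exp, div_pow]
        have : (j : ℝ) * (1 / b ^ 2) ≤ (j : ℝ) ^ 2 / b ^ 2 := by
          rw [mul_one_div]
          gcongr
          nlinarith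
        linarith
      calc D * (a * Real.exp (-((j : ℝ) / b) ^ 2)) ≤ D * (a * q ^ j) := by gcongr
        _ = D * a * q ^ j := by ring
        _ ≤ _ := mul_le_mul_of_nonneg_right (by linarith) (by positivity)
  calc ∫⁻ ω, M ω ^ 2 ∂P ≤ ∫⁻ ω, ∑' j : ℕ, {ω | ENNReal.ofReal (D * j) < M ω}.indicator
        (fun _ => ENNReal.ofReal ((D * (j + 1) : ℝ) ^ 2)) ω ∂P := lintegral_mono hpt
    _ = ∑' j : ℕ, ENNReal.ofReal ((D * (j + 1) : ℝ) ^ 2) *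
        P {ω | ENNReal.ofReal (D * j) < M ω} := by
        rw [lintegral_tsum fun j => (measurable_const.indicator (hms j)).aemeasurable]
        exact tsum_congr fun j => lintegral_indicator_const (hms j) _
    _ ≤ ∑' j : ℕ, ENNReal.ofReal ((D * (j + 1) : ℝ) ^ 2 * ((1 + D * a) * q ^ j)) := by
        exact ENNReal.tsum_le_tsum fun j => (mul_le_mul' le_rfl (hprob j)).trans
          (ENNReal.ofReal_mul (by positivity)).ge
    _ = ENNReal.ofReal (∑' j : ℕ, (D * (j + 1) : ℝ) ^ 2 * ((1 + D * a) * q ^ j)) :=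
        (ENNReal.ofReal_tsum_of_nonneg hnn hsum).symm
    _ ≤ _ := ENNReal.ofReal_le_ofReal (by linarith)

end Lipschitz

/-! ### From the sample path to a random continuous function. -/

section Modification

variable {Dx Dc : ℕ} {Z : Set (Pt Dx Dc)} {Ω : Type*} [MeasurableSpace Ω] {P : Measure Ω}
  {k : Pt Dx Dc → Pt Dx Dc → ℝ} {f : Ω → Pt Dx Dc → ℝ}

/-- A process with almost surely continuous paths agrees almost surely with a random element of
the space of continuous functions. -/
lemma exists_pathSpace_modification (hf : ∀ z ∈ Z, Measurable fun ω => f ω z)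
    (hc : ∀ᵐ ω ∂P, ContinuousOn (f ω) Z) :
    ∃ F : Ω → PathSpace Z, Measurable F ∧ ∀ᵐ ω ∂P, ∀ z : Z, (F ω).1 z = f ω z := by
  classical
  -- On a measurable null set containing all discontinuous paths, the path is replaced by zero.
  obtain ⟨A, hAc, hA, hPA⟩ := exists_measurable_superset_of_null hc
  have hcont : ∀ ω, Continuous fun z : Z => if ω ∈ A then 0 else f ω z := by
    intro ω
    by_cases hω : ω ∈ A
    · simp only [hω, if_true]
      exact continuous_const
    · simp only [hω, if_false]
      have : ContinuousOn (f ω) Z := by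
        by_contra h
        exact hω (hAc h)
      exact continuousOn_iff_continuous_domRestrict.1 this
  refine ⟨fun ω => ⟨fun z => if ω ∈ A then 0 else f ω z, hcont ω⟩, ?_, ?_⟩
  · exact Measurable.subtype_mk (measurable_pi_iff.2 fun z : Z =>
      Measurable.ite hA measurable_const (hf z.1 z.2))
  · have : ∀ᵐ ω ∂P, ω ∉ A := measure_eq_zero_iff_ae_notMem.1 hPA
    filter_upwards [this] with ω hω z
    simp [hω]

/-- The extension by zero remains Gaussian: a finite family of values is a linear image of the
values at those of its points that lie in `Z`. -/
lemma isGaussField_evalPath (hZ : MeasurableSet Z) (hf : IsCenteredGP P Z k f) {F : Ω → PathSpace Z}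
    (hF : Measurable F) (hFf : ∀ᵐ ω ∂P, ∀ z : Z, (F ω).1 z = f ω z) :
    IsGaussField (P.map F) (evalPath : PathSpace Z → Pt Dx Dc → ℝ) := by
  have hev := measurable_evalPath hZ
  have hae : ∀ z (hz : z ∈ Z), (fun ω => evalPath (F ω) z) =ᵐ[P] fun ω => f ω z := by
    intro z hz
    filter_upwards [hFf] with ω hω
    rw [evalPath_of_mem _ hz, hω]
  have hproc : IsGaussianProcess (fun z ω => evalPath (F ω) z) P := by
    have h1 : IsGaussianProcess (fun (z : Z) ω => evalPath (F ω) z) P :=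
      hf.gaussian.congr fun z => (hae z z.2).symm
    classical
    refine ⟨fun I => ?_⟩
    let L : (I.subtype (· ∈ Z) → ℝ) →L[ℝ] I → ℝ := ContinuousLinearMap.pi fun z =>
      if hz : z.1 ∈ Z then ContinuousLinearMap.proj ⟨⟨z, hz⟩, Finset.mem_subtype.2 z.2⟩ else 0
    have hL : (fun ω => I.restrict fun z => evalPath (F ω) z) =
        L ∘ fun ω => (I.subtype (· ∈ Z)).restrict fun z : Z => evalPath (F ω) z := by
      ext ω z
      by_cases hz : z.1 ∈ Z
      · simp [L, hz]
      · simp [L, hz, evalPath_of_notMem]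
    rw [hL]
    exact (h1.hasGaussianLaw _).map L
  refine ⟨hev, ⟨fun I => ⟨?_⟩⟩, fun z => ?_⟩
  · have hm : Measurable fun φ : PathSpace Z => I.restrict fun z => evalPath φ z :=
      measurable_pi_iff.2 fun z => hev.of_uncurry_right
    rw [Measure.map_map hm hF]
    exact (hproc.hasGaussianLaw I).isGaussian_map
  · rw [integral_map hF.aemeasurable (hev.of_uncurry_right).aestronglyMeasurable]
    by_cases hz : z ∈ Z
    · rw [integral_congr_ae (hae z hz), hf.mean z hz]
    · simp [evalPath_of_notMem _ hz]

lemma covKer_evalPath (hZ : MeasurableSet Z) (hf : IsCenteredGP P Z k f) {F : Ω → PathSpace Z}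
    (hF : Measurable F) (hFf : ∀ᵐ ω ∂P, ∀ z : Z, (F ω).1 z = f ω z) {z w : Pt Dx Dc} (hz : z ∈ Z)
    (hw : w ∈ Z) : covKer (P.map F) evalPath z w = k z w := by
  have hev := measurable_evalPath hZ
  have := hf.gaussian.isProbabilityMeasure
  have h2 : ∀ z ∈ Z, MemLp (fun ω => f ω z) 2 P := fun z hz =>
    (hf.gaussian.hasGaussianLaw_eval ⟨z, hz⟩).memLp_two
  have hm : Measurable fun φ : PathSpace Z => evalPath φ z * evalPath φ w :=
    hev.of_uncurry_right.mul hev.of_uncurry_right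
  rw [covKer, integral_map hF.aemeasurable hm.aestronglyMeasurable, ← hf.cov z hz w hw,
    covariance_eq_sub (h2 z hz) (h2 w hw), hf.mean z hz, zero_mul, sub_zero]
  refine integral_congr_ae ?_
  filter_upwards [hFf] with ω hω
  rw [evalPath_of_mem _ hz, evalPath_of_mem _ hw, hω, hω]
  rfl

/-- The increments of the field are at most the Lipschitz constant times the distance; taking `L²`
norms gives the factor `√A`. This mean-square bound is used twice: for the sublinear growth of the
information gain, and for the slow variation of the posterior standard deviation. -/
lemma norm_feature_evalPath_sub_le {ρ : Measure (PathSpace Z)}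
    (hG : IsGaussField ρ (evalPath : PathSpace Z → Pt Dx Dc → ℝ)) {A : ℝ} (hA : 0 ≤ A)
    (hM : ∫⁻ φ, pathLip φ ^ 2 ∂ρ ≤ ENNReal.ofReal A) {z w : Pt Dx Dc} (hz : z ∈ Z) (hw : w ∈ Z) :
    ‖hG.feature z - hG.feature w‖ ≤ √A * ‖z - w‖ := by
  have hm : Measurable fun φ : PathSpace Z => pathLip φ ^ 2 := measurable_pathLip.pow_const 2
  have hfin : ∀ᵐ φ ∂ρ, pathLip φ ≠ ∞ := by
    filter_upwards [ae_lt_top hm (ne_top_of_le_ne_top ENNReal.ofReal_ne_top hM)] with φ hφ h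
    simp [h] at hφ
  refine abs_le_of_sq_le_sq' ?_ (by positivity) |>.2
  rw [hG.norm_feature_sub_sq, mul_pow, Real.sq_sqrt hA]
  have hd : Measurable fun φ : PathSpace Z => (evalPath φ z - evalPath φ w) ^ 2 :=
    ((hG.measurable_apply z).sub (hG.measurable_apply w)).pow_const 2
  rw [integral_eq_lintegral_of_nonneg_ae (Eventually.of_forall fun φ => sq_nonneg _)
    hd.aestronglyMeasurable]
  refine ENNReal.toReal_le_of_le_ofReal (by positivity) ?_
  calc ∫⁻ φ, ENNReal.ofReal ((evalPath φ z - evalPath φ w) ^ 2) ∂ρ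
      ≤ ∫⁻ φ, pathLip φ ^ 2 * ENNReal.ofReal (‖z - w‖ ^ 2) ∂ρ := by
        refine lintegral_mono_ae ?_
        filter_upwards [hfin] with φ hφ
        have h1 := abs_evalPath_sub_le φ hφ hz hw
        rw [← ENNReal.ofReal_toReal hφ, ← ENNReal.ofReal_pow ENNReal.toReal_nonneg,
          ← ENNReal.ofReal_mul (by positivity), ← mul_pow]
        refine ENNReal.ofReal_le_ofReal ?_
        rw [← sq_abs]
        exact pow_le_pow_left₀ (abs_nonneg _) h1 2
    _ = (∫⁻ φ, pathLip φ ^ 2 ∂ρ) * ENNReal.ofReal (‖z - w‖ ^ 2) := lintegral_mul_const _ hm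
    _ ≤ ENNReal.ofReal A * ENNReal.ofReal (‖z - w‖ ^ 2) := by gcongr
    _ = _ := (ENNReal.ofReal_mul hA).symm

end Modification

end SBOKDE

end

noncomputable section

namespace SBOKDE

/-! ### The algorithm as an adaptive design. -/

section Design

variable {Dx Dc n₀ : ℕ}

/-- The initial design and all later contexts. -/
abbrev Source (Dx Dc n₀ : ℕ) : Type := (Fin n₀ → Pt Dx Dc) × (ℕ → Fin Dc → ℝ)

/-- The `n`-th context. -/
def Source.context (u : Source Dx Dc n₀) (n : ℕ) : Fin Dc → ℝ :=
  if h : n < n₀ then (u.1 ⟨n, h⟩).2 else u.2 (n - n₀)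

lemma Source.measurable_context (n : ℕ) :
    Measurable fun u : Source Dx Dc n₀ => u.context n := by
  by_cases h : n < n₀
  · simp only [Source.context, h, dif_pos]
    exact ((measurable_pi_apply _).comp measurable_fst).snd
  · simp only [Source.context, h, dif_neg, not_false_eq_true]
    exact (measurable_pi_apply _).comp measurable_snd

/-- The design points of the algorithm with decision rules `ξ`. -/
def ruleDesign (ξ : ∀ n, (Fin n → Pt Dx Dc × ℝ) → Fin Dx → ℝ) (n : ℕ)
    (d : Source Dx Dc n₀ × (Fin n → ℝ)) : Pt Dx Dc :=
  if h : n < n₀ then d.1.1 ⟨n, h⟩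
  else (ξ n fun i => (ruleDesign ξ i (d.1, fun j : Fin i => d.2 (j.castLE i.2.le)), d.2 i),
    d.1.2 (n - n₀))
termination_by n
decreasing_by exact i.2

variable {ξ : ∀ n, (Fin n → Pt Dx Dc × ℝ) → Fin Dx → ℝ}

lemma ruleDesign_of_lt {n : ℕ} (h : n < n₀) (d : Source Dx Dc n₀ × (Fin n → ℝ)) :
    ruleDesign ξ n d = d.1.1 ⟨n, h⟩ := by
  rw [ruleDesign, dif_pos h]

lemma ruleDesign_of_le {n : ℕ} (h : n₀ ≤ n) (d : Source Dx Dc n₀ × (Fin n → ℝ)) :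
    ruleDesign ξ n d = (ξ n fun i => (designPts (ruleDesign ξ) d i, d.2 i), d.1.2 (n - n₀)) := by
  rw [ruleDesign, dif_neg (not_lt.2 h)]
  rfl

lemma ruleDesign_snd (n : ℕ) (d : Source Dx Dc n₀ × (Fin n → ℝ)) :
    (ruleDesign ξ n d).2 = d.1.context n := by
  rcases lt_or_ge n n₀ with h | h
  · rw [ruleDesign_of_lt h, Source.context, dif_pos h]
  · rw [ruleDesign_of_le h, Source.context, dif_neg (not_lt.2 h)]

lemma measurable_ruleDesign (hξ : ∀ n, Measurable (ξ n)) (n : ℕ) :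
    Measurable (ruleDesign (n₀ := n₀) ξ n) := by
  induction n using Nat.strong_induction_on with
  | _ n ih =>
    rcases lt_or_ge n n₀ with h | h
    · rw [funext fun d => ruleDesign_of_lt (ξ := ξ) h d]
      exact (measurable_pi_apply _).comp measurable_fst.fst
    · rw [funext fun d => ruleDesign_of_le (ξ := ξ) h d]
      refine ((hξ n).comp (measurable_pi_iff.2 fun i => Measurable.prodMk ?_ ?_)).prodMk ?_
      · exact (ih i i.2).comp (measurable_fst.prodMk
          (measurable_pi_iff.2 fun _ => (measurable_pi_apply _).comp measurable_snd))
      · exact (measurable_pi_apply i).comp measurable_snd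
      · exact (measurable_pi_apply _).comp measurable_fst.snd

/-- The observations of `g`, with noises `e`, at the points of the design `ζ`. -/
def designObs {𝓤 : Type*} (g : Pt Dx Dc → ℝ) (ζ : ∀ n, 𝓤 × (Fin n → ℝ) → Pt Dx Dc) (u : 𝓤)
    (e : ℕ → ℝ) (n : ℕ) : ℝ :=
  g (ζ n (u, fun i : Fin n => designObs g ζ u e i)) + e n
termination_by n
decreasing_by exact i.2

/-- Measurability is required only of the contexts before round `n`. The lemma is meant for the
σ-algebra of the past on `Ω`, for which the later contexts are not known to be measurable. -/
lemma measurable_rule_history {Ω 𝓕 : Type*} [MeasurableSpace Ω] [MeasurableSpace 𝓕]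
    {G : 𝓕 → Pt Dx Dc → ℝ} (hG : Measurable (Function.uncurry G)) (hξ : ∀ n, Measurable (ξ n))
    {F : Ω → 𝓕} (hF : Measurable F) {U : Ω → Source Dx Dc n₀} {e : ℕ → Ω → ℝ} {y : ℕ → Ω → ℝ}
    (hy : ∀ n ω, y n ω = G (F ω) (ruleDesign ξ n (U ω, obs y n ω)) + e n ω) (n : ℕ)
    (hU₁ : Measurable fun ω => (U ω).1)
    (hU₂ : ∀ i, n₀ ≤ i → i < n → Measurable fun ω => (U ω).2 (i - n₀))
    (he : ∀ i, Measurable (e i)) :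
    ∀ i < n, Measurable (fun ω => ruleDesign ξ i (U ω, obs y i ω)) ∧ Measurable (y i) := by
  intro i
  induction i using Nat.strong_induction_on with
  | _ i ih =>
    intro hi
    have h1 : Measurable (fun ω => ruleDesign ξ i (U ω, obs y i ω)) := by
      rcases lt_or_ge i n₀ with h | h
      · simp only [ruleDesign_of_lt h]
        exact (measurable_pi_apply _).comp hU₁
      · simp only [ruleDesign_of_le h]
        refine ((hξ i).comp (measurable_pi_iff.2 fun j => Measurable.prodMk ?_ ?_)).prodMk
          (hU₂ i h hi)
        · exact (ih j j.2 (j.2.trans hi)).1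
        · exact (ih j j.2 (j.2.trans hi)).2
    refine ⟨h1, ?_⟩
    rw [funext (hy i)]
    exact (hG.comp (hF.prodMk h1)).add (he i)

lemma measurable_rule_present {Ω 𝓕 : Type*} [MeasurableSpace Ω] [MeasurableSpace 𝓕]
    {G : 𝓕 → Pt Dx Dc → ℝ} (hG : Measurable (Function.uncurry G)) (hξ : ∀ n, Measurable (ξ n))
    {F : Ω → 𝓕} (hF : Measurable F) {U : Ω → Source Dx Dc n₀} {e : ℕ → Ω → ℝ} {y : ℕ → Ω → ℝ}
    (hy : ∀ n ω, y n ω = G (F ω) (ruleDesign ξ n (U ω, obs y n ω)) + e n ω) {n : ℕ} (hn : n₀ ≤ n)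
    (hU₁ : Measurable fun ω => (U ω).1)
    (hU₂ : ∀ i, n₀ ≤ i → i < n → Measurable fun ω => (U ω).2 (i - n₀))
    (he : ∀ i, Measurable (e i)) :
    Measurable fun ω => (designPts (ruleDesign ξ) (U ω, obs y n ω),
      (ruleDesign ξ n (U ω, obs y n ω)).1) := by
  have hist := measurable_rule_history hG hξ hF hy n hU₁ hU₂ he
  refine (measurable_pi_iff.2 fun i : Fin n => (hist i i.2).1).prodMk ?_
  simp only [ruleDesign_of_le hn]
  exact (hξ n).comp (measurable_pi_iff.2 fun i : Fin n => (hist i i.2).1.prodMk (hist i i.2).2)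

end Design

/-! ### Independence of the sources of randomness. -/

section Independence

variable {Ω α β γ : Type*} [MeasurableSpace Ω] [MeasurableSpace α] [MeasurableSpace β]
  [MeasurableSpace γ] {P : Measure Ω}

/-- The joint law of the three variables is a product of three laws, and products of measures are
associative. -/
lemma indepFun_prodMk_of_indepFun [IsProbabilityMeasure P] {A : Ω → α} {B : Ω → β} {C : Ω → γ}
    (hA : Measurable A) (hB : Measurable B) (hC : Measurable C) (h : IndepFun A (fun ω => (B ω, C ω)) P)
    (hBC : IndepFun B C P) : IndepFun (fun ω => (A ω, B ω)) C P := by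
  have := Measure.isProbabilityMeasure_map (μ := P) hA.aemeasurable
  have := Measure.isProbabilityMeasure_map (μ := P) hB.aemeasurable
  have := Measure.isProbabilityMeasure_map (μ := P) hC.aemeasurable
  have hAB : IndepFun A B P := h.comp (φ := id) (ψ := Prod.fst) measurable_id measurable_fst
  rw [indepFun_iff_map_prod_eq_prod_map_map (hA.prodMk hB).aemeasurable hC.aemeasurable,
    (indepFun_iff_map_prod_eq_prod_map_map hA.aemeasurable hB.aemeasurable).1 hAB]
  have h1 := (indepFun_iff_map_prod_eq_prod_map_map hA.aemeasurable
    (hB.prodMk hC).aemeasurable).1 h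
  rw [(indepFun_iff_map_prod_eq_prod_map_map hB.aemeasurable hC.aemeasurable).1 hBC] at h1
  have h2 : Measurable (MeasurableEquiv.prodAssoc.symm : α × β × γ ≃ᵐ (α × β) × γ) :=
    MeasurableEquiv.measurable _
  have h3 := congrArg (Measure.map (MeasurableEquiv.prodAssoc.symm : α × β × γ ≃ᵐ (α × β) × γ)) h1
  rw [Measure.map_map h2 (hA.prodMk (hB.prodMk hC))] at h3
  refine Eq.trans h3 ?_
  have h4 := (measurePreserving_prodAssoc (P.map A) (P.map B) (P.map C)).symm
  exact h4.map_eq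

lemma indepFun_past_present {ε : ℕ → Ω → α} (hε : ∀ n, Measurable (ε n)) (h : iIndepFun ε P)
    (n : ℕ) : IndepFun (fun ω (i : Fin n) => ε i ω) (ε n) P := by
  have h1 := h.indepFun_finset (Finset.range n) {n} (by simp) hε
  have hψ : Measurable fun v : ({n} : Finset ℕ) → α => v ⟨n, Finset.mem_singleton_self n⟩ :=
    measurable_pi_apply _
  exact h1.comp (φ := fun v (i : Fin n) => v ⟨i, Finset.mem_range.2 i.2⟩)
    (ψ := fun v : ({n} : Finset ℕ) → α => v ⟨n, Finset.mem_singleton_self n⟩)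
    (measurable_pi_iff.2 fun i => measurable_pi_apply _) hψ

/-- The σ-algebra of a subtype is pulled back from the ambient space, so `F` and its underlying
value generate the same σ-algebra. -/
lemma indepFun_subtype {s : Set α} {F : Ω → s} {C : Ω → γ}
    (h : IndepFun (fun ω => (F ω : α)) C P) : IndepFun F C P := by
  rw [IndepFun_iff_Indep] at h ⊢
  rwa [show (fun ω => (F ω : α)) = Subtype.val ∘ F from rfl, ← MeasurableSpace.comap_comp] at h

lemma comap_prodMk_le {A : Ω → α} {B : Ω → β} {m : MeasurableSpace Ω}
    (hA : MeasurableSpace.comap A inferInstance ≤ m)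
    (hB : MeasurableSpace.comap B inferInstance ≤ m) :
    MeasurableSpace.comap (fun ω => (A ω, B ω)) inferInstance ≤ m := by
  exact (Measurable.prodMk (measurable_iff_comap_le.2 hA) (measurable_iff_comap_le.2 hB)).comap_le

variable {α₀ α₁ α₂ α₃ : Type*} [MeasurableSpace α₀] [MeasurableSpace α₁] [MeasurableSpace α₂]
  [MeasurableSpace α₃] {f₀ : Ω → α₀} {f₁ : Ω → α₁} {f₂ : Ω → α₂} {f₃ : Ω → α₃}

lemma indepFun_of_iIndep_four (h₀ : Measurable f₀) (h₁ : Measurable f₁) (h₂ : Measurable f₂)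
    (h₃ : Measurable f₃)
    (h : iIndep ![MeasurableSpace.comap f₀ inferInstance, MeasurableSpace.comap f₁ inferInstance,
      MeasurableSpace.comap f₂ inferInstance, MeasurableSpace.comap f₃ inferInstance] P) :
    IndepFun f₀ (fun ω => (f₁ ω, f₂ ω)) P ∧ IndepFun (fun ω => (f₀ ω, f₁ ω, f₂ ω)) f₃ P ∧
      IndepFun (fun ω => (f₀ ω, f₁ ω, f₃ ω)) f₂ P := by
  set m := ![MeasurableSpace.comap f₀ inferInstance, MeasurableSpace.comap f₁ inferInstance,
      MeasurableSpace.comap f₂ inferInstance, MeasurableSpace.comap f₃ inferInstance] with hm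
  have hle : ∀ i, m i ≤ ‹MeasurableSpace Ω› := by
    intro i
    fin_cases i
    · exact h₀.comap_le
    · exact h₁.comap_le
    · exact h₂.comap_le
    · exact h₃.comap_le
  have key : ∀ S T : Set (Fin 4), Disjoint S T → Indep (⨆ i ∈ S, m i) (⨆ i ∈ T, m i) P :=
    fun S T hST => indep_iSup_of_disjoint hle h hST
  have e : ∀ (S : Set (Fin 4)) (i : Fin 4), i ∈ S → m i ≤ ⨆ i ∈ S, m i := fun S i hi =>
    le_iSup₂_of_le i hi le_rfl
  refine ⟨?_, ?_, ?_⟩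
  · rw [IndepFun_iff_Indep]
    refine indep_of_indep_of_le_left (indep_of_indep_of_le_right (key {0} {1, 2} (by simp)) ?_) ?_
    · exact comap_prodMk_le (e _ 1 (by simp)) (e _ 2 (by simp))
    · exact e _ 0 (by simp)
  · rw [IndepFun_iff_Indep]
    refine indep_of_indep_of_le_left (indep_of_indep_of_le_right (key {0, 1, 2} {3} (by simp)) ?_) ?_
    · exact e _ 3 (by simp)
    · exact comap_prodMk_le (e _ 0 (by simp)) (comap_prodMk_le (e _ 1 (by simp)) (e _ 2 (by simp)))
  · rw [IndepFun_iff_Indep]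
    refine indep_of_indep_of_le_left (indep_of_indep_of_le_right (key {0, 1, 3} {2} (by simp)) ?_) ?_
    · exact e _ 2 (by simp)
    · exact comap_prodMk_le (e _ 0 (by simp)) (comap_prodMk_le (e _ 1 (by simp)) (e _ 3 (by simp)))

end Independence

/-! ### Runs of the algorithm. -/

section Run

variable {Dx Dc : ℕ} {Ω : Type*} [MeasurableSpace Ω] {P : Measure Ω}
  {X : Set (Fin Dx → ℝ)} {C : Set (Fin Dc → ℝ)} {K : (Fin Dc → ℝ) → ℝ} {h : ℕ → Fin Dc → ℝ}
  {p : (Fin Dc → ℝ) → ℝ} {k : Pt Dx Dc → Pt Dx Dc → ℝ} {a b r σ : ℝ} {n₀ : ℕ}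
  {f : Ω → Pt Dx Dc → ℝ} {x : ℕ → Ω → Fin Dx → ℝ} {c : ℕ → Ω → Fin Dc → ℝ} {y ε : ℕ → Ω → ℝ}

namespace IsRun

lemma isSampling (hr : IsRun P X C K h p k a b r σ n₀ f x c y ε) : IsSampling P n₀ p c :=
  ⟨hr.context_measurable, hr.context_law, hr.context_indep⟩

lemma ae_context_mem (hr : IsRun P X C K h p k a b r σ n₀ f x c y ε) (hp : IsContextDensity C p) :
    ∀ᵐ ω ∂P, ∀ n, c n ω ∈ C := by
  refine ae_all_iff.2 fun n => ?_
  rcases lt_or_ge n n₀ with hn | hn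
  · exact Eventually.of_forall (hr.init_context_mem n hn)
  · have h1 : ∀ᵐ v ∂(P.map (c n)), v ∈ C := by
      rw [hr.context_law n hn, densityLaw,
        ae_withDensity_iff hp.continuous.measurable.ennreal_ofReal]
      refine Eventually.of_forall fun v hv => ?_
      by_contra hvC
      exact hv (by rw [hp.eq_zero v hvC, ENNReal.ofReal_zero])
    exact ae_of_ae_map (hr.context_measurable n).aemeasurable h1

/-- The decision rules of the run. -/
lemma exists_rule (hr : IsRun P X C K h p k a b r σ n₀ f x c y ε) :
    ∃ ξ : ∀ n, (Fin n → Pt Dx Dc × ℝ) → Fin Dx → ℝ, (∀ n, Measurable (ξ n)) ∧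
      ∀ n, n₀ ≤ n → ∀ ω, x n ω = ξ n (history x c y n ω) := by
  have : ∀ n, ∃ g : (Fin n → Pt Dx Dc × ℝ) → Fin Dx → ℝ, Measurable g ∧
      (n₀ ≤ n → ∀ ω, x n ω = g (history x c y n ω)) := by
    intro n
    rcases lt_or_ge n n₀ with hn | hn
    · exact ⟨fun _ => 0, measurable_const, fun h => absurd hn (not_lt.2 h)⟩
    -- Doob-Dynkin factorization through the history.
    · obtain ⟨g, hg, hxg⟩ := (hr.decision_measurable n hn).exists_eq_measurable_comp
      exact ⟨g, hg, fun _ ω => congrFun hxg ω⟩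
  choose ξ hξ hx using this
  exact ⟨ξ, hξ, hx⟩

/-- The initial design and the later contexts of the run. -/
def source (n₀ : ℕ) (x : ℕ → Ω → Fin Dx → ℝ) (c : ℕ → Ω → Fin Dc → ℝ) (ω : Ω) : Source Dx Dc n₀ :=
  (fun i => (x i ω, c i ω), fun n => c (n₀ + n) ω)

lemma context_source (n : ℕ) (ω : Ω) : (source n₀ x c ω).context n = c n ω := by
  rw [Source.context, source]
  split_ifs with hn
  · rfl
  · simp only
    rw [Nat.add_sub_of_le (not_lt.1 hn)]

lemma measurable_source (hr : IsRun P X C K h p k a b r σ n₀ f x c y ε) :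
    Measurable (source n₀ x c) :=
  (measurable_pi_iff.2 fun i : Fin n₀ =>
    (hr.init_measurable i i.2).prodMk (hr.context_measurable i)).prodMk
    (measurable_pi_iff.2 fun _ => hr.context_measurable _)

/-- A run agrees almost surely with sequential observations of a random element of the path space
at the points of the design given by the decision rules. -/
lemma exists_adaptive [IsProbabilityMeasure P] (hr : IsRun P X C K h p k a b r σ n₀ f x c y ε)
    (hp : IsContextDensity C p)
    (hZ : MeasurableSet (X ×ˢ C)) (hf : IsCenteredGP P (X ×ˢ C) k f)
    {F : Ω → PathSpace (X ×ˢ C)} (hF : Measurable F)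
    (hFf : ∀ᵐ ω ∂P, ∀ z : ↥(X ×ˢ C), (F ω).1 z = f ω z) :
    ∃ (ξ : ∀ n, (Fin n → Pt Dx Dc × ℝ) → Fin Dx → ℝ) (y' : ℕ → Ω → ℝ),
      IsAdaptive P evalPath σ F (source n₀ x c) ε y' (ruleDesign ξ) ∧
      (∀ᵐ ω ∂P, ∀ n, y' n ω = y n ω ∧
        ruleDesign ξ n (source n₀ x c ω, obs y' n ω) = (x n ω, c n ω)) ∧
      ∀ n, n₀ ≤ n → IndepFun (fun ω => (designPts (ruleDesign ξ) (source n₀ x c ω, obs y' n ω),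
        (ruleDesign ξ n (source n₀ x c ω, obs y' n ω)).1)) (c n) P := by
  obtain ⟨ξ, hξ, hx⟩ := hr.exists_rule
  set U := source n₀ x c with hU
  have hUm : Measurable U := hr.measurable_source
  -- The observations are rebuilt from the path `F`, so that the recursion holds for every `ω`. They
  -- agree with `y` off the null set where `F` differs from `f` or a context leaves `C`.
  set y' : ℕ → Ω → ℝ := fun n ω =>
    designObs (evalPath (F ω)) (ruleDesign ξ) (U ω) (fun n => ε n ω) n with hy'
  have hobs : ∀ n ω, y' n ω = evalPath (F ω) (ruleDesign ξ n (U ω, obs y' n ω)) + ε n ω := by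
    intro n ω
    simp only [hy']
    rw [designObs]
    rfl
  have hG := isGaussField_evalPath hZ hf hF hFf
  have hfm : Measurable fun ω (z : ↥(X ×ˢ C)) => f ω z :=
    measurable_pi_iff.2 fun z => hf.measurable z z.2
  have hinit : Measurable fun ω (i : Fin n₀) => (x i ω, c i ω) :=
    measurable_pi_iff.2 fun i : Fin n₀ => (hr.init_measurable i i.2).prodMk (hr.context_measurable i)
  have hctx : Measurable fun ω n => c (n₀ + n) ω :=
    measurable_pi_iff.2 fun _ => hr.context_measurable _
  have hnoise : Measurable fun ω n => ε n ω := measurable_pi_iff.2 fun _ => hr.noise_measurable _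
  obtain ⟨i1, i2, i3⟩ := indepFun_of_iIndep_four hfm hinit hctx hnoise hr.indep
  have hFf' : (fun ω (z : ↥(X ×ˢ C)) => f ω z) =ᵐ[P] fun ω => (F ω).1 := by
    filter_upwards [hFf] with ω hω
    ext z
    exact (hω z).symm
  have j1 : IndepFun F U P := indepFun_subtype (i1.congr hFf' EventuallyEq.rfl)
  have hval : Measurable fun ω => (F ω).1 := measurable_subtype_coe.comp hF
  -- Independence is assumed for the values of `f`. It passes to `F` because the values agree almost
  -- surely and because `F` is measurable with respect to its values.
  have key : ∀ {β γ : Type _} [MeasurableSpace β] [MeasurableSpace γ] {B : Ω → β} {D : Ω → γ},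
      IndepFun (fun ω => ((fun z : ↥(X ×ˢ C) => f ω z), B ω)) D P →
        IndepFun (fun ω => (F ω, B ω)) D P := by
    intro β γ _ _ B D hBD
    have h1 : IndepFun (fun ω => ((F ω).1, B ω)) D P := by
      refine hBD.congr ?_ EventuallyEq.rfl
      filter_upwards [hFf'] with ω hω
      rw [← hω]
    rw [IndepFun_iff_Indep] at h1 ⊢
    refine indep_of_indep_of_le_left h1 ?_
    set W := fun ω => ((F ω).1, B ω)
    have hW : Measurable[MeasurableSpace.comap W inferInstance] W := comap_measurable W
    exact (((measurable_fst.comp hW).subtype_mk (h := fun ω => (F ω).2)).prodMk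
      (measurable_snd.comp hW)).comap_le
  have j2 : IndepFun (fun ω => (F ω, U ω)) (fun ω n => ε n ω) P := key i2
  have j3 := key i3
  refine ⟨ξ, y', ⟨hF, hUm, hr.noise_measurable, measurable_ruleDesign hξ, hG, j1, hr.noise_law, ?_,
    hobs⟩, ?_, ?_⟩
  · intro n
    have h1 : IndepFun (fun ω => (F ω, U ω)) (fun ω => ((fun i : Fin n => ε i ω), ε n ω)) P :=
      j2.comp (φ := id) (ψ := fun e : ℕ → ℝ => ((fun i : Fin n => e i), e n)) measurable_id
        ((measurable_pi_iff.2 fun i => measurable_pi_apply _).prodMk (measurable_pi_apply _))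
    have h2 := indepFun_prodMk_of_indepFun (hF.prodMk hUm)
      (measurable_pi_iff.2 fun i : Fin n => hr.noise_measurable i) (hr.noise_measurable n) h1
      (indepFun_past_present hr.noise_measurable hr.noise_indep n)
    exact h2.comp (φ := fun q => (q.1.1, q.1.2, q.2)) (ψ := id)
      (measurable_fst.fst.prodMk (measurable_fst.snd.prodMk measurable_snd)) measurable_id
  · filter_upwards [hFf, hr.ae_context_mem hp] with ω hω hcω
    intro n
    induction n using Nat.strong_induction_on with
    | _ n ih =>
      have h1 : ruleDesign ξ n (U ω, obs y' n ω) = (x n ω, c n ω) := by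
        refine Prod.ext ?_ ?_
        · rcases lt_or_ge n n₀ with hn | hn
          · rw [ruleDesign_of_lt hn]
            rfl
          · rw [ruleDesign_of_le hn, hx n hn ω]
            change ξ n _ = _
            congr 1
            ext1 i
            refine Prod.ext ?_ (ih i i.2).1
            exact (ih i i.2).2
        · rw [ruleDesign_snd]
          exact context_source n ω
      refine ⟨?_, h1⟩
      rw [hobs, h1, hr.observation, evalPath_of_mem _ (⟨hr.decision_mem n ω, hcω n⟩ :
        (x n ω, c n ω) ∈ X ×ˢ C), hω]
  -- The design points and the decision of round `n` are measurable with respect to the path, the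
  -- initial design, the noises and the contexts drawn before round `n`; all these are jointly
  -- independent of `c n`.
  · intro n hn
    have hcn : c n = fun ω => c (n₀ + (n - n₀)) ω := by
      rw [Nat.add_sub_of_le hn]
    have h1 : IndepFun (fun ω => (F ω, (fun (i : Fin n₀) => (x i ω, c i ω)), fun n => ε n ω))
        (fun ω => ((fun i : Fin (n - n₀) => c (n₀ + i) ω), c (n₀ + (n - n₀)) ω)) P :=
      j3.comp (φ := id) (ψ := fun e : ℕ → Fin Dc → ℝ => ((fun i : Fin (n - n₀) => e i), e (n - n₀)))
        measurable_id
        ((measurable_pi_iff.2 fun i => measurable_pi_apply _).prodMk (measurable_pi_apply _))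
    have hA := hF.prodMk (hinit.prodMk hnoise)
    have hB : Measurable fun ω => fun i : Fin (n - n₀) => c (n₀ + i) ω :=
      measurable_pi_iff.2 fun i => hr.context_measurable _
    have h2 := indepFun_prodMk_of_indepFun hA hB (hr.context_measurable _) h1
      (indepFun_past_present (fun n => hr.context_measurable (n₀ + n)) hr.context_indep (n - n₀))
    rw [IndepFun_iff_Indep] at h2 ⊢
    rw [hcn]
    refine indep_of_indep_of_le_left h2 ?_
    set W := fun ω => ((F ω, (fun (i : Fin n₀) => (x i ω, c i ω)), fun n => ε n ω),
      fun i : Fin (n - n₀) => c (n₀ + i) ω)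
    have hW : Measurable[MeasurableSpace.comap W inferInstance] W := comap_measurable W
    have hUm₁ : Measurable[MeasurableSpace.comap W inferInstance] fun ω => (U ω).1 :=
      measurable_fst.snd.fst.comp hW
    have hU₂ : ∀ i, n₀ ≤ i → i < n → Measurable[MeasurableSpace.comap W inferInstance]
        fun ω => (U ω).2 (i - n₀) := fun i hi hin =>
      (measurable_pi_apply (⟨i - n₀, by omega⟩ : Fin (n - n₀))).comp (measurable_snd.comp hW)
    have he : ∀ i, Measurable[MeasurableSpace.comap W inferInstance] (ε i) := fun i =>
      (measurable_pi_apply i).comp (measurable_fst.snd.snd.comp hW)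
    exact (@measurable_rule_present Dx Dc n₀ ξ Ω _ (MeasurableSpace.comap W inferInstance) _
      evalPath hG.measurable hξ F (measurable_fst.fst.comp hW) U ε y' hobs n hn hUm₁
      hU₂ he).comap_le

end IsRun

end Run

end SBOKDE

end

noncomputable section

namespace SBOKDE

/-! ### The exploration parameter and the net of decisions. -/

section Exploration

variable {Dx : ℕ} {a b r : ℝ}

/-- A finite net of the mesh `r / m` in a subset of `[0, r]^D`. -/
lemma exists_net {X : Set (Fin Dx → ℝ)} (hr : 0 < r) (hX : X ⊆ Set.Icc 0 (fun _ => r)) {m : ℕ}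
    (hm : 0 < m) :
    ∃ N : Finset (Fin Dx → ℝ), (∀ x ∈ N, x ∈ X) ∧ N.card ≤ (m + 1) ^ Dx ∧
      ∀ x ∈ X, ∃ x' ∈ N, ‖x - x'‖ ≤ r / m := by
  classical
  -- The grid of the joint space, used without context coordinates.
  set cell : (Fin Dx → ℝ) → (Fin Dx ⊕ Fin 0 → Fin (m + 1)) :=
    fun x => gridCell (Dc := 0) r m (x, 0) with hcell
  have hmem : ∀ x ∈ X, ∀ i, Sum.elim x (0 : Fin 0 → ℝ) i ∈ Set.Icc 0 r := by
    rintro x hx (i | i)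
    · exact ⟨(hX hx).1 i, (hX hx).2 i⟩
    · exact i.elim0
  refine ⟨(Finset.univ.filter fun v => v ∈ cell '' X).image (Function.invFunOn cell X), ?_, ?_, ?_⟩
  · intro x hx
    obtain ⟨v, hv, rfl⟩ := Finset.mem_image.1 hx
    exact Function.invFunOn_mem (Finset.mem_filter.1 hv).2
  · refine Finset.card_image_le.trans ((Finset.card_le_univ _).trans ?_)
    simp
  · intro x hx
    have hv : ∃ x' ∈ X, cell x' = cell x := ⟨x, hx, rfl⟩
    refine ⟨Function.invFunOn cell X (cell x), Finset.mem_image.2 ⟨cell x,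
      Finset.mem_filter.2 ⟨Finset.mem_univ _, x, hx, rfl⟩, rfl⟩, ?_⟩
    have h1 := norm_sub_le_of_gridCell_eq (Dc := 0) hr hm (z := (x, 0))
      (w := (Function.invFunOn cell X (cell x), 0)) (hmem x hx)
      (hmem _ (Function.invFunOn_mem hv)) (Function.invFunOn_eq hv).symm
    refine le_trans ?_ h1
    rw [Prod.norm_def]
    exact le_max_left _ _

/-- For `u ≥ s` one has `u - s ≤ exp((1 + s)(u - s))`, and the moment generating function at `1 + s`
gives the exponent `(1 + s)²/2 - (1 + s)s = 1/2 - s²/2`. -/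
lemma lintegral_ofReal_sub_gaussianReal_le {s : ℝ} (hs : 0 ≤ s) :
    ∫⁻ u, ENNReal.ofReal (u - s) ∂gaussianReal 0 1 ≤
      ENNReal.ofReal (Real.exp (1 / 2 - s ^ 2 / 2)) := by
  have hint : Integrable (fun u => Real.exp ((1 + s) * u)) (gaussianReal 0 1) :=
    integrable_exp_mul_gaussianReal (1 + s)
  have hmgf : ∫ u, Real.exp ((1 + s) * u) ∂gaussianReal 0 1 = Real.exp ((1 + s) ^ 2 / 2) := by
    have h1 := congrFun (mgf_id_gaussianReal (μ := 0) (v := 1)) (1 + s)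
    simp only [mgf, id] at h1
    rw [h1]
    simp
  calc ∫⁻ u, ENNReal.ofReal (u - s) ∂gaussianReal 0 1
      ≤ ∫⁻ u, ENNReal.ofReal (Real.exp ((1 + s) * u) * Real.exp (-((1 + s) * s)))
          ∂gaussianReal 0 1 := by
        refine lintegral_mono fun u => ?_
        rcases le_total u s with hu | hu
        · rw [ENNReal.ofReal_of_nonpos (by linarith)]
          exact zero_le
        · refine ENNReal.ofReal_le_ofReal ?_
          rw [← Real.exp_add]
          have h1 := Real.add_one_le_exp ((1 + s) * u + -((1 + s) * s))
          nlinarith [mul_nonneg hs (sub_nonneg.2 hu)]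
    _ = ENNReal.ofReal (Real.exp (1 / 2 - s ^ 2 / 2)) := by
        rw [← ofReal_integral_eq_lintegral_ofReal (hint.mul_const _)
          (Eventually.of_forall fun u => by positivity), integral_mul_const, hmgf, ← Real.exp_add]
        congr 2
        ring

/-- Up to a constant this is `t^(-2) t^(-2 Dx)`: the second factor pays for a net of about `t^(2
Dx)` decisions, and the first remains summable. -/
lemma exp_neg_half_beta (ha : 0 < a) (hb : 0 < b) (hr : 0 < r) (hD : 0 < Dx) {t : ℕ} (ht : 1 ≤ t) :
    Real.exp (-(beta Dx a b r t / 2)) =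
      √(2 * Real.pi) / (t : ℝ) ^ 2 * (2 / ((t : ℝ) ^ 2 * Dx * a * b * r * √Real.pi)) ^ Dx := by
  have ht' : (0 : ℝ) < t := by exact_mod_cast ht
  have hD' : (0 : ℝ) < Dx := by exact_mod_cast hD
  have hpi := Real.pi_pos
  have h1 : 0 < (t : ℝ) ^ 2 / √(2 * Real.pi) := by positivity
  have h2 : 0 < (t : ℝ) ^ 2 * Dx * a * b * r * √Real.pi / 2 := by positivity
  have h3 : -(beta Dx a b r t / 2) = -Real.log ((t : ℝ) ^ 2 / √(2 * Real.pi)) +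
      (-Real.log ((t : ℝ) ^ 2 * Dx * a * b * r * √Real.pi / 2)) * Dx := by
    rw [beta]
    ring
  rw [h3, Real.exp_add, Real.exp_mul, ← Real.log_inv, ← Real.log_inv, Real.exp_log (inv_pos.2 h1),
    Real.exp_log (inv_pos.2 h2), Real.rpow_natCast, inv_div, inv_div]

lemma beta_mono (ha : 0 < a) (hb : 0 < b) (hr : 0 < r) (hD : 0 < Dx) {s t : ℕ} (hs : 1 ≤ s)
    (hst : s ≤ t) : beta Dx a b r s ≤ beta Dx a b r t := by
  have hs' : (0 : ℝ) < s := by exact_mod_cast hs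
  have hst' : (s : ℝ) ≤ t := by exact_mod_cast hst
  have hD' : (0 : ℝ) < Dx := by exact_mod_cast hD
  have hpi := Real.pi_pos
  unfold beta
  gcongr

/-- The exploration parameter grows slower than every power. -/
lemma exists_beta_le (ha : 0 < a) (hb : 0 < b) (hr : 0 < r) (hD : 0 < Dx) {η : ℝ} (hη : 0 < η) :
    ∃ A : ℝ, 0 ≤ A ∧ ∀ n : ℕ, 1 ≤ n → beta Dx a b r (n + 1) ≤ A * (n : ℝ) ^ η := by
  have hD' : (0 : ℝ) < Dx := by exact_mod_cast hD
  have hpi := Real.pi_pos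
  set u : ℝ := (√(2 * Real.pi))⁻¹ with hu
  set v : ℝ := Dx * a * b * r * √Real.pi / 2 with hv
  have hu0 : 0 < u := by positivity
  have hv0 : 0 < v := by positivity
  set w : ℝ := 2 * Real.log u + 2 * Dx * Real.log v with hw
  refine ⟨|w| + (4 + 4 * Dx) * (1 + 1 / η), by positivity, fun n hn => ?_⟩
  have hn1 : (1 : ℝ) ≤ n := by exact_mod_cast hn
  have hn0 : (0 : ℝ) < n := by linarith
  have h1 : beta Dx a b r (n + 1) = w + (4 + 4 * Dx) * Real.log ((n : ℝ) + 1) := by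
    have e1 : (((n + 1 : ℕ) : ℝ)) ^ 2 / √(2 * Real.pi) = ((n : ℝ) + 1) ^ 2 * u := by
      push_cast
      rw [hu, div_eq_mul_inv]
    have e2 : (((n + 1 : ℕ) : ℝ)) ^ 2 * Dx * a * b * r * √Real.pi / 2 = ((n : ℝ) + 1) ^ 2 * v := by
      push_cast
      rw [hv]
      ring
    rw [beta, e1, e2, Real.log_mul (by positivity) hu0.ne', Real.log_mul (by positivity) hv0.ne',
      Real.log_pow, hw]
    push_cast
    ring
  have h2 : Real.log ((n : ℝ) + 1) ≤ 1 + (n : ℝ) ^ η / η := by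
    calc Real.log ((n : ℝ) + 1) ≤ Real.log (2 * n) :=
          Real.log_le_log (by positivity) (by linarith)
      _ = Real.log 2 + Real.log n := Real.log_mul (by norm_num) hn0.ne'
      _ ≤ 1 + (n : ℝ) ^ η / η :=
          add_le_add (by linarith [Real.log_two_lt_d9]) (Real.log_le_rpow_div hn0.le hη)
  have h3 : 1 ≤ (n : ℝ) ^ η := Real.one_le_rpow hn1 hη.le
  have h4 : Real.log ((n : ℝ) + 1) ≤ (1 + 1 / η) * (n : ℝ) ^ η := by
    refine h2.trans ?_
    rw [add_mul, one_mul, one_div_mul_eq_div]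
    linarith
  have h5 : w ≤ |w| * (n : ℝ) ^ η := (le_abs_self w).trans (le_mul_of_one_le_right (abs_nonneg _) h3)
  rw [h1]
  refine (add_le_add h5 (mul_le_mul_of_nonneg_left h4 (by positivity))).trans_eq ?_
  ring

end Exploration

/-! ### Expected deviations under the posterior. -/

section PosteriorExpectation

variable {Dx Dc : ℕ} {Ω 𝓕 𝓤 γ : Type*} [MeasurableSpace Ω] [MeasurableSpace 𝓕] [MeasurableSpace 𝓤]
  [MeasurableSpace γ] {P : Measure Ω} {G : 𝓕 → Pt Dx Dc → ℝ} {σ : ℝ} {F : Ω → 𝓕} {U : Ω → 𝓤}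
  {ε y : ℕ → Ω → ℝ} {ζ : ∀ n, 𝓤 × (Fin n → ℝ) → Pt Dx Dc}

namespace IsAdaptive

/-- Expectations, integrated over a family of adaptive query points, under the posterior. -/
lemma lintegral_lintegral_posterior (h : IsAdaptive P G σ F U ε y ζ) [IsProbabilityMeasure P]
    (hσ : 0 < σ) {ν : Measure γ} [SFinite ν] {n : ℕ} {w : 𝓤 × (Fin n → ℝ) → γ → Pt Dx Dc}
    (hw : Measurable (Function.uncurry w)) {Φ : (𝓤 × (Fin n → ℝ)) × γ × ℝ → ℝ≥0∞}
    (hΦ : Measurable Φ) :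
    ∫⁻ ω, (∫⁻ c, Φ ((U ω, obs y n ω), c, G (F ω) (w (U ω, obs y n ω) c)) ∂ν) ∂P =
      ∫⁻ ω, (∫⁻ c, (∫⁻ s, Φ ((U ω, obs y n ω), c,
        postMean (covKer (P.map F) G) σ (designPts ζ (U ω, obs y n ω)) (obs y n ω)
          (w (U ω, obs y n ω) c) +
        postStd (covKer (P.map F) G) σ (designPts ζ (U ω, obs y n ω)) (w (U ω, obs y n ω) c) * s)
          ∂gaussianReal 0 1) ∂ν) ∂P := by
  have hd : Measurable fun ω => (U ω, obs y n ω) := h.measurable_U.prodMk (h.measurable_obs n)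
  have hdc : Measurable fun q : Ω × γ => ((U q.1, obs y n q.1), q.2) :=
    (hd.comp measurable_fst).prodMk measurable_snd
  have hwc : Measurable fun q : Ω × γ => w (U q.1, obs y n q.1) q.2 := hw.comp hdc
  have hκ : Measurable (Function.uncurry (covKer (P.map F) G)) := h.field.measurable_covKer
  have hpts : ∀ i, Measurable fun q : Ω × γ => designPts ζ (U q.1, obs y n q.1) i := fun i =>
    (measurable_designPts h.measurable_design i).comp (hd.comp measurable_fst)
  have hm := measurable_postMean (σ := σ) hκ hpts ((h.measurable_obs n).comp measurable_fst) hwc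
  have hs := measurable_postStd (σ := σ) hκ hpts hwc
  have hleft : Measurable fun q : Ω × γ =>
      Φ ((U q.1, obs y n q.1), q.2, G (F q.1) (w (U q.1, obs y n q.1) q.2)) :=
    hΦ.comp ((hd.comp measurable_fst).prodMk (measurable_snd.prodMk
      (h.field.measurable.comp ((h.measurable_F.comp measurable_fst).prodMk hwc))))
  have hright : Measurable fun q : Ω × γ => ∫⁻ s, Φ ((U q.1, obs y n q.1), q.2,
        postMean (covKer (P.map F) G) σ (designPts ζ (U q.1, obs y n q.1)) (obs y n q.1)
          (w (U q.1, obs y n q.1) q.2) +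
        postStd (covKer (P.map F) G) σ (designPts ζ (U q.1, obs y n q.1))
          (w (U q.1, obs y n q.1) q.2) * s) ∂gaussianReal 0 1 := by
    refine Measurable.lintegral_prod_right' (f := fun q : (Ω × γ) × ℝ =>
      Φ ((U q.1.1, obs y n q.1.1), q.1.2,
        postMean (covKer (P.map F) G) σ (designPts ζ (U q.1.1, obs y n q.1.1)) (obs y n q.1.1)
          (w (U q.1.1, obs y n q.1.1) q.1.2) +
        postStd (covKer (P.map F) G) σ (designPts ζ (U q.1.1, obs y n q.1.1))
          (w (U q.1.1, obs y n q.1.1) q.1.2) * q.2)) ?_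
    exact hΦ.comp ((hd.comp measurable_fst.fst).prodMk (measurable_fst.snd.prodMk
      ((hm.comp measurable_fst).add ((hs.comp measurable_fst).mul measurable_snd))))
  refine (lintegral_lintegral_swap hleft.aemeasurable).trans
    (Eq.trans ?_ (lintegral_lintegral_swap hright.aemeasurable).symm)
  refine lintegral_congr fun c => ?_
  exact h.lintegral_posterior hσ (w := fun d => w d c) (hw.comp (measurable_id.prodMk measurable_const))
    (Φ := fun q => Φ (q.1, c, q.2))
    (hΦ.comp (measurable_fst.prodMk (measurable_const.prodMk measurable_snd)))

variable {n : ℕ} {w : 𝓤 × (Fin n → ℝ) → γ → Pt Dx Dc} {φ : 𝓤 × (Fin n → ℝ) → γ → ℝ≥0∞}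

/-- The deviation of the field from its posterior mean is symmetric in expectation. -/
lemma lintegral_mul_postMean_sub_eq (h : IsAdaptive P G σ F U ε y ζ) [IsProbabilityMeasure P]
    (hσ : 0 < σ) {ν : Measure γ} [SFinite ν] (hw : Measurable (Function.uncurry w))
    (hφ : Measurable (Function.uncurry φ)) :
    ∫⁻ ω, (∫⁻ c, φ (U ω, obs y n ω) c * ENNReal.ofReal (
        postMean (covKer (P.map F) G) σ (designPts ζ (U ω, obs y n ω)) (obs y n ω)
          (w (U ω, obs y n ω) c) - G (F ω) (w (U ω, obs y n ω) c)) ∂ν) ∂P =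
      ∫⁻ ω, (∫⁻ c, φ (U ω, obs y n ω) c * ENNReal.ofReal (G (F ω) (w (U ω, obs y n ω) c) -
        postMean (covKer (P.map F) G) σ (designPts ζ (U ω, obs y n ω)) (obs y n ω)
          (w (U ω, obs y n ω) c)) ∂ν) ∂P := by
  have hκ : Measurable (Function.uncurry (covKer (P.map F) G)) := h.field.measurable_covKer
  have hm : Measurable fun q : (𝓤 × (Fin n → ℝ)) × γ × ℝ =>
      postMean (covKer (P.map F) G) σ (designPts ζ q.1) q.1.2 (w q.1 q.2.1) :=
    measurable_postMean hκ
      (fun i => (measurable_designPts h.measurable_design i).comp measurable_fst)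
      measurable_fst.snd (hw.comp (measurable_fst.prodMk measurable_snd.fst))
  have hφ' : Measurable fun q : (𝓤 × (Fin n → ℝ)) × γ × ℝ => φ q.1 q.2.1 :=
    hφ.comp (measurable_fst.prodMk measurable_snd.fst)
  have h1 := h.lintegral_lintegral_posterior hσ (ν := ν) hw (Φ := fun q => φ q.1 q.2.1 *
    ENNReal.ofReal (postMean (covKer (P.map F) G) σ (designPts ζ q.1) q.1.2 (w q.1 q.2.1) - q.2.2))
    (hφ'.mul (hm.sub measurable_snd.snd).ennreal_ofReal)
  have h2 := h.lintegral_lintegral_posterior hσ (ν := ν) hw (Φ := fun q => φ q.1 q.2.1 *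
    ENNReal.ofReal (q.2.2 - postMean (covKer (P.map F) G) σ (designPts ζ q.1) q.1.2 (w q.1 q.2.1)))
    (hφ'.mul (measurable_snd.snd.sub hm).ennreal_ofReal)
  refine h1.trans (Eq.trans ?_ h2.symm)
  refine lintegral_congr fun ω => lintegral_congr fun c => ?_
  simp only [sub_add_cancel_left, add_sub_cancel_left]
  have hsymm : (gaussianReal 0 1).map (fun s => -s) = gaussianReal 0 1 := by
    rw [gaussianReal_map_neg, neg_zero]
  have hflip : ∀ (A : ℝ≥0∞) (τ : ℝ), ∫⁻ s, A * ENNReal.ofReal (-(τ * s)) ∂gaussianReal 0 1 =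
      ∫⁻ s, A * ENNReal.ofReal (τ * s) ∂gaussianReal 0 1 := by
    intro A τ
    have hΨ : Measurable fun s : ℝ => A * ENNReal.ofReal (-(τ * s)) :=
      (measurable_const_mul τ).neg.ennreal_ofReal.const_mul A
    conv_lhs => rw [← hsymm]
    rw [lintegral_map hΨ measurable_neg]
    simp only [mul_neg, neg_neg]
  exact hflip _ _

/-- The expected excess of the field over its upper confidence bound. -/
lemma lintegral_mul_sub_ucb_le (h : IsAdaptive P G σ F U ε y ζ) [IsProbabilityMeasure P]
    (hσ : 0 < σ) (hk : ∀ z, covKer (P.map F) G z z ≤ 1) {ν : Measure γ} [SFinite ν]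
    (hw : Measurable (Function.uncurry w)) (hφ : Measurable (Function.uncurry φ)) (β : ℝ) :
    ∫⁻ ω, (∫⁻ c, φ (U ω, obs y n ω) c * ENNReal.ofReal (G (F ω) (w (U ω, obs y n ω) c) -
        ucb (covKer (P.map F) G) σ β (designPts ζ (U ω, obs y n ω)) (obs y n ω)
          (w (U ω, obs y n ω) c)) ∂ν) ∂P ≤
      (∫⁻ ω, (∫⁻ c, φ (U ω, obs y n ω) c ∂ν) ∂P) *
        ENNReal.ofReal (Real.exp (1 / 2 - √β ^ 2 / 2)) := by
  have hκ : Measurable (Function.uncurry (covKer (P.map F) G)) := h.field.measurable_covKer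
  have hpts : ∀ i, Measurable fun q : (𝓤 × (Fin n → ℝ)) × γ × ℝ => designPts ζ q.1 i := fun i =>
    (measurable_designPts h.measurable_design i).comp measurable_fst
  have hw' : Measurable fun q : (𝓤 × (Fin n → ℝ)) × γ × ℝ => w q.1 q.2.1 :=
    hw.comp (measurable_fst.prodMk measurable_snd.fst)
  have hm : Measurable fun q : (𝓤 × (Fin n → ℝ)) × γ × ℝ =>
      ucb (covKer (P.map F) G) σ β (designPts ζ q.1) q.1.2 (w q.1 q.2.1) :=
    (measurable_postMean hκ hpts measurable_fst.snd hw').add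
      ((measurable_postStd hκ hpts hw').const_mul _)
  have hφ' : Measurable fun q : (𝓤 × (Fin n → ℝ)) × γ × ℝ => φ q.1 q.2.1 :=
    hφ.comp (measurable_fst.prodMk measurable_snd.fst)
  have h2 := h.lintegral_lintegral_posterior hσ (ν := ν) hw (Φ := fun q => φ q.1 q.2.1 *
    ENNReal.ofReal (q.2.2 - ucb (covKer (P.map F) G) σ β (designPts ζ q.1) q.1.2 (w q.1 q.2.1)))
    (hφ'.mul (measurable_snd.snd.sub hm).ennreal_ofReal)
  refine h2.trans_le ?_
  have hd : Measurable fun ω => (U ω, obs y n ω) := h.measurable_U.prodMk (h.measurable_obs n)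
  have hφ'' : Measurable fun ω => ∫⁻ c, φ (U ω, obs y n ω) c ∂ν :=
    hφ.lintegral_prod_right'.comp hd
  rw [← lintegral_mul_const _ hφ'']
  refine lintegral_mono fun ω => ?_
  have hφω : Measurable fun c => φ (U ω, obs y n ω) c := Measurable.of_uncurry_left hφ
  rw [← lintegral_mul_const _ hφω]
  refine lintegral_mono fun c => ?_
  have hmul : ∀ (A : ℝ≥0∞) (m τ q : ℝ),
      ∫⁻ s, A * ENNReal.ofReal (m + τ * s - q) ∂gaussianReal 0 1 =
        A * ∫⁻ s, ENNReal.ofReal (m + τ * s - q) ∂gaussianReal 0 1 := by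
    intro A m τ q
    have hΨ : Measurable fun s : ℝ => ENNReal.ofReal (m + τ * s - q) :=
      (((measurable_const_mul τ).const_add m).sub_const q).ennreal_ofReal
    exact lintegral_const_mul _ hΨ
  simp only
  rw [hmul]
  refine mul_le_mul' le_rfl ((lintegral_mono fun s => ?_).trans
    (lintegral_ofReal_sub_gaussianReal_le (Real.sqrt_nonneg β)))
  rw [ucb]
  set τ := postStd (covKer (P.map F) G) σ (designPts ζ (U ω, obs y n ω)) (w (U ω, obs y n ω) c)
    with hτ
  have hτ0 : 0 ≤ τ := Real.sqrt_nonneg _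
  have hτ1 : τ ≤ 1 := by
    rw [hτ, postStd, Real.sqrt_le_one]
    refine (postCov_self_le h.field.covKer_eq_inner hσ _ _).trans ?_
    rw [h.field.norm_feature_sq]
    exact hk _
  -- For a standard normal `s` the excess over the bound is `τ (s - √β)`; the factor `τ ≤ 1` can be
  -- dropped from its positive part.
  have e : ∀ m : ℝ, m + τ * s - (m + √β * τ) = τ * (s - √β) := fun m => by ring
  rw [e, ENNReal.ofReal_mul hτ0]
  exact mul_le_of_le_one_left' (ENNReal.ofReal_le_one.2 hτ1)

end IsAdaptive

end PosteriorExpectation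

end SBOKDE

end

noncomputable section

namespace SBOKDE

/-! ### Pathwise decomposition of the regret. -/

section Decomposition

variable {γ : Type*} [MeasurableSpace γ] {ν : Measure γ}

lemma lintegral_ofReal_mul_ofReal {q w : γ → ℝ} (hq : Integrable q ν) (hq0 : ∀ c, 0 ≤ q c)
    (hw : Measurable w) {B : ℝ} (hB : ∀ c, |w c| ≤ B) :
    Integrable (fun c => q c * max (w c) 0) ν ∧
      ∫⁻ c, ENNReal.ofReal (q c) * ENNReal.ofReal (w c) ∂ν =
        ENNReal.ofReal (∫ c, q c * max (w c) 0 ∂ν) := by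
  have hi : Integrable (fun c => q c * max (w c) 0) ν := by
    refine hq.mul_bdd (c := B) (hw.max measurable_const).aestronglyMeasurable
      (Eventually.of_forall fun c => ?_)
    rw [Real.norm_eq_abs, abs_of_nonneg (le_max_right _ _)]
    exact max_le ((le_abs_self _).trans (hB c)) ((abs_nonneg _).trans (hB c))
  refine ⟨hi, ?_⟩
  rw [ofReal_integral_eq_lintegral_ofReal hi
    (Eventually.of_forall fun c => mul_nonneg (hq0 c) (le_max_right _ _))]
  refine lintegral_congr fun c => ?_
  rw [ENNReal.ofReal_mul (hq0 c), ENNReal.ofReal_max, ENNReal.ofReal_zero, max_eq_left zero_le]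

/-- Decomposition of the regret of a maximizer of an estimated upper confidence bound: `g₀`, `g₁`,
`g₂` are the rewards at the optimum, at a point near it, and at the decision. -/
lemma ofReal_regret_add_le {p q g₀ g₁ g₂ u m τ : γ → ℝ} {S B δ s : ℝ} (hp : Integrable p ν)
    (hp0 : ∀ c, 0 ≤ p c) (hp1 : ∫ c, p c ∂ν ≤ 1) (hq : Integrable q ν) (hq0 : ∀ c, 0 ≤ q c)
    (hg₀ : Measurable g₀) (hg₁ : Measurable g₁) (hg₂ : Measurable g₂) (hu : Measurable u)
    (hm : Measurable m) (hτ : Measurable τ) (hS₀ : ∀ c, |g₀ c| ≤ S) (hS₁ : ∀ c, |g₁ c| ≤ S)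
    (hS₂ : ∀ c, |g₂ c| ≤ S) (huB : ∀ c, |u c| ≤ B) (hmB : ∀ c, |m c| ≤ B) (hτB : ∀ c, |τ c| ≤ B)
    (hδ0 : 0 ≤ δ) (hδ : ∀ᵐ c ∂ν, g₀ c - g₁ c ≤ δ) (hS : 0 ≤ S) (hs : 0 ≤ s) (hτ0 : ∀ c, 0 ≤ τ c)
    (hmax : ∫ c, q c * u c ∂ν ≤ ∫ c, q c * (m c + s * τ c) ∂ν)
    (hR : 0 ≤ ∫ c, p c * g₀ c ∂ν - ∫ c, p c * g₂ c ∂ν) :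
    ENNReal.ofReal (∫ c, p c * g₀ c ∂ν - ∫ c, p c * g₂ c ∂ν) +
        ∫⁻ c, ENNReal.ofReal (q c) * ENNReal.ofReal (g₂ c - m c) ∂ν ≤
      ENNReal.ofReal δ + ENNReal.ofReal (2 * S) * (∫⁻ c, ENNReal.ofReal |q c - p c| ∂ν) +
        (∫⁻ c, ENNReal.ofReal (q c) * ENNReal.ofReal (g₁ c - u c) ∂ν) +
        (∫⁻ c, ENNReal.ofReal (q c) * ENNReal.ofReal (m c - g₂ c) ∂ν) +
        ENNReal.ofReal s * (∫⁻ c, ENNReal.ofReal (q c) * ENNReal.ofReal (τ c) ∂ν) := by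
  have hbdd : ∀ {a w : γ → ℝ} {B' : ℝ}, Integrable a ν → Measurable w → (∀ c, |w c| ≤ B') →
      Integrable (fun c => a c * w c) ν := fun ha hw hB =>
    ha.mul_bdd hw.aestronglyMeasurable (Eventually.of_forall hB)
  have hsub : ∀ {w w' : γ → ℝ} {B₁ B₂ : ℝ}, (∀ c, |w c| ≤ B₁) → (∀ c, |w' c| ≤ B₂) →
      ∀ c, |w c - w' c| ≤ B₁ + B₂ := fun h1 h2 c => (abs_sub _ _).trans (add_le_add (h1 c) (h2 c))
  obtain ⟨i1, e1⟩ := lintegral_ofReal_mul_ofReal hq hq0 (hg₂.sub hm) (hsub hS₂ hmB)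
  obtain ⟨i2, e2⟩ := lintegral_ofReal_mul_ofReal hq hq0 (hg₁.sub hu) (hsub hS₁ huB)
  obtain ⟨i3, e3⟩ := lintegral_ofReal_mul_ofReal hq hq0 (hm.sub hg₂) (hsub hmB hS₂)
  obtain ⟨i4, e4⟩ := lintegral_ofReal_mul_ofReal hq hq0 hτ hτB
  have i5 : Integrable (fun c => |q c - p c|) ν := (hq.sub hp).abs
  have e5 := ofReal_integral_eq_lintegral_ofReal i5 (Eventually.of_forall fun c => abs_nonneg _)
  rw [show (∫⁻ c, ENNReal.ofReal (q c) * ENNReal.ofReal (g₂ c - m c) ∂ν) = _ from e1,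
    show (∫⁻ c, ENNReal.ofReal (q c) * ENNReal.ofReal (g₁ c - u c) ∂ν) = _ from e2,
    show (∫⁻ c, ENNReal.ofReal (q c) * ENNReal.ofReal (m c - g₂ c) ∂ν) = _ from e3, e4, ← e5]
  have n1 : 0 ≤ ∫ c, q c * max ((g₂ - m) c) 0 ∂ν :=
    integral_nonneg fun c => mul_nonneg (hq0 c) (le_max_right _ _)
  have n2 : 0 ≤ ∫ c, q c * max ((g₁ - u) c) 0 ∂ν :=
    integral_nonneg fun c => mul_nonneg (hq0 c) (le_max_right _ _)
  have n3 : 0 ≤ ∫ c, q c * max ((m - g₂) c) 0 ∂ν :=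
    integral_nonneg fun c => mul_nonneg (hq0 c) (le_max_right _ _)
  have n4 : 0 ≤ ∫ c, q c * max (τ c) 0 ∂ν :=
    integral_nonneg fun c => mul_nonneg (hq0 c) (le_max_right _ _)
  have n5 : 0 ≤ ∫ c, |q c - p c| ∂ν := integral_nonneg fun c => abs_nonneg _
  rw [← ENNReal.ofReal_add hR n1, ← ENNReal.ofReal_mul (by positivity), ← ENNReal.ofReal_mul hs,
    ← ENNReal.ofReal_add hδ0 (by positivity), ← ENNReal.ofReal_add (by positivity) n2,
    ← ENNReal.ofReal_add (by positivity) n3, ← ENNReal.ofReal_add (by positivity) (by positivity)]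
  refine ENNReal.ofReal_le_ofReal ?_
  have j0 := hbdd hp hg₀ hS₀
  have j1 := hbdd hp hg₁ hS₁
  have j2 := hbdd hp hg₂ hS₂
  have k1 := hbdd hq hg₁ hS₁
  have k2 := hbdd hq hg₂ hS₂
  have ku := hbdd hq hu huB
  have km := hbdd hq hm hmB
  have kτ := hbdd hq hτ hτB
  have a1 : ∫ c, p c * g₀ c ∂ν - ∫ c, p c * g₁ c ∂ν ≤ δ := by
    rw [← integral_sub j0 j1]
    calc ∫ c, (p c * g₀ c - p c * g₁ c) ∂ν ≤ ∫ c, p c * δ ∂ν := by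
          refine integral_mono_ae (j0.sub j1) (hp.mul_const δ) ?_
          filter_upwards [hδ] with c hc
          rw [← mul_sub]
          exact mul_le_mul_of_nonneg_left hc (hp0 c)
      _ = (∫ c, p c ∂ν) * δ := integral_mul_const _ _
      _ ≤ δ := mul_le_of_le_one_left hδ0 hp1
  have a2 : (∫ c, p c * g₁ c ∂ν - ∫ c, p c * g₂ c ∂ν) -
      (∫ c, q c * g₁ c ∂ν - ∫ c, q c * g₂ c ∂ν) ≤ 2 * S * ∫ c, |q c - p c| ∂ν := by
    have d1 : Integrable (fun c => p c * g₁ c - p c * g₂ c) ν := j1.sub j2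
    have d2 : Integrable (fun c => q c * g₁ c - q c * g₂ c) ν := k1.sub k2
    rw [← integral_sub j1 j2, ← integral_sub k1 k2, ← integral_sub d1 d2, ← integral_const_mul]
    refine integral_mono (d1.sub d2) (i5.const_mul _) fun c => ?_
    have h1 : (p c * g₁ c - p c * g₂ c) - (q c * g₁ c - q c * g₂ c) =
        (q c - p c) * (g₂ c - g₁ c) := by ring
    calc (p c * g₁ c - p c * g₂ c) - (q c * g₁ c - q c * g₂ c)
        = (q c - p c) * (g₂ c - g₁ c) := h1
      _ ≤ |(q c - p c) * (g₂ c - g₁ c)| := le_abs_self _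
      _ = |q c - p c| * |g₂ c - g₁ c| := abs_mul _ _
      _ ≤ |q c - p c| * (S + S) := mul_le_mul_of_nonneg_left (hsub hS₂ hS₁ c) (abs_nonneg _)
      _ = 2 * S * |q c - p c| := by ring
  have a3 : ∫ c, q c * g₁ c ∂ν - ∫ c, q c * u c ∂ν ≤ ∫ c, q c * max ((g₁ - u) c) 0 ∂ν := by
    rw [← integral_sub k1 ku]
    refine integral_mono (k1.sub ku) i2 fun c => ?_
    change q c * g₁ c - q c * u c ≤ _
    rw [← mul_sub]
    exact mul_le_mul_of_nonneg_left (le_max_left _ _) (hq0 c)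
  have a4 : ∫ c, q c * (m c + s * τ c) ∂ν =
      ∫ c, q c * m c ∂ν + s * ∫ c, q c * τ c ∂ν := by
    rw [← integral_const_mul, ← integral_add km (kτ.const_mul s)]
    exact integral_congr_ae (Eventually.of_forall fun c => by simp only; ring)
  -- The negative part of `m - g₂` stands on the left of the claim, next to the regret. Positive and
  -- negative parts will have equal expectations under the posterior; keeping them apart leaves only
  -- integrals of nonnegative functions.
  have a5 : ∫ c, q c * m c ∂ν - ∫ c, q c * g₂ c ∂ν =
      ∫ c, q c * max ((m - g₂) c) 0 ∂ν - ∫ c, q c * max ((g₂ - m) c) 0 ∂ν := by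
    rw [← integral_sub km k2, ← integral_sub i3 i1]
    refine integral_congr_ae (Eventually.of_forall fun c => ?_)
    simp only [Pi.sub_apply]
    rw [← mul_sub, ← mul_sub]
    congr 1
    rcases le_total (m c) (g₂ c) with h | h
    · rw [max_eq_right (by linarith), max_eq_left (by linarith)]
      ring
    · rw [max_eq_left (by linarith), max_eq_right (by linarith)]
      ring
  have a6 : ∫ c, q c * τ c ∂ν = ∫ c, q c * max (τ c) 0 ∂ν :=
    integral_congr_ae (Eventually.of_forall fun c => by simp only [max_eq_left (hτ0 c)])
  rw [← a6]
  linarith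

end Decomposition

/-! ### Suprema of Lipschitz paths. -/

section PathBounds

variable {Dx Dc : ℕ} {Z : Set (Pt Dx Dc)} {r A : ℝ}

/-- A bound for the absolute value of a Lipschitz path on a set of diameter `r` containing `z₀`. -/
def supBound (r : ℝ) (z₀ : Pt Dx Dc) (φ : PathSpace Z) : ℝ :=
  |evalPath φ z₀| + r * (pathLip φ).toReal

lemma supBound_nonneg (hr : 0 ≤ r) (z₀ : Pt Dx Dc) (φ : PathSpace Z) : 0 ≤ supBound r z₀ φ := by
  unfold supBound
  positivity

lemma abs_evalPath_le_supBound (hr : 0 ≤ r) {z₀ : Pt Dx Dc} (hz₀ : z₀ ∈ Z)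
    (hZ : ∀ z ∈ Z, ‖z - z₀‖ ≤ r) {φ : PathSpace Z} (hφ : pathLip φ ≠ ∞) (z : Pt Dx Dc) :
    |evalPath φ z| ≤ supBound r z₀ φ := by
  by_cases hz : z ∈ Z
  · have h1 := abs_evalPath_sub_le φ hφ hz hz₀
    have h2 : (pathLip φ).toReal * ‖z - z₀‖ ≤ (pathLip φ).toReal * r :=
      mul_le_mul_of_nonneg_left (hZ z hz) ENNReal.toReal_nonneg
    have h3 := abs_sub_abs_le_abs_sub (evalPath φ z) (evalPath φ z₀)
    unfold supBound
    linarith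
  · rw [evalPath_of_notMem _ hz, abs_zero]
    exact supBound_nonneg hr z₀ φ

lemma measurable_supBound (hZ : MeasurableSet Z) (r : ℝ) (z₀ : Pt Dx Dc) :
    Measurable (supBound r z₀ : PathSpace Z → ℝ) := by
  have h1 : Measurable fun φ : PathSpace Z => evalPath φ z₀ :=
    Measurable.of_uncurry_right (measurable_evalPath hZ)
  exact (continuous_abs.measurable.comp h1).add (measurable_pathLip.ennreal_toReal.const_mul r)

variable {ρ : Measure (PathSpace Z)}

lemma ae_pathLip_ne_top (hA : ∫⁻ φ : PathSpace Z, pathLip φ ^ 2 ∂ρ ≤ ENNReal.ofReal A) :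
    ∀ᵐ φ ∂ρ, pathLip φ ≠ ∞ := by
  have hm : Measurable fun φ : PathSpace Z => pathLip φ ^ 2 := measurable_pathLip.pow_const 2
  filter_upwards [ae_lt_top hm (hA.trans_lt ENNReal.ofReal_lt_top).ne] with φ hφ h
  rw [h] at hφ
  simp at hφ

lemma lintegral_pathLip_le [IsProbabilityMeasure ρ] (hA0 : 0 ≤ A)
    (hA : ∫⁻ φ : PathSpace Z, pathLip φ ^ 2 ∂ρ ≤ ENNReal.ofReal A) :
    ∫⁻ φ : PathSpace Z, ENNReal.ofReal (pathLip φ).toReal ∂ρ ≤ ENNReal.ofReal (1 + A) := by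
  calc ∫⁻ φ : PathSpace Z, ENNReal.ofReal (pathLip φ).toReal ∂ρ
      ≤ ∫⁻ φ : PathSpace Z, (1 + pathLip φ ^ 2) ∂ρ := by
        refine lintegral_mono fun φ => ENNReal.ofReal_toReal_le.trans ?_
        rcases le_total (pathLip φ) 1 with h | h
        · exact h.trans le_self_add
        · calc pathLip φ = pathLip φ * 1 := (mul_one _).symm
            _ ≤ pathLip φ * pathLip φ := mul_le_mul' le_rfl h
            _ = pathLip φ ^ 2 := (sq _).symm
            _ ≤ 1 + pathLip φ ^ 2 := le_add_self
    _ = 1 + ∫⁻ φ : PathSpace Z, pathLip φ ^ 2 ∂ρ := by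
        rw [lintegral_add_left measurable_const, lintegral_const, measure_univ, mul_one]
    _ ≤ ENNReal.ofReal (1 + A) := by
        rw [ENNReal.ofReal_add zero_le_one hA0, ENNReal.ofReal_one]
        exact add_le_add le_rfl hA

lemma lintegral_supBound_le (hG : IsGaussField ρ (evalPath (Z := Z))) (hr : 0 ≤ r) (hA0 : 0 ≤ A)
    (hA : ∫⁻ φ : PathSpace Z, pathLip φ ^ 2 ∂ρ ≤ ENNReal.ofReal A) {z₀ : Pt Dx Dc}
    (hk : covKer ρ evalPath z₀ z₀ ≤ 1) :
    ∫⁻ φ : PathSpace Z, ENNReal.ofReal (supBound r z₀ φ) ∂ρ ≤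
      ENNReal.ofReal (2 + r * (1 + A)) := by
  have := hG.isProbabilityMeasure
  have h1 : Measurable fun φ : PathSpace Z => ENNReal.ofReal |evalPath φ z₀| :=
    (continuous_abs.measurable.comp (hG.measurable_apply z₀)).ennreal_ofReal
  have h2 : Measurable fun φ : PathSpace Z => ENNReal.ofReal (pathLip φ).toReal :=
    measurable_pathLip.ennreal_toReal.ennreal_ofReal
  have h3 : ∀ φ : PathSpace Z, ENNReal.ofReal (supBound r z₀ φ) =
      ENNReal.ofReal |evalPath φ z₀| + ENNReal.ofReal r * ENNReal.ofReal (pathLip φ).toReal := by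
    intro φ
    rw [supBound, ENNReal.ofReal_add (abs_nonneg _) (mul_nonneg hr ENNReal.toReal_nonneg),
      ENNReal.ofReal_mul hr]
  have h4 : Integrable (fun φ => evalPath φ z₀ ^ 2) ρ := (hG.memLp z₀).integrable_sq
  have h5 : ∫⁻ φ : PathSpace Z, ENNReal.ofReal |evalPath φ z₀| ∂ρ ≤ ENNReal.ofReal 2 := by
    calc ∫⁻ φ : PathSpace Z, ENNReal.ofReal |evalPath φ z₀| ∂ρ
        ≤ ∫⁻ φ : PathSpace Z, ENNReal.ofReal (1 + evalPath φ z₀ ^ 2) ∂ρ := by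
          refine lintegral_mono fun φ => ENNReal.ofReal_le_ofReal ?_
          rw [abs_le]
          constructor <;> nlinarith [sq_nonneg (evalPath φ z₀ + 1), sq_nonneg (evalPath φ z₀ - 1)]
      _ = ENNReal.ofReal (∫ φ : PathSpace Z, (1 + evalPath φ z₀ ^ 2) ∂ρ) :=
          (ofReal_integral_eq_lintegral_ofReal ((integrable_const 1).add h4)
            (Eventually.of_forall fun φ => add_nonneg zero_le_one (sq_nonneg _))).symm
      _ ≤ ENNReal.ofReal 2 := by
          refine ENNReal.ofReal_le_ofReal ?_
          rw [integral_add (integrable_const 1) h4, integral_const]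
          have h6 : ∫ φ, evalPath φ z₀ ^ 2 ∂ρ = covKer ρ evalPath z₀ z₀ := by
            rw [covKer]
            exact integral_congr_ae (Eventually.of_forall fun φ => by simp only [sq])
          rw [h6]
          simp
          linarith
  rw [lintegral_congr h3, lintegral_add_left h1, lintegral_const_mul _ h2,
    ENNReal.ofReal_add (by norm_num) (by positivity), ENNReal.ofReal_mul hr]
  exact add_le_add h5 (mul_le_mul' le_rfl (lintegral_pathLip_le hA0 hA))

end PathBounds

/-! ### Size and variation of the posterior moments. -/

section PosteriorBounds

variable {Dx Dc n : ℕ} {k : Pt Dx Dc → Pt Dx Dc → ℝ} {σ : ℝ}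

/-- Only the existence of a bound uniform in `w` matters: it makes the averages over contexts
integrable. -/
lemma abs_postMean_le (hk : ∀ z w, |k z w| ≤ 1) (z : Fin n → Pt Dx Dc) (y : Fin n → ℝ)
    (w : Pt Dx Dc) :
    |postMean k σ z y w| ≤
      ∑ i, |((kernelMat k z + σ ^ 2 • (1 : Matrix (Fin n) (Fin n) ℝ))⁻¹ *ᵥ y) i| := by
  rw [postMean, dotProduct]
  refine (Finset.abs_sum_le_sum_abs _ _).trans (Finset.sum_le_sum fun i _ => ?_)
  rw [abs_mul]
  exact mul_le_of_le_one_left (abs_nonneg _) (hk _ _)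

variable {𝓕 : Type*} [MeasurableSpace 𝓕] {ρ : Measure 𝓕} {G : 𝓕 → Pt Dx Dc → ℝ}

lemma IsGaussField.abs_covKer_le_one (hG : IsGaussField ρ G) (hk : ∀ z, covKer ρ G z z ≤ 1)
    (z w : Pt Dx Dc) : |covKer ρ G z w| ≤ 1 := by
  have h1 : ∀ z, ‖hG.feature z‖ ≤ 1 := fun z => by
    have h2 := hG.norm_feature_sq z
    have h3 := hk z
    nlinarith [norm_nonneg (hG.feature z)]
  rw [hG.covKer_eq_inner]
  exact (abs_real_inner_le_norm _ _).trans (mul_le_one₀ (h1 z) (norm_nonneg _) (h1 w))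

lemma IsGaussField.postStd_le_one (hG : IsGaussField ρ G) (hσ : 0 < σ)
    (hk : ∀ z, covKer ρ G z z ≤ 1) (z : Fin n → Pt Dx Dc) (w : Pt Dx Dc) :
    postStd (covKer ρ G) σ z w ≤ 1 := by
  rw [postStd, Real.sqrt_le_one]
  exact (postCov_self_le hG.covKer_eq_inner hσ _ _).trans ((hG.norm_feature_sq w).trans_le (hk w))

/-- The posterior standard deviation is comparable at points whose distance is small relative to
it. -/
lemma IsGaussField.postStd_le_two_mul (hG : IsGaussField ρ G) (hσ : 0 < σ) (z : Fin n → Pt Dx Dc)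
    {w w' : Pt Dx Dc}
    (h : 2 * ‖hG.feature w - hG.feature w'‖ ≤ postStd (covKer ρ G) σ z w) :
    postStd (covKer ρ G) σ z w ≤ 2 * postStd (covKer ρ G) σ z w' := by
  have h0 := postCov_self_nonneg hG.covKer_eq_inner hσ z w
  have h0' := postCov_self_nonneg hG.covKer_eq_inner hσ z w'
  have h1 := postCov_self_le_two_mul_add hG.covKer_eq_inner hσ z w w'
  have h2 : postStd (covKer ρ G) σ z w ^ 2 = postCov (covKer ρ G) σ z w w := Real.sq_sqrt h0
  have h3 : postStd (covKer ρ G) σ z w' ^ 2 = postCov (covKer ρ G) σ z w' w' := Real.sq_sqrt h0'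
  have h4 : 0 ≤ postStd (covKer ρ G) σ z w' := Real.sqrt_nonneg _
  have h5 := norm_nonneg (hG.feature w - hG.feature w')
  -- With `d` the feature distance, `s² ≤ 2 s'² + 2 d²` and `2 d ≤ s` give `s² ≤ 4 s'²`, half of
  -- `s²` being absorbed on the left.
  refine abs_le_of_sq_le_sq' ?_ (by positivity) |>.2
  nlinarith [mul_self_le_mul_self (by positivity) h]

end PosteriorBounds

end SBOKDE

end

noncomputable section

namespace SBOKDE

/-! ### Expected regret of a single round. -/

section Congruence

variable {Dx Dc n : ℕ} {k k' : Pt Dx Dc → Pt Dx Dc → ℝ} {σ : ℝ} {Z : Set (Pt Dx Dc)}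

/-- The algorithm computes with `k`, the analysis with the covariance kernel of the path field; the
two are known to agree on the domain only. -/
lemma ucb_congr (hk : ∀ z ∈ Z, ∀ w ∈ Z, k z w = k' z w) (β : ℝ) {z : Fin n → Pt Dx Dc}
    (hz : ∀ i, z i ∈ Z) (y : Fin n → ℝ) {w : Pt Dx Dc} (hw : w ∈ Z) :
    ucb k σ β z y w = ucb k' σ β z y w := by
  have h1 : kernelVec k z w = kernelVec k' z w := funext fun i => hk _ (hz i) _ hw
  have h2 : kernelMat k z = kernelMat k' z := by
    ext i j
    exact hk _ (hz i) _ (hz j)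
  rw [ucb, ucb, postMean, postMean, postStd, postStd, postCov, postCov, h1, h2, hk _ hw _ hw]

end Congruence

section KDEMeasurable

variable {Dx Dc n₀ n : ℕ} {K : (Fin Dc → ℝ) → ℝ} {h : Fin Dc → ℝ}

lemma measurable_kde (hK : IsKDEKernel K) {α : Type*} [MeasurableSpace α]
    {s : α → Fin n → Fin Dc → ℝ} (hs : ∀ i, Measurable fun a => s a i) {v : α → Fin Dc → ℝ}
    (hv : Measurable v) : Measurable fun a => kde K h (s a) (v a) := by
  simp only [kde_eq]
  exact (Finset.measurable_sum _ fun i _ =>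
    (measurable_scaledKernel hK).comp (hv.sub (hs i))).div_const _

lemma kde_nonneg (hK : IsKDEKernel K) (hh : ∀ j, 0 < h j) (s : Fin n → Fin Dc → ℝ)
    (v : Fin Dc → ℝ) : 0 ≤ kde K h s v := by
  rw [kde_eq]
  exact div_nonneg (Finset.sum_nonneg fun i _ => scaledKernel_nonneg hK hh _) (Nat.cast_nonneg n)

lemma integrable_kde (hK : IsKDEKernel K) (hh : ∀ j, 0 < h j) (s : Fin n → Fin Dc → ℝ) :
    Integrable (kde K h s) := by
  rw [funext (kde_eq K h s)]
  exact (integrable_finsetSum _ fun i _ =>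
    (integrable_scaledKernel hK hh).comp_sub_right (s i)).div_const _

end KDEMeasurable

/-- A run on an objective with the continuous modification `F`, whose Lipschitz constant has second
moment at most `A`. -/
structure IsPathRun {Dx Dc : ℕ} {Ω : Type*} [MeasurableSpace Ω] (P : Measure Ω)
    (X : Set (Fin Dx → ℝ)) (C : Set (Fin Dc → ℝ)) (K : (Fin Dc → ℝ) → ℝ) (h : ℕ → Fin Dc → ℝ)
    (p : (Fin Dc → ℝ) → ℝ) (k : Pt Dx Dc → Pt Dx Dc → ℝ) (a b r σ : ℝ) (n₀ : ℕ)
    (f : Ω → Pt Dx Dc → ℝ) (x : ℕ → Ω → Fin Dx → ℝ) (c : ℕ → Ω → Fin Dc → ℝ) (y ε : ℕ → Ω → ℝ)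
    (A : ℝ) (F : Ω → PathSpace (X ×ˢ C)) : Prop where
  run : IsRun P X C K h p k a b r σ n₀ f x c y ε
  measurable_decisions : MeasurableSet X
  measurable_contexts : MeasurableSet C
  decisions_subset : X ⊆ Set.Icc 0 (fun _ => r)
  contexts_subset : C ⊆ Set.Icc 0 (fun _ => r)
  gaussian : IsCenteredGP P (X ×ˢ C) k f
  kernel_le_one : ∀ z ∈ X ×ˢ C, ∀ z' ∈ X ×ˢ C, k z z' ≤ 1
  measurable_path : Measurable F
  path_eq : ∀ᵐ ω ∂P, ∀ z : ↥(X ×ˢ C), (F ω).1 z = f ω z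
  second_moment : ∫⁻ φ : PathSpace (X ×ˢ C), pathLip φ ^ 2 ∂(P.map F) ≤ ENNReal.ofReal A

section Pathwise

variable {Dx Dc n : ℕ} {X : Set (Fin Dx → ℝ)} {C : Set (Fin Dc → ℝ)} {r σ β δ : ℝ}
  {κ : Pt Dx Dc → Pt Dx Dc → ℝ} {p q : (Fin Dc → ℝ) → ℝ}

/-- The regret of a maximizer of the estimated upper confidence bound, compared with a point `x'`
near the optimum `xo`. -/
lemma ofReal_regret_add_le_of_argmax (hXC : MeasurableSet (X ×ˢ C)) (hC : MeasurableSet C)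
    (hr : 0 ≤ r) {z₀ : Pt Dx Dc} (hz₀ : z₀ ∈ X ×ˢ C) (hZ : ∀ z ∈ X ×ˢ C, ‖z - z₀‖ ≤ r)
    {ψ : PathSpace (X ×ˢ C)} (hψ : pathLip ψ ≠ ∞) (hκm : Measurable (Function.uncurry κ))
    (hκ : ∀ z w, |κ z w| ≤ 1) {z : Fin n → Pt Dx Dc} (hτ : ∀ w, postStd κ σ z w ≤ 1)
    (y : Fin n → ℝ) (hp : IsContextDensity C p) (hq : Integrable q) (hq0 : ∀ u, 0 ≤ q u)
    {xo xn x' : Fin Dx → ℝ} (hxo : xo ∈ X) (hx' : x' ∈ X) (hδ : ‖xo - x'‖ ≤ δ)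
    (hmax : ∫ u in C, q u * ucb κ σ β z y (x', u) ≤ ∫ u in C, q u * ucb κ σ β z y (xn, u))
    (hR : 0 ≤ (∫ u in C, p u * evalPath ψ (xo, u)) - ∫ u in C, p u * evalPath ψ (xn, u)) :
    ENNReal.ofReal ((∫ u in C, p u * evalPath ψ (xo, u)) - ∫ u in C, p u * evalPath ψ (xn, u)) +
        (∫⁻ u in C, ENNReal.ofReal (q u) *
          ENNReal.ofReal (evalPath ψ (xn, u) - postMean κ σ z y (xn, u))) ≤
      ENNReal.ofReal ((pathLip ψ).toReal * δ) +
        ENNReal.ofReal (2 * supBound r z₀ ψ) * (∫⁻ u in C, ENNReal.ofReal |q u - p u|) +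
        (∫⁻ u in C, ENNReal.ofReal (q u) *
          ENNReal.ofReal (evalPath ψ (x', u) - ucb κ σ β z y (x', u))) +
        (∫⁻ u in C, ENNReal.ofReal (q u) *
          ENNReal.ofReal (postMean κ σ z y (xn, u) - evalPath ψ (xn, u))) +
        ENNReal.ofReal √β * (∫⁻ u in C, ENNReal.ofReal (q u) *
          ENNReal.ofReal (postStd κ σ z (xn, u))) := by
  have hδ0 : 0 ≤ δ := (norm_nonneg _).trans hδ
  have hw : ∀ v : Fin Dx → ℝ, Measurable fun u : Fin Dc → ℝ => ((v, u) : Pt Dx Dc) := fun v =>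
    measurable_const.prodMk measurable_id
  have hev : ∀ v : Fin Dx → ℝ, Measurable fun u : Fin Dc → ℝ => evalPath ψ (v, u) := fun v =>
    (Measurable.of_uncurry_left (f := fun ψ : PathSpace (X ×ˢ C) => evalPath ψ)
      (measurable_evalPath hXC) (x := ψ)).comp (hw v)
  have hμ : ∀ v : Fin Dx → ℝ, Measurable fun u : Fin Dc → ℝ => postMean κ σ z y (v, u) := fun v =>
    measurable_postMean (z := fun _ => z) (y := fun _ => y) hκm (fun _ => measurable_const)
      measurable_const (hw v)
  have hs : ∀ v : Fin Dx → ℝ, Measurable fun u : Fin Dc → ℝ => postStd κ σ z (v, u) := fun v =>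
    measurable_postStd (z := fun _ => z) hκm (fun _ => measurable_const) (hw v)
  have hs0 : ∀ w, 0 ≤ postStd κ σ z w := fun w => Real.sqrt_nonneg _
  set B : ℝ := ∑ i, |((kernelMat κ z + σ ^ 2 • (1 : Matrix (Fin n) (Fin n) ℝ))⁻¹ *ᵥ y) i| with hB
  have hB0 : 0 ≤ B := Finset.sum_nonneg fun i _ => abs_nonneg _
  have hμB : ∀ w, |postMean κ σ z y w| ≤ B := abs_postMean_le hκ z y
  have hβ0 := Real.sqrt_nonneg β
  have hsB : ∀ w, |postStd κ σ z w| ≤ 1 := fun w => by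
    rw [abs_of_nonneg (hs0 w)]
    exact hτ w
  have hS := abs_evalPath_le_supBound hr hz₀ hZ hψ
  refine ofReal_regret_add_le (ν := volume.restrict C) (B := B + √β + 1)
    hp.integrable.restrict hp.nonneg ?_ hq.restrict hq0 (hev xo) (hev x') (hev xn)
    ((hμ x').add ((hs x').const_mul _)) (hμ xn) (hs xn) (fun u => hS _) (fun u => hS _)
    (fun u => hS _) (fun u => ?_) (fun u => ?_) (fun u => ?_) (by positivity) ?_
    (supBound_nonneg hr z₀ ψ) hβ0 (fun u => hs0 _) hmax hR
  · refine (setIntegral_le_integral hp.integrable (Eventually.of_forall hp.nonneg)).trans ?_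
    exact hp.integral_eq_one.le
  · refine (abs_add_le _ _).trans ?_
    rw [abs_mul, abs_of_nonneg hβ0]
    have h1 := mul_le_mul_of_nonneg_left (hsB (x', u)) hβ0
    have h2 := hμB (x', u)
    linarith
  · have h2 := hμB (xn, u)
    linarith
  · have h2 := hsB (xn, u)
    linarith
  · refine (ae_restrict_iff' hC).2 (Eventually.of_forall fun u hu => ?_)
    have h1 := abs_evalPath_sub_le ψ hψ (show (xo, u) ∈ X ×ˢ C from ⟨hxo, hu⟩)
      (show (x', u) ∈ X ×ˢ C from ⟨hx', hu⟩)
    have h2 : ‖((xo, u) : Pt Dx Dc) - (x', u)‖ = ‖xo - x'‖ := by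
      rw [Prod.norm_def]
      simp
    rw [h2] at h1
    exact (le_abs_self _).trans (h1.trans (mul_le_mul_of_nonneg_left hδ ENNReal.toReal_nonneg))

end Pathwise

namespace IsPathRun

variable {Dx Dc : ℕ} {Ω : Type*} [MeasurableSpace Ω] {P : Measure Ω}
  {X : Set (Fin Dx → ℝ)} {C : Set (Fin Dc → ℝ)} {K : (Fin Dc → ℝ) → ℝ} {h : ℕ → Fin Dc → ℝ}
  {p : (Fin Dc → ℝ) → ℝ} {k : Pt Dx Dc → Pt Dx Dc → ℝ} {a b r σ : ℝ} {n₀ : ℕ}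
  {f : Ω → Pt Dx Dc → ℝ} {x : ℕ → Ω → Fin Dx → ℝ} {c : ℕ → Ω → Fin Dc → ℝ} {y ε : ℕ → Ω → ℝ}
  {A : ℝ} {F : Ω → PathSpace (X ×ˢ C)}

lemma measurable_domain (H : IsPathRun P X C K h p k a b r σ n₀ f x c y ε A F) :
    MeasurableSet (X ×ˢ C) := H.measurable_decisions.prod H.measurable_contexts

lemma field (H : IsPathRun P X C K h p k a b r σ n₀ f x c y ε A F) :
    IsGaussField (P.map F) (evalPath (Z := X ×ˢ C)) :=
  isGaussField_evalPath H.measurable_domain H.gaussian H.measurable_path H.path_eq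

lemma covKer_eq (H : IsPathRun P X C K h p k a b r σ n₀ f x c y ε A F) :
    ∀ z ∈ X ×ˢ C, ∀ w ∈ X ×ˢ C, covKer (P.map F) evalPath z w = k z w := fun _ hz _ hw =>
  covKer_evalPath H.measurable_domain H.gaussian H.measurable_path H.path_eq hz hw

/-- Off the domain the field is zero, so the bound holds everywhere and the posterior estimates need
no membership conditions. -/
lemma covKer_le_one (H : IsPathRun P X C K h p k a b r σ n₀ f x c y ε A F) (z : Pt Dx Dc) :
    covKer (P.map F) (evalPath (Z := X ×ˢ C)) z z ≤ 1 := by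
  by_cases hz : z ∈ X ×ˢ C
  · rw [H.covKer_eq z hz z hz]
    exact H.kernel_le_one z hz z hz
  · have h1 : ∀ φ : PathSpace (X ×ˢ C), evalPath φ z = 0 := fun φ => evalPath_of_notMem φ hz
    rw [covKer]
    simp [h1]

lemma norm_sub_le (H : IsPathRun P X C K h p k a b r σ n₀ f x c y ε A F) (hr : 0 ≤ r)
    {z z' : Pt Dx Dc} (hz : z ∈ X ×ˢ C) (hz' : z' ∈ X ×ˢ C) : ‖z - z'‖ ≤ r := by
  rw [Prod.norm_def]
  have e1 := H.decisions_subset hz.1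
  have e2 := H.decisions_subset hz'.1
  have e3 := H.contexts_subset hz.2
  have e4 := H.contexts_subset hz'.2
  refine max_le ((pi_norm_le_iff_of_nonneg hr).2 fun i => ?_)
    ((pi_norm_le_iff_of_nonneg hr).2 fun i => ?_)
  · have h1 := e1.1 i
    have h2 := e1.2 i
    have h3 := e2.1 i
    have h4 := e2.2 i
    simp only [Pi.zero_apply] at h1 h2 h3 h4
    rw [Prod.fst_sub, Pi.sub_apply, Real.norm_eq_abs, abs_le]
    constructor <;> linarith
  · have h1 := e3.1 i
    have h2 := e3.2 i
    have h3 := e4.1 i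
    have h4 := e4.2 i
    simp only [Pi.zero_apply] at h1 h2 h3 h4
    rw [Prod.snd_sub, Pi.sub_apply, Real.norm_eq_abs, abs_le]
    constructor <;> linarith

lemma ae_pathLip_ne_top (H : IsPathRun P X C K h p k a b r σ n₀ f x c y ε A F) :
    ∀ᵐ ω ∂P, pathLip (F ω) ≠ ∞ :=
  ae_of_ae_map H.measurable_path.aemeasurable (SBOKDE.ae_pathLip_ne_top H.second_moment)

lemma meanReward_eq (H : IsPathRun P X C K h p k a b r σ n₀ f x c y ε A F) :
    ∀ᵐ ω ∂P, ∀ v ∈ X, meanReward C p (f ω) v = ∫ u in C, p u * evalPath (F ω) (v, u) := by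
  filter_upwards [H.path_eq] with ω hω v hv
  refine setIntegral_congr_fun H.measurable_contexts fun u hu => ?_
  have hz : (v, u) ∈ X ×ˢ C := ⟨hv, hu⟩
  rw [evalPath_of_mem _ hz, hω]

set_option maxHeartbeats 2000000 in
/-- The expected instantaneous regret after the initial design. -/
lemma lintegral_regret_le [IsProbabilityMeasure P]
    (H : IsPathRun P X C K h p k a b r σ n₀ f x c y ε A F) (hr : 0 < r) (hσ : 0 < σ) (hA : 0 < A)
    (hK : IsKDEKernel K) (hp : IsContextDensity C p) {n : ℕ} (hn₀ : n₀ ≤ n)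
    (hh : ∀ j, 0 < h n j) {e₁ e₂ : ℝ} (he₁ : 0 ≤ e₁)
    (hkde : ∫⁻ ω, (∫⁻ u in C, ENNReal.ofReal |kde K (h n) (fun i : Fin n => c i ω) u - p u|) ∂P ≤
      ENNReal.ofReal e₁)
    (hmul : ∀ V : Ω → (Fin Dc → ℝ) → ℝ, Measurable (Function.uncurry V) →
      (∀ᵐ ω ∂P, ∀ u ∈ C, V ω u ≤ 1) →
      (∀ᵐ ω ∂P, ∀ u ∈ C, ∀ u' ∈ C, 2 * √A * ‖u - u'‖ ≤ V ω u → V ω u ≤ 2 * V ω u') →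
      ∫⁻ ω, (∫⁻ u in C, ENNReal.ofReal (kde K (h n) (fun i : Fin n => c i ω) u) *
        ENNReal.ofReal (V ω u)) ∂P ≤
      6 * (∫⁻ ω, (∫⁻ u in C, ENNReal.ofReal (p u) * ENNReal.ofReal (V ω u)) ∂P) +
        ENNReal.ofReal e₂)
    {xstar : Ω → Fin Dx → ℝ}
    (hx : ∀ᵐ ω ∂P, xstar ω ∈ X ∧ IsMaxOn (meanReward C p (f ω)) X (xstar ω)) {m : ℕ} (hm : 0 < m) :
    ∫⁻ ω, ENNReal.ofReal (meanReward C p (f ω) (xstar ω) - meanReward C p (f ω) (x n ω)) ∂P ≤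
      ENNReal.ofReal ((1 + A) * (r / m)) + ENNReal.ofReal (2 * (2 + r * (1 + A)) * e₁) +
        ENNReal.ofReal ((m + 1) ^ Dx *
          ((1 + e₁) * Real.exp (1 / 2 - √(beta Dx a b r (n + 1)) ^ 2 / 2))) +
        ENNReal.ofReal √(beta Dx a b r (n + 1)) *
          (6 * (∫⁻ ω, ENNReal.ofReal
            √(seqVar (covKer (P.map F) evalPath) σ (fun i => (x i ω, c i ω)) n) ∂P) +
            ENNReal.ofReal e₂) := by
  obtain ⟨ξ, y', hAd, hag, hfresh⟩ := H.run.exists_adaptive hp H.measurable_domain H.gaussian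
    H.measurable_path H.path_eq
  have hG := H.field
  have hρ := hG.isProbabilityMeasure
  set κ := covKer (P.map F) (evalPath (Z := X ×ˢ C)) with hκ
  set β := beta Dx a b r (n + 1) with hβ
  set U := IsRun.source n₀ x c with hU
  set ζ := ruleDesign (n₀ := n₀) ξ with hζ
  set g : Ω → Pt Dx Dc → ℝ := fun ω => evalPath (F ω) with hg
  obtain ⟨N, hNX, hNc, hN⟩ := exists_net hr H.decisions_subset hm
  have hκm : Measurable (Function.uncurry κ) := hG.measurable_covKer
  have hκ1 : ∀ z, κ z z ≤ 1 := H.covKer_le_one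
  have hCfin : Measurable fun u : Fin Dc → ℝ => ENNReal.ofReal (p u) :=
    hp.continuous.measurable.ennreal_ofReal
  -- the data, the decision and the weights as functions of the data
  let D := Source Dx Dc n₀ × (Fin n → ℝ)
  have hd : Measurable fun ω => ((U ω, obs y' n ω) : D) :=
    hAd.measurable_U.prodMk (hAd.measurable_obs n)
  set dec : D → (Fin Dc → ℝ) → Pt Dx Dc := fun d u => ((ζ n d).1, u) with hdec
  set φ : D → (Fin Dc → ℝ) → ℝ≥0∞ := fun d u =>
    ENNReal.ofReal (kde K (h n) (fun i : Fin n => d.1.context i) u) with hφ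
  have hdecm : Measurable (Function.uncurry dec) :=
    ((hAd.measurable_design n).fst.comp measurable_fst).prodMk measurable_snd
  have hφm : Measurable (Function.uncurry φ) :=
    (measurable_kde hK (fun i => (Source.measurable_context _).comp measurable_fst.fst)
      measurable_snd).ennreal_ofReal
  have hφeq : ∀ ω u, φ (U ω, obs y' n ω) u =
      ENNReal.ofReal (kde K (h n) (fun i : Fin n => c i ω) u) := by
    intro ω u
    simp only [hφ, hU, IsRun.context_source]
  have hdecm' : ∀ x' : Fin Dx → ℝ, Measurable (Function.uncurry fun (_ : D) u => ((x', u) : Pt Dx Dc)) :=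
    fun x' => measurable_const.prodMk measurable_snd
  have hptsm : ∀ i, Measurable fun q : Ω × (Fin Dc → ℝ) => designPts ζ (U q.1, obs y' n q.1) i :=
    fun i => (measurable_designPts hAd.measurable_design i).comp (hd.comp measurable_fst)
  have hobsm : Measurable fun q : Ω × (Fin Dc → ℝ) => obs y' n q.1 :=
    (hAd.measurable_obs n).comp measurable_fst
  have hdecm₁ : Measurable fun q : Ω × (Fin Dc → ℝ) => dec (U q.1, obs y' n q.1) q.2 :=
    hdecm.comp ((hd.comp measurable_fst).prodMk measurable_snd)
  have hφm₁ : Measurable fun q : Ω × (Fin Dc → ℝ) => φ (U q.1, obs y' n q.1) q.2 :=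
    hφm.comp ((hd.comp measurable_fst).prodMk measurable_snd)
  have hgm : ∀ w : Ω × (Fin Dc → ℝ) → Pt Dx Dc, Measurable w → Measurable fun q => g q.1 (w q) :=
    fun w hw => hG.measurable.comp ((H.measurable_path.comp measurable_fst).prodMk hw)
  -- the total weight
  have hφ1 : ∫⁻ ω, (∫⁻ u in C, φ (U ω, obs y' n ω) u) ∂P ≤ ENNReal.ofReal (1 + e₁) := by
    rw [ENNReal.ofReal_add zero_le_one he₁, ENNReal.ofReal_one]
    calc ∫⁻ ω, (∫⁻ u in C, φ (U ω, obs y' n ω) u) ∂P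
        ≤ ∫⁻ ω, (1 + ∫⁻ u in C,
            ENNReal.ofReal |kde K (h n) (fun i : Fin n => c i ω) u - p u|) ∂P := by
          refine lintegral_mono fun ω => ?_
          calc ∫⁻ u in C, φ (U ω, obs y' n ω) u
              ≤ ∫⁻ u in C, (ENNReal.ofReal (p u) +
                  ENNReal.ofReal |kde K (h n) (fun i : Fin n => c i ω) u - p u|) := by
                refine lintegral_mono fun u => ?_
                rw [hφeq, ← ENNReal.ofReal_add (hp.nonneg u) (abs_nonneg _)]
                refine ENNReal.ofReal_le_ofReal ?_
                linarith [le_abs_self (kde K (h n) (fun i : Fin n => c i ω) u - p u)]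
            _ = (∫⁻ u in C, ENNReal.ofReal (p u)) + ∫⁻ u in C,
                  ENNReal.ofReal |kde K (h n) (fun i : Fin n => c i ω) u - p u| :=
                lintegral_add_left hCfin _
            _ ≤ _ := by
                refine add_le_add ?_ le_rfl
                exact (setLIntegral_le_lintegral _ _).trans hp.lintegral_eq_one.le
      _ = 1 + ∫⁻ ω, (∫⁻ u in C,
            ENNReal.ofReal |kde K (h n) (fun i : Fin n => c i ω) u - p u|) ∂P := by
          rw [lintegral_add_left measurable_const, lintegral_const, measure_univ, mul_one]
      _ ≤ _ := add_le_add le_rfl hkde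
  -- the excess over the upper confidence bound at a point of the net
  have hgrid : ∀ x' : Fin Dx → ℝ, ∫⁻ ω, (∫⁻ u in C, φ (U ω, obs y' n ω) u *
      ENNReal.ofReal (g ω (x', u) - ucb κ σ β (designPts ζ (U ω, obs y' n ω)) (obs y' n ω) (x', u))) ∂P ≤
      ENNReal.ofReal ((1 + e₁) * Real.exp (1 / 2 - √β ^ 2 / 2)) := by
    intro x'
    refine (hAd.lintegral_mul_sub_ucb_le hσ hκ1 (ν := volume.restrict C) (hdecm' x') hφm β).trans ?_
    rw [ENNReal.ofReal_mul (by positivity)]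
    exact mul_le_mul' hφ1 le_rfl
  -- the deviation from the posterior mean at the decision
  set Ipos : Ω → ℝ≥0∞ := fun ω => ∫⁻ u in C, φ (U ω, obs y' n ω) u * ENNReal.ofReal
    (postMean κ σ (designPts ζ (U ω, obs y' n ω)) (obs y' n ω) (dec (U ω, obs y' n ω) u) -
      g ω (dec (U ω, obs y' n ω) u)) with hIpos
  set Ineg : Ω → ℝ≥0∞ := fun ω => ∫⁻ u in C, φ (U ω, obs y' n ω) u * ENNReal.ofReal
    (g ω (dec (U ω, obs y' n ω) u) -
      postMean κ σ (designPts ζ (U ω, obs y' n ω)) (obs y' n ω) (dec (U ω, obs y' n ω) u)) with hIneg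
  have hcent : ∫⁻ ω, Ipos ω ∂P = ∫⁻ ω, Ineg ω ∂P :=
    hAd.lintegral_mul_postMean_sub_eq hσ (ν := volume.restrict C) hdecm hφm
  -- With exploration parameter zero the upper confidence bound is the posterior mean. Finiteness is
  -- needed to cancel the two equal expectations at the end.
  have hfin : ∫⁻ ω, Ineg ω ∂P ≠ ∞ := by
    have h1 := hAd.lintegral_mul_sub_ucb_le hσ hκ1 (ν := volume.restrict C) hdecm hφm 0
    simp only [ucb, Real.sqrt_zero, zero_mul, add_zero] at h1
    exact (h1.trans_lt (ENNReal.mul_lt_top (hφ1.trans_lt ENNReal.ofReal_lt_top)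
      ENNReal.ofReal_lt_top)).ne
  have hμm := measurable_postMean (σ := σ) hκm hptsm hobsm hdecm₁
  have hIposm : Measurable Ipos := by
    refine Measurable.lintegral_prod_right' (f := fun q : Ω × (Fin Dc → ℝ) =>
      φ (U q.1, obs y' n q.1) q.2 * ENNReal.ofReal
      (postMean κ σ (designPts ζ (U q.1, obs y' n q.1)) (obs y' n q.1)
        (dec (U q.1, obs y' n q.1) q.2) - g q.1 (dec (U q.1, obs y' n q.1) q.2))) ?_
    exact hφm₁.mul (hμm.sub (hgm _ hdecm₁)).ennreal_ofReal
  have hInegm : Measurable Ineg := by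
    refine Measurable.lintegral_prod_right' (f := fun q : Ω × (Fin Dc → ℝ) =>
      φ (U q.1, obs y' n q.1) q.2 * ENNReal.ofReal
      (g q.1 (dec (U q.1, obs y' n q.1) q.2) -
        postMean κ σ (designPts ζ (U q.1, obs y' n q.1)) (obs y' n q.1)
        (dec (U q.1, obs y' n q.1) q.2))) ?_
    exact hφm₁.mul ((hgm _ hdecm₁).sub hμm).ennreal_ofReal
  -- the posterior standard deviation at the decision
  set V : Ω → (Fin Dc → ℝ) → ℝ := fun ω u =>
    postStd κ σ (designPts ζ (U ω, obs y' n ω)) (dec (U ω, obs y' n ω) u) with hV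
  have hVm : Measurable (Function.uncurry V) := measurable_postStd hκm hptsm hdecm₁
  have hdx : ∀ᵐ ω ∂P, (ζ n (U ω, obs y' n ω)).1 = x n ω := by
    filter_upwards [hag] with ω hω
    rw [(hω n).2]
  have hpts : ∀ᵐ ω ∂P, designPts ζ (U ω, obs y' n ω) = fun i : Fin n => (x i ω, c i ω) := by
    filter_upwards [hag] with ω hω
    exact funext fun i => (hω i).2
  -- At a fixed decision the features are `√A`-Lipschitz in the context, so the standard deviation
  -- at most doubles over distances up to its size divided by `2 √A`. This is the regularity that
  -- the multiplicative comparison asks for.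
  have hstd := hmul V hVm
    (Eventually.of_forall fun ω u _ => hG.postStd_le_one hσ hκ1 _ _) (by
      filter_upwards [hdx] with ω hω u hu u' hu' huu
      refine hG.postStd_le_two_mul hσ _ (le_trans ?_ huu)
      have hX : (ζ n (U ω, obs y' n ω)).1 ∈ X := by
        rw [hω]
        exact H.run.decision_mem n ω
      have h1 := norm_feature_evalPath_sub_le hG hA.le H.second_moment
        (show dec (U ω, obs y' n ω) u ∈ X ×ˢ C from ⟨hX, hu⟩)
        (show dec (U ω, obs y' n ω) u' ∈ X ×ˢ C from ⟨hX, hu'⟩)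
      have h2 : ‖dec (U ω, obs y' n ω) u - dec (U ω, obs y' n ω) u'‖ = ‖u - u'‖ := by
        rw [hdec, Prod.norm_def]
        simp
      rw [h2] at h1
      linarith)
  -- The context `c n` has density `p` and is independent of the past points and of the decision, so
  -- the expected `p`-average is the expected standard deviation at the point visited next.
  have hfreshV : ∫⁻ ω, (∫⁻ u in C, ENNReal.ofReal (p u) * ENNReal.ofReal (V ω u)) ∂P =
      ∫⁻ ω, ENNReal.ofReal √(seqVar κ σ (fun i => (x i ω, c i ω)) n) ∂P := by
    set Aω : Ω → (Fin n → Pt Dx Dc) × (Fin Dx → ℝ) := fun ω =>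
      (designPts ζ (U ω, obs y' n ω), (ζ n (U ω, obs y' n ω)).1) with hAω
    have hAm : Measurable Aω := (measurable_pi_iff.2 fun i =>
      (measurable_designPts hAd.measurable_design i).comp hd).prodMk
      ((hAd.measurable_design n).fst.comp hd)
    have hfm : Measurable fun q : ((Fin n → Pt Dx Dc) × (Fin Dx → ℝ)) × (Fin Dc → ℝ) =>
        ENNReal.ofReal (postStd κ σ q.1.1 (q.1.2, q.2)) :=
      (measurable_postStd hκm (fun i => (measurable_pi_apply i).comp measurable_fst.fst)
        (measurable_fst.snd.prodMk measurable_snd)).ennreal_ofReal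
    have h1 := lintegral_comp_indepFun hAm (H.run.context_measurable n) (hfresh n hn₀) hfm
    have h2 : ∫⁻ ω, ENNReal.ofReal √(seqVar κ σ (fun i => (x i ω, c i ω)) n) ∂P =
        ∫⁻ ω, ENNReal.ofReal (postStd κ σ (Aω ω).1 ((Aω ω).2, c n ω)) ∂P := by
      refine lintegral_congr_ae ?_
      filter_upwards [hdx, hpts] with ω h3 h4
      simp only [hAω]
      rw [h3, h4]
      rfl
    rw [h2]
    refine Eq.trans ?_ h1.symm
    refine lintegral_congr fun ω => ?_
    have hVω : Measurable fun u => ENNReal.ofReal (postStd κ σ (Aω ω).1 ((Aω ω).2, u)) :=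
      hfm.comp (measurable_const.prodMk measurable_id)
    rw [H.run.context_law n hn₀, densityLaw, lintegral_withDensity_eq_lintegral_mul _ hCfin hVω,
      hp.setLIntegral_eq H.measurable_contexts]
    rfl
  -- the error of the density estimate, independent of the objective
  obtain ⟨ω₀, hω₀⟩ := (H.run.ae_context_mem hp).exists
  set z₀ : Pt Dx Dc := (x n ω₀, c n ω₀) with hz₀
  have hz₀m : z₀ ∈ X ×ˢ C := ⟨H.run.decision_mem n ω₀, hω₀ n⟩
  set E : Ω → ℝ≥0∞ := fun ω =>
    ∫⁻ u in C, ENNReal.ofReal |kde K (h n) (fun i : Fin n => c i ω) u - p u| with hE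
  set EU : Source Dx Dc n₀ → ℝ≥0∞ := fun v =>
    ∫⁻ u in C, ENNReal.ofReal |kde K (h n) (fun i : Fin n => v.context i) u - p u| with hEU
  have hEUm : Measurable EU := by
    refine Measurable.lintegral_prod_right' (f := fun q : Source Dx Dc n₀ × (Fin Dc → ℝ) =>
      ENNReal.ofReal |kde K (h n) (fun i : Fin n => q.1.context i) q.2 - p q.2|) ?_
    exact (continuous_abs.measurable.comp ((measurable_kde hK
      (fun i => (Source.measurable_context _).comp measurable_fst) measurable_snd).sub
      (hp.continuous.measurable.comp measurable_snd))).ennreal_ofReal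
  have hEeq : E = EU ∘ U := by
    ext ω
    simp only [hE, hEU, hU, Function.comp, IsRun.context_source]
  have hEm : Measurable E := hEeq ▸ hEUm.comp hAd.measurable_U
  set S : PathSpace (X ×ˢ C) → ℝ := supBound r z₀ with hS
  have hSm : Measurable fun φ : PathSpace (X ×ˢ C) => ENNReal.ofReal (2 * S φ) :=
    ((measurable_supBound H.measurable_domain r z₀).const_mul 2).ennreal_ofReal
  -- The error of the density estimate is a function of the initial design and the contexts, hence
  -- independent of the supremum of the path; first moments of the two factors suffice.
  have hprod : ∫⁻ ω, ENNReal.ofReal (2 * S (F ω)) * E ω ∂P ≤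
      ENNReal.ofReal (2 * (2 + r * (1 + A)) * e₁) := by
    have hind : IndepFun (fun ω => ENNReal.ofReal (2 * S (F ω))) E P := by
      rw [hEeq]
      exact hAd.indep_F_U.comp hSm hEUm
    have hSF : Measurable fun ω => ENNReal.ofReal (2 * S (F ω)) := hSm.comp H.measurable_path
    rw [lintegral_mul_eq_lintegral_mul_lintegral_of_indepFun'' hSF.aemeasurable hEm.aemeasurable hind,
      ENNReal.ofReal_mul (by positivity)]
    refine mul_le_mul' ?_ hkde
    have h1 : ∫⁻ ω, ENNReal.ofReal (2 * S (F ω)) ∂P =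
        ENNReal.ofReal 2 * ∫⁻ φ, ENNReal.ofReal (S φ) ∂(P.map F) := by
      rw [← lintegral_const_mul _ (measurable_supBound H.measurable_domain r z₀).ennreal_ofReal,
        ← lintegral_map hSm H.measurable_path]
      exact lintegral_congr fun φ => ENNReal.ofReal_mul (by norm_num)
    rw [h1, ENNReal.ofReal_mul (by norm_num)]
    exact mul_le_mul' le_rfl (lintegral_supBound_le hG hr.le hA.le H.second_moment (hκ1 z₀))
  -- the Lipschitz constant
  have hMm : Measurable fun φ : PathSpace (X ×ˢ C) => ENNReal.ofReal ((pathLip φ).toReal * (r / m)) :=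
    (measurable_pathLip.ennreal_toReal.mul_const _).ennreal_ofReal
  have hlip : ∫⁻ ω, ENNReal.ofReal ((pathLip (F ω)).toReal * (r / m)) ∂P ≤
      ENNReal.ofReal ((1 + A) * (r / m)) := by
    have h2 : Measurable fun φ : PathSpace (X ×ˢ C) => ENNReal.ofReal (pathLip φ).toReal :=
      measurable_pathLip.ennreal_toReal.ennreal_ofReal
    rw [← lintegral_map hMm H.measurable_path, ENNReal.ofReal_mul (by positivity)]
    rw [lintegral_congr fun φ : PathSpace (X ×ˢ C) =>
      ENNReal.ofReal_mul (q := r / m) (ENNReal.toReal_nonneg (a := pathLip φ)),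
      lintegral_mul_const _ h2]
    exact mul_le_mul' (lintegral_pathLip_le hA.le H.second_moment) le_rfl
  set J : (Fin Dx → ℝ) → Ω → ℝ≥0∞ := fun x' ω => ∫⁻ u in C, φ (U ω, obs y' n ω) u *
      ENNReal.ofReal (g ω (x', u) -
        ucb κ σ β (designPts ζ (U ω, obs y' n ω)) (obs y' n ω) (x', u)) with hJ
  have hJm : ∀ x', Measurable (J x') := by
    intro x'
    have hw : Measurable fun q : Ω × (Fin Dc → ℝ) => ((x', q.2) : Pt Dx Dc) :=
      measurable_const.prodMk measurable_snd
    refine Measurable.lintegral_prod_right' (f := fun q : Ω × (Fin Dc → ℝ) =>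
      φ (U q.1, obs y' n q.1) q.2 * ENNReal.ofReal (g q.1 (x', q.2) -
        ucb κ σ β (designPts ζ (U q.1, obs y' n q.1)) (obs y' n q.1) (x', q.2))) ?_
    exact hφm₁.mul ((hgm _ hw).sub ((measurable_postMean hκm hptsm hobsm hw).add
      ((measurable_postStd hκm hptsm hw).const_mul _))).ennreal_ofReal
  -- The net point near the optimum depends on `ω`, while the posterior estimate is for fixed net
  -- points; its contribution is therefore bounded by the sum over the whole net.
  have hpt : ∀ᵐ ω ∂P, ENNReal.ofReal
      (meanReward C p (f ω) (xstar ω) - meanReward C p (f ω) (x n ω)) + Ineg ω ≤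
      ENNReal.ofReal ((pathLip (F ω)).toReal * (r / m)) + ENNReal.ofReal (2 * S (F ω)) * E ω +
        (∑ x' ∈ N, J x' ω) + Ipos ω + ENNReal.ofReal √β * (∫⁻ u in C,
          ENNReal.ofReal (kde K (h n) (fun i : Fin n => c i ω) u) * ENNReal.ofReal (V ω u)) := by
    filter_upwards [H.meanReward_eq (p := p), H.ae_pathLip_ne_top, hag, hdx, hpts,
      H.run.ae_context_mem hp, H.run.decision_argmax n hn₀, hx] with ω w1 w2 w3 w4 w5 w6 w7 w8
    obtain ⟨x', hx'N, hx'⟩ := hN _ w8.1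
    have hxn := H.run.decision_mem n ω
    have w9 : obs y' n ω = fun i : Fin n => y i ω := funext fun i => (w3 i).1
    have hzZ : ∀ i : Fin n, (x i ω, c i ω) ∈ X ×ˢ C := fun i => ⟨H.run.decision_mem i ω, w6 i⟩
    have hacq : ∀ v ∈ X, acquisition C K (h n) k σ β (fun i => (history x c y n ω i).1)
        (fun i => (history x c y n ω i).2) v = ∫ u in C, kde K (h n) (fun i : Fin n => c i ω) u *
          ucb κ σ β (designPts ζ (U ω, obs y' n ω)) (obs y' n ω) (v, u) := by
      intro v hv
      rw [w5, w9]
      refine setIntegral_congr_fun H.measurable_contexts fun u hu => ?_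
      have h1 := ucb_congr (σ := σ) (k := κ) (k' := k) H.covKer_eq β hzZ (fun i : Fin n => y i ω)
        (w := (v, u)) ⟨hv, hu⟩
      exact congrArg _ h1.symm
    have h1 := isMaxOn_iff.1 w7 x' (hNX x' hx'N)
    rw [hacq _ (hNX x' hx'N), hacq _ hxn] at h1
    have h2 := isMaxOn_iff.1 w8.2 _ hxn
    rw [w1 _ w8.1, w1 _ hxn] at h2
    have h3 := ofReal_regret_add_le_of_argmax H.measurable_domain H.measurable_contexts hr.le hz₀m
      (fun z hz => H.norm_sub_le hr.le hz hz₀m) w2 hκm (hG.abs_covKer_le_one hκ1)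
      (hG.postStd_le_one hσ hκ1 (designPts ζ (U ω, obs y' n ω))) (obs y' n ω) hp
      (integrable_kde hK hh _) (kde_nonneg hK hh _) w8.1 (hNX x' hx'N) hx' h1 (sub_nonneg.2 h2)
    rw [w1 _ w8.1, w1 _ hxn]
    simp only [hIneg, hIpos, hφeq, hdec, hV, w4]
    refine h3.trans (add_le_add (add_le_add (add_le_add le_rfl ?_) le_rfl) le_rfl)
    refine le_trans (le_of_eq ?_) (Finset.single_le_sum (f := fun x' => J x' ω)
      (fun _ _ => zero_le) hx'N)
    simp only [hJ, hφeq]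
    rfl
  have hWm : Measurable fun ω => ∫⁻ u in C,
      ENNReal.ofReal (kde K (h n) (fun i : Fin n => c i ω) u) * ENNReal.ofReal (V ω u) := by
    refine Measurable.lintegral_prod_right' (f := fun q : Ω × (Fin Dc → ℝ) =>
      ENNReal.ofReal (kde K (h n) (fun i : Fin n => c i q.1) q.2) *
        ENNReal.ofReal (Function.uncurry V q)) ?_
    exact (measurable_kde hK (fun i => (H.run.context_measurable i).comp measurable_fst)
      measurable_snd).ennreal_ofReal.mul hVm.ennreal_ofReal
  have hsum : ∫⁻ ω, (∑ x' ∈ N, J x' ω) ∂P ≤ ENNReal.ofReal ((m + 1) ^ Dx *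
      ((1 + e₁) * Real.exp (1 / 2 - √β ^ 2 / 2))) := by
    rw [lintegral_finsetSum _ fun x' _ => hJm x']
    refine (Finset.sum_le_sum fun x' _ => hgrid x').trans ?_
    rw [Finset.sum_const, nsmul_eq_mul,
      ENNReal.ofReal_mul (p := ((m : ℝ) + 1) ^ Dx) (by positivity)]
    refine mul_le_mul' ?_ le_rfl
    rw [← ENNReal.ofReal_natCast]
    refine ENNReal.ofReal_le_ofReal ?_
    exact_mod_cast hNc
  have hint := lintegral_mono_ae hpt
  rw [lintegral_add_right _ hInegm] at hint
  have hF1 := hMm.comp H.measurable_path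
  have hF2 : Measurable fun ω => ENNReal.ofReal (2 * S (F ω)) * E ω :=
    (hSm.comp H.measurable_path).mul hEm
  have hF3 : Measurable fun ω => ∑ x' ∈ N, J x' ω := Finset.measurable_sum _ fun x' _ => hJm x'
  rw [lintegral_add_right _ (hWm.const_mul _), lintegral_add_right _ hIposm,
    lintegral_add_right _ hF3, lintegral_add_right _ hF2, lintegral_const_mul _ hWm, hcent] at hint
  refine ENNReal.le_of_add_le_add_right hfin (hint.trans ?_)
  rw [hfreshV] at hstd
  calc _ ≤ ENNReal.ofReal ((1 + A) * (r / m)) + ENNReal.ofReal (2 * (2 + r * (1 + A)) * e₁) +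
        ENNReal.ofReal ((m + 1) ^ Dx * ((1 + e₁) * Real.exp (1 / 2 - √β ^ 2 / 2))) +
        ∫⁻ ω, Ineg ω ∂P + ENNReal.ofReal √β *
          (6 * (∫⁻ ω, ENNReal.ofReal √(seqVar κ σ (fun i => (x i ω, c i ω)) n) ∂P) +
            ENNReal.ofReal e₂) :=
        add_le_add (add_le_add (add_le_add (add_le_add hlip hprod) hsum) le_rfl)
          (mul_le_mul' le_rfl hstd)
    _ = _ := by ring

end IsPathRun

end SBOKDE

end

noncomputable section

namespace SBOKDE

lemma IsContextDensity.abs_setIntegral_mul_le {d : ℕ} {C : Set (Fin d → ℝ)} {p : (Fin d → ℝ) → ℝ}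
    (hp : IsContextDensity C p) (hC : MeasurableSet C) {w : (Fin d → ℝ) → ℝ} {B : ℝ} (hB : 0 ≤ B)
    (hw : ∀ u ∈ C, |w u| ≤ B) : |∫ u in C, p u * w u| ≤ B := by
  have h1 : ‖∫ u in C, p u * w u‖ ≤ ∫ u in C, p u * B := by
    refine norm_integral_le_of_norm_le (hp.integrable.restrict.mul_const B)
      ((ae_restrict_iff' hC).2 (Eventually.of_forall fun u hu => ?_))
    rw [Real.norm_eq_abs, abs_mul, abs_of_nonneg (hp.nonneg u)]
    exact mul_le_mul_of_nonneg_left (hw u hu) (hp.nonneg u)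
  refine h1.trans ?_
  rw [integral_mul_const]
  refine mul_le_of_le_one_left hB ?_
  exact (setIntegral_le_integral hp.integrable (Eventually.of_forall hp.nonneg)).trans
    hp.integral_eq_one.le

/-! ### Measurability and integrability of the regret. -/

section PathReward

variable {Dx Dc : ℕ} {X : Set (Fin Dx → ℝ)} {C : Set (Fin Dc → ℝ)} {p : (Fin Dc → ℝ) → ℝ}

/-- The expected reward of a decision along a path. -/
def pathReward (p : (Fin Dc → ℝ) → ℝ) (φ : PathSpace (X ×ˢ C)) (v : Fin Dx → ℝ) : ℝ :=
  ∫ u in C, p u * evalPath φ (v, u)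

lemma measurable_evalPath_section (hZ : MeasurableSet (X ×ˢ C)) (φ : PathSpace (X ×ˢ C))
    (v : Fin Dx → ℝ) : Measurable fun u : Fin Dc → ℝ => evalPath φ (v, u) :=
  (Measurable.of_uncurry_left (f := fun ψ : PathSpace (X ×ˢ C) => evalPath ψ)
      (measurable_evalPath hZ) (x := φ)).comp (measurable_const.prodMk measurable_id)

lemma measurable_pathReward (hZ : MeasurableSet (X ×ˢ C)) (hp : IsContextDensity C p) :
    Measurable fun q : PathSpace (X ×ˢ C) × (Fin Dx → ℝ) => pathReward p q.1 q.2 := by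
  have h1 : Measurable fun q : (PathSpace (X ×ˢ C) × (Fin Dx → ℝ)) × (Fin Dc → ℝ) =>
      p q.2 * evalPath q.1.1 (q.1.2, q.2) :=
    (hp.continuous.measurable.comp measurable_snd).mul
      ((measurable_evalPath hZ).comp (measurable_fst.fst.prodMk
        (measurable_fst.snd.prodMk measurable_snd)))
  exact (h1.stronglyMeasurable.integral_prod_right' (ν := volume.restrict C)).measurable

lemma abs_pathReward_sub_le (hZ : MeasurableSet (X ×ˢ C)) (hC : MeasurableSet C)
    (hp : IsContextDensity C p) {φ : PathSpace (X ×ˢ C)} (hφ : pathLip φ ≠ ∞) {S : ℝ}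
    (hS : ∀ z, |evalPath φ z| ≤ S) {v v' : Fin Dx → ℝ} (hv : v ∈ X) (hv' : v' ∈ X) :
    |pathReward p φ v - pathReward p φ v'| ≤ (pathLip φ).toReal * ‖v - v'‖ := by
  have hi : ∀ v : Fin Dx → ℝ, Integrable (fun u => p u * evalPath φ (v, u)) (volume.restrict C) :=
    fun v => hp.integrable.restrict.mul_bdd
      (measurable_evalPath_section hZ φ v).aestronglyMeasurable (Eventually.of_forall fun u => hS _)
  rw [pathReward, pathReward, ← integral_sub (hi v) (hi v')]
  simp only [← mul_sub]
  refine hp.abs_setIntegral_mul_le hC (mul_nonneg ENNReal.toReal_nonneg (norm_nonneg _))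
    fun u hu => ?_
  have h1 := abs_evalPath_sub_le φ hφ (show (v, u) ∈ X ×ˢ C from ⟨hv, hu⟩)
    (show (v', u) ∈ X ×ˢ C from ⟨hv', hu⟩)
  have h2 : ‖((v, u) : Pt Dx Dc) - (v', u)‖ = ‖v - v'‖ := by
    rw [Prod.norm_def]
    simp
  rwa [h2] at h1

/-- The maximum of the expected reward is its supremum over a dense sequence. -/
lemma pathReward_eq_iSup {φ : PathSpace (X ×ˢ C)} {L : ℝ} (hL0 : 0 ≤ L)
    (hL : ∀ v ∈ X, ∀ v' ∈ X, |pathReward p φ v - pathReward p φ v'| ≤ L * ‖v - v'‖)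
    {s : ℕ → X} (hs : DenseRange s) {v : Fin Dx → ℝ} (hv : v ∈ X)
    (hmax : ∀ v' ∈ X, pathReward p φ v' ≤ pathReward p φ v) :
    pathReward p φ v = ⨆ i, pathReward p φ (s i) := by
  have hbdd : BddAbove (Set.range fun i => pathReward p φ (s i)) := by
    refine ⟨pathReward p φ v, ?_⟩
    rintro _ ⟨i, rfl⟩
    exact hmax _ (s i).2
  refine le_antisymm (le_of_forall_pos_le_add fun e he => ?_) (ciSup_le fun i => hmax _ (s i).2)
  obtain ⟨i, hi⟩ := hs.exists_dist_lt (⟨v, hv⟩ : X) (show 0 < e / (L + 1) by positivity)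
  have h1 := (abs_le.1 (hL v hv (s i) (s i).2)).2
  have h2 : ‖v - s i‖ < e / (L + 1) := by
    rwa [Subtype.dist_eq, dist_eq_norm] at hi
  have h3 : L * ‖v - s i‖ ≤ e := by
    have h4 : (L + 1) * ‖v - s i‖ ≤ e := by
      rw [lt_div_iff₀ (by positivity)] at h2
      linarith
    nlinarith [norm_nonneg (v - s i)]
  have h5 := le_ciSup hbdd i
  linarith

end PathReward

namespace IsPathRun

variable {Dx Dc : ℕ} {Ω : Type*} [MeasurableSpace Ω] {P : Measure Ω}
  {X : Set (Fin Dx → ℝ)} {C : Set (Fin Dc → ℝ)} {K : (Fin Dc → ℝ) → ℝ} {h : ℕ → Fin Dc → ℝ}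
  {p : (Fin Dc → ℝ) → ℝ} {k : Pt Dx Dc → Pt Dx Dc → ℝ} {a b r σ : ℝ} {n₀ : ℕ}
  {f : Ω → Pt Dx Dc → ℝ} {x : ℕ → Ω → Fin Dx → ℝ} {c : ℕ → Ω → Fin Dc → ℝ} {y ε : ℕ → Ω → ℝ}
  {A : ℝ} {F : Ω → PathSpace (X ×ˢ C)} {xstar : Ω → Fin Dx → ℝ}

lemma exists_mem (H : IsPathRun P X C K h p k a b r σ n₀ f x c y ε A F) [IsProbabilityMeasure P]
    (hp : IsContextDensity C p) : ∃ z, z ∈ X ×ˢ C := by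
  obtain ⟨ω, hω⟩ := (H.run.ae_context_mem hp).exists
  exact ⟨(x 0 ω, c 0 ω), H.run.decision_mem 0 ω, hω 0⟩

/-- Nothing is assumed on the measurability of `xstar`. The optimal value is the supremum over a
countable dense set of decisions, hence a measurable function of the path. -/
lemma aestronglyMeasurable_regret (H : IsPathRun P X C K h p k a b r σ n₀ f x c y ε A F)
    [IsProbabilityMeasure P] (hr : 0 ≤ r) (hp : IsContextDensity C p)
    (hx : ∀ᵐ ω ∂P, xstar ω ∈ X ∧ IsMaxOn (meanReward C p (f ω)) X (xstar ω)) (n : ℕ) :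
    AEStronglyMeasurable
      (fun ω => meanReward C p (f ω) (xstar ω) - meanReward C p (f ω) (x n ω)) P := by
  obtain ⟨ξ, y', hAd, hag, -⟩ := H.run.exists_adaptive hp H.measurable_domain H.gaussian
    H.measurable_path H.path_eq
  obtain ⟨z₀, hz₀⟩ := H.exists_mem hp
  have : Nonempty X := ⟨⟨z₀.1, hz₀.1⟩⟩
  set s := TopologicalSpace.denseSeq X with hs
  have hd : Measurable fun ω => (ruleDesign ξ n (IsRun.source n₀ x c ω, obs y' n ω)).1 :=
    ((hAd.measurable_design n).comp (hAd.measurable_U.prodMk (hAd.measurable_obs n))).fst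
  have hmeas := measurable_pathReward H.measurable_domain hp
  have h1 : Measurable fun ω => (⨆ i, pathReward p (F ω) (s i)) -
      pathReward p (F ω) (ruleDesign ξ n (IsRun.source n₀ x c ω, obs y' n ω)).1 := by
    refine Measurable.sub (Measurable.iSup fun i => ?_) ?_
    · exact hmeas.comp (H.measurable_path.prodMk measurable_const)
    · exact hmeas.comp (H.measurable_path.prodMk hd)
  refine h1.aestronglyMeasurable.congr ?_
  filter_upwards [hag, hx, H.meanReward_eq (p := p), H.ae_pathLip_ne_top] with ω w1 w2 w3 w4
  have hS := abs_evalPath_le_supBound hr hz₀ (fun z hz => H.norm_sub_le hr hz hz₀) w4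
  rw [w3 _ w2.1, w3 _ (H.run.decision_mem n ω), (w1 n).2]
  have h2 := pathReward_eq_iSup (p := p) (φ := F ω) ENNReal.toReal_nonneg
    (fun v hv v' hv' => abs_pathReward_sub_le H.measurable_domain H.measurable_contexts hp w4 hS hv hv')
    (TopologicalSpace.denseRange_denseSeq X) w2.1 (fun v' hv' => by
      have h3 := isMaxOn_iff.1 w2.2 v' hv'
      rwa [w3 _ hv', w3 _ w2.1] at h3)
  rw [← h2]
  rfl

lemma ae_regret_nonneg (H : IsPathRun P X C K h p k a b r σ n₀ f x c y ε A F)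
    (hx : ∀ᵐ ω ∂P, xstar ω ∈ X ∧ IsMaxOn (meanReward C p (f ω)) X (xstar ω)) (n : ℕ) :
    ∀ᵐ ω ∂P, 0 ≤ meanReward C p (f ω) (xstar ω) - meanReward C p (f ω) (x n ω) := by
  filter_upwards [hx] with ω w1
  exact sub_nonneg.2 (isMaxOn_iff.1 w1.2 _ (H.run.decision_mem n ω))

/-- The expected instantaneous regret of an arbitrary decision. -/
lemma lintegral_regret_le_const (H : IsPathRun P X C K h p k a b r σ n₀ f x c y ε A F)
    [IsProbabilityMeasure P] (hr : 0 ≤ r) (hA : 0 ≤ A) (hp : IsContextDensity C p)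
    (hx : ∀ᵐ ω ∂P, xstar ω ∈ X ∧ IsMaxOn (meanReward C p (f ω)) X (xstar ω)) (n : ℕ) :
    ∫⁻ ω, ENNReal.ofReal (meanReward C p (f ω) (xstar ω) - meanReward C p (f ω) (x n ω)) ∂P ≤
      ENNReal.ofReal (2 * (2 + r * (1 + A))) := by
  obtain ⟨z₀, hz₀⟩ := H.exists_mem hp
  have hG := H.field
  have hSm := measurable_supBound (Z := X ×ˢ C) H.measurable_domain r z₀
  calc ∫⁻ ω, ENNReal.ofReal (meanReward C p (f ω) (xstar ω) - meanReward C p (f ω) (x n ω)) ∂P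
      ≤ ∫⁻ ω, ENNReal.ofReal 2 * ENNReal.ofReal (supBound r z₀ (F ω)) ∂P := by
        refine lintegral_mono_ae ?_
        filter_upwards [hx, H.meanReward_eq (p := p), H.ae_pathLip_ne_top] with ω w2 w3 w4
        have hS := abs_evalPath_le_supBound hr hz₀ (fun z hz => H.norm_sub_le hr hz hz₀) w4
        have hR : ∀ v, |∫ u in C, p u * evalPath (F ω) (v, u)| ≤ supBound r z₀ (F ω) := fun v =>
          hp.abs_setIntegral_mul_le H.measurable_contexts (supBound_nonneg hr z₀ _) fun u _ => hS _
        rw [← ENNReal.ofReal_mul (by norm_num), w3 _ w2.1, w3 _ (H.run.decision_mem n ω)]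
        refine ENNReal.ofReal_le_ofReal ?_
        have h1 := (abs_le.1 (hR (xstar ω))).2
        have h2 := (abs_le.1 (hR (x n ω))).1
        linarith
    _ = ENNReal.ofReal 2 * ∫⁻ φ, ENNReal.ofReal (supBound r z₀ φ) ∂(P.map F) := by
        rw [lintegral_map hSm.ennreal_ofReal H.measurable_path]
        exact lintegral_const_mul _ (hSm.ennreal_ofReal.comp H.measurable_path)
    _ ≤ _ := by
        rw [ENNReal.ofReal_mul (by norm_num)]
        exact mul_le_mul' le_rfl (lintegral_supBound_le hG hr hA H.second_moment (H.covKer_le_one z₀))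

lemma integrable_regret (H : IsPathRun P X C K h p k a b r σ n₀ f x c y ε A F)
    [IsProbabilityMeasure P] (hr : 0 ≤ r) (hA : 0 ≤ A) (hp : IsContextDensity C p)
    (hx : ∀ᵐ ω ∂P, xstar ω ∈ X ∧ IsMaxOn (meanReward C p (f ω)) X (xstar ω)) (n : ℕ) :
    Integrable (fun ω => meanReward C p (f ω) (xstar ω) - meanReward C p (f ω) (x n ω)) P := by
  refine ⟨H.aestronglyMeasurable_regret hr hp hx n, ?_⟩
  rw [hasFiniteIntegral_iff_ofReal (H.ae_regret_nonneg hx n)]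
  exact (H.lintegral_regret_le_const hr hA hp hx n).trans_lt ENNReal.ofReal_lt_top

lemma integrable_cumRegret (H : IsPathRun P X C K h p k a b r σ n₀ f x c y ε A F)
    [IsProbabilityMeasure P] (hr : 0 ≤ r) (hA : 0 ≤ A) (hp : IsContextDensity C p)
    (hx : ∀ᵐ ω ∂P, xstar ω ∈ X ∧ IsMaxOn (meanReward C p (f ω)) X (xstar ω)) (T : ℕ) :
    Integrable (cumRegret C p f xstar x T) P :=
  integrable_finsetSum _ fun n _ => H.integrable_regret hr hA hp hx n

lemma bcr_nonneg (H : IsPathRun P X C K h p k a b r σ n₀ f x c y ε A F)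
    (hx : ∀ᵐ ω ∂P, xstar ω ∈ X ∧ IsMaxOn (meanReward C p (f ω)) X (xstar ω)) (T : ℕ) :
    0 ≤ bcr P C p f xstar x T := by
  refine integral_nonneg_of_ae ?_
  filter_upwards [ae_all_iff.2 (H.ae_regret_nonneg hx)] with ω hω
  exact Finset.sum_nonneg fun n _ => hω n

lemma ofReal_bcr (H : IsPathRun P X C K h p k a b r σ n₀ f x c y ε A F)
    [IsProbabilityMeasure P] (hr : 0 ≤ r) (hA : 0 ≤ A) (hp : IsContextDensity C p)
    (hx : ∀ᵐ ω ∂P, xstar ω ∈ X ∧ IsMaxOn (meanReward C p (f ω)) X (xstar ω)) (T : ℕ) :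
    ENNReal.ofReal (bcr P C p f xstar x T) = ∑ n ∈ Finset.range T,
      ∫⁻ ω, ENNReal.ofReal (meanReward C p (f ω) (xstar ω) - meanReward C p (f ω) (x n ω)) ∂P := by
  have h1 : bcr P C p f xstar x T = ∑ n ∈ Finset.range T,
      ∫ ω, (meanReward C p (f ω) (xstar ω) - meanReward C p (f ω) (x n ω)) ∂P :=
    integral_finsetSum _ fun n _ => H.integrable_regret hr hA hp hx n
  rw [h1, ENNReal.ofReal_sum_of_nonneg fun n _ => integral_nonneg_of_ae (H.ae_regret_nonneg hx n)]
  exact Finset.sum_congr rfl fun n _ => ofReal_integral_eq_lintegral_ofReal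
    (H.integrable_regret hr hA hp hx n) (H.ae_regret_nonneg hx n)

end IsPathRun

end SBOKDE

end

noncomputable section

namespace SBOKDE

/-! ### Rates of the exploration terms. -/

section Rates

variable {Dx : ℕ} {a b r : ℝ}

lemma inv_succ_sq_le_bandScale_sq (d : ℕ) {n : ℕ} (hn : 1 ≤ n) :
    1 / ((n : ℝ) + 1) ^ 2 ≤ bandScale d n ^ 2 := by
  have hn' : (0 : ℝ) < n := by exact_mod_cast hn
  have h1 : (n : ℝ)⁻¹ ≤ bandScale d n := by
    rw [← bandScale_pow_eq_inv (d := d)]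
    exact pow_le_of_le_one (bandScale_pos hn).le (bandScale_le_one hn) (by omega)
  rw [one_div, ← inv_pow]
  refine pow_le_pow_left₀ (by positivity) (le_trans ?_ h1) 2
  exact inv_anti₀ hn' (by linarith)

/-- The cardinality of the net of mesh `r / t²` is compensated by the exploration parameter. -/
lemma net_mul_exp_le (ha : 0 < a) (hb : 0 < b) (hr : 0 < r) (hD : 0 < Dx) {t : ℕ} (ht : 1 ≤ t) :
    (((t ^ 2 : ℕ) : ℝ) + 1) ^ Dx * Real.exp (1 / 2 - √(beta Dx a b r t) ^ 2 / 2) ≤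
      Real.exp (1 / 2) * √(2 * Real.pi) * (4 / (Dx * a * b * r * √Real.pi)) ^ Dx /
        (t : ℝ) ^ 2 := by
  have ht1 : (1 : ℝ) ≤ t := by exact_mod_cast ht
  have ht0 : (0 : ℝ) < t := by linarith
  have hD' : (0 : ℝ) < Dx := by exact_mod_cast hD
  have hpi := Real.pi_pos
  -- For negative `beta` the square root is 0 and the inequality still holds.
  have h1 : beta Dx a b r t ≤ √(beta Dx a b r t) ^ 2 := by
    rcases le_total 0 (beta Dx a b r t) with h | h
    · exact (Real.sq_sqrt h).ge
    · exact h.trans (sq_nonneg _)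
  have h2 : Real.exp (1 / 2 - √(beta Dx a b r t) ^ 2 / 2) ≤
      Real.exp (1 / 2) * Real.exp (-(beta Dx a b r t / 2)) := by
    rw [← Real.exp_add]
    exact Real.exp_le_exp.2 (by linarith)
  have h3 : ((t ^ 2 : ℕ) : ℝ) + 1 ≤ 2 * (t : ℝ) ^ 2 := by
    push_cast
    nlinarith
  calc (((t ^ 2 : ℕ) : ℝ) + 1) ^ Dx * Real.exp (1 / 2 - √(beta Dx a b r t) ^ 2 / 2)
      ≤ (2 * (t : ℝ) ^ 2) ^ Dx * (Real.exp (1 / 2) * Real.exp (-(beta Dx a b r t / 2))) :=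
        mul_le_mul (pow_le_pow_left₀ (by positivity) h3 _) h2 (Real.exp_pos _).le (by positivity)
    _ = Real.exp (1 / 2) * √(2 * Real.pi) / (t : ℝ) ^ 2 *
          ((2 * (t : ℝ) ^ 2) * (2 / ((t : ℝ) ^ 2 * Dx * a * b * r * √Real.pi))) ^ Dx := by
        rw [exp_neg_half_beta ha hb hr hD ht, mul_pow (2 * (t : ℝ) ^ 2)]
        ring
    _ = _ := by
        have h4 : (2 * (t : ℝ) ^ 2) * (2 / ((t : ℝ) ^ 2 * Dx * a * b * r * √Real.pi)) =
            4 / (Dx * a * b * r * √Real.pi) := by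
          field_simp
          ring
        rw [h4]
        ring

/-- This direction of additivity holds without measurability of the summands. -/
lemma sum_lintegral_le {Ω : Type*} [MeasurableSpace Ω] {P : Measure Ω} (s : Finset ℕ)
    (g : ℕ → Ω → ℝ≥0∞) : ∑ n ∈ s, ∫⁻ ω, g n ω ∂P ≤ ∫⁻ ω, ∑ n ∈ s, g n ω ∂P := by
  classical
  induction s using Finset.induction_on with
  | empty => simp
  | insert i s hi ih =>
    simp only [Finset.sum_insert hi]
    exact (add_le_add le_rfl ih).trans (le_lintegral_add _ _)

end Rates

/-! ### The bound on the cumulative regret. -/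

section Regret

variable {Dx Dc n₀ : ℕ} {K : (Fin Dc → ℝ) → ℝ} {h : ℕ → Fin Dc → ℝ} {C : Set (Fin Dc → ℝ)}
  {p : (Fin Dc → ℝ) → ℝ} {a b r σ A : ℝ}

/-- The rate of the expected instantaneous regret. -/
lemma exists_regret_rate (hDx : 0 < Dx) (hr : 0 < r) (ha : 0 < a) (hb : 0 < b) (hσ : 0 < σ)
    (hn₀ : 1 ≤ n₀) (hK : IsKDEKernel K) (hp : IsContextDensity C p) (hC : IsCompact C)
    (hpos : ∀ t, 1 ≤ t → ∀ j, 0 < h t j)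
    (hh : ∀ j, (fun t : ℕ => h t j) =Θ[atTop] fun t : ℕ => (t : ℝ) ^ (-(1 : ℝ) / (4 + Dc)))
    (hA : 0 < A) :
    ∃ Q : ℝ, 0 ≤ Q ∧ ∀ {Ω : Type*} [MeasurableSpace Ω] {P : Measure Ω} [IsProbabilityMeasure P]
      {X : Set (Fin Dx → ℝ)} {k : Pt Dx Dc → Pt Dx Dc → ℝ} {f : Ω → Pt Dx Dc → ℝ}
      {x : ℕ → Ω → Fin Dx → ℝ} {c : ℕ → Ω → Fin Dc → ℝ} {y ε : ℕ → Ω → ℝ}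
      {xstar : Ω → Fin Dx → ℝ} {F : Ω → PathSpace (X ×ˢ C)},
      IsPathRun P X C K h p k a b r σ n₀ f x c y ε A F →
      (∀ᵐ ω ∂P, xstar ω ∈ X ∧ IsMaxOn (meanReward C p (f ω)) X (xstar ω)) → ∀ n, n₀ ≤ n →
      ∫⁻ ω, ENNReal.ofReal (meanReward C p (f ω) (xstar ω) - meanReward C p (f ω) (x n ω)) ∂P ≤
        ENNReal.ofReal (Q * bandScale Dc n ^ 2) + ENNReal.ofReal √(beta Dx a b r (n + 1)) *
          (6 * ∫⁻ ω, ENNReal.ofReal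
            √(seqVar (covKer (P.map F) evalPath) σ (fun i => (x i ω, c i ω)) n) ∂P) := by
  obtain ⟨A₁, hA₁, hkde⟩ := exists_kde_error_rate n₀ hK hp hC hpos hh
  obtain ⟨A₂, e, hA₂, he, hmul⟩ := exists_kde_mul_rate n₀ hK hp hC hpos hh
    (L := 2 * √A) (by positivity)
  have hd : (0 : ℝ) < 4 + Dc := by positivity
  -- With this exponent `√(beta)` is at most a constant times `n^(e/(4+Dc))`, the inverse of the
  -- gain `bandScale ^ e` of the multiplicative comparison; their product is bounded.
  obtain ⟨A₃, hA₃, hβ⟩ := exists_beta_le (Dx := Dx) ha hb hr hDx (η := 2 * (e / (4 + Dc)))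
    (by positivity)
  have hDx' : (0 : ℝ) < Dx := by exact_mod_cast hDx
  have hpi := Real.pi_pos
  set W : ℝ := Real.exp (1 / 2) * √(2 * Real.pi) * (4 / (Dx * a * b * r * √Real.pi)) ^ Dx with hW
  have hW0 : 0 ≤ W := by positivity
  refine ⟨(1 + A) * r + 2 * (2 + r * (1 + A)) * A₁ + (1 + A₁) * W + √A₃ * A₂, by positivity, ?_⟩
  intro Ω _ P _ X k f x c y ε xstar F H hx n hn
  have hn1 : 1 ≤ n := hn₀.trans hn
  have hnR : (1 : ℝ) ≤ n := by exact_mod_cast hn1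
  have hB0 := bandScale_pos (d := Dc) hn1
  have hB1 := bandScale_le_one (d := Dc) hn1
  set B := bandScale Dc n with hB
  have hBsq : B ^ 2 ≤ 1 := pow_le_one₀ hB0.le hB1
  -- The mesh is `r / t²` at iteration `t = n + 1`, the one for which `net_mul_exp_le` compensates
  -- the cardinality of the net.
  have hround := H.lintegral_regret_le hr hσ hA hK hp hn (hpos n hn1) (e₁ := A₁ * B ^ 2)
    (e₂ := A₂ * B ^ (2 + e)) (by positivity) (hkde H.run.isSampling n hn1 hn)
    (hmul H.run.isSampling n hn1 hn) hx (m := (n + 1) ^ 2) (by positivity)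
  set V := ∫⁻ ω, ENNReal.ofReal
    √(seqVar (covKer (P.map F) evalPath) σ (fun i => (x i ω, c i ω)) n) ∂P with hV
  set s := √(beta Dx a b r (n + 1)) with hs
  have hs0 : 0 ≤ s := Real.sqrt_nonneg _
  have hinv := inv_succ_sq_le_bandScale_sq Dc hn1
  rw [← hB] at hinv
  have t1 : (1 + A) * (r / (((n + 1) ^ 2 : ℕ) : ℝ)) ≤ (1 + A) * r * B ^ 2 := by
    have h1 : (1 + A) * (r / (((n + 1) ^ 2 : ℕ) : ℝ)) = (1 + A) * r * (1 / ((n : ℝ) + 1) ^ 2) := by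
      push_cast
      ring
    rw [h1]
    exact mul_le_mul_of_nonneg_left hinv (by positivity)
  have t3 : ((((n + 1) ^ 2 : ℕ) : ℝ) + 1) ^ Dx * ((1 + A₁ * B ^ 2) *
      Real.exp (1 / 2 - s ^ 2 / 2)) ≤ (1 + A₁) * W * B ^ 2 := by
    have h1 := net_mul_exp_le (Dx := Dx) ha hb hr hDx (t := n + 1) (by omega)
    have h2 : W / (((n + 1 : ℕ) : ℝ)) ^ 2 ≤ W * B ^ 2 := by
      have h3 : W / (((n + 1 : ℕ) : ℝ)) ^ 2 = W * (1 / ((n : ℝ) + 1) ^ 2) := by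
        push_cast
        ring
      rw [h3]
      exact mul_le_mul_of_nonneg_left hinv hW0
    have h4 : 1 + A₁ * B ^ 2 ≤ 1 + A₁ := by nlinarith
    calc ((((n + 1) ^ 2 : ℕ) : ℝ) + 1) ^ Dx * ((1 + A₁ * B ^ 2) * Real.exp (1 / 2 - s ^ 2 / 2))
        = (1 + A₁ * B ^ 2) * (((((n + 1) ^ 2 : ℕ) : ℝ) + 1) ^ Dx *
            Real.exp (1 / 2 - s ^ 2 / 2)) := by ring
      _ ≤ (1 + A₁) * (W * B ^ 2) := mul_le_mul h4 (h1.trans h2) (by positivity) (by positivity)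
      _ = _ := by ring
  have t4 : s * (A₂ * B ^ (2 + e)) ≤ √A₃ * A₂ * B ^ 2 := by
    have h1 : B ^ (2 + e) = B ^ 2 * B ^ e := by
      rw [Real.rpow_add hB0, Real.rpow_two]
    have h2 : s ≤ √A₃ * (n : ℝ) ^ (e / (4 + Dc)) := by
      rw [hs]
      refine (Real.sqrt_le_sqrt (hβ n hn1)).trans_eq ?_
      rw [Real.sqrt_mul hA₃, mul_comm 2, Real.rpow_mul (by positivity), Real.rpow_two,
        Real.sqrt_sq (by positivity)]
    have h3 : (n : ℝ) ^ (e / (4 + Dc)) * B ^ e = 1 := by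
      rw [hB, bandScale_rpow, ← Real.rpow_add (by linarith)]
      rw [show e / (4 + (Dc : ℝ)) + -e / (4 + Dc) = 0 by ring, Real.rpow_zero]
    have h4 : 0 ≤ B ^ e := Real.rpow_nonneg hB0.le _
    calc s * (A₂ * B ^ (2 + e)) = s * B ^ e * (A₂ * B ^ 2) := by rw [h1]; ring
      _ ≤ √A₃ * (n : ℝ) ^ (e / (4 + Dc)) * B ^ e * (A₂ * B ^ 2) :=
          mul_le_mul_of_nonneg_right (mul_le_mul_of_nonneg_right h2 h4) (by positivity)
      _ = √A₃ * ((n : ℝ) ^ (e / (4 + Dc)) * B ^ e) * (A₂ * B ^ 2) := by ring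
      _ = _ := by rw [h3]; ring
  refine hround.trans ?_
  rw [mul_add (ENNReal.ofReal s), ← ENNReal.ofReal_mul hs0, ← add_assoc, add_right_comm]
  refine add_le_add ?_ le_rfl
  rw [← ENNReal.ofReal_add (by positivity) (by positivity),
    ← ENNReal.ofReal_add (by positivity) (by positivity),
    ← ENNReal.ofReal_add (by positivity) (mul_nonneg hs0 (by positivity))]
  refine ENNReal.ofReal_le_ofReal ?_
  have t2 : 2 * (2 + r * (1 + A)) * (A₁ * B ^ 2) = 2 * (2 + r * (1 + A)) * A₁ * B ^ 2 := by ring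
  linarith

lemma IsPathRun.maxInfoGain_eq {Ω : Type*} [MeasurableSpace Ω] {P : Measure Ω}
    {X : Set (Fin Dx → ℝ)} {k : Pt Dx Dc → Pt Dx Dc → ℝ} {f : Ω → Pt Dx Dc → ℝ}
    {x : ℕ → Ω → Fin Dx → ℝ} {c : ℕ → Ω → Fin Dc → ℝ} {y ε : ℕ → Ω → ℝ} {F : Ω → PathSpace (X ×ˢ C)}
    (H : IsPathRun P X C K h p k a b r σ n₀ f x c y ε A F) (T : ℕ) :
    maxInfoGain P (X ×ˢ C) f σ T = maxInfoGain (P.map F) (X ×ˢ C) evalPath σ T := by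
  refine maxInfoGain_congr H.measurable_path H.field (fun z hz => ?_) T
  filter_upwards [H.path_eq] with ω hω
  rw [evalPath_of_mem _ hz, hω]

/-- The Cauchy-Schwarz inequality over the rounds, applied path by path: the variances along the
realized design are controlled by the maximal information gain, which is not random. -/
lemma IsPathRun.lintegral_sum_sqrt_seqVar_le {Ω : Type*} [MeasurableSpace Ω] {P : Measure Ω}
    [IsProbabilityMeasure P] {X : Set (Fin Dx → ℝ)} {k : Pt Dx Dc → Pt Dx Dc → ℝ}
    {f : Ω → Pt Dx Dc → ℝ} {x : ℕ → Ω → Fin Dx → ℝ} {c : ℕ → Ω → Fin Dc → ℝ} {y ε : ℕ → Ω → ℝ}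
    {F : Ω → PathSpace (X ×ˢ C)} (H : IsPathRun P X C K h p k a b r σ n₀ f x c y ε A F)
    (hσ : 0 < σ) (hp : IsContextDensity C p) (T : ℕ) :
    ∫⁻ ω, (∑ n ∈ Finset.range T, ENNReal.ofReal
        √(seqVar (covKer (P.map F) evalPath) σ (fun i => (x i ω, c i ω)) n)) ∂P ≤
      ENNReal.ofReal √(T * (2 * (σ ^ 2 + 1) * maxInfoGain P (X ×ˢ C) f σ T)) := by
  have hG := H.field
  rw [H.maxInfoGain_eq]
  refine (lintegral_mono_ae (g := fun _ => ENNReal.ofReal √(T * (2 * (σ ^ 2 + 1) *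
    maxInfoGain (P.map F) (X ×ˢ C) evalPath σ T))) ?_).trans_eq (by simp)
  filter_upwards [H.run.ae_context_mem hp] with ω hω
  set v : ℕ → ℝ := seqVar (covKer (P.map F) evalPath) σ (fun i => (x i ω, c i ω)) with hv
  have h0 : ∀ n, 0 ≤ v n := seqVar_nonneg hG hσ _
  rw [← ENNReal.ofReal_sum_of_nonneg fun n _ => Real.sqrt_nonneg _]
  refine ENNReal.ofReal_le_ofReal (Real.le_sqrt_of_sq_le ?_)
  refine sq_sum_le_card_mul_sum_sq.trans ?_
  rw [Finset.card_range]
  refine mul_le_mul_of_nonneg_left ?_ (Nat.cast_nonneg T)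
  simp only [Real.sq_sqrt (h0 _)]
  exact sum_seqVar_le_maxInfoGain hG hσ (fun w _ => H.covKer_le_one w)
    (Z := X ×ˢ C) (z := fun i => (x i ω, c i ω)) (fun i => ⟨H.run.decision_mem i ω, hω i⟩) T

/-- The bound on the Bayesian cumulative regret. -/
lemma exists_bcr_le (hDx : 0 < Dx) (hr : 0 < r) (ha : 0 < a) (hb : 0 < b) (hσ : 0 < σ)
    (hn₀ : 1 ≤ n₀) (hK : IsKDEKernel K) (hp : IsContextDensity C p) (hC : IsCompact C)
    (hpos : ∀ t, 1 ≤ t → ∀ j, 0 < h t j)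
    (hh : ∀ j, (fun t : ℕ => h t j) =Θ[atTop] fun t : ℕ => (t : ℝ) ^ (-(1 : ℝ) / (4 + Dc)))
    (hA : 0 < A) :
    ∃ C₁ : ℝ, 0 < C₁ ∧ ∀ {Ω : Type*} [MeasurableSpace Ω] {P : Measure Ω} [IsProbabilityMeasure P]
      {X : Set (Fin Dx → ℝ)} {k : Pt Dx Dc → Pt Dx Dc → ℝ} {f : Ω → Pt Dx Dc → ℝ}
      {x : ℕ → Ω → Fin Dx → ℝ} {c : ℕ → Ω → Fin Dc → ℝ} {y ε : ℕ → Ω → ℝ}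
      {xstar : Ω → Fin Dx → ℝ} {F : Ω → PathSpace (X ×ˢ C)},
      IsPathRun P X C K h p k a b r σ n₀ f x c y ε A F →
      (∀ᵐ ω ∂P, xstar ω ∈ X ∧ IsMaxOn (meanReward C p (f ω)) X (xstar ω)) → ∀ T : ℕ, 1 ≤ T →
      bcr P C p f xstar x T ≤ regretBound Dc C₁ (72 * (σ ^ 2 + 1)) (beta Dx a b r T)
        (maxInfoGain P (X ×ˢ C) f σ T) T := by
  obtain ⟨Q, hQ, hround⟩ := exists_regret_rate (A := A) hDx hr ha hb hσ hn₀ hK hp hC hpos hh hA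
  -- Each initial round costs at most `2 (2 + r (1 + A))`, and this constant is absorbed into the
  -- power of `T` because `T ≥ 1`. The summand 1 makes `C₁` positive.
  refine ⟨Q + n₀ * (2 + r * (1 + A)) + 1, by positivity, ?_⟩
  intro Ω _ P _ X k f x c y ε xstar F H hx T hT
  have hT1 : (1 : ℝ) ≤ T := by exact_mod_cast hT
  set γ := maxInfoGain P (X ×ˢ C) f σ T with hγ
  have hγ0 : 0 ≤ γ := ENNReal.toReal_nonneg
  set s := √(beta Dx a b r T) with hs
  have hs0 : 0 ≤ s := Real.sqrt_nonneg _
  set R : ℕ → ℝ≥0∞ := fun n => ∫⁻ ω, ENNReal.ofReal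
    (meanReward C p (f ω) (xstar ω) - meanReward C p (f ω) (x n ω)) ∂P with hR
  set V : ℕ → ℝ≥0∞ := fun n => ∫⁻ ω, ENNReal.ofReal
    √(seqVar (covKer (P.map F) evalPath) σ (fun i => (x i ω, c i ω)) n) ∂P with hV
  set τ : ℝ := (T : ℝ) ^ ((2 + Dc : ℝ) / (4 + Dc)) with hτ
  have hτ1 : 1 ≤ τ := Real.one_le_rpow hT1 (by positivity)
  set q : ℝ := √(T * (2 * (σ ^ 2 + 1) * γ)) with hq
  -- all rounds obey one bound
  have hall : ∀ n ∈ Finset.range T, R n ≤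
      (if n < n₀ then ENNReal.ofReal (2 * (2 + r * (1 + A))) else 0) +
        (if n ∈ Finset.Ico 1 T then ENNReal.ofReal (Q * bandScale Dc n ^ 2) else 0) +
        ENNReal.ofReal s * (6 * V n) := by
    intro n hn
    rcases lt_or_ge n n₀ with h1 | h1
    · rw [if_pos h1, add_assoc]
      exact (H.lintegral_regret_le_const hr.le hA.le hp hx n).trans le_self_add
    · rw [if_neg (not_lt.2 h1), zero_add,
        if_pos (Finset.mem_Ico.2 ⟨hn₀.trans h1, Finset.mem_range.1 hn⟩)]
      refine (hround H hx n h1).trans (add_le_add le_rfl (mul_le_mul' ?_ le_rfl))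
      exact ENNReal.ofReal_le_ofReal (Real.sqrt_le_sqrt
        (beta_mono ha hb hr hDx (by omega) (Finset.mem_range.1 hn)))
  have hsum1 : ∑ n ∈ Finset.range T,
      (if n < n₀ then ENNReal.ofReal (2 * (2 + r * (1 + A))) else 0) ≤
      ENNReal.ofReal (n₀ * (2 * (2 + r * (1 + A)))) := by
    rw [← Finset.sum_filter, Finset.sum_const, nsmul_eq_mul, ENNReal.ofReal_mul (Nat.cast_nonneg _),
      ENNReal.ofReal_natCast]
    refine mul_le_mul' ?_ le_rfl
    have h1 : (Finset.filter (fun n => n < n₀) (Finset.range T)).card ≤ (Finset.range n₀).card :=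
      Finset.card_le_card fun n hn => Finset.mem_range.2 (Finset.mem_filter.1 hn).2
    rw [Finset.card_range] at h1
    exact_mod_cast h1
  have hsum2 : ∑ n ∈ Finset.range T,
      (if n ∈ Finset.Ico 1 T then ENNReal.ofReal (Q * bandScale Dc n ^ 2) else 0) ≤
      ENNReal.ofReal (Q * (2 * τ)) := by
    rw [← Finset.sum_filter]
    have h1 : Finset.filter (fun n => n ∈ Finset.Ico 1 T) (Finset.range T) = Finset.Ico 1 T := by
      ext n
      simp only [Finset.mem_filter, Finset.mem_range, Finset.mem_Ico]
      omega
    rw [h1, ← ENNReal.ofReal_sum_of_nonneg fun n _ => by positivity, ← Finset.mul_sum]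
    exact ENNReal.ofReal_le_ofReal (mul_le_mul_of_nonneg_left (sum_bandScale_sq_le Dc T) hQ)
  have hsum3 : ∑ n ∈ Finset.range T, ENNReal.ofReal s * (6 * V n) ≤ ENNReal.ofReal (s * (6 * q)) := by
    rw [← Finset.mul_sum, ← Finset.mul_sum, ENNReal.ofReal_mul hs0,
      ENNReal.ofReal_mul (by norm_num : (0 : ℝ) ≤ 6)]
    refine mul_le_mul' le_rfl (mul_le_mul' (by simp) ?_)
    exact (sum_lintegral_le _ _).trans (H.lintegral_sum_sqrt_seqVar_le hσ hp T)
  have htotal : ENNReal.ofReal (bcr P C p f xstar x T) ≤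
      ENNReal.ofReal (n₀ * (2 * (2 + r * (1 + A))) + Q * (2 * τ) + s * (6 * q)) := by
    rw [H.ofReal_bcr hr.le hA.le hp hx]
    refine (Finset.sum_le_sum hall).trans ?_
    rw [Finset.sum_add_distrib, Finset.sum_add_distrib,
      ENNReal.ofReal_add (by positivity) (by positivity),
      ENNReal.ofReal_add (by positivity) (by positivity)]
    exact add_le_add (add_le_add hsum1 hsum2) hsum3
  rw [ENNReal.ofReal_le_ofReal_iff (by positivity)] at htotal
  refine htotal.trans ?_
  -- The constant 72 is `6²`, from the comparison factor 6, times the 2 in `2 (σ² + 1)`.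
  have hq6 : s * (6 * q) = √(beta Dx a b r T * γ * (72 * (σ ^ 2 + 1))) * √(T : ℝ) := by
    have h1 : √(beta Dx a b r T * γ * (72 * (σ ^ 2 + 1))) = s * √(γ * (72 * (σ ^ 2 + 1))) := by
      rw [mul_assoc, Real.sqrt_mul' _ (by positivity)]
    have h2 : 6 * q = √(γ * (72 * (σ ^ 2 + 1))) * √(T : ℝ) := by
      rw [hq, ← Real.sqrt_mul (by positivity)]
      rw [show γ * (72 * (σ ^ 2 + 1)) * (T : ℝ) = 6 ^ 2 * (T * (2 * (σ ^ 2 + 1) * γ)) by ring,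
        Real.sqrt_mul (show (0 : ℝ) ≤ 6 ^ 2 by norm_num), Real.sqrt_sq (by norm_num)]
    rw [h1, h2, mul_assoc]
  rw [hq6, regretBound, ← hτ]
  -- This term and `π² / 3` are slack in the final bound; only their nonnegativity is used.
  have h3 : 0 ≤ √(beta Dx a b r T * γ * (72 * (σ ^ 2 + 1))) *
      √((T : ℝ) ^ ((Dc : ℝ) / (4 + Dc))) := by positivity
  have h4 : 0 ≤ Real.pi ^ 2 / 3 := by positivity
  have h5 : (n₀ : ℝ) * (2 * (2 + r * (1 + A))) ≤ n₀ * (2 * (2 + r * (1 + A))) * τ :=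
    le_mul_of_one_le_right (by positivity) hτ1
  nlinarith

end Regret

end SBOKDE

end

/-! ### Sublinearity of the bound. -/

noncomputable section

namespace SBOKDE

/-- The regret bound is sublinear if the information gain grows slower than a power less than
one. -/
lemma tendsto_regretBound_div {Dx Dc : ℕ} {a b r C₁ C₂ : ℝ} (hDx : 0 < Dx) (ha : 0 < a)
    (hb : 0 < b) (hr : 0 < r) (hC₁ : 0 ≤ C₁) (hC₂ : 0 ≤ C₂) {γ : ℕ → ℝ} {A θ : ℝ} (hA : 0 ≤ A)
    (hθ : 0 < θ) (hγ0 : ∀ T, 0 ≤ γ T) (hγ : ∀ T : ℕ, 1 ≤ T → γ T ≤ A * (T : ℝ) ^ (1 - θ)) :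
    Tendsto (fun T : ℕ => regretBound Dc C₁ C₂ (beta Dx a b r T) (γ T) T / T) atTop (𝓝 0) := by
  -- Half of the gain `T^(-θ)` of `γ` is spent on `beta`, which leaves a square root of order
  -- `T^(1/2 - θ/4)`; after multiplication by `√T` and division by `T` the factor `T^(-θ/4)`
  -- remains.
  obtain ⟨A₃, hA₃, hβ⟩ := exists_beta_le (Dx := Dx) ha hb hr hDx (η := θ / 2) (by positivity)
  set W : ℝ := √(A₃ * A * C₂) with hW
  have hDc : (0 : ℝ) < 4 + Dc := by positivity
  set u : ℕ → ℝ := fun T => Real.pi ^ 2 / 3 * (T : ℝ) ^ (-(1 : ℝ)) +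
    2 * W * (T : ℝ) ^ (-(θ / 4)) + 2 * C₁ * (T : ℝ) ^ (-(2 / (4 + Dc : ℝ))) with hu
  have hT : ∀ {e : ℝ}, 0 < e → Tendsto (fun T : ℕ => (T : ℝ) ^ (-e)) atTop (𝓝 0) := fun he =>
    (tendsto_rpow_neg_atTop he).comp tendsto_natCast_atTop_atTop
  have hlim : Tendsto u atTop (𝓝 0) := by
    have h1 := (((hT one_pos).const_mul (Real.pi ^ 2 / 3)).add
      ((hT (show 0 < θ / 4 by positivity)).const_mul (2 * W))).add
      ((hT (show 0 < 2 / (4 + Dc : ℝ) by positivity)).const_mul (2 * C₁))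
    simpa using h1
  refine squeeze_zero' (Eventually.of_forall fun T => ?_) ?_ hlim
  · unfold regretBound
    positivity
  filter_upwards [eventually_ge_atTop 1] with T hT1
  have hTR : (1 : ℝ) ≤ T := by exact_mod_cast hT1
  have hT0 : (0 : ℝ) < T := by linarith
  have hβT : beta Dx a b r T ≤ A₃ * (T : ℝ) ^ (θ / 2) :=
    (beta_mono ha hb hr hDx hT1 (Nat.le_succ T)).trans (hβ T hT1)
  have h1 : √(beta Dx a b r T * γ T * C₂) ≤ W * (T : ℝ) ^ (1 / 2 - θ / 4) := by
    have h2 : beta Dx a b r T * γ T * C₂ ≤ A₃ * A * C₂ * (T : ℝ) ^ (1 - θ / 2) := by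
      calc beta Dx a b r T * γ T * C₂ = beta Dx a b r T * (γ T * C₂) := by ring
        _ ≤ A₃ * (T : ℝ) ^ (θ / 2) * (A * (T : ℝ) ^ (1 - θ) * C₂) :=
            mul_le_mul hβT (mul_le_mul_of_nonneg_right (hγ T hT1) hC₂)
              (mul_nonneg (hγ0 T) hC₂) (by positivity)
        _ = A₃ * A * C₂ * ((T : ℝ) ^ (θ / 2) * (T : ℝ) ^ (1 - θ)) := by ring
        _ = _ := by
            rw [← Real.rpow_add hT0]
            congr 2
            ring
    refine (Real.sqrt_le_sqrt h2).trans_eq ?_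
    rw [Real.sqrt_mul (by positivity), ← hW, Real.sqrt_eq_rpow (_ ^ _), ← Real.rpow_mul hT0.le]
    congr 2
    ring
  have h3 : √((T : ℝ) ^ ((Dc : ℝ) / (4 + Dc))) ≤ √(T : ℝ) := by
    refine Real.sqrt_le_sqrt ?_
    refine (Real.rpow_le_rpow_of_exponent_le hTR ?_).trans_eq (Real.rpow_one _)
    rw [div_le_one hDc]
    linarith
  have e1 : (T : ℝ) ^ (1 / 2 - θ / 4) * √(T : ℝ) = (T : ℝ) ^ (-(θ / 4)) * T := by
    rw [Real.sqrt_eq_rpow, ← Real.rpow_add hT0]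
    nth_rw 3 [← Real.rpow_one (T : ℝ)]
    rw [← Real.rpow_add hT0]
    congr 1
    ring
  have e2 : (T : ℝ) ^ ((2 + Dc : ℝ) / (4 + Dc)) = (T : ℝ) ^ (-(2 / (4 + Dc : ℝ))) * T := by
    nth_rw 3 [← Real.rpow_one (T : ℝ)]
    rw [← Real.rpow_add hT0]
    congr 1
    field_simp
    ring
  have e3 : (1 : ℝ) = (T : ℝ) ^ (-(1 : ℝ)) * T := by
    rw [Real.rpow_neg_one, inv_mul_cancel₀ hT0.ne']
  have h4 : √(beta Dx a b r T * γ T * C₂) * (√((T : ℝ) ^ ((Dc : ℝ) / (4 + Dc))) + √(T : ℝ)) ≤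
      2 * W * (T : ℝ) ^ (-(θ / 4)) * T := by
    calc √(beta Dx a b r T * γ T * C₂) * (√((T : ℝ) ^ ((Dc : ℝ) / (4 + Dc))) + √(T : ℝ))
        ≤ W * (T : ℝ) ^ (1 / 2 - θ / 4) * (2 * √(T : ℝ)) :=
          mul_le_mul h1 (by linarith) (by positivity) (by positivity)
      _ = 2 * W * ((T : ℝ) ^ (1 / 2 - θ / 4) * √(T : ℝ)) := by ring
      _ = _ := by rw [e1]; ring
  rw [div_le_iff₀ hT0, hu, regretBound, e2]
  have h5 : Real.pi ^ 2 / 3 = Real.pi ^ 2 / 3 * (T : ℝ) ^ (-(1 : ℝ)) * T := by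
    rw [mul_assoc, ← e3, mul_one]
  have h6 : (Real.pi ^ 2 / 3 * (T : ℝ) ^ (-(1 : ℝ)) + 2 * W * (T : ℝ) ^ (-(θ / 4)) +
      2 * C₁ * (T : ℝ) ^ (-(2 / (4 + Dc : ℝ)))) * T =
      Real.pi ^ 2 / 3 * (T : ℝ) ^ (-(1 : ℝ)) * T + 2 * W * (T : ℝ) ^ (-(θ / 4)) * T +
      2 * C₁ * ((T : ℝ) ^ (-(2 / (4 + Dc : ℝ))) * T) := by ring
  simp only
  rw [h6, ← h5]
  linarith

end SBOKDE

end

theorem theorem1 (Dx Dc : ℕ) (hDx : 0 < Dx) (hDc : 0 < Dc) (n₀ : ℕ) (hn₀ : 1 ≤ n₀)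
    (r a b σ : ℝ) (hr : 0 < r) (ha : 0 < a) (hb : 0 < b) (hσ : 0 < σ)
    (K : (Fin Dc → ℝ) → ℝ) (hK : SBOKDE.IsKDEKernel K)
    (h : ℕ → Fin Dc → ℝ) (hh_pos : ∀ t, 1 ≤ t → ∀ j, 0 < h t j)
    (hh : ∀ j, (fun t : ℕ => h t j) =Θ[atTop] (fun t : ℕ => (t : ℝ) ^ (-(1 : ℝ) / (4 + Dc))))
    (C : Set (Fin Dc → ℝ)) (hC_compact : IsCompact C) (hC_convex : Convex ℝ C)
    (hC_sub : C ⊆ Set.Icc 0 (fun _ => r))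
    (p : (Fin Dc → ℝ) → ℝ) (hp : SBOKDE.IsContextDensity C p) :
    ∃ C₁ C₂ : ℝ, 0 < C₁ ∧ 0 < C₂ ∧
      ∀ (Ω : Type*) [MeasurableSpace Ω] (P : Measure Ω) [IsProbabilityMeasure P]
        (X : Set (Fin Dx → ℝ)) (k : SBOKDE.Pt Dx Dc → SBOKDE.Pt Dx Dc → ℝ)
        (f : Ω → SBOKDE.Pt Dx Dc → ℝ)
        (x : ℕ → Ω → Fin Dx → ℝ) (c : ℕ → Ω → Fin Dc → ℝ) (y ε : ℕ → Ω → ℝ)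
        (xstar : Ω → Fin Dx → ℝ),
        IsCompact X → Convex ℝ X → (interior X).Nonempty → X ⊆ Set.Icc 0 (fun _ => r) →
        (∀ z ∈ X ×ˢ C, ∀ z' ∈ X ×ˢ C, k z z' ≤ 1) →
        SBOKDE.IsCenteredGP P (X ×ˢ C) k f →
        SBOKDE.HasLipschitzTail P (X ×ˢ C) a b f →
        SBOKDE.IsRun P X C K h p k a b r σ n₀ f x c y ε →
        (∀ᵐ ω ∂P, xstar ω ∈ X ∧ IsMaxOn (SBOKDE.meanReward C p (f ω)) X (xstar ω)) →
        (∀ T : ℕ, 1 ≤ T →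
          Integrable (SBOKDE.cumRegret C p f xstar x T) P ∧
          SBOKDE.bcr P C p f xstar x T ≤
            SBOKDE.regretBound Dc C₁ C₂ (SBOKDE.beta Dx a b r T)
              (SBOKDE.maxInfoGain P (X ×ˢ C) f σ T) T) ∧
        Tendsto (fun T : ℕ =>
          SBOKDE.regretBound Dc C₁ C₂ (SBOKDE.beta Dx a b r T)
            (SBOKDE.maxInfoGain P (X ×ˢ C) f σ T) T / T) atTop (𝓝 0) ∧
        Tendsto (fun T : ℕ => SBOKDE.bcr P C p f xstar x T / T) atTop (𝓝 0) := by
  -- The second moment bound for the Lipschitz constant is uniform over all objectives with the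
  -- given tail, so the constants are fixed before the probability space, the decision set and the
  -- kernel.
  obtain ⟨A, hA, hmom⟩ := SBOKDE.exists_second_moment_bound (Fintype.card (Fin Dx ⊕ Fin Dc))
    (by simp [hDx]) ha hb
  obtain ⟨C₁, hC₁, hbound⟩ := SBOKDE.exists_bcr_le (A := A) hDx hr ha hb hσ hn₀ hK hp hC_compact
    hh_pos hh hA
  have hC₂ : 0 < 72 * (σ ^ 2 + 1) := by positivity
  refine ⟨C₁, 72 * (σ ^ 2 + 1), hC₁, hC₂, ?_⟩
  intro Ω _ P _ X k f x c y ε xstar hX hXc _ hXs hk hf hlip hrun hx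
  obtain ⟨F, hF, hFf⟩ := SBOKDE.exists_pathSpace_modification (P := P) hf.measurable
    (hlip.differentiableOn.mono fun ω hω => hω.continuousOn)
  have hM : Measurable fun ω => SBOKDE.pathLip (F ω) := SBOKDE.measurable_pathLip.comp hF
  have hsecond : ∫⁻ φ, SBOKDE.pathLip φ ^ 2 ∂(P.map F) ≤ ENNReal.ofReal A := by
    rw [lintegral_map (SBOKDE.measurable_pathLip.pow_const 2) hF]
    exact hmom hM fun t ht =>
      SBOKDE.meas_lt_pathLip_le (hXc.prod hC_convex) hlip hFf ht
  have H : SBOKDE.IsPathRun P X C K h p k a b r σ n₀ f x c y ε A F :=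
    ⟨hrun, hX.measurableSet, hC_compact.measurableSet, hXs, hC_sub, hf, hk, hF, hFf, hsecond⟩
  have hG := H.field
  obtain ⟨B, θ, hB, hθ, hγ⟩ := SBOKDE.exists_maxInfoGain_le hG hσ (Z := X ×ˢ C)
    (fun w _ => H.covKer_le_one w) hr (by
      rintro z hz (i | i)
      · exact ⟨(hXs hz.1).1 i, (hXs hz.1).2 i⟩
      · exact ⟨(hC_sub hz.2).1 i, (hC_sub hz.2).2 i⟩) (Real.sqrt_nonneg A)
    fun z hz w hw => SBOKDE.norm_feature_evalPath_sub_le hG hA.le hsecond hz hw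
  have hlim := SBOKDE.tendsto_regretBound_div (Dc := Dc) hDx ha hb hr hC₁.le hC₂.le
    (γ := fun T => SBOKDE.maxInfoGain P (X ×ˢ C) f σ T) hB hθ (fun _ => ENNReal.toReal_nonneg)
    fun T hT => by
      rw [H.maxInfoGain_eq]
      exact hγ T hT
  refine ⟨fun T hT => ⟨H.integrable_cumRegret hr.le hA.le hp hx T, hbound H hx T hT⟩, hlim, ?_⟩
  refine squeeze_zero' (Eventually.of_forall fun T => div_nonneg (H.bcr_nonneg hx T)
    (Nat.cast_nonneg T)) ?_ hlim
  filter_upwards [eventually_ge_atTop 1] with T hT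
  exact div_le_div_of_nonneg_right (hbound H hx T hT) (Nat.cast_nonneg T)
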